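/- Let $G_1$ and $G_2$ be finite connected graphs (loops and multiple edges allowed) of rank at least $2$, and let $G$ be the graph obtained from $G_1\sqcup G_2$ by adding one edge $e_0$ from a vertex of $G_1$ to a vertex of $G_2$. Assume that $G$ has no vertices of valence $1$ or $2$. **Entropy.** For a graph $H$ with set of (unoriented) edges $E_+(H)$ let $\mathcal M(H)=(0,\infty)^{E_+(H)}$ be the space of length functions. The entropy of $\ell\in\mathcal M(H)$ is $\mathfrak h_H(\ell)=\lim_{t\to\infty}\frac1t\log\#\{\gamma : \ell(\gamma)\le t\}$, where $\gamma$ runs over the based circuits $(e_1,\dots,e_n)$, $n\ge 1$, of directed edges, cyclically reduced (the endpoint of $e_i$ is the origin of $e_{i+1}$ and $e_{i+1}\ne\bar e_i$, with indices modulo $n$). Put $\mathcal M^1(H)=\{\ell\in\mathcal M(H):\mathfrak h_H(\ell)=1\}$. On the tangent bundle $T\mathcal M^1(H)=\{(\ell,v): \ell\in\mathcal M^1(H),\ \langle v,\nabla\mathfrak h_H(\ell)\rangle=0\}$ the entropy norm is $\|(\ell,v)\|_{\mathfrak h,H}^2=\langle v,\mathbf H[\mathfrak h_H(\ell)]v\rangle$,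 where $\mathbf H$ is the Hessian, and $d_{\mathfrak h,H}$ is the distance on $\mathcal M^1(H)$ given by the infimum of the entropy lengths $\int_0^1\|(\ell_t,\dot\ell_t)\|_{\mathfrak h,H}\,dt$ of piecewise smooth paths in $\mathcal M^1(H)$. **Model space.** For $\ell\in(0,\infty]^{E_+(G)}$ write $\ell=(\ell^0,\ell^1,\ell^2)$ for its values on $e_0$, on $G_1$ and on $G_2$. Let $$\mathcal M^1_1=\{\ell^0\in(0,\infty],\ \ell^1\in\mathcal M^1(G_1),\ \ell^2\equiv\infty\},\qquad \mathcal M^1_2=\{\ell^0\in(0,\infty],\ \ell^1\equiv\infty,\ \ell^2\in\mathcal M^1(G_2)\},$$ $$\mathcal M^1_{1,2}=\{\ell^0=\infty,\ \ell^1\in\mathcal M(G_1),\ \ell^2\in\mathcal M(G_2),\ \max(\mathfrak h_{G_1}(\ell^1),\mathfrak h_{G_2}(\ell^2))=1\},$$ and let $\widehat{\mathcal M}^1(G)=\mathcal M^1(G)\cup\mathcal M^1_1\cup\mathcal M^1_2\cup\mathcal M^1_{1,2}$, with the topology induced from $(0,\infty]^{E_+(G)}$. A point is singular if $\ell^1\in\mathcal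 M^1(G_1)$ and $\ell^2\in\mathcal M^1(G_2)$, and regular otherwise. Let $F_G(\ell)=\det(I-A_{G,\ell})$, where $A_{G,\ell}$ is indexed by directed edges, with entry $e^{-\ell(a)}$ at $(a,b)$ if $b\neq\bar a$ starts where $a$ ends, and $0$ otherwise; its partial derivatives extend continuously to infinite lengths via $e^{-\infty}=0$. Let $T\widehat{\mathcal M}^1(G)_{\rm reg}$ be the set of pairs $(\ell,v)$ with $\ell$ a regular point, $v\in\mathbb R^{E_+(G)}$ and $\langle v,\nabla F_G(\ell)\rangle=0$. A path $[0,1]\to\widehat{\mathcal M}^1(G)$ is called piecewise smooth if it is continuous and, away from finitely many times, it runs through regular points and each edge length is locally either constantly $\infty$ or finite and smooth; the velocity of a constantly infinite edge length is taken to be $0$. **Proposition.** The following hold. 1. The entropy norm defines a pseudometric on $\widehat{\mathcal M}^1(G)$: $T\mathcal M^1(G)$ is a dense subset of $T\widehat{\mathcal M}^1(G)_{\rm reg}$, the entropy norm $\|\cdot\|_{\mathfrak h,G}$ extends (uniquely) to a continuous function on $T\widehat{\mathcal M}^1(G)_{\rm reg}$, and the infimum $d_{\mathfrak h,G}$ of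 the lengths, with respect to this extension, of the piecewise smooth paths in $\widehat{\mathcal M}^1(G)$ between two points is a (finite) pseudometric on $\widehat{\mathcal M}^1(G)$. 2. The set $\mathcal M^1_1\cup\mathcal M^1_2\cup\mathcal M^1_{1,2}$ has diameter $0$ for this pseudometric. 3. The inclusion $(\mathcal M^1(G),d_{\mathfrak h,G})\to(\widehat{\mathcal M}^1(G),d_{\mathfrak h,G})$ is an isometric embedding. -/

import Mathlib

open Filter Topology MeasureTheory
open scoped ENNReal ContDiff

noncomputable section

/-- A graph in the sense of Serre together with an orientation. `E` is the set `E₊` of positively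
oriented edges; the directed edges are the pairs `(e, b) : E × Bool`, where `(e, true)` is `e` and
`(e, false)` is `e` with the opposite orientation. Loops and multiple edges are allowed. -/
structure OGraph (V E : Type*) where
  /-- originating vertex of a positively oriented edge -/
  src : E → V
  /-- terminating vertex of a positively oriented edge -/
  tgt : E → V

namespace OGraph

variable {V E : Type*} (G : OGraph V E)

/-- Originating vertex of a directed edge. -/
def o (a : E × Bool) : V := if a.2 then G.src a.1 else G.tgt a.1

/-- Terminating vertex of a directed edge. -/
def τ (a : E × Bool) : V := if a.2 then G.tgt a.1 else G.src a.1

/-- The orientation reversing involution on directed edges. -/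
def bar (a : E × Bool) : E × Bool := (a.1, !a.2)

/-- The graph is connected (and non-empty): any two vertices are joined by an edge path. -/
def Connected : Prop :=
  Nonempty V ∧ ∀ u v : V, Relation.ReflTransGen (fun x y => ∃ a, G.o a = x ∧ G.τ a = y) u v

/-- The rank (first Betti number) of a finite connected graph. -/
def rank (_ : OGraph V E) : ℤ := (Nat.card E : ℤ) - (Nat.card V : ℤ) + 1

/-- The valence of a vertex; a loop contributes `2`. -/
def valence (v : V) : ℕ := Nat.card {a : E × Bool // G.o a = v}

/-- The directed edge `b` may follow the directed edge `a` in a reduced edge path. -/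
def Follows (a b : E × Bool) : Prop := G.τ a = G.o b ∧ b ≠ bar a

/-- The space `M(G)` of length functions. -/
def lengthSpace (_ : OGraph V E) : Set (E → ℝ) := {l | ∀ e, 0 < l e}

/-- The based circuits `(e₁, …, eₙ)`, `n ≥ 1`, of `l`-length at most `t`. A circuit with `n + 1`
directed edges is a function on `Fin (n + 1)`, whose addition is cyclic, so that the condition at
the last index says that `e₁` may follow `eₙ`. -/
def circuits (l : E → ℝ) (t : ℝ) : Set (Σ n : ℕ, Fin (n + 1) → E × Bool) :=
  {c | (∀ i, G.Follows (c.2 i) (c.2 (i + 1))) ∧ ∑ i, l (c.2 i).1 ≤ t}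

/-- The entropy of a length function. -/
def entropy (l : E → ℝ) : ℝ :=
  limUnder atTop fun t : ℝ => 1 / t * Real.log ((G.circuits l t).ncard : ℝ)

/-- The unit entropy moduli space `M¹(G)`. -/
def unitSpace : Set (E → ℝ) := {l | l ∈ G.lengthSpace ∧ G.entropy l = 1}

section Finite

variable [Fintype E]

/-- The tangent bundle `TM¹(G)`: the vectors orthogonal to the gradient of the entropy. -/
def unitTangent : Set ((E → ℝ) × (E → ℝ)) :=
  {p | p.1 ∈ G.unitSpace ∧ fderiv ℝ G.entropy p.1 p.2 = 0}

/-- The entropy norm: its square is the Hessian of the entropy at `l` applied to `(v, v)`. -/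
def entropyNorm (l v : E → ℝ) : ℝ :=
  Real.sqrt (fderiv ℝ (fderiv ℝ G.entropy) l v v)

/-- Piecewise smooth paths `[0,1] → M¹(G)`. -/
def IsUnitPath (γ : ℝ → E → ℝ) : Prop :=
  ContinuousOn γ (Set.Icc 0 1) ∧ (∀ t ∈ Set.Icc (0 : ℝ) 1, γ t ∈ G.unitSpace) ∧
    ∃ (n : ℕ) (s : ℕ → ℝ), Monotone s ∧ s 0 = 0 ∧ s n = 1 ∧
      ∀ i < n, ContDiffOn ℝ ∞ γ (Set.Icc (s i) (s (i + 1)))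

/-- The entropy length of a path in `M¹(G)`. -/
def pathLength (γ : ℝ → E → ℝ) : ℝ≥0∞ :=
  ∫⁻ t in Set.Icc (0 : ℝ) 1, ENNReal.ofReal (G.entropyNorm (γ t) (deriv γ t))

/-- The entropy distance function on `M¹(G)`. -/
def entropyDist (x y : E → ℝ) : ℝ≥0∞ :=
  ⨅ (γ : ℝ → E → ℝ) (_ : G.IsUnitPath γ ∧ γ 0 = x ∧ γ 1 = y), G.pathLength γ

open Classical in
/-- The determinant `det (I - A)`, where `A(a, b) = y(a)` if `b` may follow `a` and `0` otherwise.
Thus `F_G(l) = det (I - A_{G,l})` is the value at `y = exp(-l)`. -/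
def detFun (y : E → ℝ) : ℝ :=
  Matrix.det (1 - Matrix.of fun a b : E × Bool => if G.Follows a b then y a.1 else 0)

/-- `exp(-x)` on `[0,∞]`, with `exp(-∞) = 0`. -/
def expNeg (x : ℝ≥0∞) : ℝ := if x = ⊤ then 0 else Real.exp (-x.toReal)

open Classical in
/-- The partial derivative of `F_G` in the direction of the edge `e`, extended continuously to
length functions with infinite values: for finite `l` this is the chain rule with `y = exp(-l)`. -/
def partialF (l : E → ℝ≥0∞) (e : E) : ℝ :=
  -(expNeg (l e)) * fderiv ℝ G.detFun (fun e' => expNeg (l e')) (Pi.single e 1)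

end Finite

variable {V₁ E₁ V₂ E₂ : Type*}

/-- The graph which consists of disjoint copies of `G₁` and `G₂` and one more edge `e₀ = none`,
from the vertex `v₁` of `G₁` to the vertex `v₂` of `G₂`. -/
def join (G₁ : OGraph V₁ E₁) (G₂ : OGraph V₂ E₂) (v₁ : V₁) (v₂ : V₂) :
    OGraph (V₁ ⊕ V₂) (Option (E₁ ⊕ E₂)) where
  src
    | none => Sum.inl v₁
    | some (Sum.inl e) => Sum.inl (G₁.src e)
    | some (Sum.inr e) => Sum.inr (G₂.src e)
  tgt
    | none => Sum.inr v₂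
    | some (Sum.inl e) => Sum.inl (G₁.tgt e)
    | some (Sum.inr e) => Sum.inr (G₂.tgt e)

end OGraph

namespace SepEdge

open OGraph

variable {V₁ E₁ V₂ E₂ : Type*}

/-- The edges of the joined graph: `none` is the separating edge. -/
abbrev Edge (E₁ E₂ : Type*) := Option (E₁ ⊕ E₂)

/-- Edge lengths in `[0,∞]`, with the product topology. -/
abbrev ExtLength (E₁ E₂ : Type*) := Edge E₁ E₂ → ℝ≥0∞

/-- The edges of the first graph have finite positive length, given by an element of `S`. -/
def FiniteOn₁ (S : Set (E₁ → ℝ)) (l : ExtLength E₁ E₂) : Prop :=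
  (∀ e : E₁, l (some (Sum.inl e)) ≠ ⊤) ∧ (fun e : E₁ => (l (some (Sum.inl e))).toReal) ∈ S

/-- The edges of the second graph have finite positive length, given by an element of `S`. -/
def FiniteOn₂ (S : Set (E₂ → ℝ)) (l : ExtLength E₁ E₂) : Prop :=
  (∀ e : E₂, l (some (Sum.inr e)) ≠ ⊤) ∧ (fun e : E₂ => (l (some (Sum.inr e))).toReal) ∈ S

/-- The inclusion of finite length functions into extended ones. -/
def incl (l : Edge E₁ E₂ → ℝ) : ExtLength E₁ E₂ := fun e => ENNReal.ofReal (l e)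

variable (G₁ : OGraph V₁ E₁) (G₂ : OGraph V₂ E₂) (v₁ : V₁) (v₂ : V₂)

/-- `M¹₁`: unit entropy on the first graph, infinite length on the second one; the length of the
separating edge is anything in `(0,∞]`. -/
def unit₁ (G₁ : OGraph V₁ E₁) (E₂ : Type*) : Set (ExtLength E₁ E₂) :=
  {l | 0 < l none ∧ FiniteOn₁ G₁.unitSpace l ∧ ∀ e : E₂, l (some (Sum.inr e)) = ⊤}

/-- `M¹₂`: unit entropy on the second graph, infinite length on the first one. -/
def unit₂ (E₁ : Type*) (G₂ : OGraph V₂ E₂) : Set (ExtLength E₁ E₂) :=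
  {l | 0 < l none ∧ (∀ e : E₁, l (some (Sum.inl e)) = ⊤) ∧ FiniteOn₂ G₂.unitSpace l}

/-- `M¹₁₂`: the separating edge has infinite length, all the other edges have finite length, and
the maximum of the two entropies is `1`. -/
def unit₁₂ : Set (ExtLength E₁ E₂) :=
  {l | l none = ⊤ ∧ FiniteOn₁ G₁.lengthSpace l ∧ FiniteOn₂ G₂.lengthSpace l ∧
    max (G₁.entropy fun e => (l (some (Sum.inl e))).toReal)
      (G₂.entropy fun e => (l (some (Sum.inr e))).toReal) = 1}

/-- The added points of the model space. -/
def added : Set (ExtLength E₁ E₂) := unit₁ G₁ E₂ ∪ unit₂ E₁ G₂ ∪ unit₁₂ G₁ G₂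

/-- The model space. -/
def model : Set (ExtLength E₁ E₂) := incl '' (join G₁ G₂ v₁ v₂).unitSpace ∪ added G₁ G₂

/-- The singular points of the model space: both graphs have unit entropy. -/
def sing : Set (ExtLength E₁ E₂) :=
  {l | l ∈ model G₁ G₂ v₁ v₂ ∧ FiniteOn₁ G₁.unitSpace l ∧ FiniteOn₂ G₂.unitSpace l}

/-- The regular points of the model space. -/
def reg : Set (ExtLength E₁ E₂) := model G₁ G₂ v₁ v₂ \ sing G₁ G₂ v₁ v₂

variable [Fintype E₁] [Fintype E₂]

/-- The tangent bundle of the model space over the regular points: the pairs `(l, v)` with `v`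
orthogonal to the extended gradient of `F_G` at `l`. -/
def regTangent : Set (ExtLength E₁ E₂ × (Edge E₁ E₂ → ℝ)) :=
  {p | p.1 ∈ reg G₁ G₂ v₁ v₂ ∧ ∑ e, p.2 e * (join G₁ G₂ v₁ v₂).partialF p.1 e = 0}

/-- The tangent bundle `TM¹(G)` as a subset of the extended one. -/
def finTangent : Set (ExtLength E₁ E₂ × (Edge E₁ E₂ → ℝ)) :=
  (fun p : (Edge E₁ E₂ → ℝ) × (Edge E₁ E₂ → ℝ) => (incl p.1, p.2)) ''
    (join G₁ G₂ v₁ v₂).unitTangent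

/-- The entropy norm of the joined graph on `finTangent`. -/
def finNorm (p : ExtLength E₁ E₂ × (Edge E₁ E₂ → ℝ)) : ℝ :=
  (join G₁ G₂ v₁ v₂).entropyNorm (fun e => (p.1 e).toReal) p.2

/-- The entropy norm, extended by continuity from `finTangent`. -/
def extNorm : ExtLength E₁ E₂ × (Edge E₁ E₂ → ℝ) → ℝ :=
  extendFrom (finTangent G₁ G₂ v₁ v₂) (finNorm G₁ G₂ v₁ v₂)

/-- Piecewise smooth paths `[0,1] → model`: continuous paths such that, away from finitely many
times, the path runs through regular points and each coordinate is locally either constant equal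
to `∞`, or finite and smooth. (Edge lengths may become infinite, and singular points may be met,
at the finitely many break points, which may include `0` and `1`.) -/
def IsModelPath (γ : ℝ → ExtLength E₁ E₂) : Prop :=
  ContinuousOn γ (Set.Icc 0 1) ∧ (∀ t ∈ Set.Icc (0 : ℝ) 1, γ t ∈ model G₁ G₂ v₁ v₂) ∧
    ∃ s : Finset ℝ, ∀ t ∈ Set.Ioo (0 : ℝ) 1, t ∉ s →
      γ t ∈ reg G₁ G₂ v₁ v₂ ∧
      ∀ e, (∀ᶠ u in 𝓝 t, γ u e = ⊤) ∨
        (γ t e ≠ ⊤ ∧ ContDiffAt ℝ ∞ (fun u => (γ u e).toReal) t)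

/-- The velocity of a path; the coordinates that are constant equal to `∞` have velocity `0`. -/
def velocity (γ : ℝ → ExtLength E₁ E₂) (t : ℝ) : Edge E₁ E₂ → ℝ :=
  fun e => deriv (fun u => (γ u e).toReal) t

/-- The entropy length of a path in the model space. -/
def modelPathLength (γ : ℝ → ExtLength E₁ E₂) : ℝ≥0∞ :=
  ∫⁻ t in Set.Icc (0 : ℝ) 1, ENNReal.ofReal (extNorm G₁ G₂ v₁ v₂ (γ t, velocity γ t))

/-- The entropy distance function on the model space. -/
def modelDist (x y : ExtLength E₁ E₂) : ℝ≥0∞ :=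
  ⨅ (γ : ℝ → ExtLength E₁ E₂) (_ : IsModelPath G₁ G₂ v₁ v₂ γ ∧ γ 0 = x ∧ γ 1 = y),
    modelPathLength G₁ G₂ v₁ v₂ γ

end SepEdge

end

/-! Everything is read off the determinant `F(y) = det(I - A)` in the coordinates `y = exp(-l)`,
where an infinite length is `y = 0`. By Perron–Frobenius theory the entropy of `l` is the number `h
> 0` for which the transfer matrix at `h • l` has a positive fixed vector (`Good.entropy_eq`). `F`
vanishes on `M¹` with nonzero radial derivative (`Good.Kf_pos`), so the entropy is smooth by the
implicit function theorem. Differentiating `F(h(l) • l) = 0` twice shows that on tangent vectors the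
squared norm is `-Nf / Kf`, with `Nf` the second derivative of `F` along the vector and `Kf` the
radial derivative (`Good.hessian_entropy`). Both are continuous up to `y = 0`.

For the joined graph `F = F₁ F₂ - y₀² P₁ P₂` (`detFun_join`), where `Pᵢ / Fᵢ` is the weight of the
loops of `Gᵢ` at `vᵢ`. At an added point `y₀` or one of the restrictions of `y` vanishes, so `F = F₁
F₂` and `Kf = K₁ F₂ + F₁ K₂`. This is positive at regular points and zero at singular ones. Hence
the norm extends exactly over the regular points; density of `TM¹(G)` comes from normalising nearby
finite lengths to unit entropy.

The norm is zero in directions in which `F` is constant. If `l¹` has unit entropy, then `l²` (when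
`l⁰ = ∞`) or `l⁰` (when `l² = ∞`) moves freely and can be stretched to infinity at no cost. A
singular point can be stretched on either side and so links the two families: the added set has
diameter zero (`modelDist_added`).

For the isometry, a passage through the added set has to be replaced by paths in `M¹(G)`. The
relation `Near p q r` says that points of `M¹(G)` close to `p` and `q` are at distance at most `r +
ε`, and the main point is that `Near p q 0` holds for any two added points (`near_added`). At
regular points one uses straight segments in `z = exp(-l/4)`, normalised to unit entropy: their
speed is continuous up to `z = 0` (`tendsto_rootNorm`) and tends to zero if only free edges move. At
a singular point `Kf` degenerates. There one keeps `a = F₁` fixed, stretches `G₂` by `s` and solves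
`F = 0` for the length of `e₀`; since `b = F₂` grows at least linearly in `s - 1`, the speed is at
most a constant times `a^(1/4) (s-1)^(-3/4)`, whose integral tends to zero with `a`
(`Split.exists_step`). Finally a path of the model space is cut at the first and the last time at
which some length is infinite (`near_of_isModelPath`). -/

noncomputable section

namespace OGraph

/-! ### Irreducibility of the non-backtracking step relation -/

section Irreducibility

variable {V E : Type*} (H : OGraph V E)

/-- Connected graphs without vertices of valence `0` or `1` which are not cycles. -/
structure Good : Prop where
  conn : H.Connected
  two_le : ∀ v, 2 ≤ H.valence v
  three_le : ∃ v, 3 ≤ H.valence v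

lemma bar_bar (a : E × Bool) : bar (bar a) = a := by simp [bar]

lemma bar_injective : Function.Injective (bar : E × Bool → E × Bool) :=
  Function.Involutive.injective bar_bar

lemma o_bar (a : E × Bool) : H.o (bar a) = H.τ a := by
  rcases a with ⟨e, _ | _⟩ <;> rfl

lemma τ_bar (a : E × Bool) : H.τ (bar a) = H.o a := by
  rcases a with ⟨e, _ | _⟩ <;> rfl

lemma follows_bar {a b : E × Bool} : H.Follows (bar b) (bar a) ↔ H.Follows a b := by
  unfold Follows
  rw [τ_bar, o_bar, bar_bar]
  constructor
  · rintro ⟨h1, h2⟩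
    exact ⟨h1.symm, fun h => h2 h.symm⟩
  · rintro ⟨h1, h2⟩
    exact ⟨h1.symm, fun h => h2 h.symm⟩

lemma follows_of_o_eq {a b : E × Bool} (h : H.o a = H.o b) (hab : a ≠ b) :
    H.Follows (bar a) b := by
  refine ⟨by rw [τ_bar, h], ?_⟩
  rw [bar_bar]
  exact hab.symm

/-- Two distinct edges `a`, `b` with the same origin give the steps `bar a → b` and `bar b → a`. So
a class that contains both orientations of one edge at a vertex contains both orientations of all of
them. -/
lemma eqvGen_propagate {x a : E × Bool} (h1 : Relation.EqvGen H.Follows x a)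
    (h2 : Relation.EqvGen H.Follows x (bar a)) {b : E × Bool} (hb : H.o b = H.o a) :
    Relation.EqvGen H.Follows x b ∧ Relation.EqvGen H.Follows x (bar b) := by
  by_cases hab : a = b
  · subst hab
    exact ⟨h1, h2⟩
  · exact ⟨h2.trans _ _ _ (.rel _ _ (H.follows_of_o_eq hb.symm hab)),
      h1.trans _ _ _ ((Relation.EqvGen.rel _ _ (H.follows_of_o_eq hb (Ne.symm hab))).symm _ _)⟩

variable {H}

/-- Three distinct edges `a`, `b`, `c` leaving one vertex give `a ~ bar c ~ b ~ bar a`. A class with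
both orientations of `a` then spreads over the connected graph by `eqvGen_propagate`. -/
lemma Good.eqvGen [Finite E] (hH : H.Good) (x y : E × Bool) :
    Relation.EqvGen H.Follows x y := by
  classical
  have := Fintype.ofFinite E
  obtain ⟨v, hv⟩ := hH.three_le
  unfold valence at hv
  rw [Nat.card_eq_fintype_card] at hv
  obtain ⟨⟨a, ha⟩, ⟨b, hb⟩, ⟨c, hc⟩, hab, hac, hbc⟩ := Fintype.two_lt_card_iff.1 hv
  simp only [ne_eq, Subtype.mk.injEq] at hab hac hbc
  have key : ∀ z, Relation.EqvGen H.Follows a z := by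
    have e1 := Relation.EqvGen.rel _ _ (H.follows_of_o_eq (ha.trans hb.symm) hab)
    have e2 := Relation.EqvGen.rel _ _ (H.follows_of_o_eq (hc.trans hb.symm) (Ne.symm hbc))
    have e3 := Relation.EqvGen.rel _ _ (H.follows_of_o_eq (hc.trans ha.symm) (Ne.symm hac))
    have haa : Relation.EqvGen H.Follows a (bar a) :=
      (e3.symm _ _).trans _ _ _ (e2.trans _ _ _ (e1.symm _ _))
    have hP : ∀ w, ∀ d, H.o d = w →
        Relation.EqvGen H.Follows a d ∧ Relation.EqvGen H.Follows a (bar d) := by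
      intro w
      have hr := hH.conn.2 v w
      induction hr with
      | refl => exact fun d hd => H.eqvGen_propagate (.refl _) haa (hd.trans ha.symm)
      | tail _ hst ih =>
        obtain ⟨f, hf1, hf2⟩ := hst
        intro d hd
        have h := ih f hf1
        refine H.eqvGen_propagate (a := bar f) h.2 (by rw [bar_bar]; exact h.1) ?_
        rw [hd, o_bar, hf2]
    exact fun z => (hP _ z rfl).1
  exact ((key x).symm _ _).trans _ _ _ (key y)

open Classical in
lemma card_follows [Fintype E] (a : E × Bool) :
    (Finset.univ.filter (H.Follows a)).card = H.valence (H.τ a) - 1 := by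
  have h : Finset.univ.filter (H.Follows a) =
      (Finset.univ.filter fun b => H.o b = H.τ a).erase (bar a) := by
    ext b
    simp [Follows, and_comm, eq_comm]
  rw [h, Finset.card_erase_of_mem (by simp [o_bar])]
  congr 1
  unfold valence
  rw [Nat.card_eq_fintype_card, Fintype.card_subtype]

open Classical in
lemma card_follows' [Fintype E] (b : E × Bool) :
    (Finset.univ.filter (fun a => H.Follows a b)).card = H.valence (H.o b) - 1 := by
  rw [← τ_bar, ← card_follows]
  refine Finset.card_bij (fun a _ => bar a) ?_ ?_ ?_
  · intro a ha
    simpa [follows_bar] using ha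
  · intro a _ a' _ h
    exact bar_injective h
  · intro c hc
    refine ⟨bar c, ?_, bar_bar c⟩
    simp only [Finset.mem_filter, Finset.mem_univ, true_and] at hc ⊢
    rw [← follows_bar, bar_bar]
    exact hc

lemma Good.exists_follows [Finite E] (hH : H.Good) (a : E × Bool) : ∃ b, H.Follows a b := by
  classical
  have := Fintype.ofFinite E
  have h1 := card_follows (H := H) a
  have h2 := hH.two_le (H.τ a)
  have : 0 < (Finset.univ.filter (H.Follows a)).card := by omega
  obtain ⟨b, hb⟩ := Finset.card_pos.1 this
  exact ⟨b, by simpa using hb⟩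

/-- The uniform measure is stationary for the non-backtracking random walk, so that forward
invariant sets are backward invariant. -/
lemma Good.backward_closed [Finite E] (hH : H.Good) {S : Set (E × Bool)}
    (hS : ∀ a ∈ S, ∀ b, H.Follows a b → b ∈ S) {a b : E × Bool} (hab : H.Follows a b)
    (hb : b ∈ S) : a ∈ S := by
  classical
  have := Fintype.ofFinite E
  by_contra ha
  let P : E × Bool → E × Bool → ℝ := fun a b =>
    if H.Follows a b then 1 / ((H.valence (H.τ a) - 1 : ℕ) : ℝ) else 0
  have hpos : ∀ v, (0 : ℝ) < ((H.valence v - 1 : ℕ) : ℝ) := fun v => by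
    have := hH.two_le v
    exact_mod_cast (by omega : 0 < H.valence v - 1)
  have hP : ∀ a b, 0 ≤ P a b := fun a b => by
    simp only [P]
    split_ifs
    · exact (one_div_pos.2 (hpos _)).le
    · exact le_rfl
  have hrow : ∀ a, ∑ b, P a b = 1 := fun a => by
    simp only [P]
    rw [← Finset.sum_filter, Finset.sum_const, card_follows, nsmul_eq_mul]
    exact mul_one_div_cancel (hpos _).ne'
  have hcol : ∀ b, ∑ a, P a b = 1 := fun b => by
    have : ∀ a, P a b = if H.Follows a b then 1 / ((H.valence (H.o b) - 1 : ℕ) : ℝ) else 0 := by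
      intro a
      simp only [P]
      split_ifs with h
      · rw [h.1]
      · rfl
    simp only [this]
    rw [← Finset.sum_filter, Finset.sum_const, card_follows', nsmul_eq_mul]
    exact mul_one_div_cancel (hpos _).ne'
  set s : Finset (E × Bool) := Finset.univ.filter (· ∈ S) with hs
  -- `P` is doubly stochastic. The columns in `S` carry total mass `|S|`, and the rows in `S`
  -- already put all of their mass there; the row of `a ∉ S` would add a positive amount.
  have h1 : ∑ a, ∑ b ∈ s, P a b = ∑ b ∈ s, (1 : ℝ) := by
    rw [Finset.sum_comm]
    exact Finset.sum_congr rfl fun b _ => hcol b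
  have h2 : ∑ a ∈ s, (1 : ℝ) < ∑ a, ∑ b ∈ s, P a b := by
    have h3 : ∑ a ∈ s, ∑ b ∈ s, P a b = ∑ a ∈ s, (1 : ℝ) := by
      refine Finset.sum_congr rfl fun c hc => ?_
      rw [← hrow c]
      refine Finset.sum_subset (Finset.subset_univ _) fun b _ hb => ?_
      simp only [P]
      rw [if_neg]
      intro hcb
      exact hb (by simpa [hs] using hS c (by simpa [hs] using hc) b hcb)
    rw [← h3]
    refine Finset.sum_lt_sum_of_subset (Finset.subset_univ s) (Finset.mem_univ a)
      (by simpa [hs] using ha) ?_ fun c _ _ => Finset.sum_nonneg fun b _ => hP c b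
    refine Finset.sum_pos' (fun b _ => hP a b) ⟨b, by simpa [hs] using hb, ?_⟩
    simp only [P, if_pos hab]
    exact one_div_pos.2 (hpos _)
  linarith

/-- The set reachable from `a` is forward closed, hence backward closed, hence a union of classes of
the generated equivalence relation, of which there is only one. -/
theorem Good.transGen [Finite E] (hH : H.Good) (a b : E × Bool) :
    Relation.TransGen H.Follows a b := by
  have hfw : ∀ c ∈ {c | Relation.TransGen H.Follows a c}, ∀ d, H.Follows c d →
      d ∈ {c | Relation.TransGen H.Follows a c} := fun c hc d hd => Relation.TransGen.tail hc hd
  have key : ∀ c d, Relation.EqvGen H.Follows c d →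
      (Relation.TransGen H.Follows a c ↔ Relation.TransGen H.Follows a d) := by
    intro c d h
    induction h with
    | rel x y h => exact ⟨fun hx => hx.tail h, fun hy => hH.backward_closed hfw h hy⟩
    | refl x => exact Iff.rfl
    | symm x y _ ih => exact ih.symm
    | trans x y z _ _ ih1 ih2 => exact ih1.trans ih2
  obtain ⟨c, hc⟩ := hH.exists_follows a
  exact (key c b (hH.eqvGen c b)).1 (.single hc)

lemma Good.nonempty_dir [Finite E] (hH : H.Good) : Nonempty (E × Bool) := by
  obtain ⟨v, hv⟩ := hH.three_le
  unfold valence at hv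
  by_contra h
  rw [not_nonempty_iff] at h
  simp at hv

end Irreducibility

end OGraph

/-! ### Nonnegative matrices; `SubInv` replaces the condition that the spectral radius is at least
one -/

section NonnegMatrix

open Matrix

variable {n : Type*} [Fintype n]

/-- A square matrix has a subinvariant vector: a nonzero `x ≥ 0` with `x ≤ B x`. -/
def SubInv (B : Matrix n n ℝ) : Prop := ∃ x : n → ℝ, 0 ≤ x ∧ x ≠ 0 ∧ x ≤ B *ᵥ x

lemma SubInv.exists_simplex {B : Matrix n n ℝ} (h : SubInv B) :
    ∃ x ∈ stdSimplex ℝ n, x ≤ B *ᵥ x := by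
  obtain ⟨x, h0, h1, h2⟩ := h
  have hs : 0 < ∑ i, x i := by
    obtain ⟨i, hi⟩ := Function.ne_iff.1 h1
    exact Finset.sum_pos' (fun i _ => h0 i) ⟨i, Finset.mem_univ _, lt_of_le_of_ne (h0 i) hi.symm⟩
  refine ⟨(∑ i, x i)⁻¹ • x, ⟨fun i => ?_, ?_⟩, ?_⟩
  · exact mul_nonneg (inv_nonneg.2 hs.le) (h0 i)
  · simp only [Pi.smul_apply, smul_eq_mul]
    rw [← Finset.mul_sum, inv_mul_cancel₀ hs.ne']
  · rw [mulVec_smul]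
    exact smul_le_smul_of_nonneg_left h2 (inv_nonneg.2 hs.le)

lemma subInv_iff_simplex {B : Matrix n n ℝ} :
    SubInv B ↔ ∃ x ∈ stdSimplex ℝ n, x ≤ B *ᵥ x := by
  refine ⟨SubInv.exists_simplex, ?_⟩
  rintro ⟨x, hx, h⟩
  refine ⟨x, hx.1, ?_, h⟩
  rintro rfl
  have := hx.2
  simp at this

/-- The witness can be normalised to the compact simplex, and projections along compact factors are
closed. Openness of the complement is what yields upper bounds for the entropy near added points. -/
lemma isClosed_subInv : IsClosed {B : Matrix n n ℝ | SubInv B} := by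
  have hc : CompactSpace (stdSimplex ℝ n) := isCompact_iff_compactSpace.1 (isCompact_stdSimplex ℝ n)
  have h1 : IsClosed {p : stdSimplex ℝ n × Matrix n n ℝ | (p.1 : n → ℝ) ≤ p.2 *ᵥ (p.1 : n → ℝ)} := by
    refine isClosed_le (by fun_prop) ?_
    exact Continuous.matrix_mulVec continuous_snd (by fun_prop)
  have h2 := (isClosedMap_snd_of_compactSpace (X := stdSimplex ℝ n) (Y := Matrix n n ℝ)) _ h1
  convert h2 using 1
  ext B
  simp only [Set.mem_ofPred_eq, subInv_iff_simplex, Set.mem_image, Prod.exists, exists_eq_right,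
    Subtype.exists]
  exact ⟨fun ⟨x, hx, h⟩ => ⟨x, hx, h⟩, fun ⟨x, hx, h⟩ => ⟨x, hx, h⟩⟩

lemma mulVec_mono' {B : Matrix n n ℝ} (hB : ∀ i j, 0 ≤ B i j) {x y : n → ℝ} (h : x ≤ y) :
    B *ᵥ x ≤ B *ᵥ y := fun i =>
  Finset.sum_le_sum fun j _ => mul_le_mul_of_nonneg_left (h j) (hB i j)

lemma mulVec_le_mulVec_left {A B : Matrix n n ℝ} (hAB : ∀ i j, A i j ≤ B i j) {x : n → ℝ}
    (h : 0 ≤ x) : A *ᵥ x ≤ B *ᵥ x := fun i =>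
  Finset.sum_le_sum fun j _ => mul_le_mul_of_nonneg_right (hAB i j) (h j)

lemma mulVec_nonneg' {B : Matrix n n ℝ} (hB : ∀ i j, 0 ≤ B i j) {x : n → ℝ} (h : 0 ≤ x) :
    0 ≤ B *ᵥ x := fun i =>
  Finset.sum_nonneg fun j _ => mul_nonneg (hB i j) (h j)

lemma SubInv.mono {A B : Matrix n n ℝ} (hAB : ∀ i j, A i j ≤ B i j) (h : SubInv A) :
    SubInv B := by
  obtain ⟨x, h0, h1, h2⟩ := h
  exact ⟨x, h0, h1, h2.trans (mulVec_le_mulVec_left hAB h0)⟩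

/-- Positivity of the resolvent of a nonnegative matrix of spectral radius less than one. -/
lemma nonneg_of_sub_mulVec_nonneg [DecidableEq n] {B : Matrix n n ℝ} (hB : ∀ i j, 0 ≤ B i j)
    (hS : ¬ SubInv B) {x : n → ℝ} (h : 0 ≤ (1 - B) *ᵥ x) : 0 ≤ x := by
  by_contra hx
  -- The negative part of `x` would be subinvariant: `x ≥ B x` gives `-x ≤ B (-x) ≤ B x⁻`.
  refine hS ⟨fun i => max (-x i) 0, fun i => le_max_right _ _, ?_, fun i => ?_⟩
  · intro h0
    refine hx fun i => ?_
    have := congrFun h0 i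
    simpa using this
  · have h1 := h i
    rw [sub_mulVec, one_mulVec, Pi.sub_apply, Pi.zero_apply] at h1
    have h2 : 0 ≤ (B *ᵥ fun i => max (-x i) 0) i :=
      mulVec_nonneg' hB (fun i => le_max_right _ _) i
    have h3 : (B *ᵥ (-x)) i ≤ (B *ᵥ fun i => max (-x i) 0) i :=
      mulVec_mono' hB (fun i => le_max_left _ _) i
    rw [mulVec_neg, Pi.neg_apply] at h3
    exact max_le (by linarith) h2

lemma det_one_sub_ne_zero [DecidableEq n] {B : Matrix n n ℝ} (hB : ∀ i j, 0 ≤ B i j)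
    (hS : ¬ SubInv B) : (1 - B).det ≠ 0 := by
  intro h
  obtain ⟨x, hx0, hx⟩ := Matrix.exists_mulVec_eq_zero_iff.2 h
  have h1 := nonneg_of_sub_mulVec_nonneg hB hS (x := x) (by rw [hx])
  have h2 := nonneg_of_sub_mulVec_nonneg hB hS (x := -x) (by rw [mulVec_neg, hx, neg_zero])
  exact hx0 (le_antisymm (neg_nonneg.1 h2) h1)

/-- The determinant along `t • B`, `0 ≤ t ≤ 1`, starts at one and never vanishes, because `t • B` is
dominated by `B`. -/
lemma det_one_sub_pos [DecidableEq n] {B : Matrix n n ℝ} (hB : ∀ i j, 0 ≤ B i j)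
    (hS : ¬ SubInv B) : 0 < (1 - B).det := by
  have hc : Continuous fun t : ℝ => (1 - t • B).det :=
    Continuous.matrix_det (by fun_prop)
  by_contra hneg
  have : (0 : ℝ) ∈ (fun t : ℝ => (1 - t • B).det) '' Set.Icc 0 1 := by
    refine intermediate_value_Icc' zero_le_one hc.continuousOn ⟨?_, ?_⟩
    · simpa using hneg
    · simp
  obtain ⟨t, ht, h0⟩ := this
  refine det_one_sub_ne_zero (B := t • B) (fun i j => ?_) (fun h => hS (h.mono fun i j => ?_)) h0
  · exact mul_nonneg ht.1 (hB i j)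
  · exact mul_le_of_le_one_left (hB i j) ht.2

/-- Irreducibility of a nonnegative matrix. -/
def Irred (B : Matrix n n ℝ) : Prop := ∀ i j, Relation.TransGen (fun i j => 0 < B i j) i j

/-- A zero coordinate of a nonnegative fixed vector forces a zero at every index with a positive
entry in its row; irreducibility carries this to all indices. -/
lemma Irred.pos_of_fixed {B : Matrix n n ℝ} (hB : ∀ i j, 0 ≤ B i j) (hI : Irred B) {x : n → ℝ}
    (h0 : 0 ≤ x) (hne : x ≠ 0) (hx : B *ᵥ x = x) (i : n) : 0 < x i := by
  refine lt_of_le_of_ne (h0 i) fun hi => hne ?_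
  funext j
  have step : ∀ k l, 0 < B k l → x k = 0 → x l = 0 := by
    intro k l hkl hk
    rw [← hx] at hk
    have := (Finset.sum_eq_zero_iff_of_nonneg
      (fun j _ => mul_nonneg (hB k j) (h0 j))).1 hk l (Finset.mem_univ _)
    exact (mul_eq_zero.1 this).resolve_left hkl.ne'
  have := hI i j
  induction this with
  | single h => exact step _ _ h hi.symm
  | tail _ h ih => exact step _ _ h ih

/-- The Perron eigenvector is the only subinvariant vector. -/
lemma Irred.eq_smul {B : Matrix n n ℝ} (hB : ∀ i j, 0 ≤ B i j) (hI : Irred B) {u x : n → ℝ}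
    (hu : ∀ i, 0 < u i) (hBu : B *ᵥ u = u) (hx : x ≤ B *ᵥ x) [Nonempty n] :
    ∃ c : ℝ, x = c • u := by
  -- Maximum principle: where the ratio `x / u` attains its maximum `c`, it attains it at every
  -- index reached from there.
  obtain ⟨i, hi⟩ := Finite.exists_max fun i => x i / u i
  set c := x i / u i with hc
  have hle : ∀ j, x j ≤ c * u j := fun j => (div_le_iff₀ (hu j)).1 (hi j)
  refine ⟨c, ?_⟩
  have step : ∀ k l, 0 < B k l → x k = c * u k → x l = c * u l := by
    intro k l hkl hk
    have h1 : x k ≤ ∑ j, B k j * x j := hx k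
    have h2 : ∑ j, B k j * (c * u j) = c * u k := by
      have h3 : ∑ j, B k j * u j = u k := congrFun hBu k
      rw [← h3, Finset.mul_sum]
      exact Finset.sum_congr rfl fun j _ => by ring
    have h3 : ∑ j, B k j * (c * u j - x j) ≤ 0 := by
      simp only [mul_sub, Finset.sum_sub_distrib]
      linarith
    have h4 : ∀ j ∈ Finset.univ, 0 ≤ B k j * (c * u j - x j) := fun j _ =>
      mul_nonneg (hB k j) (sub_nonneg.2 (hle j))
    have h5 := (Finset.sum_eq_zero_iff_of_nonneg h4).1
      (le_antisymm h3 (Finset.sum_nonneg h4)) l (Finset.mem_univ _)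
    have h6 := (mul_eq_zero.1 h5).resolve_left hkl.ne'
    linarith
  have hi' : x i = c * u i := by
    rw [hc, div_mul_cancel₀ _ (hu i).ne']
  funext j
  have := hI i j
  induction this with
  | single h => exact step _ _ h hi'
  | tail _ h ih => exact step _ _ h ih

/-- With powers of `1 + B` instead of `B` the support can only grow, so one exponent serves all
coordinates and no aperiodicity is needed. -/
lemma Irred.exists_pow_pos [DecidableEq n] {B : Matrix n n ℝ} (hB : ∀ i j, 0 ≤ B i j)
    (hI : Irred B) {d : n → ℝ} (h0 : 0 ≤ d) (hne : d ≠ 0) :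
    ∃ k : ℕ, ∀ i, 0 < (((1 + B) ^ k) *ᵥ d) i := by
  have hnn : ∀ k : ℕ, 0 ≤ ((1 + B) ^ k) *ᵥ d := by
    intro k
    induction k with
    | zero => simpa using h0
    | succ k ih =>
      rw [pow_succ', ← mulVec_mulVec, add_mulVec, one_mulVec]
      exact add_nonneg ih (mulVec_nonneg' hB ih)
  have hsucc : ∀ (k : ℕ) (i : n), (((1 + B) ^ (k + 1)) *ᵥ d) i =
      (((1 + B) ^ k) *ᵥ d) i + (B *ᵥ (((1 + B) ^ k) *ᵥ d)) i := by
    intro k i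
    rw [pow_succ', ← mulVec_mulVec, add_mulVec, one_mulVec]
    rfl
  have hmono : ∀ i, Monotone fun k : ℕ => (((1 + B) ^ k) *ᵥ d) i := by
    intro i
    refine monotone_nat_of_le_succ fun k => ?_
    rw [hsucc]
    exact le_add_of_nonneg_right (mulVec_nonneg' hB (hnn k) i)
  obtain ⟨a, ha⟩ := Function.ne_iff.1 hne
  have ha' : 0 < d a := lt_of_le_of_ne (h0 a) (Ne.symm ha)
  have hstep : ∀ i j (k : ℕ), 0 < B i j → 0 < (((1 + B) ^ k) *ᵥ d) j →
      0 < (((1 + B) ^ (k + 1)) *ᵥ d) i := by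
    intro i j k hij hj
    rw [hsucc]
    refine add_pos_of_nonneg_of_pos (hnn k i) ?_
    exact Finset.sum_pos' (fun l _ => mul_nonneg (hB i l) (hnn k l))
      ⟨j, Finset.mem_univ _, mul_pos hij hj⟩
  have hex : ∀ i, ∃ k : ℕ, 0 < (((1 + B) ^ k) *ᵥ d) i := by
    intro i
    have := hI i a
    induction this using Relation.TransGen.head_induction_on with
    | single h => exact ⟨1, hstep _ _ 0 h (by simpa using ha')⟩
    | head h _ ih =>
      obtain ⟨k, hk⟩ := ih
      exact ⟨k + 1, hstep _ _ k h hk⟩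
  choose k hk using hex
  refine ⟨Finset.univ.sup k, fun i => ?_⟩
  exact (hk i).trans_le (hmono i (Finset.le_sup (Finset.mem_univ i)))

/-- A subinvariant vector which is not invariant can be made strictly subinvariant. -/
lemma Irred.exists_strict [DecidableEq n] {B : Matrix n n ℝ} (hB : ∀ i j, 0 ≤ B i j)
    (hI : Irred B) {x : n → ℝ} (h0 : 0 ≤ x) (hx : x ≤ B *ᵥ x) (hne : B *ᵥ x ≠ x) :
    ∃ x' : n → ℝ, (∀ i, 0 ≤ x' i) ∧ ∀ i, x' i < (B *ᵥ x') i := by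
  -- `(1 + B) ^ k` commutes with `B` and makes the nonzero defect `B x - x` positive everywhere.
  obtain ⟨k, hk⟩ := hI.exists_pow_pos hB (d := B *ᵥ x - x) (sub_nonneg.2 hx) (sub_ne_zero.2 hne)
  refine ⟨((1 + B) ^ k) *ᵥ x, fun i => ?_, fun i => ?_⟩
  · have : ∀ k : ℕ, 0 ≤ ((1 + B) ^ k) *ᵥ x := by
      intro k
      induction k with
      | zero => simpa using h0
      | succ k ih =>
        rw [pow_succ', ← mulVec_mulVec, add_mulVec, one_mulVec]
        exact add_nonneg ih (mulVec_nonneg' hB ih)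
    exact this k i
  · have h1 := hk i
    rw [mulVec_sub] at h1
    have h2 : ((1 + B) ^ k) *ᵥ (B *ᵥ x) = B *ᵥ (((1 + B) ^ k) *ᵥ x) := by
      rw [mulVec_mulVec, mulVec_mulVec]
      congr 1
      exact (((Commute.one_left B).add_left (Commute.refl B)).pow_left k).eq
    rw [h2, Pi.sub_apply] at h1
    linarith

end NonnegMatrix

end

noncomputable section

set_option linter.unusedSectionVars false

namespace OGraph

/-! ### The weighted transfer matrix and its Perron vector -/

section Perron

open Matrix

variable {V E : Type*} [Fintype E] (H : OGraph V E)

open Classical in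
/-- The weighted transfer matrix of reduced edge paths. -/
def T (y : E → ℝ) : Matrix (E × Bool) (E × Bool) ℝ :=
  Matrix.of fun a b : E × Bool => if H.Follows a b then y a.1 else 0

/-- The weights `exp (-l)`. -/
def yexp (l : E → ℝ) : E → ℝ := fun e => Real.exp (-l e)

/-- `l` has a positive invariant vector. -/
def PerronUnit (l : E → ℝ) : Prop := ∃ u, (∀ a, 0 < u a) ∧ H.T (yexp l) *ᵥ u = u

variable {H}

lemma yexp_pos (l : E → ℝ) (e : E) : 0 < yexp l e := Real.exp_pos _

lemma T_apply_of_follows {y : E → ℝ} {a b : E × Bool} (h : H.Follows a b) : H.T y a b = y a.1 :=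
  if_pos h

lemma T_apply_of_not_follows {y : E → ℝ} {a b : E × Bool} (h : ¬ H.Follows a b) :
    H.T y a b = 0 := if_neg h

open Classical in
lemma T_apply (y : E → ℝ) (a b : E × Bool) :
    H.T y a b = if H.Follows a b then y a.1 else 0 := rfl

open Classical in
lemma T_mulVec (y : E → ℝ) (x : E × Bool → ℝ) (a : E × Bool) :
    (H.T y *ᵥ x) a = y a.1 * ∑ b ∈ Finset.univ.filter (H.Follows a), x b := by
  rw [Finset.mul_sum, Finset.sum_filter]
  refine Finset.sum_congr rfl fun b _ => ?_
  change H.T y a b * x b = _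
  rw [T_apply]
  split_ifs <;> simp

lemma T_nonneg {y : E → ℝ} (hy : ∀ e, 0 ≤ y e) (a b : E × Bool) : 0 ≤ H.T y a b := by
  rw [T_apply]
  split_ifs
  · exact hy _
  · exact le_rfl

lemma T_mono {y y' : E → ℝ} (h : ∀ e, y e ≤ y' e) (a b : E × Bool) : H.T y a b ≤ H.T y' a b := by
  rw [T_apply, T_apply]
  split_ifs
  · exact h _
  · exact le_rfl

lemma continuous_T : Continuous (H.T) := by
  refine continuous_pi fun a => continuous_pi fun b => ?_
  by_cases h : H.Follows a b
  · simp only [T_apply_of_follows h]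
    fun_prop
  · simp only [T_apply_of_not_follows h]
    fun_prop

lemma continuous_yexp : Continuous (yexp : (E → ℝ) → E → ℝ) := by
  unfold yexp
  fun_prop

lemma detFun_eq [DecidableEq E] (y : E → ℝ) : H.detFun y = (1 - H.T y).det := by
  unfold detFun T
  congr!

lemma Good.irred (hH : H.Good) {y : E → ℝ} (hy : ∀ e, 0 < y e) : Irred (H.T y) := by
  intro a b
  refine Relation.TransGen.mono (r := H.Follows) (fun c d hcd => ?_) _ _ (hH.transGen a b)
  rw [T_apply_of_follows hcd]
  exact hy _

lemma exists_min_max (hE : Nonempty E) {l : E → ℝ} (hl : l ∈ H.lengthSpace) :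
    ∃ m M : ℝ, 0 < m ∧ m ≤ M ∧ ∀ e, m ≤ l e ∧ l e ≤ M := by
  obtain ⟨i, hi⟩ := Finite.exists_min l
  obtain ⟨j, hj⟩ := Finite.exists_max l
  exact ⟨l i, l j, hl i, hi j, fun e => ⟨hi e, hj e⟩⟩

lemma Good.nonempty_edge (hH : H.Good) : Nonempty E := hH.nonempty_dir.map Prod.fst

/-- Look at a largest coordinate of the subinvariant vector: its row has at most `card (E × Bool)`
nonzero entries, each at most `exp (-(s m))`. This bounds the `s` which occur in
`Good.exists_perronUnit`. -/
lemma subInv_bound (hE : Nonempty E) {l : E → ℝ} {m s : ℝ} (hs : 0 ≤ s)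
    (hl : ∀ e, m ≤ l e) (h : SubInv (H.T (yexp (s • l)))) :
    1 ≤ Real.exp (-(s * m)) * Fintype.card (E × Bool) := by
  obtain ⟨x, h0, h1, h2⟩ := h
  obtain ⟨a, ha⟩ := Finite.exists_max x
  have hpos : 0 < x a := by
    obtain ⟨b, hb⟩ := Function.ne_iff.1 h1
    exact (lt_of_le_of_ne (h0 b) (Ne.symm hb)).trans_le (ha b)
  classical
  have h3 := h2 a
  rw [T_mulVec] at h3
  have h4 : ∑ b ∈ Finset.univ.filter (H.Follows a), x b ≤ Fintype.card (E × Bool) * x a := by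
    refine (Finset.sum_le_univ_sum_of_nonneg h0).trans ?_
    refine (Finset.sum_le_card_nsmul _ _ _ fun b _ => ha b).trans ?_
    rw [nsmul_eq_mul, Finset.card_univ]
  have h5 : yexp (s • l) a.1 ≤ Real.exp (-(s * m)) := by
    refine Real.exp_le_exp.2 (neg_le_neg ?_)
    exact mul_le_mul_of_nonneg_left (hl _) hs
  have h6 : x a ≤ Real.exp (-(s * m)) * (Fintype.card (E × Bool) * x a) :=
    h3.trans (mul_le_mul h5 h4 (Finset.sum_nonneg fun b _ => h0 b) (Real.exp_pos _).le)
  have h7 : 1 * x a ≤ Real.exp (-(s * m)) * Fintype.card (E × Bool) * x a := by linarith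
  exact le_of_mul_le_mul_right h7 hpos

/-- Strict subinvariance persists under small changes of `s`; it contradicts the maximality of `s`
in `Good.exists_perronUnit`. -/
lemma exists_gt_subInv [Nonempty (E × Bool)] {l : E → ℝ} {s : ℝ} {x : E × Bool → ℝ}
    (h0 : ∀ a, 0 ≤ x a) (h : ∀ a, x a < (H.T (yexp (s • l)) *ᵥ x) a) :
    ∃ s' > s, SubInv (H.T (yexp (s' • l))) := by
  have hc : ∀ a, Continuous fun s' : ℝ => (H.T (yexp (s' • l)) *ᵥ x) a := fun a => by
    have : Continuous fun s' : ℝ => (H.T (yexp (s' • l)) *ᵥ x) :=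
      Continuous.matrix_mulVec (continuous_T.comp (continuous_yexp.comp (by fun_prop)))
        continuous_const
    exact (continuous_apply a).comp this
  have hev : ∀ᶠ s' in 𝓝 s, ∀ a, x a < (H.T (yexp (s' • l)) *ᵥ x) a :=
    eventually_all.2 fun a => (hc a).continuousAt.eventually_const_lt (h a)
  obtain ⟨s', h1, h2⟩ := ((hev.filter_mono nhdsWithin_le_nhds).and
    (self_mem_nhdsWithin (a := s) (s := Set.Ioi s))).exists
  refine ⟨s', h2, x, h0, ?_, fun a => (h1 a).le⟩
  rintro rfl
  obtain ⟨a⟩ := ‹Nonempty (E × Bool)›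
  have := h1 a
  simp at this

/-- The number is the largest `s` such that the matrix at `s • l` has a subinvariant vector. At `s =
0` the constant vector is subinvariant, and not invariant because some valence is at least three, so
positive `s` occur. At the maximum the subinvariant vector must be fixed, since otherwise it could
be made strict and `s` increased. -/
lemma Good.exists_perronUnit (hH : H.Good) {l : E → ℝ} (hl : l ∈ H.lengthSpace) :
    ∃ h : ℝ, 0 < h ∧ H.PerronUnit (h • l) := by
  classical
  have hne := hH.nonempty_dir
  obtain ⟨m, M, hm, -, hmM⟩ := exists_min_max hH.nonempty_edge hl
  set S : Set ℝ := {s | 0 ≤ s ∧ SubInv (H.T (yexp (s • l)))} with hS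
  have hSc : IsClosed S := by
    refine isClosed_Ici.inter (isClosed_subInv.preimage ?_)
    exact continuous_T.comp (continuous_yexp.comp (by fun_prop))
  have hSb : BddAbove S := by
    refine ⟨Real.log (Fintype.card (E × Bool)) / m, fun s hs => ?_⟩
    have h1 := subInv_bound hH.nonempty_edge hs.1 (fun e => (hmM e).1) hs.2
    rw [le_div_iff₀ hm]
    rw [Real.exp_neg, inv_mul_eq_div, one_le_div (Real.exp_pos _)] at h1
    exact (Real.le_log_iff_exp_le (by exact_mod_cast Fintype.card_pos)).2 h1
  have hone : ∀ a, (H.T (yexp ((0 : ℝ) • l)) *ᵥ 1) a = ((H.valence (H.τ a) - 1 : ℕ) : ℝ) := by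
    intro a
    rw [T_mulVec, ← card_follows]
    simp [yexp]
  have h0S : ∃ s > 0, s ∈ S := by
    have hB := T_nonneg (H := H) (y := yexp ((0 : ℝ) • l)) fun e => (yexp_pos _ e).le
    have h1 : (1 : E × Bool → ℝ) ≤ H.T (yexp ((0 : ℝ) • l)) *ᵥ 1 := by
      intro a
      rw [hone]
      have := hH.two_le (H.τ a)
      simp only [Pi.one_apply, Nat.one_le_cast]
      omega
    have h2 : H.T (yexp ((0 : ℝ) • l)) *ᵥ 1 ≠ 1 := by
      intro h
      obtain ⟨v, hv⟩ := hH.three_le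
      have hv' := hv
      unfold valence at hv'
      have : Nonempty {a : E × Bool // H.o a = v} := by
        by_contra hcon
        rw [not_nonempty_iff] at hcon
        simp at hv'
      obtain ⟨a, ha⟩ := this
      have h3 := hone (bar a)
      rw [h, τ_bar, ha] at h3
      simp only [Pi.one_apply] at h3
      have : (H.valence v - 1 : ℕ) = 1 := by exact_mod_cast h3.symm
      omega
    obtain ⟨x, hx0, hx⟩ := (hH.irred (y := yexp ((0 : ℝ) • l)) (yexp_pos _)).exists_strict hB
      (fun _ => zero_le_one) h1 h2
    obtain ⟨s, hs, hs'⟩ := exists_gt_subInv hx0 hx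
    exact ⟨s, hs, le_of_lt hs, hs'⟩
  obtain ⟨s₀, hs₀, hs₀S⟩ := h0S
  have hmem : sSup S ∈ S := hSc.csSup_mem ⟨s₀, hs₀S⟩ hSb
  have hpos : (0 : ℝ) < sSup S := hs₀.trans_le (le_csSup hSb hs₀S)
  refine ⟨sSup S, hpos, ?_⟩
  obtain ⟨-, x, hx0, hx1, hx2⟩ := hmem
  have hB := T_nonneg (H := H) (y := yexp (sSup S • l)) fun e => (yexp_pos _ e).le
  have hI := hH.irred (y := yexp (sSup S • l)) (yexp_pos _)
  by_cases hfix : H.T (yexp (sSup S • l)) *ᵥ x = x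
  · exact ⟨x, hI.pos_of_fixed hB hx0 hx1 hfix, hfix⟩
  · obtain ⟨x', hx0', hx'⟩ := hI.exists_strict hB hx0 hx2 hfix
    obtain ⟨s, hs, hs'⟩ := exists_gt_subInv hx0' hx'
    exact absurd (le_csSup hSb (show s ∈ S from ⟨hpos.le.trans hs.le, hs'⟩)) (not_le.2 hs)

end Perron

/-! ### Counting circuits: the entropy is the Perron exponent -/

section Counting

open Matrix

variable {V E : Type*} [Fintype E] (H : OGraph V E)

open Classical in
/-- The reduced edge paths with `n + 1` edges, first edge `a` and length at most `t`. -/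
def paths (l : E → ℝ) : ℕ → E × Bool → ℝ → Finset (List (E × Bool))
  | 0, a, t => if l a.1 ≤ t then {[a]} else ∅
  | n + 1, a, t => (Finset.univ.filter (H.Follows a)).biUnion fun b =>
      (paths l n b (t - l a.1)).image (List.cons a)

variable {H}

lemma mem_paths {l : E → ℝ} {n : ℕ} {a : E × Bool} {t : ℝ} {w : List (E × Bool)} :
    w ∈ H.paths l n a t ↔ w.length = n + 1 ∧ w.head? = some a ∧ w.IsChain H.Follows ∧
      (w.map fun a => l a.1).sum ≤ t := by
  induction n generalizing a t w with
  | zero =>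
    unfold paths
    split_ifs with h
    · simp only [Finset.mem_singleton]
      constructor
      · rintro rfl
        simpa using h
      · rintro ⟨h1, h2, -, -⟩
        obtain ⟨b, rfl⟩ := List.length_eq_one_iff.1 h1
        simpa using h2
    · simp only [Finset.notMem_empty, false_iff]
      rintro ⟨h1, h2, -, h3⟩
      obtain ⟨b, rfl⟩ := List.length_eq_one_iff.1 h1
      simp only [List.head?_cons, Option.some.injEq] at h2
      subst h2
      exact h (by simpa using h3)
  | succ n ih =>
    unfold paths
    simp only [Finset.mem_biUnion, Finset.mem_filter, Finset.mem_univ, true_and, Finset.mem_image]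
    constructor
    · rintro ⟨b, hab, w', hw', rfl⟩
      obtain ⟨h1, h2, h3, h4⟩ := ih.1 hw'
      obtain ⟨w'', rfl⟩ : ∃ w'', w' = b :: w'' := by
        cases w' with
        | nil => simp at h2
        | cons c w'' => exact ⟨w'', by simpa using h2⟩
      refine ⟨by simpa using h1, rfl, ?_, ?_⟩
      · exact List.isChain_cons_cons.2 ⟨hab, h3⟩
      · rw [List.map_cons, List.sum_cons]
        linarith
    · rintro ⟨h1, h2, h3, h4⟩
      match w, h1, h2, h3, h4 with
      | c :: b :: w'', h1, h2, h3, h4 =>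
        simp only [List.head?_cons, Option.some.injEq] at h2
        subst h2
        rw [List.isChain_cons_cons] at h3
        refine ⟨b, h3.1, b :: w'', ih.2 ⟨by simpa using h1, rfl, h3.2, ?_⟩, rfl⟩
        rw [List.map_cons, List.sum_cons] at h4
        linarith

lemma card_paths_succ (l : E → ℝ) (n : ℕ) (a : E × Bool) (t : ℝ) :
    open Classical in (H.paths l (n + 1) a t).card =
      ∑ b ∈ Finset.univ.filter (H.Follows a), (H.paths l n b (t - l a.1)).card := by
  classical
  rw [paths, Finset.card_biUnion]
  · convert Finset.sum_congr rfl fun b _ => ?_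
    exact Finset.card_image_of_injective _ (List.cons_injective)
  · intro b _ c _ hbc
    refine Finset.disjoint_left.2 fun w hw hw' => hbc ?_
    obtain ⟨w1, h1, rfl⟩ := Finset.mem_image.1 hw
    obtain ⟨w2, h2, h3⟩ := Finset.mem_image.1 hw'
    have := (List.cons_inj_right a).1 h3
    subst this
    have e1 := (mem_paths.1 h1).2.1
    have e2 := (mem_paths.1 h2).2.1
    rw [e1] at e2
    exact Option.some_injective _ e2

/-- The function `u a * exp (h * t)` satisfies the recursion of the path count exactly, because `u`
is fixed by the matrix at `h • l`. The bound is uniform in the number of edges. -/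
lemma card_paths_le {l : E → ℝ} (hl : ∀ e, 0 < l e) {h : ℝ} (hh : 0 < h) {u : E × Bool → ℝ}
    (hTu : H.T (yexp (h • l)) *ᵥ u = u) {C : ℝ} (hC : ∀ a, 1 ≤ C * u a)
    (n : ℕ) (a : E × Bool) (t : ℝ) :
    ((H.paths l n a t).card : ℝ) ≤ C * u a * Real.exp (h * t) := by
  classical
  have hC0 : ∀ a, 0 < C * u a := fun a => zero_lt_one.trans_le (hC a)
  induction n generalizing a t with
  | zero =>
    unfold paths
    split_ifs with ht
    · have : 1 ≤ Real.exp (h * t) := Real.one_le_exp (mul_nonneg hh.le ((hl _).le.trans ht))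
      simp only [Finset.card_singleton, Nat.cast_one]
      nlinarith [hC a]
    · simpa using (mul_pos (hC0 a) (Real.exp_pos _)).le
  | succ n ih =>
    rw [card_paths_succ, Nat.cast_sum]
    calc ∑ b ∈ Finset.univ.filter (H.Follows a), ((H.paths l n b (t - l a.1)).card : ℝ)
        ≤ ∑ b ∈ Finset.univ.filter (H.Follows a), C * u b * Real.exp (h * (t - l a.1)) :=
          Finset.sum_le_sum fun b _ => ih b _
      _ = C * Real.exp (h * t) * (H.T (yexp (h • l)) *ᵥ u) a := by
          rw [T_mulVec, Finset.mul_sum, Finset.mul_sum]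
          refine Finset.sum_congr rfl fun b _ => ?_
          have : Real.exp (h * (t - l a.1)) = Real.exp (h * t) * yexp (h • l) a.1 := by
            unfold yexp
            rw [← Real.exp_add]
            congr 1
            simp only [Pi.smul_apply, smul_eq_mul]
            ring
          rw [this]
          ring
      _ = C * u a * Real.exp (h * t) := by rw [hTu]; ring

/-- The same function solves the recursion for the count summed over the number of edges. Above `2M`
a step lowers `t` by at least `m` and leaves it at least `M`, so `k` steps suffice; below `2M` the
path with the single edge `a` is enough, by the choice of `c`. -/
lemma le_sum_card_paths {l : E → ℝ} {m M : ℝ} (hl : ∀ e, m ≤ l e ∧ l e ≤ M)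
    {h : ℝ} (hh : 0 < h) {u : E × Bool → ℝ}
    (hu : ∀ a, 0 < u a) (hTu : H.T (yexp (h • l)) *ᵥ u = u) {c : ℝ} (hc0 : 0 < c)
    (hc : ∀ a, c * u a * Real.exp (h * (2 * M)) ≤ 1)
    (k : ℕ) (a : E × Bool) (t : ℝ) (htM : M ≤ t) (htk : t ≤ 2 * M + k * m) :
    c * u a * Real.exp (h * t) ≤ ∑ n ∈ Finset.range (k + 1), ((H.paths l n a t).card : ℝ) := by
  classical
  induction k generalizing a t with
  | zero =>
    have h1 : (H.paths l 0 a t).card = 1 := by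
      unfold paths
      rw [if_pos ((hl _).2.trans htM), Finset.card_singleton]
    simp only [zero_add, Finset.range_one, Finset.sum_singleton, h1, Nat.cast_one]
    refine le_trans ?_ (hc a)
    refine mul_le_mul_of_nonneg_left (Real.exp_le_exp.2 ?_) (mul_pos hc0 (hu a)).le
    refine mul_le_mul_of_nonneg_left ?_ hh.le
    simpa using htk
  | succ k ih =>
    rw [Finset.sum_range_succ']
    by_cases ht2 : t ≤ 2 * M
    · have h1 : (H.paths l 0 a t).card = 1 := by
        unfold paths
        rw [if_pos ((hl _).2.trans htM), Finset.card_singleton]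
      rw [h1, Nat.cast_one]
      have h2 : c * u a * Real.exp (h * t) ≤ 1 := by
        refine le_trans ?_ (hc a)
        refine mul_le_mul_of_nonneg_left (Real.exp_le_exp.2 ?_) (mul_pos hc0 (hu a)).le
        exact mul_le_mul_of_nonneg_left ht2 hh.le
      have h3 : (0 : ℝ) ≤ ∑ n ∈ Finset.range (k + 1), ((H.paths l (n + 1) a t).card : ℝ) :=
        Finset.sum_nonneg fun _ _ => Nat.cast_nonneg _
      linarith
    · refine le_add_of_le_of_nonneg ?_ (Nat.cast_nonneg _)
      have e1 : ∑ n ∈ Finset.range (k + 1), ((H.paths l (n + 1) a t).card : ℝ) =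
          ∑ b ∈ Finset.univ.filter (H.Follows a),
            ∑ n ∈ Finset.range (k + 1), ((H.paths l n b (t - l a.1)).card : ℝ) := by
        rw [Finset.sum_comm]
        refine Finset.sum_congr rfl fun n _ => ?_
        rw [card_paths_succ, Nat.cast_sum]
      rw [e1]
      have e2 : c * u a * Real.exp (h * t) =
          ∑ b ∈ Finset.univ.filter (H.Follows a), c * u b * Real.exp (h * (t - l a.1)) := by
        rw [← congrFun hTu a, T_mulVec, Finset.mul_sum, Finset.mul_sum, Finset.sum_mul]
        refine Finset.sum_congr rfl fun b _ => ?_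
        have : Real.exp (h * (t - l a.1)) = Real.exp (h * t) * yexp (h • l) a.1 := by
          unfold yexp
          rw [← Real.exp_add]
          congr 1
          simp only [Pi.smul_apply, smul_eq_mul]
          ring
        rw [this]
        ring
      rw [e2]
      refine Finset.sum_le_sum fun b _ => ih b _ ?_ ?_
      · have := (hl a.1).2
        linarith
      · have := (hl a.1).1
        push_cast at htk
        linarith

lemma exists_closing {b a : E × Bool} (h : Relation.TransGen H.Follows b a) :
    ∃ w, (b :: w).IsChain H.Follows ∧ H.Follows ((b :: w).getLast (by simp)) a := by
  induction h using Relation.TransGen.head_induction_on with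
  | single h => exact ⟨[], by simp, by simpa using h⟩
  | head h _ ih =>
    obtain ⟨w, h1, h2⟩ := ih
    exact ⟨_ :: w, List.isChain_cons_cons.2 ⟨h, h1⟩, by simpa using h2⟩

lemma mem_circuits_of_list {l : E → ℝ} {t : ℝ} {a : E × Bool} {w : List (E × Bool)}
    (h1 : (a :: w).IsChain H.Follows) (h2 : H.Follows ((a :: w).getLast (by simp)) a)
    (h3 : ((a :: w).map fun a => l a.1).sum ≤ t) :
    (⟨w.length, fun i => (a :: w).get i⟩ : Σ n : ℕ, Fin (n + 1) → E × Bool) ∈ H.circuits l t := by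
  refine ⟨fun i => ?_, ?_⟩
  · by_cases hi : (i : ℕ) < w.length
    · have hv : ((i + 1 : Fin (w.length + 1)) : ℕ) = i + 1 := by
        rw [Fin.val_add_one_of_lt]
        exact Fin.lt_def.2 (by simpa using hi)
      have := List.isChain_iff_getElem.1 h1 i (by simpa using hi)
      simp only [List.get_eq_getElem, hv]
      exact this
    · have hi' : i = Fin.last _ := Fin.ext (by
        have h := i.isLt
        simp only [Fin.val_last]
        simp only at h
        omega)
      subst hi'
      simp only [Fin.last_add_one, List.get_eq_getElem, Fin.val_last, Fin.val_zero]
      rw [List.getLast_eq_getElem] at h2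
      exact h2
  · refine le_trans (le_of_eq ?_) h3
    rw [← List.sum_ofFn]
    congr 1
    refine List.ext_getElem (by simp) fun i h h' => ?_
    simp only [List.getElem_ofFn, List.getElem_map, List.get_eq_getElem]

lemma circuits_image_subset {l : E → ℝ} {m t : ℝ} (hm : 0 < m) (hl : ∀ e, m ≤ l e)
    {N : ℕ} (hN : t / m ≤ N) :
    open Classical in (fun c : Σ n : ℕ, Fin (n + 1) → E × Bool => List.ofFn c.2) ''
      H.circuits l t ⊆ ((Finset.range N).biUnion fun n => Finset.univ.biUnion fun a =>
        H.paths l n a t : Finset (List (E × Bool))) := by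
  classical
  rintro _ ⟨⟨n, c⟩, ⟨h1, h2⟩, rfl⟩
  simp only [Finset.coe_biUnion, Set.mem_iUnion, Finset.mem_coe, Finset.mem_range, Finset.mem_univ,
    exists_prop, true_and]
  have hsum : ((n : ℝ) + 1) * m ≤ t := by
    refine le_trans ?_ h2
    have := Finset.card_nsmul_le_sum Finset.univ (fun i => l (c i).1) m fun i _ => hl _
    simpa using this
  refine ⟨n, ?_, c 0, mem_paths.2 ⟨by simp, by simp, ?_, ?_⟩⟩
  · rw [div_le_iff₀ hm] at hN
    have : ((n : ℝ) + 1) * m ≤ N * m := hsum.trans hN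
    have := le_of_mul_le_mul_right this hm
    exact_mod_cast this
  · rw [List.isChain_ofFn]
    intro i hi
    have hi' : i + 1 < n + 1 := hi
    have := h1 ⟨i, by change i < n + 1; omega⟩
    convert this using 2
    refine Fin.ext ?_
    rw [Fin.val_add_one_of_lt]
    refine Fin.lt_def.2 ?_
    change i < n
    omega
  · refine le_trans (le_of_eq ?_) h2
    simp only [List.map_ofFn, List.sum_ofFn, Function.comp_apply]

lemma ofFn_sigma_injective :
    Function.Injective (fun c : Σ n : ℕ, Fin (n + 1) → E × Bool => List.ofFn c.2) := by
  rintro ⟨n, c⟩ ⟨n', c'⟩ h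
  have hn : n = n' := by
    have := congrArg List.length h
    simpa using this
  subst hn
  have := List.ofFn_injective h
  simp only at this
  rw [this]

lemma circuits_finite {l : E → ℝ} {m t : ℝ} (hm : 0 < m) (hl : ∀ e, m ≤ l e) :
    (H.circuits l t).Finite := by
  obtain ⟨N, hN⟩ := exists_nat_ge (t / m)
  refine Set.Finite.of_finite_image ?_ ofFn_sigma_injective.injOn
  exact (Finset.finite_toSet _).subset (circuits_image_subset hm hl hN)

lemma ncard_circuits_le {l : E → ℝ} {m t : ℝ} (hm : 0 < m) (hl : ∀ e, m ≤ l e)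
    {N : ℕ} (hN : t / m ≤ N) :
    ((H.circuits l t).ncard : ℝ) ≤
      ∑ n ∈ Finset.range N, ∑ a : E × Bool, ((H.paths l n a t).card : ℝ) := by
  classical
  rw [← Set.ncard_image_of_injective _ ofFn_sigma_injective]
  have h1 := Set.ncard_le_ncard (circuits_image_subset (H := H) (t := t) hm hl hN)
    (Finset.finite_toSet _)
  rw [Set.ncard_coe_finset] at h1
  have h2 := h1.trans (Finset.card_biUnion_le.trans
    (Finset.sum_le_sum fun n _ => Finset.card_biUnion_le))
  exact_mod_cast h2

/-- Each path from `a` is closed up by a connecting path which depends only on its last edge and has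
at most `K` edges. The circuit together with the number of added edges determines the path, whence
the factor `K + 1`. -/
lemma Good.sum_card_paths_le (hH : H.Good) {l : E → ℝ} {m M : ℝ} (hm : 0 < m)
    (hl : ∀ e, m ≤ l e ∧ l e ≤ M) (a : E × Bool) :
    ∃ (K : ℕ) (C : ℝ), ∀ (N : ℕ) (t : ℝ),
      ∑ n ∈ Finset.range N, ((H.paths l n a t).card : ℝ) ≤
        (K + 1) * ((H.circuits l (t + C)).ncard : ℝ) := by
  classical
  choose κ hκ1 hκ2 using fun b => exists_closing (hH.transGen b a)
  set K : ℕ := Finset.univ.sup fun b => (κ b).length with hK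
  have hκK : ∀ b, (κ b).length ≤ K := fun b =>
    Finset.le_sup (f := fun b => (κ b).length) (Finset.mem_univ b)
  have hM : 0 ≤ M := by
    have := hl a.1
    linarith
  refine ⟨K, K * M, fun N t => ?_⟩
  have hfin := circuits_finite (H := H) (t := t + K * M) hm fun e => (hl e).1
  set L : Finset (List (E × Bool)) := hfin.toFinset.image fun c => List.ofFn c.2 with hL
  have hLc : L.card = (H.circuits l (t + K * M)).ncard := by
    rw [hL, Finset.card_image_of_injective _ ofFn_sigma_injective,
      Set.ncard_eq_toFinset_card _ hfin]
  set W := (Finset.range N).biUnion fun n => H.paths l n a t with hW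
  have hWc : W.card = ∑ n ∈ Finset.range N, (H.paths l n a t).card := by
    refine Finset.card_biUnion fun n _ n' _ hnn => Finset.disjoint_left.2 fun w hw hw' => hnn ?_
    have e1 := (mem_paths.1 hw).1
    have e2 := (mem_paths.1 hw').1
    omega
  let g : List (E × Bool) → List (E × Bool) := fun w => κ (w.getLast?.getD a)
  have hmaps : ∀ w ∈ W, (w ++ g w, (g w).length) ∈ L ×ˢ Finset.range (K + 1) := by
    intro w hw
    obtain ⟨n, -, hn⟩ := Finset.mem_biUnion.1 hw
    obtain ⟨h1, h2, h3, h4⟩ := mem_paths.1 hn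
    obtain ⟨w', rfl⟩ : ∃ w', w = a :: w' := by
      cases w with
      | nil => simp at h2
      | cons c w' => exact ⟨w', by simpa using h2⟩
    rw [Finset.mem_product, Finset.mem_range]
    refine ⟨?_, Nat.lt_succ_of_le (hκK _)⟩
    rw [hL, Finset.mem_image]
    set b := (a :: w').getLast (by simp) with hb
    have hg : g (a :: w') = κ b := by
      simp only [g, List.getLast?_eq_getLast_of_ne_nil (List.cons_ne_nil a w'), Option.getD_some, hb]
    refine ⟨⟨(w' ++ g (a :: w')).length, fun i => (a :: (w' ++ g (a :: w'))).get i⟩, ?_, ?_⟩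
    · rw [Set.Finite.mem_toFinset]
      rw [hg]
      refine mem_circuits_of_list ?_ ?_ ?_
      · rw [← List.cons_append, List.isChain_append]
        refine ⟨h3, (hκ1 b).tail, fun x hx y hy => ?_⟩
        have hxb : x = b := by
          rw [List.getLast?_eq_getLast_of_ne_nil (List.cons_ne_nil a w')] at hx
          simpa [hb] using hx.symm
        subst hxb
        have := hκ1 b
        cases hk : κ b with
        | nil => simp [hk] at hy
        | cons c k =>
          rw [hk] at this hy
          simp only [List.head?_cons, Option.mem_def, Option.some.injEq] at hy
          subst hy
          exact (List.isChain_cons_cons.1 this).1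
      · convert hκ2 b using 1
        by_cases hk : κ b = []
        · simp only [hk, List.append_nil, List.getLast_singleton]
          rfl
        · rw [List.getLast_cons (by simp [hk]), List.getLast_cons hk,
            List.getLast_append_of_ne_nil _ hk]
      · rw [← List.cons_append, List.map_append, List.sum_append]
        refine add_le_add h4 ?_
        have := List.sum_le_card_nsmul ((κ b).map fun a => l a.1) M (by
          intro x hx
          obtain ⟨c, -, rfl⟩ := List.mem_map.1 hx
          exact (hl _).2)
        rw [List.length_map, nsmul_eq_mul] at this
        refine this.trans (mul_le_mul_of_nonneg_right ?_ hM)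
        exact_mod_cast hκK b
    · exact List.ofFn_get (a :: (w' ++ g (a :: w')))
  have hinj : Set.InjOn (fun w => (w ++ g w, (g w).length)) (W : Set (List (E × Bool))) := by
    intro w _ w' _ h
    rw [Prod.mk.injEq] at h
    exact (List.append_inj' h.1 h.2).1
  have := Finset.card_le_card_of_injOn _ hmaps hinj
  rw [Finset.card_product, Finset.card_range, hLc, hWc, mul_comm] at this
  exact_mod_cast this

/-- The number of circuits lies between constant multiples of `exp (h t)` and `t * exp (h t)`. The
extra factor `t` bounds the possible numbers of edges and disappears in `(1/t) log`. -/
theorem Good.entropy_eq (hH : H.Good) {l : E → ℝ} (hl : l ∈ H.lengthSpace) {h : ℝ} (hh : 0 < h)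
    (hP : H.PerronUnit (h • l)) : H.entropy l = h := by
  classical
  obtain ⟨u, hu, hTu⟩ := hP
  obtain ⟨m, M, hm, hmM', hmM⟩ := exists_min_max hH.nonempty_edge hl
  have hne := hH.nonempty_dir
  have a : E × Bool := hne.some
  have hM : 0 < M := hm.trans_le hmM'
  obtain ⟨amin, hamin⟩ := Finite.exists_min u
  obtain ⟨amax, hamax⟩ := Finite.exists_max u
  obtain ⟨K, C', hKC⟩ := hH.sum_card_paths_le hm hmM a
  set c : ℝ := (u amax * Real.exp (h * (2 * M)))⁻¹ with hc
  have hc0 : 0 < c := inv_pos.2 (mul_pos (hu _) (Real.exp_pos _))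
  have hc1 : ∀ a, c * u a * Real.exp (h * (2 * M)) ≤ 1 := fun b => by
    rw [hc, mul_assoc, inv_mul_le_one₀ (mul_pos (hu _) (Real.exp_pos _))]
    exact mul_le_mul_of_nonneg_right (hamax b) (Real.exp_pos _).le
  set C : ℝ := (u amin)⁻¹ with hC
  have hC1 : ∀ a, 1 ≤ C * u a := fun b => by
    rw [hC, inv_mul_eq_div, one_le_div (hu _)]
    exact hamin b
  have hlow : ∀ t, M + C' ≤ t →
      c * u a / (K + 1) * Real.exp (h * (t - C')) ≤ ((H.circuits l t).ncard : ℝ) := by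
    intro t ht
    obtain ⟨k, hk⟩ := exists_nat_ge ((t - C' - 2 * M) / m)
    rw [div_le_iff₀ hm] at hk
    have h1 := le_sum_card_paths hmM hh hu hTu hc0 hc1 k a (t - C') (by linarith) (by linarith)
    have h2 := h1.trans (hKC (k + 1) (t - C'))
    rw [sub_add_cancel] at h2
    rw [div_mul_eq_mul_div, div_le_iff₀ (by positivity), mul_comm _ ((K : ℝ) + 1)]
    exact h2
  have hup : ∀ t, 1 ≤ t → ((H.circuits l t).ncard : ℝ) ≤
      ((1 / m + 1) * t) * ((∑ b, C * u b) * Real.exp (h * t)) := by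
    intro t ht
    have h1 := ncard_circuits_le (H := H) (t := t) hm (fun e => (hmM e).1) (Nat.le_ceil (t / m))
    refine h1.trans ?_
    have h2 : ∀ n ∈ Finset.range ⌈t / m⌉₊, ∑ b : E × Bool, ((H.paths l n b t).card : ℝ) ≤
        (∑ b, C * u b) * Real.exp (h * t) := fun n _ => by
      rw [Finset.sum_mul]
      exact Finset.sum_le_sum fun b _ => card_paths_le hl hh hTu hC1 n b t
    refine (Finset.sum_le_card_nsmul _ _ _ h2).trans ?_
    rw [nsmul_eq_mul, Finset.card_range]
    refine mul_le_mul_of_nonneg_right ?_ ?_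
    · have := (Nat.ceil_lt_add_one (div_nonneg (zero_le_one.trans ht) hm.le)).le
      refine this.trans ?_
      have e : (1 / m + 1) * t = t / m + t := by ring
      rw [e]
      linarith
    · exact mul_nonneg (Finset.sum_nonneg fun b _ => zero_le_one.trans (hC1 b)) (Real.exp_pos _).le
  have hS : 0 < ∑ b, C * u b :=
    Finset.sum_pos (fun b _ => zero_lt_one.trans_le (hC1 b)) ⟨a, Finset.mem_univ _⟩
  have hc2 : 0 < c * u a / (K + 1) := div_pos (mul_pos hc0 (hu a)) (by positivity)
  unfold entropy
  refine Tendsto.limUnder_eq ?_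
  set A : ℝ := Real.log (c * u a / (K + 1)) - h * C' with hA
  set B : ℝ := Real.log (1 / m + 1) + Real.log (∑ b, C * u b) with hB
  have l1 : Tendsto (fun t : ℝ => h + A / t) atTop (𝓝 h) := by
    simpa using (tendsto_const_nhds (x := h)).add (tendsto_const_nhds.div_atTop (a := A) tendsto_id)
  have l2 : Tendsto (fun t : ℝ => h + (B / t + Real.log t / t)) atTop (𝓝 h) := by
    have := (tendsto_const_nhds (x := h)).add
      ((tendsto_const_nhds.div_atTop (a := B) tendsto_id).add
        Real.isLittleO_log_id_atTop.tendsto_div_nhds_zero)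
    simpa using this
  refine tendsto_of_tendsto_of_tendsto_of_le_of_le' l1 l2 ?_ ?_
  · filter_upwards [eventually_ge_atTop (M + C'), eventually_ge_atTop 1] with t ht ht1
    have ht0 : 0 < t := zero_lt_one.trans_le ht1
    have h1 := Real.log_le_log (mul_pos hc2 (Real.exp_pos _)) (hlow t ht)
    rw [Real.log_mul hc2.ne' (Real.exp_ne_zero _), Real.log_exp] at h1
    rw [one_div, inv_mul_eq_div, le_div_iff₀ ht0, add_mul, div_mul_cancel₀ _ ht0.ne']
    linarith
  · filter_upwards [eventually_ge_atTop (M + C'), eventually_ge_atTop 1] with t ht ht1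
    have ht0 : 0 < t := zero_lt_one.trans_le ht1
    have hpos : (0 : ℝ) < ((H.circuits l t).ncard : ℝ) :=
      (mul_pos hc2 (Real.exp_pos _)).trans_le (hlow t ht)
    have hm1 : (0 : ℝ) < 1 / m + 1 := by positivity
    have h1 := Real.log_le_log hpos (hup t ht1)
    rw [Real.log_mul (mul_pos hm1 ht0).ne' (mul_pos hS (Real.exp_pos _)).ne',
      Real.log_mul hm1.ne' ht0.ne', Real.log_mul hS.ne' (Real.exp_ne_zero _), Real.log_exp] at h1
    rw [one_div, inv_mul_eq_div, div_le_iff₀ ht0, add_mul, add_mul, div_mul_cancel₀ _ ht0.ne',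
      div_mul_cancel₀ _ ht0.ne']
    linarith

end Counting

end OGraph

end

noncomputable section

set_option linter.unusedSectionVars false

namespace OGraph

/-! ### Entropy through subinvariant vectors: monotonicity and continuity -/

section Criteria

open Matrix

variable {V E : Type*} [Fintype E] {H : OGraph V E}

lemma smul_mem_lengthSpace {l : E → ℝ} (hl : l ∈ H.lengthSpace) {c : ℝ} (hc : 0 < c) :
    c • l ∈ H.lengthSpace := fun e => mul_pos hc (hl e)

lemma Good.entropy_spec (hH : H.Good) {l : E → ℝ} (hl : l ∈ H.lengthSpace) :
    0 < H.entropy l ∧ H.PerronUnit (H.entropy l • l) := by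
  obtain ⟨h, hh, hP⟩ := hH.exists_perronUnit hl
  rw [hH.entropy_eq hl hh hP]
  exact ⟨hh, hP⟩

lemma Good.entropy_smul (hH : H.Good) {l : E → ℝ} (hl : l ∈ H.lengthSpace) {c : ℝ} (hc : 0 < c) :
    H.entropy (c • l) = H.entropy l / c := by
  obtain ⟨h1, h2⟩ := hH.entropy_spec hl
  refine hH.entropy_eq (smul_mem_lengthSpace hl hc) (div_pos h1 hc) ?_
  rwa [smul_smul, div_mul_cancel₀ _ hc.ne']

lemma Good.normalize_mem (hH : H.Good) {l : E → ℝ} (hl : l ∈ H.lengthSpace) :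
    H.entropy l • l ∈ H.unitSpace := by
  have h := (hH.entropy_spec hl).1
  refine ⟨smul_mem_lengthSpace hl h, ?_⟩
  rw [hH.entropy_smul hl h, div_self h.ne']

lemma Good.perronUnit_of_mem (hH : H.Good) {l : E → ℝ} (hl : l ∈ H.unitSpace) :
    H.PerronUnit l := by
  have := (hH.entropy_spec hl.1).2
  rwa [hl.2, one_smul] at this

/-- Let `h` be the entropy and `u` the Perron vector at `h • l`. If `h ≥ 1`, then `u` is
subinvariant at `l`, where the weights are larger. If `h < 1`, a subinvariant vector at `l` is one
at `h • l`, hence a multiple of `u`; but the weights at `l` are strictly smaller. -/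
lemma Good.subInv_iff (hH : H.Good) {l : E → ℝ} (hl : l ∈ H.lengthSpace) :
    SubInv (H.T (yexp l)) ↔ 1 ≤ H.entropy l := by
  classical
  have hne := hH.nonempty_dir
  obtain ⟨h0, u, hu, hTu⟩ := hH.entropy_spec hl
  have hnn : ∀ l : E → ℝ, ∀ a b, 0 ≤ H.T (yexp l) a b := fun l =>
    T_nonneg fun e => (yexp_pos _ e).le
  constructor
  · rintro ⟨x, hx0, hx1, hx2⟩
    by_contra hlt
    rw [not_le] at hlt
    have hy : ∀ e, yexp l e < yexp (H.entropy l • l) e := fun e => by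
      refine Real.exp_lt_exp.2 (neg_lt_neg ?_)
      exact mul_lt_of_lt_one_left (hl e) hlt
    have h1 : x ≤ H.T (yexp (H.entropy l • l)) *ᵥ x :=
      hx2.trans (mulVec_le_mulVec_left (T_mono fun e => (hy e).le) hx0)
    obtain ⟨c, rfl⟩ := (hH.irred (yexp_pos _)).eq_smul (hnn _) hu hTu h1
    obtain ⟨a⟩ := hne
    have hc : 0 < c := by
      refine lt_of_le_of_ne ?_ ?_
      · have := hx0 a
        exact nonneg_of_mul_nonneg_left this (hu a)
      · rintro rfl
        exact hx1 (zero_smul _ _)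
    have h2 := hx2 a
    rw [mulVec_smul] at h2
    have h3 : u a ≤ (H.T (yexp l) *ᵥ u) a := le_of_mul_le_mul_left h2 hc
    have h4 := congrFun hTu a
    rw [T_mulVec] at h3 h4
    have h5 : 0 < ∑ b ∈ Finset.univ.filter (H.Follows a), u b := by
      by_contra hneg
      have : yexp (H.entropy l • l) a.1 * ∑ b ∈ Finset.univ.filter (H.Follows a), u b ≤ 0 :=
        mul_nonpos_of_nonneg_of_nonpos (yexp_pos _ _).le (not_lt.1 hneg)
      linarith [hu a]
    have := mul_lt_mul_of_pos_right (hy a.1) h5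
    linarith
  · intro h1
    refine ⟨u, fun a => (hu a).le, ?_, ?_⟩
    · rintro rfl
      obtain ⟨a⟩ := hne
      exact lt_irrefl _ (hu a)
    · conv_lhs => rw [← hTu]
      refine mulVec_le_mulVec_left (T_mono fun e => ?_) fun a => (hu a).le
      refine Real.exp_le_exp.2 (neg_le_neg ?_)
      exact le_mul_of_one_le_left (hl e).le h1

lemma Good.entropy_anti (hH : H.Good) {l l' : E → ℝ} (hl : l ∈ H.lengthSpace)
    (hll : ∀ e, l e ≤ l' e) : H.entropy l' ≤ H.entropy l := by
  have hl' : l' ∈ H.lengthSpace := fun e => (hl e).trans_le (hll e)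
  have h' := (hH.entropy_spec hl').1
  have h1 : SubInv (H.T (yexp (H.entropy l' • l'))) := by
    rw [hH.subInv_iff (smul_mem_lengthSpace hl' h'), hH.entropy_smul hl' h', div_self h'.ne']
  have h2 : SubInv (H.T (yexp (H.entropy l' • l))) := by
    refine h1.mono (T_mono fun e => Real.exp_le_exp.2 (neg_le_neg ?_))
    exact mul_le_mul_of_nonneg_left (hll e) h'.le
  rw [hH.subInv_iff (smul_mem_lengthSpace hl h'), hH.entropy_smul hl h', one_le_div h'] at h2
  exact h2

lemma isOpen_lengthSpace : IsOpen H.lengthSpace := by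
  have : H.lengthSpace = ⋂ e, {l : E → ℝ | 0 < l e} := by
    ext l
    simp [lengthSpace]
  rw [this]
  exact isOpen_iInter_of_finite fun e => isOpen_lt continuous_const (continuous_apply e)

/-- Monotonicity and homogeneity of degree `-1`: near `l` all length functions are squeezed between
multiples of `l` with factors close to one. -/
lemma Good.continuousAt_entropy (hH : H.Good) {l : E → ℝ} (hl : l ∈ H.lengthSpace) :
    ContinuousAt H.entropy l := by
  have h0 := (hH.entropy_spec hl).1
  have hopen := isOpen_lengthSpace.mem_nhds hl
  refine tendsto_order.2 ⟨fun a ha => ?_, fun b hb => ?_⟩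
  · obtain ⟨a', ha1, ha2⟩ := exists_between (max_lt ha h0)
    have ha0 : 0 < a' := (le_max_right _ _).trans_lt ha1
    have hc : 1 < H.entropy l / a' := (one_lt_div ha0).2 ha2
    have hev : ∀ᶠ l' in 𝓝 l, ∀ e, l' e < (H.entropy l / a') * l e :=
      eventually_all.2 fun e => (continuous_apply e).continuousAt.eventually_lt_const
        (lt_mul_of_one_lt_left (hl e) hc)
    filter_upwards [hev, hopen] with l' h1 h2
    have h3 := hH.entropy_anti h2 (l' := (H.entropy l / a') • l) fun e => (h1 e).le
    rw [hH.entropy_smul hl (div_pos h0 ha0), div_div_cancel₀ h0.ne'] at h3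
    exact ((le_max_left _ _).trans_lt ha1).trans_le h3
  · obtain ⟨b', hb1, hb2⟩ := exists_between hb
    have hb0 : 0 < b' := h0.trans hb1
    have hc : H.entropy l / b' < 1 := (div_lt_one hb0).2 hb1
    have hev : ∀ᶠ l' in 𝓝 l, ∀ e, (H.entropy l / b') * l e < l' e :=
      eventually_all.2 fun e => (continuous_apply e).continuousAt.eventually_const_lt
        (mul_lt_of_lt_one_left (hl e) hc)
    filter_upwards [hev] with l' h1
    have h3 := hH.entropy_anti (smul_mem_lengthSpace hl (div_pos h0 hb0))
      (l' := l') fun e => (h1 e).le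
    rw [hH.entropy_smul hl (div_pos h0 hb0), div_div_cancel₀ h0.ne'] at h3
    exact h3.trans_lt hb2

lemma detFun_pos {y : E → ℝ} (hy : ∀ e, 0 ≤ y e) (h : ¬ SubInv (H.T y)) : 0 < H.detFun y := by
  classical
  rw [detFun_eq]
  exact det_one_sub_pos (T_nonneg hy) h

lemma Good.detFun_eq_zero (hH : H.Good) {l : E → ℝ} (hl : l ∈ H.unitSpace) :
    H.detFun (yexp l) = 0 := by
  classical
  obtain ⟨u, hu, hTu⟩ := hH.perronUnit_of_mem hl
  obtain ⟨a⟩ := hH.nonempty_dir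
  rw [detFun_eq, ← Matrix.exists_mulVec_eq_zero_iff]
  refine ⟨u, fun h => (hu a).ne' (congrFun h a), ?_⟩
  rw [sub_mulVec, one_mulVec, hTu, sub_self]

end Criteria

/-! ### The determinant and its radial derivative -/

section Determinant

open Matrix

variable {V E : Type*} [Fintype E] {H : OGraph V E}

lemma T_add_smul (y w : E → ℝ) (t : ℝ) : H.T (y + t • w) = H.T y + t • H.T w := by
  ext a b
  change H.T (y + t • w) a b = H.T y a b + t * H.T w a b
  by_cases h : H.Follows a b
  · simp [T_apply_of_follows h]
  · simp [T_apply_of_not_follows h]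

lemma contDiff_detFun {n : ℕ∞ω} : ContDiff ℝ n H.detFun := by
  classical
  have : H.detFun = fun y => (1 - H.T y).det := funext fun y => detFun_eq y
  rw [this]
  simp only [Matrix.det_apply]
  refine ContDiff.sum fun σ _ => ContDiff.const_smul _ (contDiff_prod fun a _ => ?_)
  change ContDiff ℝ n fun y => (1 : Matrix (E × Bool) (E × Bool) ℝ) (σ a) a - H.T y (σ a) a
  refine contDiff_const.sub ?_
  by_cases h : H.Follows (σ a) a
  · simp only [T_apply_of_follows h]
    exact contDiff_apply ℝ ℝ _
  · simp only [T_apply_of_not_follows h]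
    exact contDiff_const

lemma differentiableAt_detFun (y : E → ℝ) : DifferentiableAt ℝ H.detFun y :=
  (contDiff_detFun (n := 1)).differentiable one_ne_zero y

lemma differentiableAt_fderiv_detFun (y : E → ℝ) :
    DifferentiableAt ℝ (fderiv ℝ H.detFun) y :=
  ((contDiff_detFun (n := 2)).fderiv_right (m := 1) le_rfl).differentiable one_ne_zero y

lemma hasDerivAt_det {n : Type*} [Fintype n] [DecidableEq n] (A B : Matrix n n ℝ) :
    HasDerivAt (fun t : ℝ => (A + t • B).det) (∑ i, (A.updateRow i (B i)).det) 0 := by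
  let D : ContinuousMultilinearMap ℝ (fun _ : n => n → ℝ) ℝ :=
    { (Matrix.detRowAlternating (R := ℝ) (n := n)).toMultilinearMap with
      cont := Continuous.matrix_det (A := fun M : Matrix n n ℝ => M) continuous_id }
  have hD : ∀ M : Matrix n n ℝ, D (fun i => M i) = M.det := fun M => rfl
  have h1 := D.hasFDerivAt (x := fun i => A i)
  have h2 : HasDerivAt (fun t : ℝ => ((fun i => A i + t • B i) : n → n → ℝ)) (fun i => B i) 0 := by
    refine hasDerivAt_pi.2 fun i => ?_
    simpa using ((hasDerivAt_id (0 : ℝ)).smul_const (B i)).const_add (A i)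
  have h3 := HasFDerivAt.comp_hasDerivAt_of_eq (0 : ℝ) h1 h2 (by simp)
  rw [ContinuousMultilinearMap.linearDeriv_apply] at h3
  exact h3

lemma fderiv_detFun_apply [DecidableEq E] (y w : E → ℝ) :
    fderiv ℝ H.detFun y w = -∑ a, ((1 - H.T y).updateRow a (H.T w a)).det := by
  have h1 : HasDerivAt (fun t : ℝ => y + t • w) w 0 := by
    simpa using ((hasDerivAt_id (0 : ℝ)).smul_const w).const_add y
  have h2 := (differentiableAt_detFun (H := H) y).hasFDerivAt.comp_hasDerivAt_of_eq (0 : ℝ) h1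
    (by simp)
  have h3 := hasDerivAt_det (1 - H.T y) (-H.T w)
  have h4 : (fun t : ℝ => (1 - H.T y + t • -H.T w).det) = H.detFun ∘ fun t : ℝ => y + t • w := by
    funext t
    rw [Function.comp_apply, detFun_eq, T_add_smul, smul_neg, ← sub_eq_add_neg, sub_add_eq_sub_sub]
  rw [h4] at h3
  rw [h2.unique h3, ← Finset.sum_neg_distrib]
  refine Finset.sum_congr rfl fun a _ => ?_
  have : (-H.T w) a = (-1 : ℝ) • H.T w a := by
    rw [neg_one_smul]
    rfl
  rw [this, det_updateRow_smul, neg_one_mul]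

variable (H)

/-- The derivative of `det (I - A)` in the direction of `y log y`. On `y = exp (-l)` it is the
derivative of `F_H` in the direction of `l`. -/
def Kf (y : E → ℝ) : ℝ := fderiv ℝ H.detFun y fun e => y e * Real.log (y e)

/-- The second derivative of `F_H` in the direction of `v`, in terms of `y = exp (-l)`. -/
def Nf (y v : E → ℝ) : ℝ :=
  fderiv ℝ (fderiv ℝ H.detFun) y (fun e => y e * v e) (fun e => y e * v e) +
    fderiv ℝ H.detFun y fun e => y e * v e ^ 2

variable {H}

lemma yexp_mul_log (l : E → ℝ) :
    (fun e => yexp l e * Real.log (yexp l e)) = fun e => -(yexp l e * l e) := by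
  funext e
  simp only [yexp, Real.log_exp]
  ring

/-- With row `a` erased there is no subinvariant vector: it would vanish at `a` and be subinvariant
for the full matrix, hence be a multiple of the positive Perron vector. -/
lemma Good.minor_pos [DecidableEq E] (hH : H.Good) {l : E → ℝ} (hl : l ∈ H.unitSpace)
    (a : E × Bool) : 0 < (1 - (H.T (yexp l)).updateRow a 0).det := by
  have hne := hH.nonempty_dir
  obtain ⟨u, hu, hTu⟩ := hH.perronUnit_of_mem hl
  have hy : ∀ e, 0 ≤ yexp l e := fun e => (yexp_pos l e).le
  refine det_one_sub_pos (fun c d => ?_) ?_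
  · by_cases hc : c = a
    · subst hc
      simp
    · rw [updateRow_ne hc]
      exact T_nonneg hy c d
  · rintro ⟨x, hx0, hx1, hx2⟩
    have hxa : x a = 0 := by
      refine le_antisymm ?_ (hx0 a)
      have := hx2 a
      simpa [mulVec, dotProduct] using this
    have hx3 : x ≤ H.T (yexp l) *ᵥ x := by
      refine hx2.trans (mulVec_le_mulVec_left (fun c d => ?_) hx0)
      by_cases hc : c = a
      · subst hc
        simpa using T_nonneg hy c d
      · rw [updateRow_ne hc]
    obtain ⟨c, rfl⟩ := (hH.irred (yexp_pos l)).eq_smul (T_nonneg hy) hu hTu hx3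
    have : c = 0 := (mul_eq_zero.1 hxa).resolve_right (hu a).ne'
    subst this
    exact hx1 (zero_smul _ _)

/-- The derivative is a sum over the rows, and the term of row `a` is the length of `a` times the
positive minor of `Good.minor_pos`. So the hypersurface `F = 0` is transversal to rays on `M¹`. -/
lemma Good.Kf_pos (hH : H.Good) {l : E → ℝ} (hl : l ∈ H.unitSpace) : 0 < H.Kf (yexp l) := by
  classical
  have hne := hH.nonempty_dir
  have hdet : (1 - H.T (yexp l)).det = 0 := by
    rw [← detFun_eq]
    exact hH.detFun_eq_zero hl
  unfold Kf
  rw [yexp_mul_log, fderiv_detFun_apply, ← Finset.sum_neg_distrib]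
  refine Finset.sum_pos (fun a _ => ?_) Finset.univ_nonempty
  set A := H.T (yexp l) with hA
  have h1 : H.T (fun e => -(yexp l e * l e)) a = (-(l a.1)) • A a := by
    funext b
    change H.T (fun e => -(yexp l e * l e)) a b = -(l a.1) * H.T (yexp l) a b
    by_cases h : H.Follows a b
    · simp only [T_apply_of_follows h]
      ring
    · simp only [T_apply_of_not_follows h, mul_zero]
  -- The row is replaced by a unit vector minus the row of `1 - A`; the latter contributes `det (1 -
  -- A) = 0`.
  have h2 : A a = (1 : Matrix (E × Bool) (E × Bool) ℝ) a + (-1 : ℝ) • ((1 - A) a) := by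
    funext b
    change A a b = (1 : Matrix (E × Bool) (E × Bool) ℝ) a b +
      -1 * ((1 : Matrix (E × Bool) (E × Bool) ℝ) a b - A a b)
    ring
  have h3 : ((1 - A).updateRow a (A a)).det = (1 - A.updateRow a 0).det := by
    rw [h2, det_updateRow_add, det_updateRow_smul, updateRow_eq_self, hdet, mul_zero, add_zero]
    congr 1
    ext c d
    by_cases hc : c = a
    · subst hc
      simp
    · simp [updateRow_ne hc]
  rw [h1, det_updateRow_smul, h3, neg_mul, neg_neg]
  exact mul_pos (hl.1 _) (hH.minor_pos hl a)

end Determinant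

/-! ### Smoothness of the entropy and its Hessian on tangent vectors -/

section Smooth

variable {V E : Type*} [Fintype E] {H : OGraph V E}

variable (H) in
/-- The determinant function in terms of lengths. -/
def FH (l : E → ℝ) : ℝ := H.detFun (yexp l)

lemma contDiff_yexp {n : ℕ∞ω} : ContDiff ℝ n (yexp : (E → ℝ) → E → ℝ) := by
  unfold yexp
  fun_prop

lemma contDiff_FH {n : ℕ∞ω} : ContDiff ℝ n H.FH := contDiff_detFun.comp contDiff_yexp

lemma hasDerivAt_yexp {g : ℝ → E → ℝ} {g' : E → ℝ} {t : ℝ}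
    (hg : ∀ e, HasDerivAt (fun t => g t e) (g' e) t) :
    HasDerivAt (fun t => yexp (g t)) (fun e => -(yexp (g t) e * g' e)) t := by
  refine hasDerivAt_pi.2 fun e => ?_
  have := (hg e).neg.exp
  exact this.congr_deriv (by simp [yexp])

lemma hasDerivAt_FH {g : ℝ → E → ℝ} {g' : E → ℝ} {t : ℝ}
    (hg : ∀ e, HasDerivAt (fun t => g t e) (g' e) t) :
    HasDerivAt (fun t => H.FH (g t))
      (fderiv ℝ H.detFun (yexp (g t)) fun e => -(yexp (g t) e * g' e)) t :=
  (differentiableAt_detFun _).hasFDerivAt.comp_hasDerivAt t (hasDerivAt_yexp hg)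

lemma hasDerivAt_FH_smul (l : E → ℝ) {s : ℝ} (hs : s ≠ 0) :
    HasDerivAt (fun s : ℝ => H.FH (s • l)) (H.Kf (yexp (s • l)) / s) s := by
  have h1 : ∀ e, HasDerivAt (fun s : ℝ => (s • l) e) (l e) s := fun e => by
    simpa using (hasDerivAt_id s).mul_const (l e)
  have h2 := hasDerivAt_FH (H := H) h1
  convert h2 using 1
  unfold Kf
  rw [yexp_mul_log, div_eq_inv_mul, ← smul_eq_mul, ← map_smul]
  congr 1
  funext e
  simp only [Pi.smul_apply, smul_eq_mul]
  field_simp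

/-- Implicit function theorem for `F (s • l) = 0`, whose derivative in `s` is `Kf / s ≠ 0`.
Continuity of the entropy is needed to identify it with the implicit function. -/
theorem Good.contDiffAt_entropy (hH : H.Good) {l : E → ℝ} (hl : l ∈ H.lengthSpace) :
    ContDiffAt ℝ ∞ H.entropy l := by
  obtain ⟨h0, -⟩ := hH.entropy_spec hl
  set u : (E → ℝ) × ℝ := (l, H.entropy l) with hu
  let Φ : (E → ℝ) × ℝ → ℝ := fun p => H.FH (p.2 • p.1)
  have cdf : ContDiffAt ℝ ∞ Φ u :=
    (contDiff_FH.comp (contDiff_snd.smul contDiff_fst)).contDiffAt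
  have hne : (∞ : ℕ∞ω) ≠ 0 := by simp
  have hΦ : ∀ l ∈ H.lengthSpace, Φ (l, H.entropy l) = 0 := fun l hl =>
    hH.detFun_eq_zero (hH.normalize_mem hl)
  set c := H.Kf (yexp (H.entropy l • l)) / H.entropy l with hc
  have hc0 : c ≠ 0 := (div_pos (hH.Kf_pos (hH.normalize_mem hl)) h0).ne'
  have hd : (fderiv ℝ Φ u) (0, 1) = c := by
    have h1 : HasDerivAt (fun s : ℝ => (l, s)) ((0 : E → ℝ), (1 : ℝ)) (H.entropy l) :=
      (hasDerivAt_const _ _).prodMk (hasDerivAt_id _)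
    have h2 := (cdf.differentiableAt hne).hasFDerivAt.comp_hasDerivAt (H.entropy l) h1
    exact h2.unique (hasDerivAt_FH_smul l h0.ne')
  have if₂ : (fderiv ℝ Φ u ∘L .inr ℝ (E → ℝ) ℝ).IsInvertible := by
    refine ⟨ContinuousLinearEquiv.unitsEquivAut ℝ (Units.mk0 c hc0), ?_⟩
    ext
    simp [hd]
  have hev := cdf.eventually_apply_eq_iff_implicitFunction hne if₂
  have hcont : Tendsto (fun l' => (l', H.entropy l')) (𝓝 l) (𝓝 u) :=
    (continuousAt_id.prodMk (hH.continuousAt_entropy hl))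
  refine (cdf.contDiffAt_implicitFunction hne if₂).congr_of_eventuallyEq ?_
  filter_upwards [hcont.eventually hev, isOpen_lengthSpace.mem_nhds hl] with l' h1 h2
  exact (h1.1 ((hΦ l' h2).trans (hΦ l hl).symm)).symm

lemma Good.differentiableAt_entropy (hH : H.Good) {l : E → ℝ} (hl : l ∈ H.lengthSpace) :
    DifferentiableAt ℝ H.entropy l :=
  (hH.contDiffAt_entropy hl).differentiableAt (by simp)

lemma Good.differentiableAt_fderiv_entropy (hH : H.Good) {l : E → ℝ} (hl : l ∈ H.lengthSpace) :
    DifferentiableAt ℝ (fderiv ℝ H.entropy) l :=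
  ((hH.contDiffAt_entropy hl).fderiv_right (m := 1) (by norm_cast)).differentiableAt one_ne_zero

/-- First derivative of the identity `F (entropy l • l) = 0` along a curve. -/
lemma Good.fderiv_detFun_curve (hH : H.Good) {g : ℝ → E → ℝ} {g' : E → ℝ} {t : ℝ}
    (hl : g t ∈ H.lengthSpace) (hg : ∀ e, HasDerivAt (fun t => g t e) (g' e) t) :
    fderiv ℝ H.detFun (yexp (H.entropy (g t) • g t)) (fun e =>
      yexp (H.entropy (g t) • g t) e *
        (fderiv ℝ H.entropy (g t) g' * g t e + H.entropy (g t) * g' e)) = 0 := by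
  have hg' : HasDerivAt g g' t := hasDerivAt_pi.2 hg
  have h1 : HasDerivAt (fun t => H.entropy (g t)) (fderiv ℝ H.entropy (g t) g') t :=
    (hH.differentiableAt_entropy hl).hasFDerivAt.comp_hasDerivAt t hg'
  have h2 := hasDerivAt_FH (H := H) (g := fun t => H.entropy (g t) • g t)
    (g' := fun e => fderiv ℝ H.entropy (g t) g' * g t e + H.entropy (g t) * g' e) (t := t)
    fun e => h1.mul (hg e)
  have h3 : (fun t => H.FH (H.entropy (g t) • g t)) =ᶠ[𝓝 t] fun _ => 0 := by
    filter_upwards [hg'.continuousAt.eventually (isOpen_lengthSpace.mem_nhds hl)] with s hs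
    exact hH.detFun_eq_zero (hH.normalize_mem hs)
  have h4 := h2.unique ((hasDerivAt_const t (0 : ℝ)).congr_of_eventuallyEq h3)
  have h5 := congrArg Neg.neg h4
  rw [neg_zero, ← map_neg] at h5
  rw [← h5]
  congr 1
  funext e
  simp

lemma hasDerivAt_line (l v : E → ℝ) (t : ℝ) (e : E) :
    HasDerivAt (fun t : ℝ => (l + t • v) e) (v e) t := by
  simpa using ((hasDerivAt_id t).mul_const (v e)).const_add (l e)

/-- The gradient of the entropy is proportional to the gradient of `F_H`. -/
lemma Good.fderiv_detFun_unit (hH : H.Good) {l : E → ℝ} (hl : l ∈ H.unitSpace) (v : E → ℝ) :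
    fderiv ℝ H.detFun (yexp l) (fun e => yexp l e * v e) =
      fderiv ℝ H.entropy l v * H.Kf (yexp l) := by
  have h := hH.fderiv_detFun_curve (g := fun t : ℝ => l + t • v) (g' := v) (t := 0)
    (by simpa using hl.1) (hasDerivAt_line l v 0)
  simp only [zero_smul, add_zero, hl.2, one_smul, one_mul] at h
  unfold Kf
  rw [yexp_mul_log, ← smul_eq_mul, ← map_smul, ← sub_eq_zero, ← map_sub, ← h]
  congr 1
  funext e
  simp only [Pi.sub_apply, Pi.smul_apply, smul_eq_mul]
  ring

/-- The Hessian of the entropy on tangent vectors. -/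
theorem Good.hessian_entropy (hH : H.Good) {l v : E → ℝ} (hl : l ∈ H.unitSpace)
    (hv : fderiv ℝ H.entropy l v = 0) :
    fderiv ℝ (fderiv ℝ H.entropy) l v v = -(H.Nf (yexp l) v / H.Kf (yexp l)) := by
  have hK := (hH.Kf_pos hl).ne'
  let g : ℝ → E → ℝ := fun t => l + t • v
  have hg0 : g 0 = l := by simp [g]
  have hg : ∀ t e, HasDerivAt (fun t => g t e) (v e) t := hasDerivAt_line l v
  have hgd : ∀ t, HasDerivAt g v t := fun t => hasDerivAt_pi.2 (hg t)
  let h : ℝ → ℝ := fun t => H.entropy (g t)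
  let h1 : ℝ → ℝ := fun t => fderiv ℝ H.entropy (g t) v
  set q := fderiv ℝ (fderiv ℝ H.entropy) l v v with hq
  have hh0 : h 0 = 1 := by simp only [h, hg0, hl.2]
  have hh10 : h1 0 = 0 := by simp only [h1, hg0, hv]
  have hh : HasDerivAt h 0 0 := by
    have := (hH.differentiableAt_entropy (l := g 0) (by rw [hg0]; exact hl.1)).hasFDerivAt.comp_hasDerivAt
      (0 : ℝ) (hgd 0)
    rw [hg0, hv] at this
    exact this
  have hh1 : HasDerivAt h1 q 0 := by
    have := (hH.differentiableAt_fderiv_entropy (l := g 0)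
      (by rw [hg0]; exact hl.1)).hasFDerivAt.comp_hasDerivAt (0 : ℝ) (hgd 0)
    have := this.clm_apply (hasDerivAt_const (0 : ℝ) v)
    rw [hg0] at this
    simpa using this
  let y : ℝ → E → ℝ := fun t => yexp (h t • g t)
  have hy0 : y 0 = yexp l := by simp only [y, hh0, hg0, one_smul]
  have hy : HasDerivAt y (fun e => -(yexp l e * v e)) 0 := by
    have := hasDerivAt_yexp (g := fun t => h t • g t) (g' := v) (t := 0) fun e => by
      exact (hh.mul (hg 0 e)).congr_deriv (by simp [hh0])
    rw [hh0, hg0, one_smul] at this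
    exact this
  let w : ℝ → E → ℝ := fun t e => y t e * (h1 t * g t e + h t * v e)
  have hw0 : w 0 = fun e => yexp l e * v e := by
    funext e
    simp only [w, hy0, hh10, hh0, zero_mul, zero_add, one_mul]
  have hw : HasDerivAt w (fun e => -(yexp l e * v e) * v e + yexp l e * (q * l e)) 0 := by
    refine hasDerivAt_pi.2 fun e => ?_
    have := (hasDerivAt_pi.1 hy e).mul ((hh1.mul (hg 0 e)).add (hh.mul_const (v e)))
    refine this.congr_deriv ?_
    simp only [hy0, hh10, hh0, hg0, Pi.add_apply, Pi.mul_apply]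
    ring
  -- The first-order identity along the line is now differentiated at `t = 0`, where the entropy is
  -- one and its derivative is zero, so that the unknown `q` enters only through `q * Kf`.
  have hz : (fun t => fderiv ℝ H.detFun (y t) (w t)) =ᶠ[𝓝 0] fun _ => 0 := by
    have hc : ∀ᶠ t in 𝓝 (0 : ℝ), g t ∈ H.lengthSpace :=
      (hgd 0).continuousAt.eventually (isOpen_lengthSpace.mem_nhds (by rw [hg0]; exact hl.1))
    filter_upwards [hc] with t ht
    exact hH.fderiv_detFun_curve ht (hg t)
  have hD : HasDerivAt (fun t => fderiv ℝ H.detFun (y t)) _ 0 :=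
    (differentiableAt_fderiv_detFun (H := H) (y 0)).hasFDerivAt.comp_hasDerivAt (0 : ℝ) hy
  have h4 := (hD.clm_apply hw).unique ((hasDerivAt_const (0 : ℝ) (0 : ℝ)).congr_of_eventuallyEq hz)
  rw [hy0, hw0] at h4
  have e1 : (fun e => -(yexp l e * v e)) = -fun e => yexp l e * v e := rfl
  have e2 : (fun e => -(yexp l e * v e) * v e + yexp l e * (q * l e)) =
      -(fun e => yexp l e * v e ^ 2) - q • fun e => -(yexp l e * l e) := by
    funext e
    simp only [Pi.sub_apply, Pi.neg_apply, Pi.smul_apply, smul_eq_mul]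
    ring
  rw [e1, e2, map_neg, map_sub, map_neg, map_smul, ← yexp_mul_log, neg_apply] at h4
  have h5 : -(H.Nf (yexp l) v) - q * H.Kf (yexp l) = 0 := by
    rw [← h4]
    unfold Nf Kf
    rw [smul_eq_mul]
    ring
  field_simp
  linarith

theorem Good.entropyNorm_eq (hH : H.Good) {l v : E → ℝ} (hl : l ∈ H.unitSpace)
    (hv : fderiv ℝ H.entropy l v = 0) :
    H.entropyNorm l v = Real.sqrt (-(H.Nf (yexp l) v / H.Kf (yexp l))) := by
  rw [entropyNorm, hH.hessian_entropy hl hv]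

/-- `Nf` as a second derivative along a line. -/
lemma Nf_eq_of_hasDerivAt {l v : E → ℝ} {g1 : ℝ → ℝ} {g2 : ℝ}
    (h1 : ∀ t, HasDerivAt (fun t : ℝ => H.FH (l + t • v)) (g1 t) t)
    (h2 : HasDerivAt g1 g2 0) : H.Nf (yexp l) v = g2 := by
  let g : ℝ → E → ℝ := fun t => l + t • v
  have hg0 : g 0 = l := by simp [g]
  have hg : ∀ t e, HasDerivAt (fun t => g t e) (v e) t := hasDerivAt_line l v
  have hy : ∀ t, HasDerivAt (fun t => yexp (g t)) (fun e => -(yexp (g t) e * v e)) t := fun t =>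
    hasDerivAt_yexp (hg t)
  have e1 : g1 = fun t => fderiv ℝ H.detFun (yexp (g t)) fun e => -(yexp (g t) e * v e) := by
    funext t
    exact (h1 t).unique (hasDerivAt_FH (hg t))
  have hw : HasDerivAt (fun t => fun e => -(yexp (g t) e * v e))
      (fun e => yexp l e * v e ^ 2) 0 := by
    refine hasDerivAt_pi.2 fun e => ?_
    have := ((hasDerivAt_pi.1 (hy 0) e).mul_const (v e)).neg
    refine this.congr_deriv ?_
    simp only [hg0]
    ring
  have hD := (differentiableAt_fderiv_detFun (H := H) (yexp (g 0))).hasFDerivAt.comp_hasDerivAt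
    (0 : ℝ) (hy 0)
  rw [e1] at h2
  have h4 := h2.unique (hD.clm_apply hw)
  rw [hg0] at h4
  have e2 : (fun e => -(yexp l e * v e)) = -fun e => yexp l e * v e := rfl
  rw [h4, e2, map_neg, Function.comp_apply, hg0, Nf]
  simp

end Smooth

end OGraph

end

noncomputable section

set_option linter.unusedSectionVars false

/-! ### Block determinants with off-diagonal blocks of rank one -/

section BlockDet

open Matrix

variable {m n : Type*} [Fintype m] [Fintype n] [DecidableEq m] [DecidableEq n]

/-- Only the roots of the characteristic polynomial of `-A` are excluded. Density reduces the block
identity to invertible diagonal blocks. -/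
lemma dense_det_add_smul_ne_zero (A : Matrix m m ℝ) :
    Dense {t : ℝ | (A + t • (1 : Matrix m m ℝ)).det ≠ 0} := by
  have hfin : {t : ℝ | (A + t • (1 : Matrix m m ℝ)).det = 0}.Finite := by
    refine ((-A).charpoly.roots.toFinset.finite_toSet).subset fun t ht => ?_
    simp only [Finset.mem_coe, Multiset.mem_toFinset]
    rw [Polynomial.mem_roots (charpoly_monic _).ne_zero, Polynomial.IsRoot.def, eval_charpoly,
      sub_neg_eq_add, add_comm, ← ht.out]
    congr 2
    ext i j
    by_cases h : i = j
    · subst h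
      simp
    · simp [h]
  exact hfin.countable.dense_compl ℝ

lemma det_sub_smul_vecMulVec {B : Matrix n n ℝ} (hB : B.det ≠ 0) (c r : n → ℝ) (k : ℝ) :
    (B - k • vecMulVec c r).det = B.det - k * (r ⬝ᵥ (B.adjugate *ᵥ c)) := by
  have hU : IsUnit B.det := isUnit_iff_ne_zero.2 hB
  have h := det_add_replicateCol_mul_replicateRow (ι := Unit) hU (-k • c) r
  have e1 : B + replicateCol Unit (-k • c) * replicateRow Unit r = B - k • vecMulVec c r := by
    ext i j
    simp [Matrix.mul_apply, vecMulVec_apply]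
    ring
  rw [e1] at h
  rw [h, inv_def, Ring.inverse_eq_inv']
  have : (1 + replicateRow Unit r * (B.det⁻¹ • B.adjugate) * replicateCol Unit (-k • c)).det =
      1 - k * (B.det⁻¹ * (r ⬝ᵥ (B.adjugate *ᵥ c))) := by
    rw [det_unique, Matrix.add_apply, Matrix.one_apply_eq]
    have : (replicateRow Unit r * (B.det⁻¹ • B.adjugate) * replicateCol Unit (-k • c))
        default default = r ⬝ᵥ ((B.det⁻¹ • B.adjugate) *ᵥ (-k • c)) := by
      rw [Matrix.mul_assoc]
      rfl
    rw [this, mulVec_smul, smul_mulVec, dotProduct_smul, dotProduct_smul, smul_eq_mul, smul_eq_mul]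
    ring
  rw [this]
  field_simp

/-- The Schur complement of `A` is `B` minus a scalar multiple of `c₂ r₂ᵀ`, to which the matrix
determinant lemma applies. -/
lemma det_fromBlocks_vecMulVec_of_ne_zero {A : Matrix m m ℝ} {B : Matrix n n ℝ} (hA : A.det ≠ 0)
    (hB : B.det ≠ 0) (c₁ r₁ : m → ℝ) (c₂ r₂ : n → ℝ) :
    (fromBlocks A (vecMulVec c₁ r₂) (vecMulVec c₂ r₁) B).det =
      A.det * B.det - (r₁ ⬝ᵥ (A.adjugate *ᵥ c₁)) * (r₂ ⬝ᵥ (B.adjugate *ᵥ c₂)) := by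
  have hU : IsUnit A.det := isUnit_iff_ne_zero.2 hA
  let _ := A.invertibleOfIsUnitDet hU
  rw [det_fromBlocks₁₁]
  have e1 : vecMulVec c₂ r₁ * ⅟A * vecMulVec c₁ r₂ =
      (A.det⁻¹ * (r₁ ⬝ᵥ (A.adjugate *ᵥ c₁))) • vecMulVec c₂ r₂ := by
    rw [invOf_eq_nonsing_inv, inv_def, Ring.inverse_eq_inv', Matrix.mul_assoc, mul_vecMulVec,
      vecMulVec_mul_vecMulVec, smul_mulVec, dotProduct_smul, smul_eq_mul, vecMulVec_smul]
  rw [e1, det_sub_smul_vecMulVec hB]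
  field_simp

/-- A block determinant whose off-diagonal blocks have rank one. -/
lemma det_fromBlocks_vecMulVec (A : Matrix m m ℝ) (B : Matrix n n ℝ) (c₁ r₁ : m → ℝ)
    (c₂ r₂ : n → ℝ) :
    (fromBlocks A (vecMulVec c₁ r₂) (vecMulVec c₂ r₁) B).det =
      A.det * B.det - (r₁ ⬝ᵥ (A.adjugate *ᵥ c₁)) * (r₂ ⬝ᵥ (B.adjugate *ᵥ c₂)) := by
  have key : ∀ B : Matrix n n ℝ, B.det ≠ 0 → ∀ A : Matrix m m ℝ,
      (fromBlocks A (vecMulVec c₁ r₂) (vecMulVec c₂ r₁) B).det =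
      A.det * B.det - (r₁ ⬝ᵥ (A.adjugate *ᵥ c₁)) * (r₂ ⬝ᵥ (B.adjugate *ᵥ c₂)) := by
    intro B hB A
    have h : (fun t : ℝ => (fromBlocks (A + t • (1 : Matrix m m ℝ)) (vecMulVec c₁ r₂)
        (vecMulVec c₂ r₁) B).det) = fun t => (A + t • (1 : Matrix m m ℝ)).det * B.det -
        (r₁ ⬝ᵥ ((A + t • (1 : Matrix m m ℝ)).adjugate *ᵥ c₁)) *
          (r₂ ⬝ᵥ (B.adjugate *ᵥ c₂)) := by
      refine Continuous.ext_on (dense_det_add_smul_ne_zero A) ?_ ?_ fun t ht =>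
        det_fromBlocks_vecMulVec_of_ne_zero ht hB c₁ r₁ c₂ r₂
      · exact Continuous.matrix_det (Continuous.matrix_fromBlocks (by fun_prop) continuous_const
          continuous_const continuous_const)
      · refine ((Continuous.matrix_det (by fun_prop)).mul continuous_const).sub
          (Continuous.mul ?_ continuous_const)
        exact Continuous.dotProduct continuous_const
          (Continuous.matrix_mulVec (Continuous.matrix_adjugate (by fun_prop)) continuous_const)
    have := congrFun h 0
    simpa using this
  have h : (fun t : ℝ => (fromBlocks A (vecMulVec c₁ r₂)
      (vecMulVec c₂ r₁) (B + t • (1 : Matrix n n ℝ))).det) = fun t =>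
      A.det * (B + t • (1 : Matrix n n ℝ)).det - (r₁ ⬝ᵥ (A.adjugate *ᵥ c₁)) *
        (r₂ ⬝ᵥ ((B + t • (1 : Matrix n n ℝ)).adjugate *ᵥ c₂)) := by
    refine Continuous.ext_on (dense_det_add_smul_ne_zero B) ?_ ?_ fun t ht => key _ ht A
    · exact Continuous.matrix_det (Continuous.matrix_fromBlocks continuous_const continuous_const
        continuous_const (by fun_prop))
    · refine (continuous_const.mul (Continuous.matrix_det (by fun_prop))).sub
          (continuous_const.mul ?_)
      exact Continuous.dotProduct continuous_const
        (Continuous.matrix_mulVec (Continuous.matrix_adjugate (by fun_prop)) continuous_const)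
  have := congrFun h 0
  simpa using this

end BlockDet

namespace OGraph

/-! ### The weight of the loops at a vertex -/

section Loops

open Matrix

variable {V E : Type*} [Fintype E] (H : OGraph V E) (v : V)

open Classical in
/-- Indicator of the directed edges which start at `v`. -/
def rowVec : E × Bool → ℝ := fun a => if H.o a = v then 1 else 0

open Classical in
/-- Weights of the directed edges which end at `v`. -/
def colVec (y : E → ℝ) : E × Bool → ℝ := fun a => if H.τ a = v then y a.1 else 0

open Classical in
/-- `det (I - A)` times the total weight of the nonempty reduced loops at `v`. -/
def Pf (y : E → ℝ) : ℝ := H.rowVec v ⬝ᵥ ((1 - H.T y).adjugate *ᵥ H.colVec v y)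

variable {H v}

lemma rowVec_nonneg (a : E × Bool) : 0 ≤ H.rowVec v a := by
  unfold rowVec
  split_ifs <;> norm_num

lemma colVec_nonneg {y : E → ℝ} (hy : ∀ e, 0 ≤ y e) (a : E × Bool) : 0 ≤ H.colVec v y a := by
  unfold colVec
  split_ifs
  · exact hy _
  · exact le_rfl

lemma colVec_mono {y y' : E → ℝ} (h : ∀ e, y e ≤ y' e) (a : E × Bool) :
    H.colVec v y a ≤ H.colVec v y' a := by
  unfold colVec
  split_ifs
  · exact h _
  · exact le_rfl

lemma Pf_zero : H.Pf v 0 = 0 := by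
  have : H.colVec v (0 : E → ℝ) = 0 := by
    funext a
    simp [colVec]
  simp [Pf, this]

lemma contDiff_T_apply {n : ℕ∞ω} (a b : E × Bool) : ContDiff ℝ n fun y => H.T y a b := by
  by_cases h : H.Follows a b
  · simp only [T_apply_of_follows h]
    exact contDiff_apply ℝ ℝ _
  · simp only [T_apply_of_not_follows h]
    exact contDiff_const

lemma contDiff_Pf {n : ℕ∞ω} : ContDiff ℝ n (H.Pf v) := by
  classical
  have hdet : ∀ a b, ContDiff ℝ n fun y => (1 - H.T y).adjugate a b := by
    intro a b
    simp only [adjugate_apply, Matrix.det_apply]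
    refine ContDiff.sum fun σ _ => ContDiff.const_smul _ (contDiff_prod fun c _ => ?_)
    by_cases hc : σ c = b
    · simp only [hc, updateRow_self]
      exact contDiff_const
    · simp only [updateRow_ne hc]
      exact contDiff_const.sub (contDiff_T_apply _ _)
  have hcol : ∀ b, ContDiff ℝ n fun y => H.colVec v y b := by
    intro b
    unfold colVec
    by_cases hb : H.τ b = v
    · simp only [hb, if_true]
      exact contDiff_apply ℝ ℝ _
    · simp only [hb, if_false]
      exact contDiff_const
  have : H.Pf v = fun y => ∑ a, H.rowVec v a * ∑ b, (1 - H.T y).adjugate a b * H.colVec v y b := by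
    funext y
    simp only [Pf, dotProduct, mulVec]
  rw [this]
  exact ContDiff.sum fun a _ => contDiff_const.mul (ContDiff.sum fun b _ => (hdet a b).mul (hcol b))

/-- Since `det (1 - A) = 0`, the columns of the adjugate are fixed by `A`, hence multiples of the
Perron vector, and their diagonal entries are the positive minors of `Good.minor_pos`. All entries
are therefore positive. -/
lemma Good.Pf_pos (hH : H.Good) {l : E → ℝ} (hl : l ∈ H.unitSpace) : 0 < H.Pf v (yexp l) := by
  classical
  have hne := hH.nonempty_dir
  obtain ⟨u, hu, hTu⟩ := hH.perronUnit_of_mem hl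
  have hy : ∀ e, 0 ≤ yexp l e := fun e => (yexp_pos l e).le
  set A := H.T (yexp l) with hA
  have hdet : (1 - A).det = 0 := by
    rw [← detFun_eq]
    exact hH.detFun_eq_zero hl
  have hadj : ∀ a b, 0 < (1 - A).adjugate a b := by
    intro a b
    have hdiag : 0 < (1 - A).adjugate b b := by
      rw [adjugate_apply]
      convert hH.minor_pos hl b using 2
      ext c d
      by_cases hc : c = b
      · subst hc
        simp [Matrix.one_apply, Pi.single_apply, eq_comm]
      · simp [updateRow_ne hc, hA]
    have hcol : A *ᵥ (fun c => (1 - A).adjugate c b) = fun c => (1 - A).adjugate c b := by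
      have h1 := mul_adjugate (1 - A)
      rw [hdet, zero_smul] at h1
      funext c
      have h2 := congrFun (congrFun h1 c) b
      rw [Matrix.sub_mul, Matrix.one_mul] at h2
      exact (sub_eq_zero.1 h2).symm
    obtain ⟨k, hk⟩ := (hH.irred (yexp_pos l)).eq_smul (T_nonneg hy) hu hTu hcol.ge
    have hk' : ∀ c, (1 - A).adjugate c b = k * u c := fun c => congrFun hk c
    rw [hk' b] at hdiag
    rw [hk' a]
    exact mul_pos (pos_of_mul_pos_left hdiag (hu b).le) (hu a)
  have hex : ∃ a, H.o a = v := by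
    have h2 := hH.two_le v
    unfold valence at h2
    by_contra hcon
    push Not at hcon
    have : IsEmpty {a : E × Bool // H.o a = v} := ⟨fun a => hcon a.1 a.2⟩
    rw [Nat.card_of_isEmpty] at h2
    omega
  obtain ⟨a, ha⟩ := hex
  have hP : H.Pf v (yexp l) = H.rowVec v ⬝ᵥ ((1 - A).adjugate *ᵥ H.colVec v (yexp l)) := by
    unfold Pf
    congr!
  rw [hP]
  have hinner : ∀ a, 0 < ((1 - A).adjugate *ᵥ H.colVec v (yexp l)) a := by
    intro c
    refine Finset.sum_pos' (fun b _ => mul_nonneg (hadj c b).le (colVec_nonneg hy b))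
      ⟨bar a, Finset.mem_univ _, mul_pos (hadj _ _) ?_⟩
    unfold colVec
    rw [if_pos (by rw [τ_bar, ha])]
    exact yexp_pos _ _
  refine Finset.sum_pos' (fun b _ => mul_nonneg (rowVec_nonneg b) (hinner b).le)
      ⟨a, Finset.mem_univ _, mul_pos ?_ (hinner _)⟩
  unfold rowVec
  rw [if_pos ha]
  exact zero_lt_one

/-- The resolvent applied to the column vector: the weights of reduced paths which end at `v`. -/
lemma exists_resolvent {y : E → ℝ} (hy : ∀ e, 0 ≤ y e) (hS : ¬ SubInv (H.T y)) :
    ∃ X : E × Bool → ℝ, 0 ≤ X ∧ X = H.T y *ᵥ X + H.colVec v y ∧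
      H.Pf v y = H.detFun y * (H.rowVec v ⬝ᵥ X) := by
  classical
  have hd := detFun_pos hy hS
  have hd' : (1 - H.T y).det = H.detFun y := (detFun_eq y).symm
  set X := (H.detFun y)⁻¹ • ((1 - H.T y).adjugate *ᵥ H.colVec v y) with hX
  have h1 : (1 - H.T y) *ᵥ X = H.colVec v y := by
    rw [hX, mulVec_smul, mulVec_mulVec, mul_adjugate, smul_mulVec, one_mulVec, hd', smul_smul,
      inv_mul_cancel₀ hd.ne', one_smul]
  refine ⟨X, nonneg_of_sub_mulVec_nonneg (T_nonneg hy) hS ?_, ?_, ?_⟩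
  · rw [h1]
    exact colVec_nonneg hy
  · rw [sub_mulVec, one_mulVec] at h1
    rw [← h1]
    abel
  · rw [hX, dotProduct_smul, smul_eq_mul, mul_inv_cancel_left₀ hd.ne']
    unfold Pf
    congr!

/-- The quotient is the generating function of reduced loops at `v`, which has nonnegative
coefficients. Monotonicity is obtained from `X = T X + colVec` and the positivity of the resolvent,
without expanding a series. -/
lemma Pf_div_mono {y y' : E → ℝ} (hy : ∀ e, 0 ≤ y e) (hyy : ∀ e, y e ≤ y' e)
    (hS : ¬ SubInv (H.T y')) :
    0 ≤ H.Pf v y / H.detFun y ∧ H.Pf v y / H.detFun y ≤ H.Pf v y' / H.detFun y' := by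
  classical
  have hS' : ¬ SubInv (H.T y) := fun h => hS (h.mono (T_mono hyy))
  have hy' : ∀ e, 0 ≤ y' e := fun e => (hy e).trans (hyy e)
  obtain ⟨X, hX0, hX1, hX2⟩ := exists_resolvent (v := v) hy hS'
  obtain ⟨X', hX0', hX1', hX2'⟩ := exists_resolvent (v := v) hy' hS
  have hle : 0 ≤ X' - X := by
    refine nonneg_of_sub_mulVec_nonneg (T_nonneg hy') hS ?_
    rw [sub_mulVec, one_mulVec, mulVec_sub]
    intro a
    have e1 := congrFun hX1 a
    have e2 := congrFun hX1' a
    have e3 := mulVec_le_mulVec_left (T_mono (H := H) hyy) hX0 a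
    have e4 := colVec_mono (H := H) (v := v) hyy a
    simp only [Pi.add_apply] at e1 e2
    simp only [Pi.sub_apply, Pi.zero_apply]
    linarith
  rw [hX2, hX2', mul_div_cancel_left₀ _ (detFun_pos hy hS').ne',
    mul_div_cancel_left₀ _ (detFun_pos hy' hS).ne']
  refine ⟨Finset.sum_nonneg fun a _ => mul_nonneg (rowVec_nonneg a) (hX0 a),
    Finset.sum_le_sum fun a _ => mul_le_mul_of_nonneg_left ?_ (rowVec_nonneg a)⟩
  have := hle a
  simp only [Pi.sub_apply, Pi.zero_apply] at this
  linarith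

end Loops

end OGraph

end

noncomputable section

set_option linter.unusedSectionVars false

namespace OGraph

/-! ### The joined graph and its determinant -/

section Join

open Matrix SepEdge

variable {V₁ E₁ V₂ E₂ : Type*}

/-- Directed edges of the first graph as directed edges of the joined graph. -/
def i₁ (E₂ : Type*) (a : E₁ × Bool) : Edge E₁ E₂ × Bool := (some (Sum.inl a.1), a.2)

/-- Directed edges of the second graph as directed edges of the joined graph. -/
def i₂ (E₁ : Type*) (a : E₂ × Bool) : Edge E₁ E₂ × Bool := (some (Sum.inr a.1), a.2)

/-- Restriction of an edge function to the first graph. -/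
def res₁ {R : Type*} (l : Edge E₁ E₂ → R) : E₁ → R := fun e => l (some (Sum.inl e))

/-- Restriction of an edge function to the second graph. -/
def res₂ {R : Type*} (l : Edge E₁ E₂ → R) : E₂ → R := fun e => l (some (Sum.inr e))

/-- The directed edges of the joined graph. -/
def dirEquiv (E₁ E₂ : Type*) : ((E₁ × Bool) ⊕ (E₂ × Bool)) ⊕ Bool ≃ Edge E₁ E₂ × Bool where
  toFun
    | .inl (.inl a) => i₁ E₂ a
    | .inl (.inr a) => i₂ E₁ a
    | .inr b => (none, b)
  invFun
    | (some (.inl e), b) => .inl (.inl (e, b))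
    | (some (.inr e), b) => .inl (.inr (e, b))
    | (none, b) => .inr b
  left_inv := by rintro ((⟨e, b⟩ | ⟨e, b⟩) | b) <;> rfl
  right_inv := by rintro ⟨_ | (e | e), b⟩ <;> rfl

lemma i₁_injective : Function.Injective (i₁ E₂ : E₁ × Bool → _) := by
  rintro ⟨e, b⟩ ⟨e', b'⟩ h
  simpa [i₁] using h

lemma i₂_injective : Function.Injective (i₂ E₁ : E₂ × Bool → _) := by
  rintro ⟨e, b⟩ ⟨e', b'⟩ h
  simpa [i₂] using h

lemma bar_i₁ (a : E₁ × Bool) : bar (i₁ E₂ a) = i₁ E₂ (bar a) := rfl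

lemma bar_i₂ (a : E₂ × Bool) : bar (i₂ E₁ a) = i₂ E₁ (bar a) := rfl

variable (G₁ : OGraph V₁ E₁) (G₂ : OGraph V₂ E₂) (v₁ : V₁) (v₂ : V₂)

lemma o_i₁ (a : E₁ × Bool) : (join G₁ G₂ v₁ v₂).o (i₁ E₂ a) = Sum.inl (G₁.o a) := by
  rcases a with ⟨e, _ | _⟩ <;> rfl

lemma τ_i₁ (a : E₁ × Bool) : (join G₁ G₂ v₁ v₂).τ (i₁ E₂ a) = Sum.inl (G₁.τ a) := by
  rcases a with ⟨e, _ | _⟩ <;> rfl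

lemma o_i₂ (a : E₂ × Bool) : (join G₁ G₂ v₁ v₂).o (i₂ E₁ a) = Sum.inr (G₂.o a) := by
  rcases a with ⟨e, _ | _⟩ <;> rfl

lemma τ_i₂ (a : E₂ × Bool) : (join G₁ G₂ v₁ v₂).τ (i₂ E₁ a) = Sum.inr (G₂.τ a) := by
  rcases a with ⟨e, _ | _⟩ <;> rfl

lemma o_none_true : (join G₁ G₂ v₁ v₂).o (none, true) = Sum.inl v₁ := rfl

lemma o_none_false : (join G₁ G₂ v₁ v₂).o (none, false) = Sum.inr v₂ := rfl

lemma τ_none_true : (join G₁ G₂ v₁ v₂).τ (none, true) = Sum.inr v₂ := rfl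

lemma τ_none_false : (join G₁ G₂ v₁ v₂).τ (none, false) = Sum.inl v₁ := rfl

lemma follows_i₁_i₁ (a b : E₁ × Bool) :
    (join G₁ G₂ v₁ v₂).Follows (i₁ E₂ a) (i₁ E₂ b) ↔ G₁.Follows a b := by
  unfold Follows
  rw [τ_i₁, o_i₁, bar_i₁, Sum.inl.injEq, i₁_injective.ne_iff]

lemma follows_i₂_i₂ (a b : E₂ × Bool) :
    (join G₁ G₂ v₁ v₂).Follows (i₂ E₁ a) (i₂ E₁ b) ↔ G₂.Follows a b := by
  unfold Follows
  rw [τ_i₂, o_i₂, bar_i₂, Sum.inr.injEq, i₂_injective.ne_iff]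

section Valence

open Classical in
lemma valence_inl [Finite E₁] [Finite E₂] (x : V₁) : (join G₁ G₂ v₁ v₂).valence (Sum.inl x) =
    G₁.valence x + if x = v₁ then 1 else 0 := by
  have := Fintype.ofFinite E₁
  have := Fintype.ofFinite E₂
  unfold valence
  rw [Nat.card_eq_fintype_card, Nat.card_eq_fintype_card, Fintype.card_subtype,
    Fintype.card_subtype]
  have h : (Finset.univ.filter fun a => (join G₁ G₂ v₁ v₂).o a = Sum.inl x) =
      (Finset.univ.filter fun a => G₁.o a = x).image (i₁ E₂) ∪
        if x = v₁ then {(none, true)} else ∅ := by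
    ext a
    obtain ⟨b, rfl⟩ := (dirEquiv E₁ E₂).surjective a
    rcases b with (b | b) | (_ | _)
    · have : (i₁ E₂ b) ∉ (if x = v₁ then {(none, true)} else ∅ :
          Finset (Edge E₁ E₂ × Bool)) := by
        split_ifs <;> simp [i₁]
      simp [dirEquiv, o_i₁, i₁_injective.eq_iff, this]
    · have : (i₂ E₁ b) ∉ (if x = v₁ then {(none, true)} else ∅ :
          Finset (Edge E₁ E₂ × Bool)) := by
        split_ifs <;> simp [i₂]
      simp [dirEquiv, o_i₂, this]
      simp [i₁, i₂]
    · simp [dirEquiv, o_none_false, i₁]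
      split_ifs <;> simp
    · simp [dirEquiv, o_none_true, i₁]
      split_ifs with hx
      · simp [hx]
      · simp [Ne.symm hx]
  rw [h, Finset.card_union_of_disjoint, Finset.card_image_of_injective _ i₁_injective]
  · congr 1
    split_ifs <;> simp
  · rw [Finset.disjoint_left]
    intro a ha
    obtain ⟨b, -, rfl⟩ := Finset.mem_image.1 ha
    split_ifs <;> simp [i₁]

open Classical in
lemma valence_inr [Finite E₁] [Finite E₂] (x : V₂) : (join G₁ G₂ v₁ v₂).valence (Sum.inr x) =
    G₂.valence x + if x = v₂ then 1 else 0 := by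
  have := Fintype.ofFinite E₁
  have := Fintype.ofFinite E₂
  unfold valence
  rw [Nat.card_eq_fintype_card, Nat.card_eq_fintype_card, Fintype.card_subtype,
    Fintype.card_subtype]
  have h : (Finset.univ.filter fun a => (join G₁ G₂ v₁ v₂).o a = Sum.inr x) =
      (Finset.univ.filter fun a => G₂.o a = x).image (i₂ E₁) ∪
        if x = v₂ then {(none, false)} else ∅ := by
    ext a
    obtain ⟨b, rfl⟩ := (dirEquiv E₁ E₂).surjective a
    rcases b with (b | b) | (_ | _)
    · have : (i₁ E₂ b) ∉ (if x = v₂ then {(none, false)} else ∅ :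
          Finset (Edge E₁ E₂ × Bool)) := by
        split_ifs <;> simp [i₁]
      simp [dirEquiv, o_i₁, this]
      simp [i₁, i₂]
    · have : (i₂ E₁ b) ∉ (if x = v₂ then {(none, false)} else ∅ :
          Finset (Edge E₁ E₂ × Bool)) := by
        split_ifs <;> simp [i₂]
      simp [dirEquiv, o_i₂, i₂_injective.eq_iff, this]
    · simp [dirEquiv, o_none_false, i₂]
      split_ifs with hx
      · simp [hx]
      · simp [Ne.symm hx]
    · simp [dirEquiv, o_none_true, i₂]
      split_ifs <;> simp
  rw [h, Finset.card_union_of_disjoint, Finset.card_image_of_injective _ i₂_injective]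
  · congr 1
    split_ifs <;> simp
  · rw [Finset.disjoint_left]
    intro a ha
    obtain ⟨b, -, rfl⟩ := Finset.mem_image.1 ha
    split_ifs <;> simp [i₂]

end Valence

section Good

variable {V E : Type*} {H : OGraph V E}

lemma sum_valence [Fintype V] [Fintype E] :
    ∑ v, H.valence v = 2 * Fintype.card E := by
  classical
  have h := Finset.card_eq_sum_card_fiberwise (s := (Finset.univ : Finset (E × Bool)))
    (t := (Finset.univ : Finset V)) (f := H.o) (fun _ _ => Finset.mem_coe.2 (Finset.mem_univ _))
  rw [Finset.card_univ, Fintype.card_prod, Fintype.card_bool, mul_comm] at h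
  rw [h]
  refine Finset.sum_congr rfl fun v _ => ?_
  unfold valence
  rw [Nat.card_eq_fintype_card, Fintype.card_subtype]

lemma valence_pos_of_rank [Fintype V] [Fintype E] (hc : H.Connected) (hr : 2 ≤ H.rank) (v : V) :
    0 < H.valence v := by
  obtain ⟨⟨w⟩, hw⟩ := hc
  have hV : 0 < Fintype.card V := Fintype.card_pos_iff.2 ⟨w⟩
  unfold rank at hr
  rw [Nat.card_eq_fintype_card, Nat.card_eq_fintype_card] at hr
  have hE : 0 < Fintype.card E := by omega
  obtain ⟨e⟩ := Fintype.card_pos_iff.1 hE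
  have hex : ∃ a, H.o a = v := by
    rcases (hw v (H.o (e, true))).cases_head with h | ⟨c, ⟨a, ha, -⟩, -⟩
    · exact ⟨_, h.symm⟩
    · exact ⟨a, ha⟩
  obtain ⟨a, ha⟩ := hex
  unfold valence
  have : Nonempty {a : E × Bool // H.o a = v} := ⟨⟨a, ha⟩⟩
  exact Nat.card_pos

/-- If all valences were at most two, the handshake formula would give at most as many edges as
vertices, that is rank at most one. -/
lemma exists_three_le_valence [Fintype V] [Fintype E] (hr : 2 ≤ H.rank) :
    ∃ v, 3 ≤ H.valence v := by
  by_contra hcon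
  push Not at hcon
  unfold rank at hr
  rw [Nat.card_eq_fintype_card, Nat.card_eq_fintype_card] at hr
  have h1 : ∑ v, H.valence v ≤ ∑ v : V, 2 :=
    Finset.sum_le_sum fun v _ => Nat.le_of_lt_succ (hcon v)
  rw [sum_valence] at h1
  simp at h1
  omega

variable {G₁ G₂ v₁ v₂}

/-- Joining raises only the valence of `v₁`, and by one. So the exclusion of valences one and two in
the joined graph leaves valence at least two in `G₁`; valence zero is impossible by connectedness
and rank. -/
theorem good_left [Fintype V₁] [Fintype E₁] [Finite E₂]
    (hc : G₁.Connected) (hr : 2 ≤ G₁.rank) (hval : ∀ v, (join G₁ G₂ v₁ v₂).valence v ≠ 1 ∧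
      (join G₁ G₂ v₁ v₂).valence v ≠ 2) : G₁.Good := by
  classical
  refine ⟨hc, fun x => ?_, exists_three_le_valence hr⟩
  have h1 := valence_pos_of_rank hc hr x
  have h2 := hval (Sum.inl x)
  rw [valence_inl] at h2
  split_ifs at h2 <;> omega

theorem good_right [Finite E₁] [Fintype V₂] [Fintype E₂]
    (hc : G₂.Connected) (hr : 2 ≤ G₂.rank) (hval : ∀ v, (join G₁ G₂ v₁ v₂).valence v ≠ 1 ∧
      (join G₁ G₂ v₁ v₂).valence v ≠ 2) : G₂.Good := by
  classical
  refine ⟨hc, fun x => ?_, exists_three_le_valence hr⟩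
  have h1 := valence_pos_of_rank hc hr x
  have h2 := hval (Sum.inr x)
  rw [valence_inr] at h2
  split_ifs at h2 <;> omega

theorem good_join [Finite E₁] [Finite E₂] (h₁ : G₁.Good) (h₂ : G₂.Good) :
    (join G₁ G₂ v₁ v₂).Good := by
  classical
  set R : V₁ ⊕ V₂ → V₁ ⊕ V₂ → Prop :=
    fun x y => ∃ a, (join G₁ G₂ v₁ v₂).o a = x ∧ (join G₁ G₂ v₁ v₂).τ a = y with hR
  have l1 : ∀ u v : V₁, Relation.ReflTransGen R (Sum.inl u) (Sum.inl v) := by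
    intro u v
    have := h₁.conn.2 u v
    induction this with
    | refl => exact .refl
    | tail _ h ih =>
      obtain ⟨a, rfl, rfl⟩ := h
      exact ih.tail ⟨i₁ E₂ a, o_i₁ _ _ _ _ _, τ_i₁ _ _ _ _ _⟩
  have l2 : ∀ u v : V₂, Relation.ReflTransGen R (Sum.inr u) (Sum.inr v) := by
    intro u v
    have := h₂.conn.2 u v
    induction this with
    | refl => exact .refl
    | tail _ h ih =>
      obtain ⟨a, rfl, rfl⟩ := h
      exact ih.tail ⟨i₂ E₁ a, o_i₂ _ _ _ _ _, τ_i₂ _ _ _ _ _⟩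
  have l12 : R (Sum.inl v₁) (Sum.inr v₂) := ⟨(none, true), rfl, rfl⟩
  have l21 : R (Sum.inr v₂) (Sum.inl v₁) := ⟨(none, false), rfl, rfl⟩
  refine ⟨⟨h₁.conn.1.map Sum.inl, ?_⟩, ?_, ?_⟩
  · rintro (u | u) (v | v)
    · exact l1 u v
    · exact ((l1 u v₁).tail l12).trans (l2 v₂ v)
    · exact ((l2 u v₂).tail l21).trans (l1 v₁ v)
    · exact l2 u v
  · rintro (v | v)
    · rw [valence_inl]
      exact (h₁.two_le v).trans (Nat.le_add_right _ _)
    · rw [valence_inr]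
      exact (h₂.two_le v).trans (Nat.le_add_right _ _)
  · obtain ⟨v, hv⟩ := h₁.three_le
    refine ⟨Sum.inl v, ?_⟩
    rw [valence_inl]
    exact hv.trans (Nat.le_add_right _ _)

end Good

section Transfer

variable [Fintype E₁] [Fintype E₂] (y : Edge E₁ E₂ → ℝ)

lemma T_i₁_i₁ (a b : E₁ × Bool) :
    (join G₁ G₂ v₁ v₂).T y (i₁ E₂ a) (i₁ E₂ b) = G₁.T (res₁ y) a b := by
  by_cases h : G₁.Follows a b
  · rw [T_apply_of_follows h, T_apply_of_follows ((follows_i₁_i₁ G₁ G₂ v₁ v₂ a b).2 h)]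
    rfl
  · rw [T_apply_of_not_follows h,
      T_apply_of_not_follows (mt (follows_i₁_i₁ G₁ G₂ v₁ v₂ a b).1 h)]

lemma T_i₂_i₂ (a b : E₂ × Bool) :
    (join G₁ G₂ v₁ v₂).T y (i₂ E₁ a) (i₂ E₁ b) = G₂.T (res₂ y) a b := by
  by_cases h : G₂.Follows a b
  · rw [T_apply_of_follows h, T_apply_of_follows ((follows_i₂_i₂ G₁ G₂ v₁ v₂ a b).2 h)]
    rfl
  · rw [T_apply_of_not_follows h,
      T_apply_of_not_follows (mt (follows_i₂_i₂ G₁ G₂ v₁ v₂ a b).1 h)]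

lemma T_i₁_i₂ (a : E₁ × Bool) (b : E₂ × Bool) :
    (join G₁ G₂ v₁ v₂).T y (i₁ E₂ a) (i₂ E₁ b) = 0 :=
  T_apply_of_not_follows fun h => by simpa [τ_i₁, o_i₂] using h.1

lemma T_i₂_i₁ (a : E₂ × Bool) (b : E₁ × Bool) :
    (join G₁ G₂ v₁ v₂).T y (i₂ E₁ a) (i₁ E₂ b) = 0 :=
  T_apply_of_not_follows fun h => by simpa [τ_i₂, o_i₁] using h.1

lemma T_i₁_none_true (a : E₁ × Bool) :
    (join G₁ G₂ v₁ v₂).T y (i₁ E₂ a) (none, true) = G₁.colVec v₁ (res₁ y) a := by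
  unfold colVec
  split_ifs with h
  · refine T_apply_of_follows ⟨?_, ?_⟩
    · rw [τ_i₁, o_none_true, h]
    · simp [bar, i₁]
  · refine T_apply_of_not_follows fun h' => h ?_
    simpa [τ_i₁, o_none_true] using h'.1

lemma T_i₁_none_false (a : E₁ × Bool) :
    (join G₁ G₂ v₁ v₂).T y (i₁ E₂ a) (none, false) = 0 :=
  T_apply_of_not_follows fun h => by simpa [τ_i₁, o_none_false] using h.1

lemma T_i₂_none_true (a : E₂ × Bool) :
    (join G₁ G₂ v₁ v₂).T y (i₂ E₁ a) (none, true) = 0 :=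
  T_apply_of_not_follows fun h => by simpa [τ_i₂, o_none_true] using h.1

lemma T_i₂_none_false (a : E₂ × Bool) :
    (join G₁ G₂ v₁ v₂).T y (i₂ E₁ a) (none, false) = G₂.colVec v₂ (res₂ y) a := by
  unfold colVec
  split_ifs with h
  · refine T_apply_of_follows ⟨?_, ?_⟩
    · rw [τ_i₂, o_none_false, h]
    · simp [bar, i₂]
  · refine T_apply_of_not_follows fun h' => h ?_
    simpa [τ_i₂, o_none_false] using h'.1

lemma T_none_true_i₁ (b : E₁ × Bool) :
    (join G₁ G₂ v₁ v₂).T y (none, true) (i₁ E₂ b) = 0 :=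
  T_apply_of_not_follows fun h => by simpa [o_i₁, τ_none_true] using h.1

lemma T_none_true_i₂ (b : E₂ × Bool) :
    (join G₁ G₂ v₁ v₂).T y (none, true) (i₂ E₁ b) = y none * G₂.rowVec v₂ b := by
  unfold rowVec
  split_ifs with h
  · rw [mul_one]
    refine T_apply_of_follows ⟨?_, ?_⟩
    · rw [o_i₂, τ_none_true, h]
    · simp [bar, i₂]
  · rw [mul_zero]
    refine T_apply_of_not_follows fun h' => h ?_
    simpa [o_i₂, τ_none_true, eq_comm] using h'.1

lemma T_none_false_i₁ (b : E₁ × Bool) :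
    (join G₁ G₂ v₁ v₂).T y (none, false) (i₁ E₂ b) = y none * G₁.rowVec v₁ b := by
  unfold rowVec
  split_ifs with h
  · rw [mul_one]
    refine T_apply_of_follows ⟨?_, ?_⟩
    · rw [o_i₁, τ_none_false, h]
    · simp [bar, i₁]
  · rw [mul_zero]
    refine T_apply_of_not_follows fun h' => h ?_
    simpa [o_i₁, τ_none_false, eq_comm] using h'.1

lemma T_none_false_i₂ (b : E₂ × Bool) :
    (join G₁ G₂ v₁ v₂).T y (none, false) (i₂ E₁ b) = 0 :=
  T_apply_of_not_follows fun h => by simpa [o_i₂, τ_none_false] using h.1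

lemma T_none_none (b b' : Bool) :
    (join G₁ G₂ v₁ v₂).T y (none, b) (none, b') = 0 :=
  T_apply_of_not_follows fun h => by
    rcases b <;> rcases b' <;> simp [Follows, o, τ, bar, join] at h

lemma sum_dir {M : Type*} [AddCommMonoid M] (f : Edge E₁ E₂ × Bool → M) :
    ∑ a, f a = ∑ a, f (i₁ E₂ a) + ∑ a, f (i₂ E₁ a) + (f (none, true) + f (none, false)) := by
  rw [← (dirEquiv E₁ E₂).sum_comp, Fintype.sum_sum_type, Fintype.sum_sum_type, Fintype.sum_bool]
  rfl

lemma T_mulVec_i₁ (x : Edge E₁ E₂ × Bool → ℝ) (a : E₁ × Bool) :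
    ((join G₁ G₂ v₁ v₂).T y *ᵥ x) (i₁ E₂ a) = (G₁.T (res₁ y) *ᵥ fun b => x (i₁ E₂ b)) a +
      G₁.colVec v₁ (res₁ y) a * x (none, true) := by
  have h : ((join G₁ G₂ v₁ v₂).T y *ᵥ x) (i₁ E₂ a) =
    ∑ b, (join G₁ G₂ v₁ v₂).T y (i₁ E₂ a) b * x b := rfl
  rw [h, sum_dir]
  simp only [T_i₁_i₁, T_i₁_i₂, T_i₁_none_true, T_i₁_none_false, zero_mul, Finset.sum_const_zero,
    add_zero]
  rfl

lemma T_mulVec_i₂ (x : Edge E₁ E₂ × Bool → ℝ) (a : E₂ × Bool) :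
    ((join G₁ G₂ v₁ v₂).T y *ᵥ x) (i₂ E₁ a) = (G₂.T (res₂ y) *ᵥ fun b => x (i₂ E₁ b)) a +
      G₂.colVec v₂ (res₂ y) a * x (none, false) := by
  have h : ((join G₁ G₂ v₁ v₂).T y *ᵥ x) (i₂ E₁ a) =
    ∑ b, (join G₁ G₂ v₁ v₂).T y (i₂ E₁ a) b * x b := rfl
  rw [h, sum_dir]
  simp only [T_i₂_i₂, T_i₂_i₁, T_i₂_none_true, T_i₂_none_false, zero_mul, Finset.sum_const_zero,
    zero_add]
  rfl

lemma T_mulVec_none_true (x : Edge E₁ E₂ × Bool → ℝ) :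
    ((join G₁ G₂ v₁ v₂).T y *ᵥ x) (none, true) =
      y none * (G₂.rowVec v₂ ⬝ᵥ fun b => x (i₂ E₁ b)) := by
  have h : ((join G₁ G₂ v₁ v₂).T y *ᵥ x) (none, true) =
    ∑ b, (join G₁ G₂ v₁ v₂).T y (none, true) b * x b := rfl
  rw [h, sum_dir]
  simp only [T_none_true_i₁, T_none_true_i₂, T_none_none, zero_mul, Finset.sum_const_zero,
    zero_add, add_zero, dotProduct, Finset.mul_sum, mul_assoc]

lemma T_mulVec_none_false (x : Edge E₁ E₂ × Bool → ℝ) :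
    ((join G₁ G₂ v₁ v₂).T y *ᵥ x) (none, false) =
      y none * (G₁.rowVec v₁ ⬝ᵥ fun b => x (i₁ E₂ b)) := by
  have h : ((join G₁ G₂ v₁ v₂).T y *ᵥ x) (none, false) =
    ∑ b, (join G₁ G₂ v₁ v₂).T y (none, false) b * x b := rfl
  rw [h, sum_dir]
  simp only [T_none_false_i₁, T_none_false_i₂, T_none_none, zero_mul, Finset.sum_const_zero,
    add_zero, dotProduct, Finset.mul_sum, mul_assoc]

/-- The determinant of the joined graph. -/
theorem detFun_join : (join G₁ G₂ v₁ v₂).detFun y =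
    G₁.detFun (res₁ y) * G₂.detFun (res₂ y) -
      y none ^ 2 * (G₁.Pf v₁ (res₁ y) * G₂.Pf v₂ (res₂ y)) := by
  classical
  set M₁ := 1 - G₁.T (res₁ y) with hM₁
  set M₂ := 1 - G₂.T (res₂ y) with hM₂
  set c₁ := G₁.colVec v₁ (res₁ y) with hc₁
  set c₂ := G₂.colVec v₂ (res₂ y) with hc₂
  let B : Matrix ((E₁ × Bool) ⊕ (E₂ × Bool)) Bool ℝ := Matrix.of fun a b =>
    match a, b with
    | .inl a, true => -c₁ a
    | .inl _, false => 0
    | .inr _, true => 0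
    | .inr a, false => -c₂ a
  let C : Matrix Bool ((E₁ × Bool) ⊕ (E₂ × Bool)) ℝ := Matrix.of fun b a =>
    match b, a with
    | true, .inl _ => 0
    | false, .inl a => -(y none * G₁.rowVec v₁ a)
    | true, .inr a => -(y none * G₂.rowVec v₂ a)
    | false, .inr _ => 0
  have h1 : (join G₁ G₂ v₁ v₂).detFun y = (fromBlocks (fromBlocks M₁ 0 0 M₂) B C 1).det := by
    rw [detFun_eq, ← det_submatrix_equiv_self (dirEquiv E₁ E₂)]
    congr 1
    ext a b
    rw [submatrix_apply, Matrix.sub_apply]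
    rcases a with (a | a) | a <;> rcases b with (b | b) | b
    · change _ - (join G₁ G₂ v₁ v₂).T y (i₁ E₂ a) (i₁ E₂ b) = M₁ a b
      rw [T_i₁_i₁, hM₁, Matrix.sub_apply]
      congr 1
      simp only [Matrix.one_apply, EmbeddingLike.apply_eq_iff_eq, Sum.inl.injEq]
    · change _ - (join G₁ G₂ v₁ v₂).T y (i₁ E₂ a) (i₂ E₁ b) = 0
      rw [T_i₁_i₂]
      simp
    · rcases b
      · change _ - (join G₁ G₂ v₁ v₂).T y (i₁ E₂ a) (none, false) = 0
        rw [T_i₁_none_false]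
        simp
      · change _ - (join G₁ G₂ v₁ v₂).T y (i₁ E₂ a) (none, true) = -c₁ a
        rw [T_i₁_none_true]
        simp [hc₁]
    · change _ - (join G₁ G₂ v₁ v₂).T y (i₂ E₁ a) (i₁ E₂ b) = 0
      rw [T_i₂_i₁]
      simp
    · change _ - (join G₁ G₂ v₁ v₂).T y (i₂ E₁ a) (i₂ E₁ b) = M₂ a b
      rw [T_i₂_i₂, hM₂, Matrix.sub_apply]
      congr 1
      simp only [Matrix.one_apply, EmbeddingLike.apply_eq_iff_eq, Sum.inl.injEq, Sum.inr.injEq]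
    · rcases b
      · change _ - (join G₁ G₂ v₁ v₂).T y (i₂ E₁ a) (none, false) = -c₂ a
        rw [T_i₂_none_false]
        simp [hc₂]
      · change _ - (join G₁ G₂ v₁ v₂).T y (i₂ E₁ a) (none, true) = 0
        rw [T_i₂_none_true]
        simp
    · rcases a
      · change _ - (join G₁ G₂ v₁ v₂).T y (none, false) (i₁ E₂ b) = -(y none * G₁.rowVec v₁ b)
        rw [T_none_false_i₁]
        simp
      · change _ - (join G₁ G₂ v₁ v₂).T y (none, true) (i₁ E₂ b) = 0
        rw [T_none_true_i₁]
        simp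
    · rcases a
      · change _ - (join G₁ G₂ v₁ v₂).T y (none, false) (i₂ E₁ b) = 0
        rw [T_none_false_i₂]
        simp
      · change _ - (join G₁ G₂ v₁ v₂).T y (none, true) (i₂ E₁ b) = -(y none * G₂.rowVec v₂ b)
        rw [T_none_true_i₂]
        simp
    · change _ - (join G₁ G₂ v₁ v₂).T y (none, a) (none, b) = (1 : Matrix Bool Bool ℝ) a b
      rw [T_none_none, sub_zero]
      simp only [Matrix.one_apply, EmbeddingLike.apply_eq_iff_eq, Sum.inr.injEq]
  -- The block of the two orientations of `e₀` is the identity, because `e₀` cannot follow itself in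
  -- either direction. Eliminating it couples the two graphs by rank-one blocks.
  have h2 : fromBlocks M₁ 0 0 M₂ - B * C =
      fromBlocks M₁ (vecMulVec (-y none • c₁) (G₂.rowVec v₂))
        (vecMulVec (-y none • c₂) (G₁.rowVec v₁)) M₂ := by
    ext a b
    rw [Matrix.sub_apply, Matrix.mul_apply, Fintype.sum_bool]
    rcases a with a | a <;> rcases b with b | b <;>
      simp [B, C, vecMulVec_apply] <;> ring
  rw [h1, det_fromBlocks_one₂₂, h2, det_fromBlocks_vecMulVec, detFun_eq, detFun_eq, mulVec_smul,
    mulVec_smul, dotProduct_smul, dotProduct_smul]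
  have e1 : G₁.Pf v₁ (res₁ y) = G₁.rowVec v₁ ⬝ᵥ (M₁.adjugate *ᵥ c₁) := by
    unfold Pf
    congr!
  have e2 : G₂.Pf v₂ (res₂ y) = G₂.rowVec v₂ ⬝ᵥ (M₂.adjugate *ᵥ c₂) := by
    unfold Pf
    congr!
  rw [e1, e2, smul_eq_mul, smul_eq_mul]
  ring

variable {G₁ G₂ v₁ v₂} {y}

/-- Subinvariant vectors of the first graph extend by zero; they vanish on the separating edge. -/
lemma SubInv.join_left (hy : ∀ e, 0 ≤ y e) (h : SubInv (G₁.T (res₁ y))) :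
    ∃ x : Edge E₁ E₂ × Bool → ℝ, 0 ≤ x ∧ x ≠ 0 ∧ x ≤ (join G₁ G₂ v₁ v₂).T y *ᵥ x ∧
      x (none, true) = 0 := by
  obtain ⟨x, h0, h1, h2⟩ := h
  set X : Edge E₁ E₂ × Bool → ℝ := fun a =>
    match a with
    | (some (.inl e), b) => x (e, b)
    | _ => 0 with hX
  have hX0 : 0 ≤ X := by
    rintro ⟨_ | (e | e), b⟩
    exacts [le_rfl, h0 _, le_rfl]
  refine ⟨X, hX0, ?_, fun a => ?_, rfl⟩
  · obtain ⟨a, ha⟩ := Function.ne_iff.1 h1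
    exact Function.ne_iff.2 ⟨i₁ E₂ a, ha⟩
  · have hnn := mulVec_nonneg' (T_nonneg (H := join G₁ G₂ v₁ v₂) hy) hX0
    rcases a with ⟨_ | (e | e), b⟩
    · exact hnn _
    · have := h2 (e, b)
      change x (e, b) ≤ ((join G₁ G₂ v₁ v₂).T y *ᵥ X) (i₁ E₂ (e, b))
      rw [T_mulVec_i₁]
      change x (e, b) ≤ (G₁.T (res₁ y) *ᵥ x) (e, b) + G₁.colVec v₁ (res₁ y) (e, b) * 0
      rwa [mul_zero, add_zero]
    · exact hnn _

lemma SubInv.join_right (hy : ∀ e, 0 ≤ y e) (h : SubInv (G₂.T (res₂ y))) :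
    ∃ x : Edge E₁ E₂ × Bool → ℝ, 0 ≤ x ∧ x ≠ 0 ∧ x ≤ (join G₁ G₂ v₁ v₂).T y *ᵥ x ∧
      x (none, true) = 0 := by
  obtain ⟨x, h0, h1, h2⟩ := h
  set X : Edge E₁ E₂ × Bool → ℝ := fun a =>
    match a with
    | (some (.inr e), b) => x (e, b)
    | _ => 0 with hX
  have hX0 : 0 ≤ X := by
    rintro ⟨_ | (e | e), b⟩
    exacts [le_rfl, le_rfl, h0 _]
  refine ⟨X, hX0, ?_, fun a => ?_, rfl⟩
  · obtain ⟨a, ha⟩ := Function.ne_iff.1 h1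
    exact Function.ne_iff.2 ⟨i₂ E₁ a, ha⟩
  · have hnn := mulVec_nonneg' (T_nonneg (H := join G₁ G₂ v₁ v₂) hy) hX0
    rcases a with ⟨_ | (e | e), b⟩
    · exact hnn _
    · exact hnn _
    · have := h2 (e, b)
      change x (e, b) ≤ ((join G₁ G₂ v₁ v₂).T y *ᵥ X) (i₂ E₁ (e, b))
      rw [T_mulVec_i₂]
      change x (e, b) ≤ (G₂.T (res₂ y) *ᵥ x) (e, b) + G₂.colVec v₂ (res₂ y) (e, b) * 0
      rwa [mul_zero, add_zero]

/-- A criterion for the spectral radius of the joined graph to be less than one. -/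
theorem not_subInv_join (hy : ∀ e, 0 ≤ y e) (h₁ : ¬ SubInv (G₁.T (res₁ y)))
    (h₂ : ¬ SubInv (G₂.T (res₂ y))) (hpos : 0 < (join G₁ G₂ v₁ v₂).detFun y) :
    ¬ SubInv ((join G₁ G₂ v₁ v₂).T y) := by
  classical
  rintro ⟨x, hx0, hx1, hx2⟩
  have hy₁ : ∀ e, 0 ≤ res₁ y e := fun e => hy _
  have hy₂ : ∀ e, 0 ≤ res₂ y e := fun e => hy _
  obtain ⟨X₁, hX0₁, hX1₁, hX2₁⟩ := exists_resolvent (v := v₁) hy₁ h₁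
  obtain ⟨X₂, hX0₂, hX1₂, hX2₂⟩ := exists_resolvent (v := v₂) hy₂ h₂
  set s := x (none, true) with hs
  set r := x (none, false) with hr
  -- On the side of `G₁` the vector is at most its value on `e₀` times the resolvent vector `X₁`.
  have b1 : 0 ≤ s • X₁ - fun b => x (i₁ E₂ b) := by
    refine nonneg_of_sub_mulVec_nonneg (T_nonneg hy₁) h₁ fun a => ?_
    rw [sub_mulVec, one_mulVec, mulVec_sub, mulVec_smul]
    have e1 := hx2 (i₁ E₂ a)
    rw [T_mulVec_i₁] at e1
    have e2 := congrFun hX1₁ a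
    simp only [Pi.add_apply] at e2
    simp only [Pi.sub_apply, Pi.smul_apply, smul_eq_mul, Pi.zero_apply]
    rw [e2]
    linarith
  have b2 : 0 ≤ r • X₂ - fun b => x (i₂ E₁ b) := by
    refine nonneg_of_sub_mulVec_nonneg (T_nonneg hy₂) h₂ fun a => ?_
    rw [sub_mulVec, one_mulVec, mulVec_sub, mulVec_smul]
    have e1 := hx2 (i₂ E₁ a)
    rw [T_mulVec_i₂] at e1
    have e2 := congrFun hX1₂ a
    simp only [Pi.add_apply] at e2
    simp only [Pi.sub_apply, Pi.smul_apply, smul_eq_mul, Pi.zero_apply]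
    rw [e2]
    linarith
  set L₁ := G₁.rowVec v₁ ⬝ᵥ X₁ with hL₁
  set L₂ := G₂.rowVec v₂ ⬝ᵥ X₂ with hL₂
  have hL₂0 : 0 ≤ L₂ := Finset.sum_nonneg fun b _ => mul_nonneg (rowVec_nonneg b) (hX0₂ b)
  have c1 : (G₁.rowVec v₁ ⬝ᵥ fun b => x (i₁ E₂ b)) ≤ s * L₁ := by
    rw [hL₁, dotProduct, dotProduct, Finset.mul_sum]
    refine Finset.sum_le_sum fun b _ => ?_
    have := b1 b
    simp only [Pi.sub_apply, Pi.smul_apply, smul_eq_mul, Pi.zero_apply] at this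
    nlinarith [rowVec_nonneg (H := G₁) (v := v₁) b]
  have c2 : (G₂.rowVec v₂ ⬝ᵥ fun b => x (i₂ E₁ b)) ≤ r * L₂ := by
    rw [hL₂, dotProduct, dotProduct, Finset.mul_sum]
    refine Finset.sum_le_sum fun b _ => ?_
    have := b2 b
    simp only [Pi.sub_apply, Pi.smul_apply, smul_eq_mul, Pi.zero_apply] at this
    nlinarith [rowVec_nonneg (H := G₂) (v := v₂) b]
  have d1 : r ≤ y none * (s * L₁) := by
    have := hx2 (none, false)
    rw [T_mulVec_none_false] at this
    exact this.trans (mul_le_mul_of_nonneg_left c1 (hy none))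
  have d2 : s ≤ y none * (r * L₂) := by
    have := hx2 (none, true)
    rw [T_mulVec_none_true] at this
    exact this.trans (mul_le_mul_of_nonneg_left c2 (hy none))
  have hs0 : 0 ≤ s := hx0 _
  have hr0 : 0 ≤ r := hx0 _
  have hf : 0 < 1 - y none ^ 2 * (L₁ * L₂) := by
    rw [detFun_join, hX2₁, hX2₂] at hpos
    have e : G₁.detFun (res₁ y) * G₂.detFun (res₂ y) - y none ^ 2 *
        (G₁.detFun (res₁ y) * L₁ * (G₂.detFun (res₂ y) * L₂)) =
        (G₁.detFun (res₁ y) * G₂.detFun (res₂ y)) * (1 - y none ^ 2 * (L₁ * L₂)) := by ring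
    rw [e] at hpos
    exact pos_of_mul_pos_right hpos (mul_pos (detFun_pos hy₁ h₁) (detFun_pos hy₂ h₂)).le
  -- A round trip through both graphs multiplies `s` by at most `y₀² L₁ L₂`, and positivity of the
  -- determinant says that this factor is less than one.
  have hs1 : s = 0 := by
    have e : s ≤ y none * ((y none * (s * L₁)) * L₂) :=
      d2.trans (mul_le_mul_of_nonneg_left (mul_le_mul_of_nonneg_right d1 hL₂0) (hy none))
    by_contra hne
    have hspos : 0 < s := lt_of_le_of_ne hs0 (Ne.symm hne)
    nlinarith [mul_pos hspos hf]
  have hr1 : r = 0 := by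
    rw [hs1, zero_mul, mul_zero] at d1
    exact le_antisymm d1 hr0
  refine hx1 (le_antisymm (fun a => ?_) hx0)
  rcases a with ⟨_ | (e | e), b⟩
  · rcases b
    · exact hr1.le
    · exact hs1.le
  · have := b1 (e, b)
    rw [hs1, zero_smul] at this
    exact (by simpa using this : x (i₁ E₂ (e, b)) ≤ 0)
  · have := b2 (e, b)
    rw [hr1, zero_smul] at this
    exact (by simpa using this : x (i₂ E₁ (e, b)) ≤ 0)

end Transfer

end Join

end OGraph

end

noncomputable section

set_option linter.unusedSectionVars false

namespace OGraph

/-! ### Extended lengths in the coordinates `exp (-l)` -/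

section ExpNeg

lemma expNeg_top : expNeg ⊤ = 0 := if_pos rfl

lemma expNeg_of_ne_top {x : ℝ≥0∞} (h : x ≠ ⊤) : expNeg x = Real.exp (-x.toReal) := if_neg h

lemma expNeg_ofReal {x : ℝ} (hx : 0 ≤ x) : expNeg (ENNReal.ofReal x) = Real.exp (-x) := by
  rw [expNeg_of_ne_top ENNReal.ofReal_ne_top, ENNReal.toReal_ofReal hx]

lemma expNeg_nonneg (x : ℝ≥0∞) : 0 ≤ expNeg x := by
  unfold expNeg
  split_ifs
  · exact le_rfl
  · exact (Real.exp_pos _).le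

lemma expNeg_eq_zero {x : ℝ≥0∞} : expNeg x = 0 ↔ x = ⊤ := by
  unfold expNeg
  split_ifs with h
  · simp [h]
  · simp [h, Real.exp_ne_zero]

lemma expNeg_lt_one {x : ℝ≥0∞} (hx : 0 < x) : expNeg x < 1 := by
  unfold expNeg
  split_ifs with h
  · exact zero_lt_one
  · rw [Real.exp_lt_one_iff, neg_lt_zero]
    exact ENNReal.toReal_pos hx.ne' h

lemma continuous_expNeg : Continuous expNeg := by
  rw [continuous_iff_continuousAt]
  intro x
  by_cases hx : x = ⊤
  · subst hx
    rw [ContinuousAt, expNeg_top]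
    refine tendsto_order.2 ⟨fun a ha => Eventually.of_forall fun x => ha.trans_le (expNeg_nonneg x),
      fun a ha => ?_⟩
    filter_upwards [lt_mem_nhds (ENNReal.ofReal_lt_top (r := -Real.log a))] with x hx
    by_cases h : x = ⊤
    · rwa [h, expNeg_top]
    · rw [expNeg_of_ne_top h, ← Real.lt_log_iff_exp_lt ha, neg_lt]
      have h1 := (ENNReal.toReal_lt_toReal ENNReal.ofReal_ne_top h).2 hx
      rw [ENNReal.toReal_ofReal'] at h1
      exact (le_max_left _ _).trans_lt h1
  · have h1 : expNeg =ᶠ[𝓝 x] fun x => Real.exp (-x.toReal) := by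
      filter_upwards [(isOpen_ne (x := (⊤ : ℝ≥0∞))).mem_nhds hx] with z hz
      exact expNeg_of_ne_top hz
    refine ContinuousAt.congr ?_ h1.symm
    exact (ENNReal.tendsto_toReal hx).neg.rexp

lemma expNeg_injective : Function.Injective expNeg := by
  intro x x' h
  by_cases hx : x = ⊤
  · rw [hx, expNeg_top, eq_comm, expNeg_eq_zero] at h
    rw [hx, h]
  · have hx' : x' ≠ ⊤ := fun h' => hx (by rwa [h', expNeg_top, expNeg_eq_zero] at h)
    rw [expNeg_of_ne_top hx, expNeg_of_ne_top hx', Real.exp_eq_exp, neg_inj] at h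
    exact (ENNReal.toReal_eq_toReal_iff' hx hx').1 h

end ExpNeg

variable {V E : Type*} [Fintype E] {H : OGraph V E}

lemma sum_partialF (l : E → ℝ≥0∞) (v : E → ℝ) :
    ∑ e, v e * H.partialF l e =
      -fderiv ℝ H.detFun (fun e => expNeg (l e)) (fun e => expNeg (l e) * v e) := by
  classical
  have h : (fun e => expNeg (l e) * v e) =
      ∑ e, (expNeg (l e) * v e) • (Pi.single e 1 : E → ℝ) := by
    conv_lhs => rw [← Finset.univ_sum_single fun e => expNeg (l e) * v e]
    refine Finset.sum_congr rfl fun e _ => ?_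
    rw [← Pi.single_smul]
    simp
  rw [h, map_sum, ← Finset.sum_neg_distrib]
  refine Finset.sum_congr rfl fun e _ => ?_
  rw [map_smul, smul_eq_mul]
  unfold partialF
  have : ∀ a b c : ℝ, a * (-b * c) = -(b * a * c) := fun a b c => by ring
  rw [this]

lemma continuous_fderiv_detFun : Continuous (fderiv ℝ H.detFun) :=
  (contDiff_detFun (n := 1)).continuous_fderiv one_ne_zero

lemma continuous_Kf : Continuous H.Kf := by
  refine continuous_fderiv_detFun.clm_apply (continuous_pi fun e => ?_)
  exact Real.continuous_mul_log.comp (continuous_apply e)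

lemma continuous_fderiv_fderiv_detFun : Continuous (fderiv ℝ (fderiv ℝ H.detFun)) :=
  ((contDiff_detFun (n := 2)).fderiv_right (m := 1) le_rfl).continuous_fderiv one_ne_zero

lemma continuous_Nf : Continuous fun p : (E → ℝ) × (E → ℝ) => H.Nf p.1 p.2 := by
  unfold Nf
  have h1 : Continuous fun p : (E → ℝ) × (E → ℝ) => fun e => p.1 e * p.2 e := by fun_prop
  have h2 : Continuous fun p : (E → ℝ) × (E → ℝ) => fun e => p.1 e * p.2 e ^ 2 := by fun_prop
  exact (((continuous_fderiv_fderiv_detFun.comp continuous_fst).clm_apply h1).clm_apply h1).add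
    ((continuous_fderiv_detFun.comp continuous_fst).clm_apply h2)

end OGraph

namespace SepEdge

open OGraph

variable {V₁ E₁ V₂ E₂ : Type*} [Fintype E₁] [Fintype E₂]
  {G₁ : OGraph V₁ E₁} {G₂ : OGraph V₂ E₂} {v₁ : V₁} {v₂ : V₂}

/-- The coordinates `exp (-l)` on the space of extended lengths. -/
def Yc (p : ExtLength E₁ E₂) : Edge E₁ E₂ → ℝ := fun e => expNeg (p e)

lemma continuous_Yc : Continuous (Yc : ExtLength E₁ E₂ → Edge E₁ E₂ → ℝ) :=
  continuous_pi fun e => continuous_expNeg.comp (continuous_apply e)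

lemma isClosedEmbedding_Yc : IsClosedEmbedding (Yc : ExtLength E₁ E₂ → Edge E₁ E₂ → ℝ) := by
  refine Continuous.isClosedEmbedding continuous_Yc fun p q h => funext fun e => ?_
  exact expNeg_injective (congrFun h e)

lemma Yc_nonneg (p : ExtLength E₁ E₂) (e : Edge E₁ E₂) : 0 ≤ Yc p e := expNeg_nonneg _

lemma Yc_incl {l : Edge E₁ E₂ → ℝ} (hl : ∀ e, 0 ≤ l e) : Yc (incl l) = yexp l :=
  funext fun e => expNeg_ofReal (hl e)

lemma incl_toReal {l : Edge E₁ E₂ → ℝ} (hl : ∀ e, 0 ≤ l e) :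
    (fun e => (incl l e).toReal) = l := funext fun e => ENNReal.toReal_ofReal (hl e)

/-- A subinvariant vector of one of the graphs, extended by zero, vanishes on `e₀` and so cannot be
a nonzero multiple of the Perron vector of the joined graph. Thus both graphs have entropy less than
one at points of `M¹(G)`. -/
lemma not_subInv_of_unit (hJ : (join G₁ G₂ v₁ v₂).Good) {l : Edge E₁ E₂ → ℝ}
    (hl : l ∈ (join G₁ G₂ v₁ v₂).unitSpace) :
    ¬ SubInv (G₁.T (yexp (res₁ l))) ∧ ¬ SubInv (G₂.T (yexp (res₂ l))) := by
  have hne := hJ.nonempty_dir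
  obtain ⟨u, hu, hTu⟩ := hJ.perronUnit_of_mem hl
  have hy : ∀ e, 0 ≤ yexp l e := fun e => (yexp_pos _ e).le
  have key : ¬ ∃ x : Edge E₁ E₂ × Bool → ℝ, 0 ≤ x ∧ x ≠ 0 ∧
      x ≤ Matrix.mulVec ((join G₁ G₂ v₁ v₂).T (yexp l)) x ∧ x (none, true) = 0 := by
    rintro ⟨x, h0, h1, h2, h3⟩
    obtain ⟨c, rfl⟩ := (hJ.irred (yexp_pos l)).eq_smul (T_nonneg hy) hu hTu h2
    have : c = 0 := (mul_eq_zero.1 h3).resolve_right (hu _).ne'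
    exact h1 (by rw [this, zero_smul])
  exact ⟨fun h => key (SubInv.join_left hy h), fun h => key (SubInv.join_right hy h)⟩

/-- Added points in the coordinates `exp (-l)`. -/
structure AddedY (G₁ : OGraph V₁ E₁) (G₂ : OGraph V₂ E₂) (y : Edge E₁ E₂ → ℝ) : Prop where
  nonneg : ∀ e, 0 ≤ y e
  lt_one : ∀ e, y e < 1
  -- `y ^ s` is the weight of `s • l`, so this says that the entropy is at most one, in a form which
  -- allows infinite lengths.
  sub₁ : ∀ s : ℝ, 1 < s → ¬ SubInv (G₁.T fun e => res₁ y e ^ s)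
  sub₂ : ∀ s : ℝ, 1 < s → ¬ SubInv (G₂.T fun e => res₂ y e ^ s)
  zero : y none = 0 ∨ res₁ y = 0 ∨ res₂ y = 0
  unit : (∃ l ∈ G₁.unitSpace, res₁ y = yexp l) ∨ (∃ l ∈ G₂.unitSpace, res₂ y = yexp l)

lemma not_subInv_zero {V E : Type*} [Fintype E] {H : OGraph V E} : ¬ SubInv (H.T 0) := by
  rintro ⟨x, h0, h1, h2⟩
  refine h1 (le_antisymm (fun a => ?_) h0)
  classical
  have := h2 a
  rw [T_mulVec] at this
  simpa using this

lemma yexp_rpow {E : Type*} [Fintype E] (l : E → ℝ) (s : ℝ) : (fun e => yexp l e ^ s) = yexp (s • l) := by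
  funext e
  simp only [yexp, Pi.smul_apply, smul_eq_mul]
  rw [← Real.exp_mul]
  congr 1
  ring

lemma not_subInv_rpow {V E : Type*} [Fintype E] {H : OGraph V E} (hH : H.Good) {l : E → ℝ}
    (hl : l ∈ H.lengthSpace) (h : H.entropy l ≤ 1) {s : ℝ} (hs : 1 < s) :
    ¬ SubInv (H.T fun e => yexp l e ^ s) := by
  have hs0 : 0 < s := zero_lt_one.trans hs
  rw [yexp_rpow, hH.subInv_iff (smul_mem_lengthSpace hl hs0), hH.entropy_smul hl hs0, not_le,
    div_lt_one hs0]
  exact h.trans_lt hs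

lemma not_subInv_zero_rpow {V E : Type*} [Fintype E] {H : OGraph V E} {s : ℝ} (hs : 1 < s) :
    ¬ SubInv (H.T fun e => (0 : E → ℝ) e ^ s) := by
  have : (fun e => (0 : E → ℝ) e ^ s) = 0 := funext fun e =>
    Real.zero_rpow (zero_lt_one.trans hs).ne'
  rw [this]
  exact not_subInv_zero

lemma res₁_Yc_of_ne_top {p : ExtLength E₁ E₂} (h : ∀ e : E₁, p (some (Sum.inl e)) ≠ ⊤) :
    res₁ (Yc p) = yexp fun e : E₁ => (p (some (Sum.inl e))).toReal :=
  funext fun e => expNeg_of_ne_top (h e)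

lemma res₂_Yc_of_ne_top {p : ExtLength E₁ E₂} (h : ∀ e : E₂, p (some (Sum.inr e)) ≠ ⊤) :
    res₂ (Yc p) = yexp fun e : E₂ => (p (some (Sum.inr e))).toReal :=
  funext fun e => expNeg_of_ne_top (h e)

lemma res₁_Yc_of_top {p : ExtLength E₁ E₂} (h : ∀ e : E₁, p (some (Sum.inl e)) = ⊤) :
    res₁ (Yc p) = 0 := funext fun e => expNeg_eq_zero.2 (h e)

lemma res₂_Yc_of_top {p : ExtLength E₁ E₂} (h : ∀ e : E₂, p (some (Sum.inr e)) = ⊤) :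
    res₂ (Yc p) = 0 := funext fun e => expNeg_eq_zero.2 (h e)

lemma pos_of_mem_added {p : ExtLength E₁ E₂} (hp : p ∈ added G₁ G₂) (e : Edge E₁ E₂) :
    0 < p e := by
  rcases hp with (⟨h0, ⟨h1, h2⟩, h3⟩ | ⟨h0, h3, ⟨h1, h2⟩⟩) | ⟨h0, ⟨h1, h2⟩, ⟨h3, h4⟩, -⟩ <;>
    rcases e with _ | (e | e)
  · exact h0
  · exact (ENNReal.toReal_pos_iff.1 (h2.1 e)).1
  · rw [h3 e]; exact ENNReal.zero_lt_top
  · exact h0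
  · rw [h3 e]; exact ENNReal.zero_lt_top
  · exact (ENNReal.toReal_pos_iff.1 (h2.1 e)).1
  · rw [h0]; exact ENNReal.zero_lt_top
  · exact (ENNReal.toReal_pos_iff.1 (h2 e)).1
  · exact (ENNReal.toReal_pos_iff.1 (h4 e)).1

lemma addedY_of_mem (h₁ : G₁.Good) (h₂ : G₂.Good) {p : ExtLength E₁ E₂}
    (hp : p ∈ added G₁ G₂) : AddedY G₁ G₂ (Yc p) := by
  have hlt : ∀ e, Yc p e < 1 := fun e => expNeg_lt_one (pos_of_mem_added hp e)
  rcases hp with (⟨h0, ⟨f1, f2⟩, f3⟩ | ⟨h0, f3, ⟨f1, f2⟩⟩) | ⟨h0, ⟨f1, f2⟩, ⟨f3, f4⟩, hm⟩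
  · refine ⟨Yc_nonneg p, hlt, fun s hs => ?_, fun s hs => ?_, .inr (.inr (res₂_Yc_of_top f3)),
      .inl ⟨_, f2, res₁_Yc_of_ne_top f1⟩⟩
    · rw [res₁_Yc_of_ne_top f1]
      exact not_subInv_rpow h₁ f2.1 f2.2.le hs
    · rw [res₂_Yc_of_top f3]
      exact not_subInv_zero_rpow hs
  · refine ⟨Yc_nonneg p, hlt, fun s hs => ?_, fun s hs => ?_, .inr (.inl (res₁_Yc_of_top f3)),
      .inr ⟨_, f2, res₂_Yc_of_ne_top f1⟩⟩
    · rw [res₁_Yc_of_top f3]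
      exact not_subInv_zero_rpow hs
    · rw [res₂_Yc_of_ne_top f1]
      exact not_subInv_rpow h₂ f2.1 f2.2.le hs
  · refine ⟨Yc_nonneg p, hlt, fun s hs => ?_, fun s hs => ?_, .inl (expNeg_eq_zero.2 h0), ?_⟩
    · rw [res₁_Yc_of_ne_top f1]
      exact not_subInv_rpow h₁ f2 ((le_max_left _ _).trans hm.le) hs
    · rw [res₂_Yc_of_ne_top f3]
      exact not_subInv_rpow h₂ f4 ((le_max_right _ _).trans hm.le) hs
    · rcases max_choice (G₁.entropy fun e => (p (some (Sum.inl e))).toReal)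
        (G₂.entropy fun e => (p (some (Sum.inr e))).toReal) with h | h
      · exact .inl ⟨_, ⟨f2, h.symm.trans hm⟩, res₁_Yc_of_ne_top f1⟩
      · exact .inr ⟨_, ⟨f4, h.symm.trans hm⟩, res₂_Yc_of_ne_top f3⟩

lemma detFun_join_of_zero {y : Edge E₁ E₂ → ℝ} (h : y none = 0 ∨ res₁ y = 0 ∨ res₂ y = 0) :
    (join G₁ G₂ v₁ v₂).detFun y = G₁.detFun (res₁ y) * G₂.detFun (res₂ y) := by
  rw [detFun_join]
  rcases h with h | h | h <;> simp [h, Pf_zero]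

lemma AddedY.detFun_eq_zero (h₁ : G₁.Good) (h₂ : G₂.Good) {y : Edge E₁ E₂ → ℝ}
    (hy : AddedY G₁ G₂ y) : (join G₁ G₂ v₁ v₂).detFun y = 0 := by
  rw [detFun_join_of_zero hy.zero]
  rcases hy.unit with ⟨l, hl, h⟩ | ⟨l, hl, h⟩
  · rw [h, h₁.detFun_eq_zero hl, zero_mul]
  · rw [h, h₂.detFun_eq_zero hl, mul_zero]

/-- The lengths `-log y`. -/
def negLog {E : Type*} (y : E → ℝ) : E → ℝ := fun e => -Real.log (y e)

lemma negLog_yexp {E : Type*} [Fintype E] (l : E → ℝ) : negLog (yexp l) = l := by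
  funext e
  simp [negLog, yexp]

lemma yexp_negLog {E : Type*} [Fintype E] {y : E → ℝ} (hy : ∀ e, 0 < y e) : yexp (negLog y) = y := by
  funext e
  simp [negLog, yexp, Real.exp_log (hy e)]

/-- The positive unit cube. -/
def cube (E : Type*) : Set (E → ℝ) := {y | ∀ e, 0 < y e ∧ y e < 1}

lemma negLog_mem {V E : Type*} {H : OGraph V E} {y : E → ℝ} (hy : y ∈ cube E) :
    negLog y ∈ H.lengthSpace := fun e => neg_pos.2 (Real.log_neg (hy e).1 (hy e).2)

/-- Points `y` near which unit entropy is asymptotically attained. -/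
def EntropyTendsto {V E : Type*} (H : OGraph V E) (y : E → ℝ) : Prop :=
  Tendsto (fun y => H.entropy (negLog y)) (𝓝[cube E] y) (𝓝 1)

lemma entropyTendsto_of_unit {V E : Type*} [Fintype E] {H : OGraph V E} (hH : H.Good)
    {l : E → ℝ} (hl : l ∈ H.unitSpace) : EntropyTendsto H (yexp l) := by
  have h1 : ContinuousAt negLog (yexp l) := by
    refine continuousAt_pi.2 fun e => ?_
    exact (ContinuousAt.log (f := fun y : E → ℝ => y e) (continuous_apply e).continuousAt
      (yexp_pos l e).ne').neg
  have h2 : ContinuousAt (fun y => H.entropy (negLog y)) (yexp l) := by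
    refine ContinuousAt.comp (g := H.entropy) ?_ h1
    rw [negLog_yexp]
    exact hH.continuousAt_entropy hl.1
  have h3 := h2.tendsto
  rw [negLog_yexp, hl.2] at h3
  exact h3.mono_left nhdsWithin_le_nhds

/-- From below: the entropy of the joined graph dominates that of the graph which has unit entropy
at `y`, and the latter is continuous there. From above: for `s > 1` the weights `y ^ s` have `F = F₁
F₂ > 0` and no subinvariant vector, which is an open condition, so the entropy is less than `s`
nearby. -/
lemma AddedY.entropyTendsto (h₁ : G₁.Good) (h₂ : G₂.Good) {y : Edge E₁ E₂ → ℝ}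
    (hy : AddedY G₁ G₂ y) : EntropyTendsto (join G₁ G₂ v₁ v₂) y := by
  have hJ : (join G₁ G₂ v₁ v₂).Good := good_join h₁ h₂
  refine tendsto_order.2 ⟨fun a ha => ?_, fun b hb => ?_⟩
  · rcases le_or_gt a 0 with ha0 | ha0
    · filter_upwards [self_mem_nhdsWithin] with y' hy'
      exact ha0.trans_lt (hJ.entropy_spec (negLog_mem hy')).1
    obtain ⟨s, hs1, hs2⟩ := exists_between ha
    have hs0 : 0 < s := ha0.trans hs1
    have lower : ∀ y' ∈ cube (Edge E₁ E₂),
        (s < G₁.entropy (negLog (res₁ y')) ∨ s < G₂.entropy (negLog (res₂ y'))) →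
        a < (join G₁ G₂ v₁ v₂).entropy (negLog y') := by
      intro y' hy' h
      refine hs1.trans_le ?_
      have hl := negLog_mem (H := join G₁ G₂ v₁ v₂) hy'
      have hS : SubInv ((join G₁ G₂ v₁ v₂).T (yexp (s • negLog y'))) := by
        rcases h with h | h
        · have hl₁ : negLog (res₁ y') ∈ G₁.lengthSpace := negLog_mem fun e => hy' _
          have : SubInv (G₁.T (res₁ (yexp (s • negLog y')))) := by
            refine (h₁.subInv_iff (smul_mem_lengthSpace hl₁ hs0)).2 ?_
            rw [h₁.entropy_smul hl₁ hs0, one_le_div hs0]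
            exact h.le
          obtain ⟨x, x1, x2, x3, -⟩ := SubInv.join_left (G₂ := G₂) (v₁ := v₁) (v₂ := v₂)
            (fun e => (yexp_pos _ e).le) this
          exact ⟨x, x1, x2, x3⟩
        · have hl₂ : negLog (res₂ y') ∈ G₂.lengthSpace := negLog_mem fun e => hy' _
          have : SubInv (G₂.T (res₂ (yexp (s • negLog y')))) := by
            refine (h₂.subInv_iff (smul_mem_lengthSpace hl₂ hs0)).2 ?_
            rw [h₂.entropy_smul hl₂ hs0, one_le_div hs0]
            exact h.le
          obtain ⟨x, x1, x2, x3, -⟩ := SubInv.join_right (G₁ := G₁) (v₁ := v₁) (v₂ := v₂)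
            (fun e => (yexp_pos _ e).le) this
          exact ⟨x, x1, x2, x3⟩
      rw [hJ.subInv_iff (smul_mem_lengthSpace hl hs0), hJ.entropy_smul hl hs0,
        one_le_div hs0] at hS
      exact hS
    rcases hy.unit with ⟨l, hl, h⟩ | ⟨l, hl, h⟩
    · have h1 : ContinuousAt (fun y : Edge E₁ E₂ → ℝ => G₁.entropy (negLog (res₁ y))) y := by
        refine ContinuousAt.comp (f := fun y : Edge E₁ E₂ → ℝ => negLog (res₁ y))
          (g := G₁.entropy) ?_ ?_
        · rw [h, negLog_yexp]
          exact h₁.continuousAt_entropy hl.1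
        · refine continuousAt_pi.2 fun e => ?_
          refine ((continuous_apply _).continuousAt.log ?_).neg
          rw [congrFun h e]
          exact (yexp_pos l e).ne'
      have h2 : s < G₁.entropy (negLog (res₁ y)) := by
        rwa [h, negLog_yexp, hl.2]
      filter_upwards [nhdsWithin_le_nhds (h1.eventually_const_lt h2), self_mem_nhdsWithin]
        with y' e1 e2
      exact lower y' e2 (.inl e1)
    · have h1 : ContinuousAt (fun y : Edge E₁ E₂ → ℝ => G₂.entropy (negLog (res₂ y))) y := by
        refine ContinuousAt.comp (f := fun y : Edge E₁ E₂ → ℝ => negLog (res₂ y))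
          (g := G₂.entropy) ?_ ?_
        · rw [h, negLog_yexp]
          exact h₂.continuousAt_entropy hl.1
        · refine continuousAt_pi.2 fun e => ?_
          refine ((continuous_apply _).continuousAt.log ?_).neg
          rw [congrFun h e]
          exact (yexp_pos l e).ne'
      have h2 : s < G₂.entropy (negLog (res₂ y)) := by
        rwa [h, negLog_yexp, hl.2]
      filter_upwards [nhdsWithin_le_nhds (h1.eventually_const_lt h2), self_mem_nhdsWithin]
        with y' e1 e2
      exact lower y' e2 (.inr e1)
  · obtain ⟨s, hs1, hs2⟩ := exists_between hb
    have hs0 : 0 < s := zero_lt_one.trans hs1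
    set P : (Edge E₁ E₂ → ℝ) → Edge E₁ E₂ → ℝ := fun y e => y e ^ s with hP
    have hPc : Continuous P :=
      continuous_pi fun e => (continuous_apply e).rpow_const fun _ => .inr hs0.le
    have hzero : ∀ z : Edge E₁ E₂ → ℝ, (z none = 0 ∨ res₁ z = 0 ∨ res₂ z = 0) →
        (P z none = 0 ∨ res₁ (P z) = 0 ∨ res₂ (P z) = 0) := by
      intro z hz
      rcases hz with hz | hz | hz
      · exact .inl (by simp only [hP, hz]; exact Real.zero_rpow hs0.ne')
      · refine .inr (.inl (funext fun e => ?_))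
        have : z (some (Sum.inl e)) = 0 := congrFun hz e
        simp only [hP, res₁, this]
        exact Real.zero_rpow hs0.ne'
      · refine .inr (.inr (funext fun e => ?_))
        have : z (some (Sum.inr e)) = 0 := congrFun hz e
        simp only [hP, res₂, this]
        exact Real.zero_rpow hs0.ne'
    have hPnn : ∀ e, 0 ≤ P y e := fun e => Real.rpow_nonneg (hy.nonneg e) s
    have hnot : ¬ SubInv ((join G₁ G₂ v₁ v₂).T (P y)) := by
      refine not_subInv_join hPnn (hy.sub₁ s hs1) (hy.sub₂ s hs1) ?_
      rw [detFun_join_of_zero (hzero y hy.zero)]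
      exact mul_pos (detFun_pos (fun e => hPnn _) (hy.sub₁ s hs1))
        (detFun_pos (fun e => hPnn _) (hy.sub₂ s hs1))
    have hopen : ∀ᶠ y' in 𝓝 y, ¬ SubInv ((join G₁ G₂ v₁ v₂).T (P y')) :=
      ((isClosed_subInv.preimage (continuous_T.comp hPc)).isOpen_compl).mem_nhds hnot
    filter_upwards [nhdsWithin_le_nhds hopen, self_mem_nhdsWithin] with y' e1 e2
    have hl := negLog_mem (H := join G₁ G₂ v₁ v₂) e2
    refine lt_trans ?_ hs2
    have e3 : P y' = yexp (s • negLog y') := by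
      rw [← yexp_rpow, yexp_negLog fun e => (e2 e).1]
    rw [e3, hJ.subInv_iff (smul_mem_lengthSpace hl hs0), hJ.entropy_smul hl hs0, not_le,
      div_lt_one hs0] at e1
    exact e1

end SepEdge

end

noncomputable section

set_option linter.unusedSectionVars false

/-! ### Regular points and their approximation by points of unit entropy -/

namespace SepEdge

open OGraph

variable {V₁ E₁ V₂ E₂ : Type*} [Fintype E₁] [Fintype E₂]
  {G₁ : OGraph V₁ E₁} {G₂ : OGraph V₂ E₂} {v₁ : V₁} {v₂ : V₂}

/-- The added regular points in the coordinates `exp (-l)`: one of the two graphs has unit entropy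
and the other one has smaller entropy. -/
def RegSide (G₁ : OGraph V₁ E₁) (G₂ : OGraph V₂ E₂) (y : Edge E₁ E₂ → ℝ) : Prop :=
  ((∃ l ∈ G₁.unitSpace, res₁ y = yexp l) ∧ ¬ SubInv (G₂.T (res₂ y)) ∧
    (y none = 0 ∨ res₂ y = 0)) ∨
  ((∃ l ∈ G₂.unitSpace, res₂ y = yexp l) ∧ ¬ SubInv (G₁.T (res₁ y)) ∧
    (y none = 0 ∨ res₁ y = 0))

lemma regSide_of_mem (h₁ : G₁.Good) (h₂ : G₂.Good) {p : ExtLength E₁ E₂}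
    (hp : p ∈ added G₁ G₂) (hs : ¬ (FiniteOn₁ G₁.unitSpace p ∧ FiniteOn₂ G₂.unitSpace p)) :
    RegSide G₁ G₂ (Yc p) := by
  rcases hp with (⟨h0, ⟨f1, f2⟩, f3⟩ | ⟨h0, f3, ⟨f1, f2⟩⟩) | ⟨h0, ⟨f1, f2⟩, ⟨f3, f4⟩, hm⟩
  · refine .inl ⟨⟨_, f2, res₁_Yc_of_ne_top f1⟩, ?_, .inr (res₂_Yc_of_top f3)⟩
    rw [res₂_Yc_of_top f3]
    exact not_subInv_zero
  · refine .inr ⟨⟨_, f2, res₂_Yc_of_ne_top f1⟩, ?_, .inr (res₁_Yc_of_top f3)⟩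
    rw [res₁_Yc_of_top f3]
    exact not_subInv_zero
  · have hz : Yc p none = 0 := expNeg_eq_zero.2 h0
    rcases max_choice (G₁.entropy fun e => (p (some (Sum.inl e))).toReal)
        (G₂.entropy fun e => (p (some (Sum.inr e))).toReal) with h | h
    · have hu := h.symm.trans hm
      refine .inl ⟨⟨_, ⟨f2, hu⟩, res₁_Yc_of_ne_top f1⟩, ?_, .inl hz⟩
      rw [res₂_Yc_of_ne_top f3, h₂.subInv_iff f4]
      intro h'
      exact hs ⟨⟨f1, f2, hu⟩, f3, f4, le_antisymm ((le_max_right _ _).trans hm.le) h'⟩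
    · have hu := h.symm.trans hm
      refine .inr ⟨⟨_, ⟨f4, hu⟩, res₂_Yc_of_ne_top f3⟩, ?_, .inl hz⟩
      rw [res₁_Yc_of_ne_top f1, h₁.subInv_iff f2]
      intro h'
      exact hs ⟨⟨f1, f2, le_antisymm ((le_max_left _ _).trans hm.le) h'⟩, f3, f4, hu⟩

lemma regSide_of_reg (h₁ : G₁.Good) (h₂ : G₂.Good) {p : ExtLength E₁ E₂}
    (hp : p ∈ reg G₁ G₂ v₁ v₂) (ha : p ∈ added G₁ G₂) : RegSide G₁ G₂ (Yc p) :=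
  regSide_of_mem h₁ h₂ ha fun h => hp.2 ⟨hp.1, h⟩

lemma hasDerivAt_detFun_add_smul {V E : Type*} [Fintype E] {H : OGraph V E} (y w : E → ℝ) :
    HasDerivAt (fun t : ℝ => H.detFun (y + t • w)) (fderiv ℝ H.detFun y w) 0 := by
  have h1 : HasDerivAt (fun t : ℝ => y + t • w) w 0 := by
    simpa using ((hasDerivAt_id (0 : ℝ)).smul_const w).const_add y
  have h2 : HasFDerivAt H.detFun (fderiv ℝ H.detFun y) (y + (0 : ℝ) • w) := by
    rw [zero_smul, add_zero]
    exact (differentiableAt_detFun y).hasFDerivAt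
  exact h2.comp_hasDerivAt (0 : ℝ) h1

/-- The loop term of `detFun_join` vanishes along the whole line, so the product rule for `F₁ F₂`
applies. -/
lemma fderiv_join_of_zero {y w : Edge E₁ E₂ → ℝ}
    (h : ∀ t : ℝ, (y + t • w) none = 0 ∨ res₁ (y + t • w) = 0 ∨ res₂ (y + t • w) = 0) :
    fderiv ℝ (join G₁ G₂ v₁ v₂).detFun y w =
      fderiv ℝ G₁.detFun (res₁ y) (res₁ w) * G₂.detFun (res₂ y) +
        G₁.detFun (res₁ y) * fderiv ℝ G₂.detFun (res₂ y) (res₂ w) := by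
  have h1 := hasDerivAt_detFun_add_smul (H := join G₁ G₂ v₁ v₂) y w
  have h2 : (fun t : ℝ => (join G₁ G₂ v₁ v₂).detFun (y + t • w)) =
      fun t => G₁.detFun (res₁ y + t • res₁ w) * G₂.detFun (res₂ y + t • res₂ w) :=
    funext fun t => detFun_join_of_zero (h t)
  rw [h2] at h1
  have h3 := (hasDerivAt_detFun_add_smul (H := G₁) (res₁ y) (res₁ w)).mul
    (hasDerivAt_detFun_add_smul (H := G₂) (res₂ y) (res₂ w))
  rw [zero_smul, zero_smul, add_zero, add_zero] at h3
  exact h1.unique h3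

lemma Kf_join_of_zero {y : Edge E₁ E₂ → ℝ} (h : y none = 0 ∨ res₁ y = 0 ∨ res₂ y = 0) :
    (join G₁ G₂ v₁ v₂).Kf y = G₁.Kf (res₁ y) * G₂.detFun (res₂ y) +
        G₁.detFun (res₁ y) * G₂.Kf (res₂ y) := by
  refine fderiv_join_of_zero fun t => ?_
  rcases h with h | h | h
  · exact .inl (by simp [h])
  · refine .inr (.inl (funext fun e => ?_))
    have : y (some (Sum.inl e)) = 0 := congrFun h e
    simp [res₁, this]
  · refine .inr (.inr (funext fun e => ?_))
    have : y (some (Sum.inr e)) = 0 := congrFun h e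
    simp [res₂, this]

/-- Exactly one of the factors `F₁`, `F₂` vanishes, so one of the two terms of the product rule is
positive and the other is zero. At a singular point both are zero, which is why the norm is not
extended there. -/
lemma RegSide.Kf_pos (h₁ : G₁.Good) (h₂ : G₂.Good) {y : Edge E₁ E₂ → ℝ} (hy : ∀ e, 0 ≤ y e)
    (h : RegSide G₁ G₂ y) : 0 < (join G₁ G₂ v₁ v₂).Kf y := by
  rcases h with ⟨⟨l, hl, e⟩, hn, hz⟩ | ⟨⟨l, hl, e⟩, hn, hz⟩
  · rw [Kf_join_of_zero (by tauto), e, h₁.detFun_eq_zero hl, zero_mul, add_zero]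
    exact mul_pos (h₁.Kf_pos hl) (detFun_pos (fun _ => hy _) hn)
  · rw [Kf_join_of_zero (by tauto), e, h₂.detFun_eq_zero hl, mul_zero, zero_add]
    exact mul_pos (detFun_pos (fun _ => hy _) hn) (h₂.Kf_pos hl)

lemma incl_mem_reg (h₁ : G₁.Good) (h₂ : G₂.Good) {x : Edge E₁ E₂ → ℝ}
    (hx : x ∈ (join G₁ G₂ v₁ v₂).unitSpace) : incl x ∈ reg G₁ G₂ v₁ v₂ := by
  refine ⟨.inl ⟨x, hx, rfl⟩, fun h => ?_⟩
  have h1 := (not_subInv_of_unit (good_join h₁ h₂) hx).1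
  have h2 : (fun e : E₁ => (incl x (some (Sum.inl e))).toReal) = res₁ x :=
    funext fun e => ENNReal.toReal_ofReal (hx.1 _).le
  have h3 := h.2.1.2
  rw [h2] at h3
  exact h1 ((h₁.subInv_iff h3.1).2 h3.2.ge)

lemma Kf_pos_of_reg (h₁ : G₁.Good) (h₂ : G₂.Good) {p : ExtLength E₁ E₂}
    (hp : p ∈ reg G₁ G₂ v₁ v₂) : 0 < (join G₁ G₂ v₁ v₂).Kf (Yc p) := by
  rcases hp.1 with ⟨x, hx, rfl⟩ | ha
  · rw [Yc_incl fun e => (hx.1 e).le]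
    exact (good_join h₁ h₂).Kf_pos hx
  · exact (regSide_of_reg h₁ h₂ hp ha).Kf_pos h₁ h₂ (Yc_nonneg p)

lemma detFun_Yc_of_model (h₁ : G₁.Good) (h₂ : G₂.Good) {p : ExtLength E₁ E₂}
    (hp : p ∈ model G₁ G₂ v₁ v₂) : (join G₁ G₂ v₁ v₂).detFun (Yc p) = 0 := by
  rcases hp with ⟨x, hx, rfl⟩ | ha
  · rw [Yc_incl fun e => (hx.1 e).le]
    exact (good_join h₁ h₂).detFun_eq_zero hx
  · exact (addedY_of_mem h₁ h₂ ha).detFun_eq_zero h₁ h₂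

lemma pos_of_mem_model {p : ExtLength E₁ E₂} (hp : p ∈ model G₁ G₂ v₁ v₂) (e : Edge E₁ E₂) :
    0 < p e := by
  rcases hp with ⟨x, hx, rfl⟩ | ha
  · exact ENNReal.ofReal_pos.2 (hx.1 e)
  · exact pos_of_mem_added ha e

lemma entropyTendsto_of_model (h₁ : G₁.Good) (h₂ : G₂.Good) {p : ExtLength E₁ E₂}
    (hp : p ∈ model G₁ G₂ v₁ v₂) : EntropyTendsto (join G₁ G₂ v₁ v₂) (Yc p) := by
  rcases hp with ⟨x, hx, rfl⟩ | ha
  · rw [Yc_incl fun e => (hx.1 e).le]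
    exact entropyTendsto_of_unit (good_join h₁ h₂) hx
  · exact (addedY_of_mem h₁ h₂ ha).entropyTendsto h₁ h₂

section Normalization

variable {V E : Type*} [Fintype E] {H : OGraph V E}

/-- The point of unit entropy on the ray through `-log y`. -/
def unitPt (H : OGraph V E) (y : E → ℝ) : E → ℝ := H.entropy (negLog y) • negLog y

lemma unitPt_mem (hH : H.Good) {y : E → ℝ} (hy : y ∈ cube E) : unitPt H y ∈ H.unitSpace :=
  hH.normalize_mem (negLog_mem hy)

lemma unitPt_yexp {l : E → ℝ} (hl : l ∈ H.unitSpace) : unitPt H (yexp l) = l := by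
  rw [unitPt, negLog_yexp, hl.2, one_smul]

lemma yexp_unitPt {y : E → ℝ} (hy : y ∈ cube E) :
    yexp (unitPt H y) = fun e => y e ^ H.entropy (negLog y) := by
  rw [unitPt, ← yexp_rpow, yexp_negLog fun e => (hy e).1]

/-- Normalising to unit entropy raises the weights to the power of the entropy, which tends to one;
this is harmless also where `y = 0`. -/
lemma tendsto_yexp_unitPt {y : E → ℝ} (h : EntropyTendsto H y) :
    Tendsto (fun y => yexp (unitPt H y)) (𝓝[cube E] y) (𝓝 y) := by
  have h1 : Tendsto (fun y : E → ℝ => fun e => y e ^ H.entropy (negLog y)) (𝓝[cube E] y)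
      (𝓝 fun e => y e ^ (1 : ℝ)) := by
    refine tendsto_pi_nhds.2 fun e => ?_
    have h2 : Tendsto (fun y : E → ℝ => y e) (𝓝[cube E] y) (𝓝 (y e)) :=
      (continuous_apply e).continuousAt.mono_left nhdsWithin_le_nhds
    exact h2.rpow h (.inr zero_lt_one)
  simp only [Real.rpow_one] at h1
  refine h1.congr' ?_
  filter_upwards [self_mem_nhdsWithin] with y' hy'
  exact (yexp_unitPt hy').symm

lemma nhdsWithin_cube_neBot {y : E → ℝ} (h0 : ∀ e, 0 ≤ y e) (h1 : ∀ e, y e < 1) :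
    (𝓝[cube E] y).NeBot := by
  rw [← mem_closure_iff_nhdsWithin_neBot]
  have : cube E = Set.univ.pi fun _ => Set.Ioo (0 : ℝ) 1 := by
    ext y
    simp [cube, Set.mem_pi]
  rw [this, closure_pi_set]
  intro e _
  rw [closure_Ioo zero_ne_one]
  exact ⟨h0 e, (h1 e).le⟩

end Normalization

lemma tendsto_incl_unitPt (h₁ : G₁.Good) (h₂ : G₂.Good) {p : ExtLength E₁ E₂}
    (hp : p ∈ model G₁ G₂ v₁ v₂) :
    Tendsto (fun y => incl (unitPt (join G₁ G₂ v₁ v₂) y)) (𝓝[cube _] (Yc p)) (𝓝 p) := by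
  rw [isClosedEmbedding_Yc.toIsEmbedding.tendsto_nhds_iff]
  refine (tendsto_yexp_unitPt (entropyTendsto_of_model h₁ h₂ hp)).congr' ?_
  filter_upwards [self_mem_nhdsWithin] with y hy
  exact (Yc_incl fun e => ((unitPt_mem (good_join h₁ h₂) hy).1 e).le).symm

lemma cube_neBot {p : ExtLength E₁ E₂} (hp : p ∈ model G₁ G₂ v₁ v₂) :
    (𝓝[cube _] (Yc p)).NeBot :=
  nhdsWithin_cube_neBot (Yc_nonneg p) fun e => expNeg_lt_one (pos_of_mem_model hp e)

/-! ### The extended entropy norm -/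

section Norm

lemma mem_regTangent {q : ExtLength E₁ E₂ × (Edge E₁ E₂ → ℝ)} :
    q ∈ regTangent G₁ G₂ v₁ v₂ ↔ q.1 ∈ reg G₁ G₂ v₁ v₂ ∧
      fderiv ℝ (join G₁ G₂ v₁ v₂).detFun (Yc q.1) (fun e => Yc q.1 e * q.2 e) = 0 := by
  change _ ∧ _ ↔ _
  rw [sum_partialF, neg_eq_zero]
  rfl

variable (G₁ G₂ v₁ v₂) in
/-- The formula for the extended entropy norm. -/
def nrm (q : ExtLength E₁ E₂ × (Edge E₁ E₂ → ℝ)) : ℝ :=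
  Real.sqrt (-((join G₁ G₂ v₁ v₂).Nf (Yc q.1) q.2 / (join G₁ G₂ v₁ v₂).Kf (Yc q.1)))

lemma finTangent_subset (h₁ : G₁.Good) (h₂ : G₂.Good) :
    finTangent G₁ G₂ v₁ v₂ ⊆ regTangent G₁ G₂ v₁ v₂ := by
  rintro _ ⟨⟨x, v⟩, ⟨hx, hv⟩, rfl⟩
  refine mem_regTangent.2 ⟨incl_mem_reg h₁ h₂ hx, ?_⟩
  dsimp only at hx hv ⊢
  rw [Yc_incl fun e => (hx.1 e).le, (good_join h₁ h₂).fderiv_detFun_unit hx, hv, zero_mul]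

lemma mem_finTangent (h₁ : G₁.Good) (h₂ : G₂.Good) {x v : Edge E₁ E₂ → ℝ}
    (hx : x ∈ (join G₁ G₂ v₁ v₂).unitSpace)
    (hv : fderiv ℝ (join G₁ G₂ v₁ v₂).detFun (yexp x) (fun e => yexp x e * v e) = 0) :
    (incl x, v) ∈ finTangent G₁ G₂ v₁ v₂ := by
  refine ⟨(x, v), ⟨hx, ?_⟩, rfl⟩
  rw [(good_join h₁ h₂).fderiv_detFun_unit hx] at hv
  exact (mul_eq_zero.1 hv).resolve_right ((good_join h₁ h₂).Kf_pos hx).ne'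

lemma finNorm_eq (h₁ : G₁.Good) (h₂ : G₂.Good) :
    Set.EqOn (finNorm G₁ G₂ v₁ v₂) (nrm G₁ G₂ v₁ v₂) (finTangent G₁ G₂ v₁ v₂) := by
  rintro _ ⟨⟨x, v⟩, ⟨hx, hv⟩, rfl⟩
  dsimp only at hx hv
  unfold finNorm nrm
  dsimp only
  rw [Yc_incl fun e => (hx.1 e).le, incl_toReal fun e => (hx.1 e).le]
  exact (good_join h₁ h₂).entropyNorm_eq hx hv

/-- The base point is approximated by normalised points, and `v` is corrected by a multiple of a
fixed vector `w` transversal to `F = 0`. The multiple tends to zero because `v` is tangent at the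
limit. -/
lemma regTangent_subset_closure (h₁ : G₁.Good) (h₂ : G₂.Good) :
    regTangent G₁ G₂ v₁ v₂ ⊆ closure (finTangent G₁ G₂ v₁ v₂) := by
  rintro ⟨p, v⟩ hq
  obtain ⟨hp, hv⟩ := mem_regTangent.1 hq
  dsimp only at hp hv
  have hJ := good_join (v₁ := v₁) (v₂ := v₂) h₁ h₂
  set J := join G₁ G₂ v₁ v₂ with hJdef
  have := cube_neBot hp.1
  -- The derivative of `F` at `p` along `w`, weighted by `y`, is `Kf (Yc p) ≠ 0`. On infinite edges
  -- `Real.log 0 = 0`, so no correction is made there.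
  set w : Edge E₁ E₂ → ℝ := fun e => Real.log (Yc p e) with hw
  set D : (Edge E₁ E₂ → ℝ) → (Edge E₁ E₂ → ℝ) → ℝ := fun y v =>
    fderiv ℝ J.detFun y fun e => y e * v e with hD
  have hDc : ∀ v, Continuous fun y => D y v := fun v =>
    continuous_fderiv_detFun.clm_apply (by fun_prop)
  have hlin : ∀ y c, D y (v - c • w) = D y v - c * D y w := fun y c => by
    simp only [hD]
    rw [← smul_eq_mul, ← map_smul, ← map_sub]
    congr 1
    funext e
    simp only [Pi.sub_apply, Pi.smul_apply, smul_eq_mul]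
    ring
  have hK : D (Yc p) w ≠ 0 := (Kf_pos_of_reg h₁ h₂ hp).ne'
  have hY := tendsto_yexp_unitPt (entropyTendsto_of_model h₁ h₂ hp.1)
  have t1 := ((hDc v).tendsto (Yc p)).comp hY
  have t2 := ((hDc w).tendsto (Yc p)).comp hY
  have t3 := ((t1.div t2 hK).smul_const w).const_sub v
  rw [show D (Yc p) v = 0 from hv, zero_div, zero_smul, sub_zero] at t3
  refine mem_closure_of_tendsto ((tendsto_incl_unitPt h₁ h₂ hp.1).prodMk_nhds t3) ?_
  filter_upwards [self_mem_nhdsWithin, t2.eventually_ne hK] with y hy hne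
  refine mem_finTangent h₁ h₂ (unitPt_mem hJ hy) ?_
  have := hlin (yexp (unitPt J y)) (D (yexp (unitPt J y)) v / D (yexp (unitPt J y)) w)
  rw [div_mul_cancel₀ _ (show D (yexp (unitPt J y)) w ≠ 0 from hne), sub_self] at this
  exact this

lemma continuousOn_nrm (h₁ : G₁.Good) (h₂ : G₂.Good) :
    ContinuousOn (nrm G₁ G₂ v₁ v₂) (regTangent G₁ G₂ v₁ v₂) := by
  unfold nrm
  have h1 : Continuous fun q : ExtLength E₁ E₂ × (Edge E₁ E₂ → ℝ) =>
      (join G₁ G₂ v₁ v₂).Nf (Yc q.1) q.2 :=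
    continuous_Nf.comp ((continuous_Yc.comp continuous_fst).prodMk continuous_snd)
  have h2 : Continuous fun q : ExtLength E₁ E₂ × (Edge E₁ E₂ → ℝ) =>
      (join G₁ G₂ v₁ v₂).Kf (Yc q.1) :=
    continuous_Kf.comp (continuous_Yc.comp continuous_fst)
  exact (h1.continuousOn.div h2.continuousOn fun q hq => (Kf_pos_of_reg h₁ h₂ hq.1).ne').neg.sqrt

/-- `nrm` is continuous over the regular points and agrees with the entropy norm on the dense
subset, so the extension by limits must be `nrm`. -/
lemma extNorm_eq (h₁ : G₁.Good) (h₂ : G₂.Good) :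
    Set.EqOn (extNorm G₁ G₂ v₁ v₂) (nrm G₁ G₂ v₁ v₂) (regTangent G₁ G₂ v₁ v₂) := by
  intro q hq
  refine extendFrom_eq (regTangent_subset_closure h₁ h₂ hq) ?_
  have h1 := ((continuousOn_nrm h₁ h₂) q hq).mono (finTangent_subset h₁ h₂)
  exact h1.tendsto.congr' (eventually_nhdsWithin_of_forall fun q hq => (finNorm_eq h₁ h₂ hq).symm)

lemma nrm_smul (q : ExtLength E₁ E₂ × (Edge E₁ E₂ → ℝ)) (c : ℝ) :
    nrm G₁ G₂ v₁ v₂ (q.1, c • q.2) = |c| * nrm G₁ G₂ v₁ v₂ q := by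
  have : (join G₁ G₂ v₁ v₂).Nf (Yc q.1) (c • q.2) = c ^ 2 * (join G₁ G₂ v₁ v₂).Nf (Yc q.1) q.2 := by
    unfold Nf
    have e1 : (fun e => Yc q.1 e * (c • q.2) e) = c • fun e => Yc q.1 e * q.2 e := by
      funext e; simp only [Pi.smul_apply, smul_eq_mul]; ring
    have e2 : (fun e => Yc q.1 e * (c • q.2) e ^ 2) = c ^ 2 • fun e => Yc q.1 e * q.2 e ^ 2 := by
      funext e; simp only [Pi.smul_apply, smul_eq_mul]; ring
    rw [e1, e2]
    simp only [map_smul, smul_apply, smul_eq_mul]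
    ring
  unfold nrm
  dsimp only
  rw [this, mul_div_assoc, ← mul_neg, Real.sqrt_mul (sq_nonneg c), Real.sqrt_sq_eq_abs]

end Norm

end SepEdge

end

noncomputable section

set_option linter.unusedSectionVars false

/-! ### Reparametrisation, reversal and concatenation of paths -/

section Integrals

lemma lintegral_uIcc_affine {c : ℝ} (hc : c ≠ 0) (d p q : ℝ) (g : ℝ → ℝ≥0∞) :
    ∫⁻ t in Set.uIcc p q, ENNReal.ofReal |c| * g (c * t + d) =
      ∫⁻ t in Set.uIcc (c * p + d) (c * q + d), g t := by
  have h1 : (fun t => c * t + d) '' Set.uIcc p q = Set.uIcc (c * p + d) (c * q + d) := by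
    rw [← Set.image_add_const_uIcc, ← Set.image_const_mul_uIcc, Set.image_image]
  rw [← h1, lintegral_image_eq_lintegral_abs_deriv_mul measurableSet_uIcc
    (f' := fun _ => c) ?_ ?_]
  · intro x _
    simpa using (((hasDerivAt_id x).const_mul c).add_const d).hasDerivWithinAt
  · intro x _ y _ h
    simpa [hc] using h

lemma lintegral_Icc_eq_Ioo (a b : ℝ) (g : ℝ → ℝ≥0∞) :
    ∫⁻ t in Set.Icc a b, g t = ∫⁻ t in Set.Ioo a b, g t :=
  setLIntegral_congr Ioo_ae_eq_Icc.symm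

lemma lintegral_Icc_add {a b c : ℝ} (hab : a ≤ b) (hbc : b ≤ c) (g : ℝ → ℝ≥0∞) :
    (∫⁻ t in Set.Icc a b, g t) + ∫⁻ t in Set.Icc b c, g t = ∫⁻ t in Set.Icc a c, g t := by
  rw [setLIntegral_congr (Ioc_ae_eq_Icc (a := b) (b := c)).symm, ← lintegral_union measurableSet_Ioc,
    Set.Icc_union_Ioc_eq_Icc hab hbc]
  rw [Set.disjoint_left]
  intro x h1 h2
  exact absurd h1.2 (not_le.2 h2.1)

lemma lintegral_concat {g g₁ g₂ : ℝ → ℝ≥0∞}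
    (h₁ : ∀ᵐ t, t ∈ Set.Icc (0 : ℝ) (1 / 2) → g t = ENNReal.ofReal |2| * g₁ (2 * t + 0))
    (h₂ : ∀ᵐ t, t ∈ Set.Icc (1 / 2 : ℝ) 1 → g t = ENNReal.ofReal |2| * g₂ (2 * t + (-1))) :
    ∫⁻ t in Set.Icc (0 : ℝ) 1, g t =
      (∫⁻ t in Set.Icc (0 : ℝ) 1, g₁ t) + ∫⁻ t in Set.Icc (0 : ℝ) 1, g₂ t := by
  rw [← lintegral_Icc_add (b := 1 / 2) (by norm_num) (by norm_num),
    setLIntegral_congr_fun_ae measurableSet_Icc h₁, setLIntegral_congr_fun_ae measurableSet_Icc h₂,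
    ← Set.uIcc_of_le (by norm_num : (0 : ℝ) ≤ 1 / 2), ← Set.uIcc_of_le (by norm_num : (1 / 2 : ℝ) ≤ 1),
    lintegral_uIcc_affine two_ne_zero, lintegral_uIcc_affine two_ne_zero]
  norm_num

lemma ae_mem_Icc {a b : ℝ} {s : Set ℝ} (hs : s.Finite) {P : ℝ → Prop}
    (h : ∀ t ∈ Set.Ioo a b, t ∉ s → P t) : ∀ᵐ t, t ∈ Set.Icc a b → P t := by
  have h1 : ∀ᵐ t : ℝ, t ∉ s ∪ {a, b} := by
    refine (measure_eq_zero_iff_ae_notMem).1 (Set.Finite.measure_zero ?_ _)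
    exact hs.union (Set.toFinite _)
  filter_upwards [h1] with t ht hI
  have ha : t ≠ a := fun h => ht (by simp [h])
  have hb : t ≠ b := fun h => ht (by simp [h])
  exact h t ⟨lt_of_le_of_ne hI.1 ha.symm, lt_of_le_of_ne hI.2 hb⟩ fun h => ht (.inl h)

end Integrals

section Concat

variable {X : Type*}

/-- Concatenation of paths which are parametrized by `[0,1]`. -/
def concat (γ₁ γ₂ : ℝ → X) (t : ℝ) : X := if t ≤ 1 / 2 then γ₁ (2 * t + 0) else γ₂ (2 * t + (-1))

variable {γ₁ γ₂ : ℝ → X}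

lemma concat_of_le {t : ℝ} (ht : t ≤ 1 / 2) : concat γ₁ γ₂ t = γ₁ (2 * t + 0) := if_pos ht

lemma concat_of_ge (h : γ₁ 1 = γ₂ 0) {t : ℝ} (ht : 1 / 2 ≤ t) :
    concat γ₁ γ₂ t = γ₂ (2 * t + (-1)) := by
  rcases ht.eq_or_lt with rfl | ht
  · rw [concat_of_le le_rfl]
    norm_num [h]
  · exact if_neg (not_le.2 ht)

lemma concat_eventuallyEq_left {t : ℝ} (ht : t < 1 / 2) :
    concat γ₁ γ₂ =ᶠ[𝓝 t] fun t => γ₁ (2 * t + 0) := by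
  filter_upwards [gt_mem_nhds ht] with u hu
  exact concat_of_le hu.le

lemma concat_eventuallyEq_right {t : ℝ} (ht : 1 / 2 < t) :
    concat γ₁ γ₂ =ᶠ[𝓝 t] fun t => γ₂ (2 * t + (-1)) := by
  filter_upwards [lt_mem_nhds ht] with u hu
  exact if_neg (not_le.2 hu)

lemma forall_concat (h : γ₁ 1 = γ₂ 0) {P : X → Prop} (h₁ : ∀ t ∈ Set.Icc (0 : ℝ) 1, P (γ₁ t))
    (h₂ : ∀ t ∈ Set.Icc (0 : ℝ) 1, P (γ₂ t)) : ∀ t ∈ Set.Icc (0 : ℝ) 1, P (concat γ₁ γ₂ t) := by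
  intro t ht
  rcases le_total t (1 / 2) with h' | h'
  · rw [concat_of_le h']
    exact h₁ _ ⟨by linarith [ht.1], by linarith⟩
  · rw [concat_of_ge h h']
    exact h₂ _ ⟨by linarith, by linarith [ht.2]⟩

lemma continuousOn_concat [TopologicalSpace X] (h : γ₁ 1 = γ₂ 0)
    (h₁ : ContinuousOn γ₁ (Set.Icc 0 1)) (h₂ : ContinuousOn γ₂ (Set.Icc 0 1)) :
    ContinuousOn (concat γ₁ γ₂) (Set.Icc 0 1) := by
  rw [← Set.Icc_union_Icc_eq_Icc (b := 1 / 2) (by norm_num : (0 : ℝ) ≤ 1 / 2) (by norm_num)]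
  refine ContinuousOn.union_of_isClosed ?_ ?_ isClosed_Icc isClosed_Icc
  · refine (ContinuousOn.comp (f := fun t : ℝ => 2 * t + 0) h₁ (by fun_prop) ?_).congr
      fun t ht => concat_of_le ht.2
    intro t ht
    exact ⟨by linarith [ht.1], by linarith [ht.2]⟩
  · refine (ContinuousOn.comp (f := fun t : ℝ => 2 * t + (-1)) h₂ (by fun_prop) ?_).congr
      fun t ht => concat_of_ge h ht.1
    intro t ht
    exact ⟨by linarith [ht.1], by linarith [ht.2]⟩

lemma deriv_comp_affine {F : Type*} [NormedAddCommGroup F] [NormedSpace ℝ F] (γ : ℝ → F)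
    (c d t : ℝ) : deriv (fun t => γ (c * t + d)) t = c • deriv γ (c * t + d) := by
  have h := deriv_comp_mul_left c (fun s => γ (s + d)) t
  rw [deriv_comp_add_const] at h
  exact h

end Concat

namespace OGraph

variable {V E : Type*} [Fintype E] {H : OGraph V E}

lemma entropyNorm_smul (l v : E → ℝ) (c : ℝ) :
    H.entropyNorm l (c • v) = |c| * H.entropyNorm l v := by
  unfold entropyNorm
  simp only [map_smul, smul_apply, smul_eq_mul]
  rw [← mul_assoc, ← sq, Real.sqrt_mul (sq_nonneg c), Real.sqrt_sq_eq_abs]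

/-- The speed of a path with respect to the entropy norm. -/
def speed (H : OGraph V E) (γ : ℝ → E → ℝ) (t : ℝ) : ℝ≥0∞ :=
  ENNReal.ofReal (H.entropyNorm (γ t) (deriv γ t))

lemma speed_affine (γ : ℝ → E → ℝ) (c d t : ℝ) :
    H.speed (fun t => γ (c * t + d)) t = ENNReal.ofReal |c| * H.speed γ (c * t + d) := by
  unfold speed
  rw [deriv_comp_affine, entropyNorm_smul, ENNReal.ofReal_mul (abs_nonneg c)]

lemma speed_congr {γ γ' : ℝ → E → ℝ} {t : ℝ} (h : γ =ᶠ[𝓝 t] γ') : H.speed γ t = H.speed γ' t := by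
  unfold speed
  rw [h.eq_of_nhds, h.deriv_eq]

/-- The parameters `p`, `q` are not ordered, since an affine substitution may reverse the arc;
`near_of_smooth` uses two times whose order is unknown. -/
lemma entropyDist_le_arc {γ : ℝ → E → ℝ} {p q : ℝ}
    (hs : ∀ t ∈ Set.uIcc p q, ContDiffAt ℝ ∞ γ t) (hu : ∀ t ∈ Set.uIcc p q, γ t ∈ H.unitSpace) :
    H.entropyDist (γ p) (γ q) ≤ ∫⁻ t in Set.uIcc p q, H.speed γ t := by
  have hmaps : ∀ t ∈ Set.Icc (0 : ℝ) 1, (q - p) * t + p ∈ Set.uIcc p q := by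
    intro t ht
    rw [← segment_eq_uIcc, segment_eq_image']
    exact ⟨t, ht, by simp only [smul_eq_mul]; ring⟩
  have hc : ContDiffOn ℝ ∞ (fun t => γ ((q - p) * t + p)) (Set.Icc 0 1) := by
    intro t ht
    refine ContDiffAt.contDiffWithinAt ?_
    exact ContDiffAt.comp (f := fun t => (q - p) * t + p) t (hs _ (hmaps t ht)) (by fun_prop)
  have hpath : H.IsUnitPath fun t => γ ((q - p) * t + p) := by
    refine ⟨hc.continuousOn, fun t ht => hu _ (hmaps t ht), 1, fun i => (i : ℝ), Nat.mono_cast,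
      by simp, by simp, fun i hi => ?_⟩
    obtain rfl : i = 0 := by omega
    simpa using hc
  refine (iInf₂_le (fun t => γ ((q - p) * t + p)) ⟨hpath, by simp, by simp⟩).trans ?_
  change ∫⁻ t in Set.Icc (0 : ℝ) 1, H.speed (fun t => γ ((q - p) * t + p)) t ≤ _
  simp only [speed_affine]
  by_cases hpq : q - p = 0
  · simp [hpq]
  · rw [← Set.uIcc_of_le (zero_le_one' ℝ), lintegral_uIcc_affine hpq]
    simp

lemma entropyDist_triangle (x y z : E → ℝ) :
    H.entropyDist x z ≤ H.entropyDist x y + H.entropyDist y z := by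
  unfold entropyDist
  simp only [ENNReal.iInf_add, ENNReal.add_iInf]
  refine le_iInf₂ fun γ₂ h₂ => le_iInf₂ fun γ₁ h₁ => ?_
  obtain ⟨⟨c₁, u₁, n₁, s₁, ms₁, a₁, b₁, d₁⟩, x₁, y₁⟩ := h₁
  obtain ⟨⟨c₂, u₂, n₂, s₂, ms₂, a₂, b₂, d₂⟩, x₂, y₂⟩ := h₂
  have h : γ₁ 1 = γ₂ 0 := y₁.trans x₂.symm
  have key : H.pathLength (concat γ₁ γ₂) = H.pathLength γ₁ + H.pathLength γ₂ := by
    change ∫⁻ t in Set.Icc (0 : ℝ) 1, H.speed (concat γ₁ γ₂) t =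
      (∫⁻ t in Set.Icc (0 : ℝ) 1, H.speed γ₁ t) + ∫⁻ t in Set.Icc (0 : ℝ) 1, H.speed γ₂ t
    refine lintegral_concat (ae_mem_Icc Set.finite_empty fun t ht _ => ?_)
      (ae_mem_Icc Set.finite_empty fun t ht _ => ?_)
    · exact (speed_congr (concat_eventuallyEq_left ht.2)).trans (speed_affine _ _ _ _)
    · exact (speed_congr (concat_eventuallyEq_right ht.1)).trans (speed_affine _ _ _ _)
  rw [← key]
  refine iInf₂_le _ ⟨⟨continuousOn_concat h c₁ c₂, forall_concat h u₁ u₂, n₁ + n₂,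
    fun i => if i ≤ n₁ then s₁ i / 2 else (s₂ (i - n₁) + 1) / 2, ?_, ?_, ?_, ?_⟩, ?_, ?_⟩
  · refine monotone_nat_of_le_succ fun i => ?_
    rcases lt_trichotomy i n₁ with hi | rfl | hi
    · rw [if_pos hi.le, if_pos (Nat.succ_le_of_lt hi)]
      linarith [ms₁ (Nat.le_succ i)]
    · rw [if_pos le_rfl, if_neg (by omega), b₁]
      have := ms₂ (Nat.zero_le (i + 1 - i))
      linarith
    · rw [if_neg (by omega), if_neg (by omega)]
      have := ms₂ (show i - n₁ ≤ i + 1 - n₁ by omega)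
      linarith
  · simp [a₁]
  · by_cases hn : n₂ = 0
    · rw [hn] at b₂
      linarith
    · beta_reduce
      rw [if_neg (by omega), Nat.add_sub_cancel_left, b₂]
      norm_num
  · intro i hi
    beta_reduce
    by_cases hi' : i < n₁
    · rw [if_pos hi'.le, if_pos (Nat.succ_le_of_lt hi')]
      have hle : s₁ (i + 1) ≤ 1 := b₁ ▸ ms₁ (Nat.succ_le_of_lt hi')
      refine (ContDiffOn.comp (f := fun t : ℝ => 2 * t + 0) (d₁ i hi') (by fun_prop) ?_).congr
        fun t ht => concat_of_le (by linarith [ht.2])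
      intro t ht
      exact ⟨by linarith [ht.1], by linarith [ht.2]⟩
    · have e1 : (if i ≤ n₁ then s₁ i / 2 else (s₂ (i - n₁) + 1) / 2) = (s₂ (i - n₁) + 1) / 2 := by
        split_ifs with h'
        · obtain rfl : i = n₁ := by omega
          simp [b₁, a₂]
        · rfl
      rw [e1, if_neg (by omega), show i + 1 - n₁ = i - n₁ + 1 by omega]
      have hge : 0 ≤ s₂ (i - n₁) := a₂ ▸ ms₂ (Nat.zero_le _)
      refine (ContDiffOn.comp (f := fun t : ℝ => 2 * t + (-1)) (d₂ (i - n₁) (by omega))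
        (by fun_prop) ?_).congr fun t ht => concat_of_ge h (by linarith [ht.1])
      intro t ht
      exact ⟨by linarith [ht.1], by linarith [ht.2]⟩
  · rw [concat_of_le (by norm_num)]
    simpa using x₁
  · rw [concat_of_ge h (by norm_num)]
    norm_num [y₂]

end OGraph

namespace SepEdge

open OGraph

variable {V₁ E₁ V₂ E₂ : Type*} [Fintype E₁] [Fintype E₂]
  {G₁ : OGraph V₁ E₁} {G₂ : OGraph V₂ E₂} {v₁ : V₁} {v₂ : V₂}

variable (G₁ G₂ v₁ v₂) in
/-- The condition on a piecewise smooth path at the times which are not break points. -/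
def SmoothTime (γ : ℝ → ExtLength E₁ E₂) (t : ℝ) : Prop :=
  γ t ∈ reg G₁ G₂ v₁ v₂ ∧ ∀ e, (∀ᶠ u in 𝓝 t, γ u e = ⊤) ∨
    (γ t e ≠ ⊤ ∧ ContDiffAt ℝ ∞ (fun u => (γ u e).toReal) t)

variable (G₁ G₂ v₁ v₂) in
/-- The speed of a path with respect to the extended norm. -/
def mspeed (γ : ℝ → ExtLength E₁ E₂) (t : ℝ) : ℝ≥0∞ :=
  ENNReal.ofReal (extNorm G₁ G₂ v₁ v₂ (γ t, velocity γ t))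

lemma SmoothTime.comp_affine {γ : ℝ → ExtLength E₁ E₂} {c d t : ℝ}
    (h : SmoothTime G₁ G₂ v₁ v₂ γ (c * t + d)) :
    SmoothTime G₁ G₂ v₁ v₂ (fun t => γ (c * t + d)) t := by
  have hc : Continuous fun t : ℝ => c * t + d := by fun_prop
  refine ⟨h.1, fun e => (h.2 e).imp (fun h => ?_) fun h => ⟨h.1, ?_⟩⟩
  · exact (hc.tendsto t).eventually h
  · exact ContDiffAt.comp (f := fun t => c * t + d) (g := fun u => (γ u e).toReal) t h.2
      (by fun_prop)

lemma SmoothTime.congr {γ γ' : ℝ → ExtLength E₁ E₂} {t : ℝ} (h : SmoothTime G₁ G₂ v₁ v₂ γ' t)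
    (hγ : γ =ᶠ[𝓝 t] γ') : SmoothTime G₁ G₂ v₁ v₂ γ t := by
  refine ⟨hγ.eq_of_nhds ▸ h.1, fun e => (h.2 e).imp (fun h => ?_) fun h =>
    ⟨hγ.eq_of_nhds ▸ h.1, h.2.congr_of_eventuallyEq ?_⟩⟩
  · filter_upwards [hγ, h] with u h1 h2
    rw [h1, h2]
  · filter_upwards [hγ] with u h1
    rw [h1]

lemma velocity_affine (γ : ℝ → ExtLength E₁ E₂) (c d t : ℝ) :
    velocity (fun t => γ (c * t + d)) t = c • velocity γ (c * t + d) :=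
  funext fun e => deriv_comp_affine (fun u => (γ u e).toReal) c d t

lemma mspeed_congr {γ γ' : ℝ → ExtLength E₁ E₂} {t : ℝ} (h : γ =ᶠ[𝓝 t] γ') :
    mspeed G₁ G₂ v₁ v₂ γ t = mspeed G₁ G₂ v₁ v₂ γ' t := by
  have : velocity γ t = velocity γ' t := by
    funext e
    refine EventuallyEq.deriv_eq ?_
    filter_upwards [h] with u hu
    rw [hu]
  unfold mspeed
  rw [this, h.eq_of_nhds]

/-- In the coordinates `exp (-l)` the constantly infinite and the finite smooth lengths obey the
same formula, as the weight of the former is zero. -/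
lemma hasDerivAt_Yc {γ : ℝ → ExtLength E₁ E₂} {t : ℝ} (h : SmoothTime G₁ G₂ v₁ v₂ γ t) :
    HasDerivAt (fun u => Yc (γ u)) (fun e => -(Yc (γ t) e * velocity γ t e)) t := by
  refine hasDerivAt_pi.2 fun e => ?_
  rcases h.2 e with h | ⟨h1, h2⟩
  · have h3 : (fun u => Yc (γ u) e) =ᶠ[𝓝 t] fun _ => 0 := by
      filter_upwards [h] with u hu
      exact expNeg_eq_zero.2 hu
    have h4 : Yc (γ t) e = 0 := h3.eq_of_nhds
    rw [h4, zero_mul, neg_zero]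
    exact (hasDerivAt_const t (0 : ℝ)).congr_of_eventuallyEq h3
  · have h3 : HasDerivAt (fun u => (γ u e).toReal) (velocity γ t e) t :=
      (h2.differentiableAt (by simp)).hasDerivAt
    have h4 : HasDerivAt (fun u => Real.exp (-(γ u e).toReal))
        (Real.exp (-(γ t e).toReal) * -velocity γ t e) t := h3.neg.exp
    -- Since `toReal ⊤ = 0`, continuity of `toReal` at a positive value keeps the length finite
    -- nearby; the value zero is excluded by positivity of the lengths.
    have h5 : ∀ᶠ u in 𝓝 t, γ u e ≠ ⊤ := by
      have h6 : 0 < (γ t e).toReal ∨ (γ t e).toReal = 0 := by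
        rcases ENNReal.toReal_nonneg.eq_or_lt with h | h
        · exact .inr h.symm
        · exact .inl h
      rcases h6 with h6 | h6
      · filter_upwards [h3.continuousAt.eventually_const_lt h6] with u hu
        intro h'
        rw [h'] at hu
        simp at hu
      · exact absurd ((ENNReal.toReal_eq_zero_iff _).1 h6)
          (by simp [h1, (pos_of_mem_model h.1.1 e).ne'])
    have h6 : (fun u => Yc (γ u) e) =ᶠ[𝓝 t] fun u => Real.exp (-(γ u e).toReal) := by
      filter_upwards [h5] with u hu
      exact expNeg_of_ne_top hu
    refine (h4.congr_of_eventuallyEq h6).congr_deriv ?_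
    rw [show Yc (γ t) e = Real.exp (-(γ t e).toReal) from expNeg_of_ne_top h1]
    ring

/-- `F` vanishes on the whole model space, so its derivative along the path is zero. -/
lemma velocity_mem (h₁ : G₁.Good) (h₂ : G₂.Good) {γ : ℝ → ExtLength E₁ E₂} {t : ℝ}
    (h : SmoothTime G₁ G₂ v₁ v₂ γ t) (hm : ∀ᶠ u in 𝓝 t, γ u ∈ model G₁ G₂ v₁ v₂) :
    (γ t, velocity γ t) ∈ regTangent G₁ G₂ v₁ v₂ := by
  refine mem_regTangent.2 ⟨h.1, ?_⟩
  dsimp only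
  have h3 := (differentiableAt_detFun (H := join G₁ G₂ v₁ v₂) (Yc (γ t))).hasFDerivAt.comp_hasDerivAt
    t (hasDerivAt_Yc h)
  have h4 : ((join G₁ G₂ v₁ v₂).detFun ∘ fun u => Yc (γ u)) =ᶠ[𝓝 t] fun _ => 0 := by
    filter_upwards [hm] with u hu
    exact detFun_Yc_of_model h₁ h₂ hu
  have h5 := h3.unique ((hasDerivAt_const t (0 : ℝ)).congr_of_eventuallyEq h4)
  have h6 : (fun e => -(Yc (γ t) e * velocity γ t e)) = -fun e => Yc (γ t) e * velocity γ t e := rfl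
  rwa [h6, map_neg, neg_eq_zero] at h5

lemma mspeed_affine (h₁ : G₁.Good) (h₂ : G₂.Good) {γ : ℝ → ExtLength E₁ E₂} {c d t : ℝ}
    (h : SmoothTime G₁ G₂ v₁ v₂ γ (c * t + d))
    (hm : ∀ᶠ u in 𝓝 (c * t + d), γ u ∈ model G₁ G₂ v₁ v₂) :
    mspeed G₁ G₂ v₁ v₂ (fun t => γ (c * t + d)) t =
      ENNReal.ofReal |c| * mspeed G₁ G₂ v₁ v₂ γ (c * t + d) := by
  have h3 := velocity_mem h₁ h₂ h hm
  have hc : Continuous fun t : ℝ => c * t + d := by fun_prop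
  have h4 := velocity_mem h₁ h₂ h.comp_affine ((hc.tendsto t).eventually hm)
  unfold mspeed
  rw [extNorm_eq h₁ h₂ h3, extNorm_eq h₁ h₂ h4, velocity_affine, ← ENNReal.ofReal_mul (abs_nonneg c)]
  congr 1
  exact nrm_smul (γ (c * t + d), velocity γ (c * t + d)) c

lemma modelDist_comm_le (h₁ : G₁.Good) (h₂ : G₂.Good) (x y : ExtLength E₁ E₂) :
    modelDist G₁ G₂ v₁ v₂ y x ≤ modelDist G₁ G₂ v₁ v₂ x y := by
  refine le_iInf₂ fun γ h => ?_
  obtain ⟨⟨hc, hm, s, hs⟩, hx, hy⟩ := h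
  have hs' : ∀ t ∈ Set.Ioo (0 : ℝ) 1, t ∉ s → SmoothTime G₁ G₂ v₁ v₂ γ t := hs
  have hmaps : ∀ t ∈ Set.Icc (0 : ℝ) 1, -1 * t + 1 ∈ Set.Icc (0 : ℝ) 1 := fun t ht =>
    ⟨by linarith [ht.2], by linarith [ht.1]⟩
  have hmaps' : ∀ t ∈ Set.Ioo (0 : ℝ) 1, -1 * t + 1 ∈ Set.Ioo (0 : ℝ) 1 := fun t ht =>
    ⟨by linarith [ht.2], by linarith [ht.1]⟩
  have hnot : ∀ t, t ∉ s.image (fun t => -1 * t + 1) → -1 * t + 1 ∉ s := fun t ht h =>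
    ht (Finset.mem_image.2 ⟨_, h, by ring⟩)
  refine (iInf₂_le (fun t => γ (-1 * t + 1)) ⟨⟨hc.comp (by fun_prop) hmaps, fun t ht =>
    hm _ (hmaps t ht), s.image fun t => -1 * t + 1, fun t ht hts =>
      (hs' _ (hmaps' t ht) (hnot t hts)).comp_affine⟩, by simpa, by simpa⟩).trans ?_
  change ∫⁻ t in Set.Icc (0 : ℝ) 1, mspeed G₁ G₂ v₁ v₂ (fun t => γ (-1 * t + 1)) t ≤
    ∫⁻ t in Set.Icc (0 : ℝ) 1, mspeed G₁ G₂ v₁ v₂ γ t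
  rw [setLIntegral_congr_fun_ae (g := fun t => ENNReal.ofReal |-1| *
    mspeed G₁ G₂ v₁ v₂ γ (-1 * t + 1)) measurableSet_Icc, ← Set.uIcc_of_le (zero_le_one' ℝ),
    lintegral_uIcc_affine (by norm_num)]
  · norm_num [Set.uIcc_comm]
  · refine ae_mem_Icc (s.image fun t => -1 * t + 1).finite_toSet fun t ht hts => ?_
    refine mspeed_affine h₁ h₂ (hs' _ (hmaps' t ht) (hnot t hts)) ?_
    filter_upwards [Ioo_mem_nhds (hmaps' t ht).1 (hmaps' t ht).2] with u hu
    exact hm _ (Set.Ioo_subset_Icc_self hu)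

lemma modelDist_triangle (h₁ : G₁.Good) (h₂ : G₂.Good) (x y z : ExtLength E₁ E₂) :
    modelDist G₁ G₂ v₁ v₂ x z ≤ modelDist G₁ G₂ v₁ v₂ x y + modelDist G₁ G₂ v₁ v₂ y z := by
  unfold modelDist
  simp only [ENNReal.iInf_add, ENNReal.add_iInf]
  refine le_iInf₂ fun γ₂ h₂' => le_iInf₂ fun γ₁ h₁' => ?_
  obtain ⟨⟨c₁, u₁, s₁, d₁⟩, x₁, y₁⟩ := h₁'
  obtain ⟨⟨c₂, u₂, s₂, d₂⟩, x₂, y₂⟩ := h₂'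
  have d₁' : ∀ t ∈ Set.Ioo (0 : ℝ) 1, t ∉ s₁ → SmoothTime G₁ G₂ v₁ v₂ γ₁ t := d₁
  have d₂' : ∀ t ∈ Set.Ioo (0 : ℝ) 1, t ∉ s₂ → SmoothTime G₁ G₂ v₁ v₂ γ₂ t := d₂
  have h : γ₁ 1 = γ₂ 0 := y₁.trans x₂.symm
  have n₁ : ∀ t, t ∉ s₁.image (fun t => t / 2) → 2 * t + 0 ∉ s₁ := fun t ht h =>
    ht (Finset.mem_image.2 ⟨_, h, by ring⟩)
  have n₂ : ∀ t, t ∉ s₂.image (fun t => (t + 1) / 2) → 2 * t + (-1) ∉ s₂ := fun t ht h =>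
    ht (Finset.mem_image.2 ⟨_, h, by ring⟩)
  have m₁ : ∀ t ∈ Set.Ioo (0 : ℝ) (1 / 2), 2 * t + 0 ∈ Set.Ioo (0 : ℝ) 1 := fun t ht =>
    ⟨by linarith [ht.1], by linarith [ht.2]⟩
  have m₂ : ∀ t ∈ Set.Ioo (1 / 2 : ℝ) 1, 2 * t + (-1) ∈ Set.Ioo (0 : ℝ) 1 := fun t ht =>
    ⟨by linarith [ht.1], by linarith [ht.2]⟩
  have key : modelPathLength G₁ G₂ v₁ v₂ (concat γ₁ γ₂) =
      modelPathLength G₁ G₂ v₁ v₂ γ₁ + modelPathLength G₁ G₂ v₁ v₂ γ₂ := by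
    change ∫⁻ t in Set.Icc (0 : ℝ) 1, mspeed G₁ G₂ v₁ v₂ (concat γ₁ γ₂) t =
      (∫⁻ t in Set.Icc (0 : ℝ) 1, mspeed G₁ G₂ v₁ v₂ γ₁ t) +
        ∫⁻ t in Set.Icc (0 : ℝ) 1, mspeed G₁ G₂ v₁ v₂ γ₂ t
    refine lintegral_concat (ae_mem_Icc (s₁.image fun t => t / 2).finite_toSet fun t ht hts => ?_)
      (ae_mem_Icc (s₂.image fun t => (t + 1) / 2).finite_toSet fun t ht hts => ?_)
    · refine (mspeed_congr (concat_eventuallyEq_left ht.2)).trans (mspeed_affine h₁ h₂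
        (d₁' _ (m₁ t ht) (n₁ t hts)) ?_)
      filter_upwards [Ioo_mem_nhds (m₁ t ht).1 (m₁ t ht).2] with u hu
      exact u₁ _ (Set.Ioo_subset_Icc_self hu)
    · refine (mspeed_congr (concat_eventuallyEq_right ht.1)).trans (mspeed_affine h₁ h₂
        (d₂' _ (m₂ t ht) (n₂ t hts)) ?_)
      filter_upwards [Ioo_mem_nhds (m₂ t ht).1 (m₂ t ht).2] with u hu
      exact u₂ _ (Set.Ioo_subset_Icc_self hu)
  rw [← key]
  refine iInf₂_le _ ⟨⟨continuousOn_concat h c₁ c₂, forall_concat h u₁ u₂,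
    s₁.image (fun t => t / 2) ∪ s₂.image (fun t => (t + 1) / 2) ∪ {1 / 2}, ?_⟩, ?_, ?_⟩
  · intro t ht hts
    simp only [Finset.mem_union, Finset.mem_singleton, not_or] at hts
    obtain ⟨⟨t1, t2⟩, t3⟩ := hts
    rcases lt_or_gt_of_ne t3 with h' | h'
    · exact (d₁' _ (m₁ t ⟨ht.1, h'⟩) (n₁ t t1)).comp_affine.congr (concat_eventuallyEq_left h')
    · exact (d₂' _ (m₂ t ⟨h', ht.2⟩) (n₂ t t2)).comp_affine.congr (concat_eventuallyEq_right h')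
  · rw [concat_of_le (by norm_num)]
    simpa using x₁
  · rw [concat_of_ge h (by norm_num)]
    norm_num [y₂]

end SepEdge

end

noncomputable section

set_option linter.unusedSectionVars false

namespace OGraph

variable {V E : Type*} [Fintype E] {H : OGraph V E}

lemma entropyDist_comm_le (x y : E → ℝ) : H.entropyDist y x ≤ H.entropyDist x y := by
  refine le_iInf₂ fun γ h => ?_
  obtain ⟨⟨hc, hu, n, s, hs, s0, sn, hd⟩, hx, hy⟩ := h
  have hmaps : ∀ t ∈ Set.Icc (0 : ℝ) 1, -1 * t + 1 ∈ Set.Icc (0 : ℝ) 1 := fun t ht =>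
    ⟨by linarith [ht.2], by linarith [ht.1]⟩
  have hpath : H.IsUnitPath fun t => γ (-1 * t + 1) := by
    refine ⟨hc.comp (by fun_prop) hmaps, fun t ht => hu _ (hmaps t ht), n, fun i => 1 - s (n - i),
      fun i j hij => ?_, by simp [sn], by simp [s0], fun i hi => ?_⟩
    · have := hs (show n - j ≤ n - i by omega)
      dsimp only
      linarith
    · have h1 := hd (n - (i + 1)) (by omega)
      rw [show n - (i + 1) + 1 = n - i by omega] at h1
      refine ContDiffOn.comp (f := fun t : ℝ => -1 * t + 1) h1 (by fun_prop) fun t ht => ?_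
      exact ⟨by linarith [ht.2], by linarith [ht.1]⟩
  refine (iInf₂_le (fun t => γ (-1 * t + 1)) ⟨hpath, by simpa, by simpa⟩).trans ?_
  change ∫⁻ t in Set.Icc (0 : ℝ) 1, H.speed (fun t => γ (-1 * t + 1)) t ≤
    ∫⁻ t in Set.Icc (0 : ℝ) 1, H.speed γ t
  simp only [speed_affine]
  rw [← Set.uIcc_of_le (zero_le_one' ℝ), lintegral_uIcc_affine (by norm_num)]
  norm_num [Set.uIcc_comm]

lemma tendsto_clm_apply {ι F F' : Type*} [NormedAddCommGroup F] [NormedSpace ℝ F]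
    [NormedAddCommGroup F'] [NormedSpace ℝ F'] {L : Filter ι} {φ : ι → F →L[ℝ] F'} {x : ι → F}
    {φ₀ : F →L[ℝ] F'} {x₀ : F} (h : Tendsto φ L (𝓝 φ₀)) (hx : Tendsto x L (𝓝 x₀)) :
    Tendsto (fun i => φ i (x i)) L (𝓝 (φ₀ x₀)) :=
  ((isBoundedBilinearMap_apply (𝕜 := ℝ) (E := F) (F := F')).continuous.tendsto (φ₀, x₀)).comp
    (h.prodMk_nhds hx)

/-! ### The coordinates `z = exp (-l / 4)`, in which the norm is continuous up to `z = 0` -/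

section RootCoordinates

variable (H)

/-- The velocity of `η` along a path `4η • (-log z)` in the unit entropy space, if `z` has
velocity `d`. -/
def etaDeriv (η : ℝ) (z d : E → ℝ) : ℝ :=
  -4 * η ^ 2 * fderiv ℝ H.detFun (fun e => z e ^ (4 * η)) (fun e => z e ^ (4 * η - 1) * d e) /
    H.Kf fun e => z e ^ (4 * η)

/-- The velocity of the path `4η • (-log z)` in the unit entropy space, multiplied by
`z ^ (2η)`. -/
def rootVel (η : ℝ) (z d : E → ℝ) (e : E) : ℝ :=
  -4 * (H.etaDeriv η z d * (η⁻¹ * z e ^ η * (z e ^ η * Real.log (z e ^ η))) +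
    η * (z e ^ (2 * η - 1) * d e))

/-- The entropy norm of the velocity of the path `4η • (-log z)` in the unit entropy space.
This expression is continuous up to `z = 0`. -/
def rootNorm (η : ℝ) (z d : E → ℝ) : ℝ :=
  Real.sqrt (-((fderiv ℝ (fderiv ℝ H.detFun) (fun e => z e ^ (4 * η))
      (fun e => z e ^ (2 * η) * H.rootVel η z d e) (fun e => z e ^ (2 * η) * H.rootVel η z d e) +
    fderiv ℝ H.detFun (fun e => z e ^ (4 * η)) (fun e => H.rootVel η z d e ^ 2)) /
    H.Kf fun e => z e ^ (4 * η)))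

variable {H}

/-- With `y = z ^ (4 η)` the velocity `v` enters only through `z ^ (2 η) * v`, which consists of
multiples of `z ^ (2 η) * log z` and `z ^ (2 η - 1)`. These are continuous at `z = 0` as soon as `η
> 1 / 2`, and `η` is close to one near the points of interest. Square roots in place of fourth roots
would give the exponent `η - 1`, which may be negative. -/
lemma tendsto_rootNorm {ι : Type*} {L : Filter ι} {η : ι → ℝ} {z d : ι → E → ℝ} {z₀ d₀ : E → ℝ}
    {η₀ : ℝ} (hη₀ : 0 < η₀) (h0 : ∀ e, z₀ e ≠ 0 ∨ 1 / 2 < η₀) (hη : Tendsto η L (𝓝 η₀)) (hz : Tendsto z L (𝓝 z₀)) (hd : Tendsto d L (𝓝 d₀))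
    (hK : H.Kf (fun e => z₀ e ^ (4 * η₀)) ≠ 0) :
    Tendsto (fun i => H.rootNorm (η i) (z i) (d i)) L (𝓝 (H.rootNorm η₀ z₀ d₀)) := by
  have hze : ∀ e, Tendsto (fun i => z i e) L (𝓝 (z₀ e)) := fun e => (tendsto_pi_nhds.1 hz) e
  have hde : ∀ e, Tendsto (fun i => d i e) L (𝓝 (d₀ e)) := fun e => (tendsto_pi_nhds.1 hd) e
  have p1 : ∀ e, Tendsto (fun i => z i e ^ η i) L (𝓝 (z₀ e ^ η₀)) := fun e =>
    (hze e).rpow hη (.inr hη₀)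
  have p2 : ∀ e, Tendsto (fun i => z i e ^ (2 * η i)) L (𝓝 (z₀ e ^ (2 * η₀))) := fun e =>
    (hze e).rpow (hη.const_mul 2) ((h0 e).imp_right fun h => by linarith)
  have p3 : ∀ e, Tendsto (fun i => z i e ^ (2 * η i - 1)) L (𝓝 (z₀ e ^ (2 * η₀ - 1))) :=
    fun e => (hze e).rpow ((hη.const_mul 2).sub_const 1) ((h0 e).imp_right fun h => by linarith)
  have p4 : Tendsto (fun i => fun e => z i e ^ (4 * η i)) L (𝓝 fun e => z₀ e ^ (4 * η₀)) :=
    tendsto_pi_nhds.2 fun e => (hze e).rpow (hη.const_mul 4) ((h0 e).imp_right fun h => by linarith)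
  have p5 : Tendsto (fun i => fun e => z i e ^ (4 * η i - 1) * d i e) L
      (𝓝 fun e => z₀ e ^ (4 * η₀ - 1) * d₀ e) :=
    tendsto_pi_nhds.2 fun e =>
      ((hze e).rpow ((hη.const_mul 4).sub_const 1) ((h0 e).imp_right fun h => by linarith)).mul (hde e)
  have k1 := ((continuous_Kf (H := H)).tendsto _).comp p4
  have k2 : Tendsto (fun i => fderiv ℝ H.detFun (fun e => z i e ^ (4 * η i))) L
      (𝓝 (fderiv ℝ H.detFun fun e => z₀ e ^ (4 * η₀))) :=
    ((continuous_fderiv_detFun (H := H)).tendsto _).comp p4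
  have k3 : Tendsto (fun i => fderiv ℝ (fderiv ℝ H.detFun) (fun e => z i e ^ (4 * η i))) L
      (𝓝 (fderiv ℝ (fderiv ℝ H.detFun) fun e => z₀ e ^ (4 * η₀))) :=
    ((continuous_fderiv_fderiv_detFun (H := H)).tendsto _).comp p4
  have a1 : Tendsto (fun i => H.etaDeriv (η i) (z i) (d i)) L (𝓝 (H.etaDeriv η₀ z₀ d₀)) :=
    ((((hη.pow 2).const_mul (-4)).mul (tendsto_clm_apply k2 p5)).div k1 hK)
  have q1 : ∀ e, Tendsto (fun i => H.rootVel (η i) (z i) (d i) e) L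
      (𝓝 (H.rootVel η₀ z₀ d₀ e)) := fun e => by
    refine ((a1.mul (((hη.inv₀ hη₀.ne').mul (p1 e)).mul ?_)).add
      (hη.mul ((p3 e).mul (hde e)))).const_mul (-4)
    exact (Real.continuous_mul_log.tendsto _).comp (p1 e)
  have q2 : Tendsto (fun i => fun e => z i e ^ (2 * η i) * H.rootVel (η i) (z i) (d i) e) L
      (𝓝 fun e => z₀ e ^ (2 * η₀) * H.rootVel η₀ z₀ d₀ e) :=
    tendsto_pi_nhds.2 fun e => (p2 e).mul (q1 e)
  have q3 : Tendsto (fun i => fun e => H.rootVel (η i) (z i) (d i) e ^ 2) L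
      (𝓝 fun e => H.rootVel η₀ z₀ d₀ e ^ 2) := tendsto_pi_nhds.2 fun e => (q1 e).pow 2
  exact (((tendsto_clm_apply (tendsto_clm_apply k3 q2) q2).add (tendsto_clm_apply k2 q3)).div
    k1 hK).neg.sqrt

end RootCoordinates

/-! ### Normalised straight segments in the root coordinates -/

section RootPaths

open SepEdge

/-- The entropy of `-4 log z`. -/
def rootEnt (H : OGraph V E) (z : E → ℝ) : ℝ := H.entropy (negLog fun e => z e ^ 4)

/-- The point of unit entropy on the ray through `-log z`. -/
def rootPt (H : OGraph V E) (z : E → ℝ) : E → ℝ := unitPt H fun e => z e ^ 4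

lemma isOpen_cube : IsOpen (cube E) := by
  have : cube E = Set.univ.pi fun _ => Set.Ioo (0 : ℝ) 1 := by
    ext y
    simp [cube, Set.mem_pi]
  rw [this]
  exact isOpen_set_pi Set.finite_univ fun _ _ => isOpen_Ioo

lemma pow_mem_cube {z : E → ℝ} (hz : z ∈ cube E) : (fun e => z e ^ 4) ∈ cube E := fun e =>
  ⟨pow_pos (hz e).1 4, pow_lt_one₀ (hz e).1.le (hz e).2 (by norm_num)⟩

lemma rootPt_mem (hH : H.Good) {z : E → ℝ} (hz : z ∈ cube E) : rootPt H z ∈ H.unitSpace :=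
  unitPt_mem hH (pow_mem_cube hz)

lemma yexp_rootPt {z : E → ℝ} (hz : z ∈ cube E) :
    yexp (rootPt H z) = fun e => z e ^ (4 * rootEnt H z) := by
  rw [rootPt, yexp_unitPt (pow_mem_cube hz)]
  funext e
  rw [Real.rpow_mul (hz e).1.le]
  norm_num [rootEnt]

/-- The path is `η • (-4 log z)` with `η` the entropy of `-4 log z`. Its radial velocity `α` is
determined by tangency to `M¹`, which turns out to be `etaDeriv`; the norm is then a substitution in
`Good.entropyNorm_eq`. -/
lemma rootPt_arc (hH : H.Good) {a d : E → ℝ} {t : ℝ} (ht : a + t • d ∈ cube E) :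
    ContDiffAt ℝ ∞ (fun u : ℝ => rootPt H (a + u • d)) t ∧
      H.entropyNorm (rootPt H (a + t • d)) (deriv (fun u : ℝ => rootPt H (a + u • d)) t) =
        H.rootNorm (rootEnt H (a + t • d)) (a + t • d) d := by
  set z : ℝ → E → ℝ := fun u => a + u • d with hz
  set m : ℝ → E → ℝ := fun u => negLog fun e => z u e ^ 4 with hm
  have hzd : ∀ e, HasDerivAt (fun u => z u e) (d e) t := fun e => hasDerivAt_line a d t e
  have hzc : ∀ e, ContDiffAt ℝ ∞ (fun u => z u e) t := fun e => by
    simp only [hz, Pi.add_apply, Pi.smul_apply, smul_eq_mul]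
    fun_prop
  have hpos : ∀ e, 0 < z t e := fun e => (ht e).1
  have hne : ∀ e, z t e ^ 4 ≠ 0 := fun e => (pow_pos (hpos e) 4).ne'
  have hmc : ContDiffAt ℝ ∞ m t := contDiffAt_pi.2 fun e => (((hzc e).pow 4).log (hne e)).neg
  have hmd : HasDerivAt m (fun e => -(4 * d e / z t e)) t := by
    refine hasDerivAt_pi.2 fun e => ((((hzd e).pow 4).log (hne e)).neg).congr_deriv ?_
    have := (hpos e).ne'
    norm_num
    field_simp
  have hl : m t ∈ H.lengthSpace := negLog_mem (pow_mem_cube ht)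
  have hηc : ContDiffAt ℝ ∞ (fun u => H.entropy (m u)) t :=
    ContDiffAt.comp (g := H.entropy) t (hH.contDiffAt_entropy hl) hmc
  have hηd := (hηc.differentiableAt (by simp)).hasDerivAt
  set α := deriv (fun u => H.entropy (m u)) t with hα
  set η := rootEnt H (z t) with hη
  have hη0 : 0 < η := (hH.entropy_spec hl).1
  have hγ : (fun u => rootPt H (z u)) = fun u => H.entropy (m u) • m u := rfl
  have hγc : ContDiffAt ℝ ∞ (fun u => rootPt H (z u)) t := by
    rw [hγ]
    exact hηc.smul hmc
  have hγd : HasDerivAt (fun u => rootPt H (z u))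
      (η • (fun e => -(4 * d e / z t e)) + α • m t) t := by
    rw [hγ]
    exact hηd.smul hmd
  refine ⟨hγc, ?_⟩
  have hu : rootPt H (z t) ∈ H.unitSpace := rootPt_mem hH ht
  set w := η • (fun e => -(4 * d e / z t e)) + α • m t with hw
  have htan : fderiv ℝ H.entropy (rootPt H (z t)) w = 0 := by
    have h1 := (hH.differentiableAt_entropy hu.1).hasFDerivAt.comp_hasDerivAt t hγd
    have h2 : (H.entropy ∘ fun u => rootPt H (z u)) =ᶠ[𝓝 t] fun _ => 1 := by
      have h3 : ∀ᶠ u in 𝓝 t, z u ∈ cube E := by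
        have : Continuous z := by fun_prop
        exact this.continuousAt.eventually_mem (isOpen_cube.mem_nhds ht)
      filter_upwards [h3] with u hu
      exact (rootPt_mem hH hu).2
    exact h1.unique ((hasDerivAt_const t (1 : ℝ)).congr_of_eventuallyEq h2)
  have hy : yexp (rootPt H (z t)) = fun e => z t e ^ (4 * η) := yexp_rootPt ht
  have hK : H.Kf (fun e => z t e ^ (4 * η)) ≠ 0 := by
    rw [← hy]
    exact (hH.Kf_pos hu).ne'
  have hmt : ∀ e, m t e = -(4 * Real.log (z t e)) := fun e => by
    simp only [hm, negLog]
    rw [Real.log_pow]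
    norm_num
  have hwe : ∀ e, w e = -4 * (α * Real.log (z t e) + η * (d e / z t e)) := fun e => by
    simp only [hw, Pi.add_apply, Pi.smul_apply, smul_eq_mul]
    rw [hmt]
    ring
  have hae : α = H.etaDeriv η (z t) d := by
    have h1 := hH.fderiv_detFun_unit hu w
    rw [htan, zero_mul, hy] at h1
    have h2 : (fun e => z t e ^ (4 * η) * w e) =
        (-(α / η)) • (fun e => z t e ^ (4 * η) * Real.log (z t e ^ (4 * η))) +
          (-4 * η) • fun e => z t e ^ (4 * η - 1) * d e := by
      funext e
      simp only [Pi.add_apply, Pi.smul_apply, smul_eq_mul]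
      rw [hwe, Real.log_rpow (hpos e), Real.rpow_sub_one (hpos e).ne']
      have := (hpos e).ne'
      field_simp
      ring
    rw [h2, map_add, map_smul, map_smul, smul_eq_mul, smul_eq_mul] at h1
    change -(α / η) * H.Kf (fun e => z t e ^ (4 * η)) + _ = 0 at h1
    unfold etaDeriv
    rw [eq_div_iff hK]
    generalize H.Kf (fun e => z t e ^ (4 * η)) = K at *
    generalize fderiv ℝ H.detFun (fun e => z t e ^ (4 * η))
      (fun e => z t e ^ (4 * η - 1) * d e) = D at *
    field_simp at h1
    linarith
  have hroot : ∀ e, H.rootVel η (z t) d e = z t e ^ (2 * η) * w e := fun e => by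
    unfold rootVel
    rw [← hae, hwe, Real.log_rpow (hpos e), Real.rpow_sub_one (hpos e).ne',
      show (2 : ℝ) * η = η + η by ring, Real.rpow_add (hpos e)]
    have := (hpos e).ne'
    field_simp
  have hsq : ∀ e, z t e ^ (4 * η) = z t e ^ (2 * η) * z t e ^ (2 * η) := fun e => by
    rw [← Real.rpow_add (hpos e)]
    congr 1
    ring
  have e1 : (fun e => z t e ^ (4 * η) * w e) =
      fun e => z t e ^ (2 * η) * H.rootVel η (z t) d e := by
    funext e
    rw [hroot, hsq]
    ring
  have e2 : (fun e => z t e ^ (4 * η) * w e ^ 2) = fun e => H.rootVel η (z t) d e ^ 2 := by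
    funext e
    rw [hroot, hsq]
    ring
  rw [hγd.deriv, hH.entropyNorm_eq hu htan, hy]
  unfold Nf rootNorm
  beta_reduce
  rw [e1, e2]

/-- This is the source of all motions at no cost: both terms of `Nf` vanish on velocities supported
on edges on which `F` does not depend. -/
lemma fderiv_eq_zero_of_const {y : E → ℝ} {T : Set E}
    (hf : ∀ w : E → ℝ, (∀ e ∉ T, w e = 0) → H.detFun (y + w) = 0) {w : E → ℝ}
    (hw : ∀ e ∉ T, w e = 0) :
    fderiv ℝ H.detFun y w = 0 ∧ fderiv ℝ (fderiv ℝ H.detFun) y w w = 0 := by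
  have h1 : ∀ v : E → ℝ, (∀ e ∉ T, v e = 0) → fderiv ℝ H.detFun (y + v) w = 0 := by
    intro v hv
    have h2 := hasDerivAt_detFun_add_smul (H := H) (y + v) w
    have h3 : (fun t : ℝ => H.detFun (y + v + t • w)) = fun _ => 0 := by
      funext t
      rw [add_assoc]
      exact hf _ fun e he => by simp [hv e he, hw e he]
    rw [h3] at h2
    exact h2.unique (hasDerivAt_const _ _)
  refine ⟨by have := h1 0 (by simp); rwa [add_zero] at this, ?_⟩
  let g : ℝ → E → ℝ := fun t => y + t • w
  have hg0 : g 0 = y := by simp [g]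
  have h3 : HasDerivAt g w 0 :=
    (by simpa using (hasDerivAt_id (0 : ℝ)).smul_const w :
      HasDerivAt (fun t : ℝ => t • w) w 0).const_add y
  have h4 := (differentiableAt_fderiv_detFun (H := H) (g 0)).hasFDerivAt.comp_hasDerivAt
    (0 : ℝ) h3
  have h5 := h4.clm_apply (hasDerivAt_const (0 : ℝ) w)
  have h6 : (fun t : ℝ => (fderiv ℝ H.detFun ∘ g) t w) = fun _ => 0 :=
    funext fun t => h1 (t • w) fun e he => by simp [hw e he]
  rw [h6, hg0] at h5
  have h7 := h5.unique (hasDerivAt_const _ _)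
  rwa [map_zero, add_zero] at h7

/-- The norm vanishes if the determinant is constant in the directions of a set of edges which
supports the velocity. -/
lemma rootNorm_eq_zero {z d : E → ℝ} {T : Set E} (hd : ∀ e ∉ T, d e = 0)
    (hf : ∀ w : E → ℝ, (∀ e ∉ T, w e = 0) →
      H.detFun ((fun e => z e ^ (4 * (1 : ℝ))) + w) = 0) :
    H.rootNorm 1 z d = 0 := by
  have h0 := fun w hw => (fderiv_eq_zero_of_const hf (w := w) hw).1
  have h3 : H.etaDeriv 1 z d = 0 := by
    unfold etaDeriv
    rw [h0 _ fun e he => by simp [hd e he]]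
    simp
  have h4 : ∀ e ∉ T, H.rootVel 1 z d e = 0 := fun e he => by
    unfold rootVel
    rw [h3, hd e he]
    ring
  unfold rootNorm
  rw [(fderiv_eq_zero_of_const hf fun e he => by rw [h4 e he, mul_zero]).2,
    h0 _ fun e he => by rw [h4 e he]; ring]
  simp

lemma add_smul_mem_cube {a b : E → ℝ} (ha : a ∈ cube E) (hb : b ∈ cube E) {t : ℝ}
    (ht : t ∈ Set.Icc (0 : ℝ) 1) : a + t • (b - a) ∈ cube E := by
  intro e
  have h1 := ha e
  have h2 := hb e
  have e1 : (a + t • (b - a)) e = (1 - t) * a e + t * b e := by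
    simp only [Pi.add_apply, Pi.smul_apply, Pi.sub_apply, smul_eq_mul]
    ring
  rw [e1]
  rcases ht.1.eq_or_lt with rfl | h0
  · simpa using h1
  · constructor
    · have := mul_nonneg (sub_nonneg.2 ht.2) h1.1.le
      have := mul_pos h0 h2.1
      linarith
    · have := mul_le_mul_of_nonneg_left h1.2.le (sub_nonneg.2 ht.2)
      have := mul_lt_mul_of_pos_left h2.2 h0
      linarith

lemma rpow_four_one (z : E → ℝ) : (fun e => z e ^ (4 * (1 : ℝ))) = fun e => z e ^ 4 := by
  funext e
  norm_num

lemma tendsto_rootEnt {ι : Type*} {L : Filter ι} {z : ι → E → ℝ} {z₀ : E → ℝ}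
    (h : EntropyTendsto H fun e => z₀ e ^ 4) (hz : Tendsto z L (𝓝 z₀))
    (hc : ∀ᶠ i in L, z i ∈ cube E) : Tendsto (fun i => rootEnt H (z i)) L (𝓝 1) := by
  refine Tendsto.comp (f := fun i => fun e => z i e ^ 4) h (tendsto_nhdsWithin_iff.2 ⟨?_, ?_⟩)
  · exact tendsto_pi_nhds.2 fun e => ((tendsto_pi_nhds.1 hz) e).pow 4
  · filter_upwards [hc] with i hi
    exact pow_mem_cube hi

lemma entropyDist_rootPt_le (hH : H.Good) {a b : E → ℝ} (ha : a ∈ cube E) (hb : b ∈ cube E) {ε : ℝ}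
    (h : ∀ t ∈ Set.Icc (0 : ℝ) 1,
      H.rootNorm (rootEnt H (a + t • (b - a))) (a + t • (b - a)) (b - a) ≤ ε) :
    H.entropyDist (rootPt H a) (rootPt H b) ≤ ENNReal.ofReal ε := by
  have h1 := entropyDist_le_arc (H := H) (γ := fun u : ℝ => rootPt H (a + u • (b - a)))
    (p := 0) (q := 1) ?_ ?_
  · simp only [zero_smul, add_zero, one_smul, add_sub_cancel] at h1
    refine h1.trans ?_
    rw [Set.uIcc_of_le (zero_le_one' ℝ)]
    calc _ ≤ ∫⁻ t in Set.Icc (0 : ℝ) 1, ENNReal.ofReal ε := by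
          refine setLIntegral_mono' measurableSet_Icc fun t ht => ENNReal.ofReal_le_ofReal ?_
          exact (rootPt_arc hH (add_smul_mem_cube ha hb ht)).2.trans_le (h t ht)
      _ = ENNReal.ofReal ε := by simp
  · intro t ht
    rw [Set.uIcc_of_le (zero_le_one' ℝ)] at ht
    exact (rootPt_arc hH (add_smul_mem_cube ha hb ht)).1
  · intro t ht
    rw [Set.uIcc_of_le (zero_le_one' ℝ)] at ht
    exact rootPt_mem hH (add_smul_mem_cube ha hb ht)

/-- If the limiting norm vanishes along the segment from `a` to `b`, then segments with nearby end
points in the cube are uniformly slow: the norm is jointly continuous and the time interval is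
compact. -/
theorem eventually_entropyDist_rootPt_le (hH : H.Good) {a b : E → ℝ}
    (h : ∀ t ∈ Set.Icc (0 : ℝ) 1, EntropyTendsto H (fun e => (a + t • (b - a)) e ^ 4) ∧
      H.Kf (fun e => (a + t • (b - a)) e ^ 4) ≠ 0 ∧ H.rootNorm 1 (a + t • (b - a)) (b - a) = 0)
    {ε : ℝ} (hε : 0 < ε) :
    ∀ᶠ w in 𝓝[cube E] a ×ˢ 𝓝[cube E] b,
      H.entropyDist (rootPt H w.1) (rootPt H w.2) ≤ ENNReal.ofReal ε := by
  let z : ((E → ℝ) × (E → ℝ)) × ℝ → E → ℝ := fun w => w.1.1 + w.2 • (w.1.2 - w.1.1)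
  have hz : Continuous z := by fun_prop
  have key : ∀ᶠ w in 𝓝 (a, b), ∀ t ∈ Set.Icc (0 : ℝ) 1, (w.1 ∈ cube E ∧ w.2 ∈ cube E ∧
      t ∈ Set.Icc (0 : ℝ) 1) → H.rootNorm (rootEnt H (z (w, t))) (z (w, t)) (w.2 - w.1) ≤ ε := by
    refine isCompact_Icc.eventually_forall_of_forall_eventually fun t ht => ?_
    obtain ⟨h1, h2, h3⟩ := h t ht
    have key2 : ∀ᶠ w in 𝓝 ((a, b), t) ⊓ 𝓟 {w | w.1.1 ∈ cube E ∧ w.1.2 ∈ cube E ∧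
        w.2 ∈ Set.Icc (0 : ℝ) 1},
        H.rootNorm (rootEnt H (z w)) (z w) (w.1.2 - w.1.1) ≤ ε := by
      have t1 : Tendsto z (𝓝 ((a, b), t) ⊓ 𝓟 {w | w.1.1 ∈ cube E ∧ w.1.2 ∈ cube E ∧
        w.2 ∈ Set.Icc (0 : ℝ) 1}) (𝓝 (a + t • (b - a))) :=
        (hz.tendsto _).mono_left inf_le_left
      have t2 : ∀ᶠ w in 𝓝 ((a, b), t) ⊓ 𝓟 {w | w.1.1 ∈ cube E ∧ w.1.2 ∈ cube E ∧
        w.2 ∈ Set.Icc (0 : ℝ) 1}, z w ∈ cube E := by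
        refine eventually_inf_principal.2 (Eventually.of_forall fun w hw => ?_)
        exact add_smul_mem_cube hw.1 hw.2.1 hw.2.2
      have t3 : Tendsto (fun w : ((E → ℝ) × (E → ℝ)) × ℝ => w.1.2 - w.1.1)
          (𝓝 ((a, b), t) ⊓ 𝓟 {w | w.1.1 ∈ cube E ∧ w.1.2 ∈ cube E ∧
          w.2 ∈ Set.Icc (0 : ℝ) 1}) (𝓝 (b - a)) := by
        have : Continuous fun w : ((E → ℝ) × (E → ℝ)) × ℝ => w.1.2 - w.1.1 := by fun_prop
        exact (this.tendsto _).mono_left inf_le_left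
      have t4 := tendsto_rootNorm (H := H) one_pos (fun _ => .inr (by norm_num)) (tendsto_rootEnt h1 t1 t2) t1 t3
        (by rw [rpow_four_one]; exact h2)
      rw [h3] at t4
      filter_upwards [t4.eventually_lt_const hε] with w hw
      exact hw.le
    have key3 := eventually_inf_principal.1 key2
    exact key3
  rw [← nhdsWithin_prod_eq]
  filter_upwards [nhdsWithin_le_nhds key, self_mem_nhdsWithin] with w hw hc
  exact entropyDist_rootPt_le hH hc.1 hc.2 fun t ht => hw t ht ⟨hc.1, hc.2, ht⟩

end RootPaths

end OGraph

end

noncomputable section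

set_option linter.unusedSectionVars false

/-! ### Asymptotic distances between points of the model space -/

namespace SepEdge

open OGraph

variable {V₁ E₁ V₂ E₂ : Type*} [Fintype E₁] [Fintype E₂]
  {G₁ : OGraph V₁ E₁} {G₂ : OGraph V₂ E₂} {v₁ : V₁} {v₂ : V₂}

/-- The fourth root of `exp (-l)`. -/
def Zc (p : ExtLength E₁ E₂) : Edge E₁ E₂ → ℝ := fun e => Real.sqrt (Real.sqrt (Yc p e))

lemma Zc_pow (p : ExtLength E₁ E₂) (e : Edge E₁ E₂) : Zc p e ^ 4 = Yc p e := by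
  unfold Zc
  rw [show 4 = 2 * 2 by norm_num, pow_mul, Real.sq_sqrt (Real.sqrt_nonneg _),
    Real.sq_sqrt (Yc_nonneg p e)]

lemma Zc_pow' (p : ExtLength E₁ E₂) : (fun e => Zc p e ^ 4) = Yc p := funext (Zc_pow p)

lemma continuous_Zc : Continuous (Zc : ExtLength E₁ E₂ → Edge E₁ E₂ → ℝ) :=
  continuous_pi fun e => ((continuous_apply e).comp continuous_Yc).sqrt.sqrt

lemma Zc_incl_mem {x : Edge E₁ E₂ → ℝ} (hx : ∀ e, 0 < x e) : Zc (incl x) ∈ cube (Edge E₁ E₂) := by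
  intro e
  unfold Zc
  rw [Yc_incl fun e => (hx e).le]
  refine ⟨Real.sqrt_pos.2 (Real.sqrt_pos.2 (yexp_pos x e)), ?_⟩
  rw [Real.sqrt_lt' one_pos, one_pow, Real.sqrt_lt' one_pos, one_pow]
  exact Real.exp_lt_one_iff.2 (neg_lt_zero.2 (hx e))

lemma rootPt_Zc {x : Edge E₁ E₂ → ℝ} (hx : x ∈ (join G₁ G₂ v₁ v₂).unitSpace) :
    rootPt (join G₁ G₂ v₁ v₂) (Zc (incl x)) = x := by
  unfold rootPt
  rw [Zc_pow', Yc_incl fun e => (hx.1 e).le, unitPt_yexp hx]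

variable (G₁ G₂ v₁ v₂) in
/-- The trace on the unit entropy space of the neighbourhoods of a point of the model space. -/
def nearby (p : ExtLength E₁ E₂) : Filter (Edge E₁ E₂ → ℝ) :=
  comap incl (𝓝 p) ⊓ 𝓟 (join G₁ G₂ v₁ v₂).unitSpace

lemma tendsto_incl_nearby (p : ExtLength E₁ E₂) : Tendsto incl (nearby G₁ G₂ v₁ v₂ p) (𝓝 p) :=
  tendsto_comap.mono_left inf_le_left

lemma eventually_nearby_mem (p : ExtLength E₁ E₂) :
    ∀ᶠ x in nearby G₁ G₂ v₁ v₂ p, x ∈ (join G₁ G₂ v₁ v₂).unitSpace :=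
  mem_inf_of_right (mem_principal_self _)

lemma tendsto_nearby_iff {ι : Type*} {L : Filter ι} {f : ι → Edge E₁ E₂ → ℝ}
    {p : ExtLength E₁ E₂} : Tendsto f L (nearby G₁ G₂ v₁ v₂ p) ↔
      Tendsto (fun i => incl (f i)) L (𝓝 p) ∧ ∀ᶠ i in L, f i ∈ (join G₁ G₂ v₁ v₂).unitSpace := by
  rw [nearby, tendsto_inf, tendsto_comap_iff, tendsto_principal]
  rfl

lemma nearby_neBot (h₁ : G₁.Good) (h₂ : G₂.Good) {p : ExtLength E₁ E₂}
    (hp : p ∈ model G₁ G₂ v₁ v₂) : (nearby G₁ G₂ v₁ v₂ p).NeBot := by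
  have := cube_neBot hp
  refine Tendsto.neBot (tendsto_nearby_iff.2 ⟨tendsto_incl_unitPt h₁ h₂ hp, ?_⟩)
  filter_upwards [self_mem_nhdsWithin] with y hy
  exact unitPt_mem (good_join h₁ h₂) hy

lemma pure_le_nearby {x : Edge E₁ E₂ → ℝ} (hx : x ∈ (join G₁ G₂ v₁ v₂).unitSpace) :
    pure x ≤ nearby G₁ G₂ v₁ v₂ (incl x) := by
  refine le_inf ?_ (by simpa using hx)
  rw [← map_le_iff_le_comap, map_pure]
  exact pure_le_nhds _

lemma tendsto_Zc_nearby (p : ExtLength E₁ E₂) :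
    Tendsto (fun x => Zc (incl x)) (nearby G₁ G₂ v₁ v₂ p) (𝓝[cube _] (Zc p)) := by
  refine tendsto_nhdsWithin_iff.2 ⟨(continuous_Zc.tendsto p).comp (tendsto_incl_nearby p), ?_⟩
  filter_upwards [eventually_nearby_mem p] with x hx
  exact Zc_incl_mem hx.1

variable (G₁ G₂ v₁ v₂) in
/-- The asymptotic entropy distance of points of the unit entropy space which are close to `p` and
`q` is at most `r`. -/
def Near (p q : ExtLength E₁ E₂) (r : ℝ≥0∞) : Prop :=
  ∀ ε : ℝ, 0 < ε → ∀ᶠ w in nearby G₁ G₂ v₁ v₂ p ×ˢ nearby G₁ G₂ v₁ v₂ q,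
    (join G₁ G₂ v₁ v₂).entropyDist w.1 w.2 ≤ r + ENNReal.ofReal ε

lemma Near.symm {p q : ExtLength E₁ E₂} {r : ℝ≥0∞} (h : Near G₁ G₂ v₁ v₂ p q r) :
    Near G₁ G₂ v₁ v₂ q p r := by
  intro ε hε
  have := h ε hε
  rw [prod_comm] at this
  filter_upwards [eventually_map.1 this] with w hw
  exact (entropyDist_comm_le _ _).trans hw

lemma Near.mono {p q : ExtLength E₁ E₂} {r r' : ℝ≥0∞} (h : Near G₁ G₂ v₁ v₂ p q r) (hr : r ≤ r') :
    Near G₁ G₂ v₁ v₂ p q r' := fun ε hε => (h ε hε).mono fun _ hw => hw.trans (by gcongr)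

/-- One intermediate point of `M¹(G)` close to `q` serves both estimates; it exists because points
of the model space are limits of points of `M¹(G)`. -/
lemma Near.trans (h₁ : G₁.Good) (h₂ : G₂.Good) {p q m : ExtLength E₁ E₂} {r r' : ℝ≥0∞}
    (hq : q ∈ model G₁ G₂ v₁ v₂)
    (h : Near G₁ G₂ v₁ v₂ p q r) (h' : Near G₁ G₂ v₁ v₂ q m r') :
    Near G₁ G₂ v₁ v₂ p m (r + r') := by
  intro ε hε
  have := nearby_neBot h₁ h₂ hq
  obtain ⟨A, hA, B, hB, h3⟩ := mem_prod_iff.1 (h (ε / 2) (half_pos hε))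
  obtain ⟨C, hC, D, hD, h4⟩ := mem_prod_iff.1 (h' (ε / 2) (half_pos hε))
  obtain ⟨u, hu⟩ := nonempty_of_mem (inter_mem hB hC)
  filter_upwards [prod_mem_prod hA hD] with w hw
  have h5 := h3 (Set.mk_mem_prod hw.1 hu.1)
  have h6 := h4 (Set.mk_mem_prod hu.2 hw.2)
  refine (entropyDist_triangle _ u _).trans ((add_le_add h5 h6).trans_eq ?_)
  rw [add_add_add_comm, ← ENNReal.ofReal_add (half_pos hε).le (half_pos hε).le, add_halves]

lemma Near.entropyDist_le {x y : Edge E₁ E₂ → ℝ} (hx : x ∈ (join G₁ G₂ v₁ v₂).unitSpace)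
    (hy : y ∈ (join G₁ G₂ v₁ v₂).unitSpace) {r : ℝ≥0∞}
    (h : Near G₁ G₂ v₁ v₂ (incl x) (incl y) r) :
    (join G₁ G₂ v₁ v₂).entropyDist x y ≤ r := by
  refine ENNReal.le_of_forall_pos_le_add fun ε hε _ => ?_
  have h3 := h ε hε
  have h4 := h3.filter_mono (prod_mono (pure_le_nearby hx) (pure_le_nearby hy))
  rw [prod_pure_pure, eventually_pure] at h4
  simpa using h4

/-! ### Sending free edges to infinity -/

section Kill

open Classical in
/-- The edges of a set get infinite length. -/
def kill (T : Set (Edge E₁ E₂)) (p : ExtLength E₁ E₂) : ExtLength E₁ E₂ :=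
  fun e => if e ∈ T then ⊤ else p e

open Classical in
/-- The coordinates of the edges of a set are multiplied by a scalar. -/
def scaleOn (T : Set (Edge E₁ E₂)) (c : ℝ) (y : Edge E₁ E₂ → ℝ) : Edge E₁ E₂ → ℝ :=
  fun e => if e ∈ T then c * y e else y e

lemma Zc_segment (T : Set (Edge E₁ E₂)) (p : ExtLength E₁ E₂) (t : ℝ) :
    Zc p + t • (Zc (kill T p) - Zc p) = scaleOn T (1 - t) (Zc p) := by
  funext e
  simp only [Pi.add_apply, Pi.smul_apply, Pi.sub_apply, smul_eq_mul, scaleOn, kill, Zc, Yc]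
  split_ifs with h
  · rw [expNeg_top]
    simp
    ring
  · ring

lemma scaleOn_pow (T : Set (Edge E₁ E₂)) (c : ℝ) (p : ExtLength E₁ E₂) :
    (fun e => scaleOn T c (Zc p) e ^ 4) = scaleOn T (c ^ 4) (Yc p) := by
  funext e
  unfold scaleOn
  split_ifs
  · rw [mul_pow, Zc_pow]
  · rw [Zc_pow]

/-- The segment from `Zc p` to `Zc (kill T p)` moves only the edges in `T`, and `F` does not depend
on them; hence the norm vanishes on it and `eventually_entropyDist_rootPt_le` applies. -/
theorem near_kill (h₁ : G₁.Good) (h₂ : G₂.Good) (T : Set (Edge E₁ E₂)) (p : ExtLength E₁ E₂)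
    (h : ∀ c ∈ Set.Icc (0 : ℝ) 1,
      EntropyTendsto (join G₁ G₂ v₁ v₂) (scaleOn T c (Yc p)) ∧
        (join G₁ G₂ v₁ v₂).Kf (scaleOn T c (Yc p)) ≠ 0)
    (hf : ∀ y, (∀ e ∉ T, y e = Yc p e) → (join G₁ G₂ v₁ v₂).detFun y = 0) :
    Near G₁ G₂ v₁ v₂ p (kill T p) 0 := by
  intro ε hε
  have hJ := good_join (v₁ := v₁) (v₂ := v₂) h₁ h₂
  have key := eventually_entropyDist_rootPt_le hJ (a := Zc p) (b := Zc (kill T p)) ?_ hε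
  · have h3 := ((tendsto_Zc_nearby (G₁ := G₁) (G₂ := G₂) (v₁ := v₁) (v₂ := v₂) p).prodMap
      (tendsto_Zc_nearby (G₁ := G₁) (G₂ := G₂) (v₁ := v₁) (v₂ := v₂) (kill T p))).eventually key
    have h4 := prod_mem_prod (eventually_nearby_mem (G₁ := G₁) (G₂ := G₂) (v₁ := v₁) (v₂ := v₂) p)
      (eventually_nearby_mem (G₁ := G₁) (G₂ := G₂) (v₁ := v₁) (v₂ := v₂) (kill T p))
    filter_upwards [h3, h4] with w hw hw'
    rw [zero_add]
    have hw1 : w.1 ∈ (join G₁ G₂ v₁ v₂).unitSpace := hw'.1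
    have hw2 : w.2 ∈ (join G₁ G₂ v₁ v₂).unitSpace := hw'.2
    simpa only [Prod.map_fst, Prod.map_snd, rootPt_Zc hw1, rootPt_Zc hw2] using hw
  · intro t ht
    -- At time `t` the root coordinates of `T` are scaled by `1 - t`, hence the weights by the
    -- fourth power.
    have hc : (1 - t) ^ 4 ∈ Set.Icc (0 : ℝ) 1 :=
      ⟨pow_nonneg (sub_nonneg.2 ht.2) 4, pow_le_one₀ (sub_nonneg.2 ht.2) (by linarith [ht.1])⟩
    rw [Zc_segment, scaleOn_pow]
    refine ⟨(h _ hc).1, (h _ hc).2, rootNorm_eq_zero (T := T) (fun e he => ?_) fun w hw => ?_⟩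
    · simp only [Pi.sub_apply, Zc, Yc, kill, if_neg he, sub_self]
    · rw [rpow_four_one, scaleOn_pow]
      refine hf _ fun e he => ?_
      rw [Pi.add_apply, hw e he, add_zero, scaleOn, if_neg he]

lemma kill_empty (p : ExtLength E₁ E₂) : kill ∅ p = p := funext fun _ => if_neg id

lemma scaleOn_empty (c : ℝ) (y : Edge E₁ E₂ → ℝ) : scaleOn ∅ c y = y := funext fun _ => if_neg id

/-- The case `T = ∅`. It is not vacuous: it says that points of `M¹(G)` which converge to `p` in
extended lengths become close in the entropy distance. -/
lemma near_self (h₁ : G₁.Good) (h₂ : G₂.Good) {p : ExtLength E₁ E₂}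
    (hp : p ∈ reg G₁ G₂ v₁ v₂) : Near G₁ G₂ v₁ v₂ p p 0 := by
  have h3 := near_kill (v₁ := v₁) (v₂ := v₂) h₁ h₂ ∅ p ?_ ?_
  · rwa [kill_empty] at h3
  · intro c _
    rw [scaleOn_empty]
    exact ⟨entropyTendsto_of_model h₁ h₂ hp.1, (Kf_pos_of_reg h₁ h₂ hp).ne'⟩
  · intro y hy
    rw [show y = Yc p from funext fun e => hy e (Set.notMem_empty e)]
    exact detFun_Yc_of_model h₁ h₂ hp.1

lemma addedY_of_left (h₁ : G₁.Good) {y : Edge E₁ E₂ → ℝ} {l : E₁ → ℝ}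
    (hl : l ∈ G₁.unitSpace) (hy : res₁ y = yexp l) (h0 : ∀ e, 0 ≤ y e) (hlt : ∀ e, y e < 1)
    (hS : ¬ SubInv (G₂.T (res₂ y))) (hz : y none = 0 ∨ res₂ y = 0) :
    AddedY G₁ G₂ y ∧ RegSide G₁ G₂ y := by
  refine ⟨⟨h0, hlt, fun s hs => ?_, fun s hs h => hS ?_, by tauto, .inl ⟨l, hl, hy⟩⟩,
    .inl ⟨⟨l, hl, hy⟩, hS, hz⟩⟩
  · rw [hy]
    exact not_subInv_rpow h₁ hl.1 hl.2.le hs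
  · refine h.mono (T_mono fun e => ?_)
    exact (Real.rpow_le_rpow_of_exponent_ge' (h0 _) (hlt _).le zero_le_one hs.le).trans_eq
      (Real.rpow_one _)

lemma addedY_of_right (h₂ : G₂.Good) {y : Edge E₁ E₂ → ℝ} {l : E₂ → ℝ}
    (hl : l ∈ G₂.unitSpace) (hy : res₂ y = yexp l) (h0 : ∀ e, 0 ≤ y e) (hlt : ∀ e, y e < 1)
    (hS : ¬ SubInv (G₁.T (res₁ y))) (hz : y none = 0 ∨ res₁ y = 0) :
    AddedY G₁ G₂ y ∧ RegSide G₁ G₂ y := by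
  refine ⟨⟨h0, hlt, fun s hs h => hS ?_, fun s hs => ?_, by tauto, .inr ⟨l, hl, hy⟩⟩,
    .inr ⟨⟨l, hl, hy⟩, hS, hz⟩⟩
  · refine h.mono (T_mono fun e => ?_)
    exact (Real.rpow_le_rpow_of_exponent_ge' (h0 _) (hlt _).le zero_le_one hs.le).trans_eq
      (Real.rpow_one _)
  · rw [hy]
    exact not_subInv_rpow h₂ hl.1 hl.2.le hs

end Kill

end SepEdge

end

noncomputable section

set_option linter.unusedSectionVars false

namespace SepEdge

open OGraph

variable {V₁ E₁ V₂ E₂ : Type*} [Fintype E₁] [Fintype E₂]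
  {G₁ : OGraph V₁ E₁} {G₂ : OGraph V₂ E₂} {v₁ : V₁} {v₂ : V₂}

/-! ### Paths of unit entropy as paths in the model space -/

section FinitePaths

lemma smoothTime_incl (h₁ : G₁.Good) (h₂ : G₂.Good) {γ : ℝ → ExtLength E₁ E₂}
    {β : ℝ → Edge E₁ E₂ → ℝ} {t : ℝ} (h : γ =ᶠ[𝓝 t] fun u => incl (β u))
    (hβ : ContDiffAt ℝ ∞ β t) (hu : ∀ᶠ u in 𝓝 t, β u ∈ (join G₁ G₂ v₁ v₂).unitSpace) :
    SmoothTime G₁ G₂ v₁ v₂ γ t ∧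
      mspeed G₁ G₂ v₁ v₂ γ t = (join G₁ G₂ v₁ v₂).speed β t := by
  have hJ := good_join (v₁ := v₁) (v₂ := v₂) h₁ h₂
  have hut := hu.self_of_nhds
  have hre : ∀ e, (fun u => (incl (β u) e).toReal) =ᶠ[𝓝 t] fun u => β u e := fun e => by
    filter_upwards [hu] with u hu
    exact ENNReal.toReal_ofReal (hu.1 e).le
  have hs : SmoothTime G₁ G₂ v₁ v₂ (fun u => incl (β u)) t := by
    refine ⟨incl_mem_reg h₁ h₂ hut, fun e => .inr ⟨ENNReal.ofReal_ne_top, ?_⟩⟩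
    exact (contDiffAt_pi.1 hβ e).congr_of_eventuallyEq (hre e)
  have hv : velocity (fun u => incl (β u)) t = deriv β t := by
    funext e
    unfold velocity
    rw [(hre e).deriv_eq]
    exact (hasDerivAt_pi.1 (hβ.differentiableAt (by simp)).hasDerivAt e).deriv
  refine ⟨hs.congr h, ?_⟩
  rw [mspeed_congr h]
  have hm : ∀ᶠ u in 𝓝 t, incl (β u) ∈ model G₁ G₂ v₁ v₂ := by
    filter_upwards [hu] with u hu
    exact .inl ⟨_, hu, rfl⟩
  have hreg := velocity_mem h₁ h₂ hs hm
  have hfin : (incl (β t), velocity (fun u => incl (β u)) t) ∈ finTangent G₁ G₂ v₁ v₂ := by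
    refine mem_finTangent h₁ h₂ hut ?_
    have := (mem_regTangent.1 hreg).2
    dsimp only at this
    rwa [Yc_incl fun e => (hut.1 e).le] at this
  unfold mspeed speed
  rw [extNorm_eq h₁ h₂ hreg, ← finNorm_eq h₁ h₂ hfin, hv]
  unfold finNorm
  dsimp only
  rw [incl_toReal fun e => (hut.1 e).le]

lemma continuous_incl : Continuous (incl : (Edge E₁ E₂ → ℝ) → ExtLength E₁ E₂) :=
  continuous_pi fun e => ENNReal.continuous_ofReal.comp (continuous_apply e)

lemma exists_mem_Ioo_of_monotone {n : ℕ} {s : ℕ → ℝ} (s0 : s 0 = 0) (sn : s n = 1) {t : ℝ}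
    (ht : t ∈ Set.Ioo (0 : ℝ) 1) (hts : ∀ i ≤ n, t ≠ s i) :
    ∃ i < n, t ∈ Set.Ioo (s i) (s (i + 1)) := by
  by_contra! hno
  have : ∀ i ≤ n, s i < t := by
    intro i
    induction i with
    | zero => intro _; rw [s0]; exact ht.1
    | succ i ih =>
      intro hi
      have h1 := ih (by omega)
      by_contra! h2
      exact hno i (by omega) ⟨h1, lt_of_le_of_ne h2 (hts _ hi)⟩
  have := this n le_rfl
  rw [sn] at this
  exact absurd ht.2 this.not_gt

theorem modelDist_le_entropyDist (h₁ : G₁.Good) (h₂ : G₂.Good) (x y : Edge E₁ E₂ → ℝ) :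
    modelDist G₁ G₂ v₁ v₂ (incl x) (incl y) ≤ (join G₁ G₂ v₁ v₂).entropyDist x y := by
  refine le_iInf₂ fun γ h => ?_
  obtain ⟨⟨hc, hu, n, s, hs, s0, sn, hd⟩, hx, hy⟩ := h
  let S : Finset ℝ := (Finset.range (n + 1)).image s
  have hS : ∀ t ∈ Set.Ioo (0 : ℝ) 1, t ∉ S → SmoothTime G₁ G₂ v₁ v₂ (fun u => incl (γ u)) t ∧
      mspeed G₁ G₂ v₁ v₂ (fun u => incl (γ u)) t = (join G₁ G₂ v₁ v₂).speed γ t := by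
    intro t ht hts
    have hne : ∀ i ≤ n, t ≠ s i := fun i hi h' => hts
      (Finset.mem_image.2 ⟨i, Finset.mem_range.2 (Nat.lt_succ_of_le hi), h'.symm⟩)
    obtain ⟨i, hi, hti⟩ := exists_mem_Ioo_of_monotone s0 sn ht hne
    refine smoothTime_incl h₁ h₂ EventuallyEq.rfl
      ((hd i hi).contDiffAt (Icc_mem_nhds hti.1 hti.2)) ?_
    filter_upwards [Icc_mem_nhds ht.1 ht.2] with u hu'
    exact hu u hu'
  refine (iInf₂_le (fun u => incl (γ u)) ⟨⟨continuous_incl.comp_continuousOn hc,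
    fun t ht => .inl ⟨_, hu t ht, rfl⟩, S, fun t ht hts => (hS t ht hts).1⟩, by simp [hx],
    by simp [hy]⟩).trans (le_of_eq ?_)
  exact setLIntegral_congr_fun_ae measurableSet_Icc
    (ae_mem_Icc S.finite_toSet fun t ht hts => (hS t ht hts).2)

end FinitePaths

/-! ### Stretching at no cost inside the model space -/

section Stretch

open Classical in
/-- The edges of a set are stretched to infinite length. -/
def stretch (T : Set (Edge E₁ E₂)) (p : ExtLength E₁ E₂) (t : ℝ) : ExtLength E₁ E₂ :=
  fun e => if e ∈ T then p e / ENNReal.ofReal (1 - t) else p e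

/-- Along the stretching path only edges in `T` move, and `F` is zero whatever their weights are, so
its extended speed is zero. Regularity is required only at interior times, so `p` itself may be
singular. -/
lemma modelDist_kill (h₁ : G₁.Good) (h₂ : G₂.Good) {T : Set (Edge E₁ E₂)} {p : ExtLength E₁ E₂}
    (hm : ∀ t ∈ Set.Icc (0 : ℝ) 1, stretch T p t ∈ model G₁ G₂ v₁ v₂)
    (hr : ∀ t ∈ Set.Ioo (0 : ℝ) 1, stretch T p t ∈ reg G₁ G₂ v₁ v₂)
    (hf : ∀ y, (∀ e ∉ T, y e = Yc p e) → (join G₁ G₂ v₁ v₂).detFun y = 0) :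
    modelDist G₁ G₂ v₁ v₂ p (kill T p) = 0 := by
  have h0 : stretch T p 0 = p := by
    funext e
    simp [stretch]
  have hpos : ∀ e, 0 < p e := by
    have := hm 0 (by simp)
    rw [h0] at this
    exact pos_of_mem_model this
  have h1 : stretch T p 1 = kill T p := by
    funext e
    unfold stretch kill
    split_ifs
    · rw [sub_self, ENNReal.ofReal_zero, ENNReal.div_zero (hpos e).ne']
    · rfl
  have hcont : Continuous (stretch T p) := by
    refine continuous_pi fun e => ?_
    unfold stretch
    split_ifs
    · by_cases hp : p e = ⊤
      · have : (fun t : ℝ => p e / ENNReal.ofReal (1 - t)) = fun _ => ⊤ := by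
          funext t
          rw [hp, ENNReal.top_div_of_ne_top ENNReal.ofReal_ne_top]
        rw [this]
        exact continuous_const
      · have hc : Continuous fun t : ℝ => ENNReal.ofReal (1 - t) :=
          ENNReal.continuous_ofReal.comp (by fun_prop)
        simp only [div_eq_mul_inv]
        exact (ENNReal.continuous_const_mul hp).comp (continuous_inv.comp hc)
    · exact continuous_const
  have hsm : ∀ t ∈ Set.Ioo (0 : ℝ) 1, SmoothTime G₁ G₂ v₁ v₂ (stretch T p) t := by
    intro t ht
    refine ⟨hr t ht, fun e => ?_⟩
    by_cases hp : p e = ⊤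
    · refine .inl (Eventually.of_forall fun u => ?_)
      unfold stretch
      rw [hp, ENNReal.top_div_of_ne_top ENNReal.ofReal_ne_top, ite_self]
    · refine .inr ⟨?_, ?_⟩
      · unfold stretch
        split_ifs
        · refine ENNReal.div_ne_top hp (ENNReal.ofReal_pos.2 (sub_pos.2 ht.2)).ne'
        · exact hp
      · unfold stretch
        split_ifs
        · have : (fun u : ℝ => (p e / ENNReal.ofReal (1 - u)).toReal) =ᶠ[𝓝 t]
              fun u => (p e).toReal / (1 - u) := by
            filter_upwards [gt_mem_nhds ht.2] with u hu
            rw [ENNReal.toReal_div, ENNReal.toReal_ofReal (sub_pos.2 hu).le]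
          refine ContDiffAt.congr_of_eventuallyEq ?_ this
          exact contDiffAt_const.div (by fun_prop) (sub_pos.2 ht.2).ne'
        · exact contDiffAt_const
  have hspeed : ∀ t ∈ Set.Ioo (0 : ℝ) 1, mspeed G₁ G₂ v₁ v₂ (stretch T p) t = 0 := by
    intro t ht
    have hreg := velocity_mem h₁ h₂ (hsm t ht) (by
      filter_upwards [Icc_mem_nhds ht.1 ht.2] with u hu
      exact hm u hu)
    have hv : ∀ e ∉ T, velocity (stretch T p) t e = 0 := by
      intro e he
      unfold velocity stretch
      simp only [if_neg he, deriv_const]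
    have hf' : ∀ w : Edge E₁ E₂ → ℝ, (∀ e ∉ T, w e = 0) →
        (join G₁ G₂ v₁ v₂).detFun (Yc (stretch T p t) + w) = 0 := fun w hw =>
      hf _ fun e he => by
        rw [Pi.add_apply, hw e he, add_zero]
        simp only [Yc, stretch, if_neg he]
    unfold mspeed
    rw [extNorm_eq h₁ h₂ hreg]
    unfold nrm Nf
    dsimp only
    rw [(fderiv_eq_zero_of_const hf' fun e he => by rw [hv e he, mul_zero]).2,
      (fderiv_eq_zero_of_const hf' fun e he => by rw [hv e he]; ring).1]
    simp
  refine le_antisymm ?_ zero_le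
  refine (iInf₂_le (stretch T p) ⟨⟨hcont.continuousOn, hm, ∅, fun t ht _ => hsm t ht⟩, h0,
    h1⟩).trans (le_of_eq ?_)
  change ∫⁻ t in Set.Icc (0 : ℝ) 1, mspeed G₁ G₂ v₁ v₂ (stretch T p) t = 0
  rw [setLIntegral_congr_fun_ae (g := fun _ => 0) measurableSet_Icc
    (ae_mem_Icc Set.finite_empty fun t ht _ => hspeed t ht)]
  simp

end Stretch

/-! ### Finiteness of the distance -/

section FiniteDistance

lemma exists_mem_unitSpace {V E : Type*} [Fintype E] {H : OGraph V E} (hH : H.Good) :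
    ∃ l, l ∈ H.unitSpace := ⟨_, hH.normalize_mem (l := fun _ => 1) fun _ => one_pos⟩

/-- A point with unit entropy on the first graph and otherwise infinite lengths. -/
def top₁ (E₂ : Type*) (l : E₁ → ℝ) : ExtLength E₁ E₂
  | none => ⊤
  | some (Sum.inl e) => ENNReal.ofReal (l e)
  | some (Sum.inr _) => ⊤

/-- A point with unit entropy on the second graph and otherwise infinite lengths. -/
def top₂ (E₁ : Type*) (l : E₂ → ℝ) : ExtLength E₁ E₂
  | none => ⊤
  | some (Sum.inl _) => ⊤
  | some (Sum.inr e) => ENNReal.ofReal (l e)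

lemma top₁_mem {l : E₁ → ℝ} (hl : l ∈ G₁.unitSpace) : top₁ E₂ l ∈ unit₁ G₁ E₂ := by
  refine ⟨ENNReal.zero_lt_top, ⟨fun _ => ENNReal.ofReal_ne_top, ?_⟩, fun _ => rfl⟩
  convert hl using 1
  exact funext fun e => ENNReal.toReal_ofReal (hl.1 e).le

lemma top₂_mem {l : E₂ → ℝ} (hl : l ∈ G₂.unitSpace) : top₂ E₁ l ∈ unit₂ E₁ G₂ := by
  refine ⟨ENNReal.zero_lt_top, fun _ => rfl, fun _ => ENNReal.ofReal_ne_top, ?_⟩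
  convert hl using 1
  exact funext fun e => ENNReal.toReal_ofReal (hl.1 e).le

lemma unit₁_subset_reg (h₂ : G₂.Good) : unit₁ G₁ E₂ ⊆ reg G₁ G₂ v₁ v₂ := by
  intro p hp
  obtain ⟨e⟩ := h₂.nonempty_edge
  exact ⟨.inr (.inl (.inl hp)), fun h => h.2.2.1 e (hp.2.2 e)⟩

lemma unit₂_subset_reg (h₁ : G₁.Good) : unit₂ E₁ G₂ ⊆ reg G₁ G₂ v₁ v₂ := by
  intro p hp
  obtain ⟨e⟩ := h₁.nonempty_edge
  exact ⟨.inr (.inl (.inr hp)), fun h => h.2.1.1 e (hp.2.1 e)⟩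

/-- The normalised segment in root coordinates from `x` to `p` has finite length: its speed is
continuous for `t < 1` and has a limit at `t = 1`, because `Kf` does not vanish at a regular point.
-/
lemma modelDist_incl_lt_top (h₁ : G₁.Good) (h₂ : G₂.Good) {x : Edge E₁ E₂ → ℝ}
    (hx : x ∈ (join G₁ G₂ v₁ v₂).unitSpace) {p : ExtLength E₁ E₂} (hp : p ∈ reg G₁ G₂ v₁ v₂) :
    modelDist G₁ G₂ v₁ v₂ (incl x) p < ⊤ := by
  have hJ := good_join (v₁ := v₁) (v₂ := v₂) h₁ h₂
  set J := join G₁ G₂ v₁ v₂ with hJd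
  set a := Zc (incl x) with ha
  set b := Zc p with hb
  have hac : a ∈ cube (Edge E₁ E₂) := Zc_incl_mem hx.1
  set z : ℝ → Edge E₁ E₂ → ℝ := fun t => a + t • (b - a) with hz
  have hzc : Continuous z := by fun_prop
  have hz1 : z 1 = b := by simp [hz]
  have hb0 : ∀ e, 0 ≤ b e := fun e => Real.sqrt_nonneg _
  have hb1 : ∀ e, b e < 1 := fun e => by
    rw [hb, Zc, Real.sqrt_lt' one_pos, one_pow, Real.sqrt_lt' one_pos, one_pow]
    exact expNeg_lt_one (pos_of_mem_model hp.1 e)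
  have hzcube : ∀ t ∈ Set.Ico (0 : ℝ) 1, z t ∈ cube (Edge E₁ E₂) := by
    intro t ht e
    have e1 : z t e = (1 - t) * a e + t * b e := by
      simp only [hz, Pi.add_apply, Pi.smul_apply, Pi.sub_apply, smul_eq_mul]
      ring
    rw [e1]
    have k1 := mul_pos (sub_pos.2 ht.2) (hac e).1
    have k2 := mul_lt_mul_of_pos_left (hac e).2 (sub_pos.2 ht.2)
    have k3 := mul_nonneg ht.1 (hb0 e)
    have k4 := mul_le_mul_of_nonneg_left (hb1 e).le ht.1
    constructor <;> linarith
  have hev : ∀ t ∈ Set.Ioo (0 : ℝ) 1, ∀ᶠ u in 𝓝 t, z u ∈ cube (Edge E₁ E₂) := fun t ht =>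
    hzc.continuousAt.eventually_mem (isOpen_cube.mem_nhds (hzcube t ⟨ht.1.le, ht.2⟩))
  set β : ℝ → Edge E₁ E₂ → ℝ := fun t => rootPt J (z t) with hβ
  -- The end point is prescribed, since the normalisation makes sense only inside the open cube,
  -- which the segment may leave at `t = 1`.
  set γ : ℝ → ExtLength E₁ E₂ := fun t => if t = 1 then p else incl (β t) with hγ
  have hγ1 : γ 1 = p := if_pos rfl
  have hγ0 : γ 0 = incl x := by
    rw [hγ]
    simp only [zero_ne_one, if_false, hβ, hz, zero_smul, add_zero]
    rw [ha, rootPt_Zc hx]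
  have hγe : ∀ t ∈ Set.Ioo (0 : ℝ) 1, γ =ᶠ[𝓝 t] fun u => incl (β u) := by
    intro t ht
    filter_upwards [isOpen_ne.mem_nhds ht.2.ne] with u hu
    exact if_neg hu
  have hβu : ∀ t ∈ Set.Ico (0 : ℝ) 1, β t ∈ J.unitSpace := fun t ht => rootPt_mem hJ (hzcube t ht)
  have hsm : ∀ t ∈ Set.Ioo (0 : ℝ) 1, SmoothTime G₁ G₂ v₁ v₂ γ t ∧
      mspeed G₁ G₂ v₁ v₂ γ t = ENNReal.ofReal (J.rootNorm (rootEnt J (z t)) (z t) (b - a)) := by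
    intro t ht
    have harc := rootPt_arc hJ (a := a) (d := b - a) (hzcube t ⟨ht.1.le, ht.2⟩)
    have h3 := smoothTime_incl h₁ h₂ (hγe t ht) harc.1 (by
      filter_upwards [hev t ht] with u hu
      exact rootPt_mem hJ hu)
    refine ⟨h3.1, h3.2.trans ?_⟩
    unfold speed
    rw [← harc.2]
  have hYb : (fun e => b e ^ 4) = Yc p := Zc_pow' p
  have hmod : ∀ t ∈ Set.Icc (0 : ℝ) 1, γ t ∈ model G₁ G₂ v₁ v₂ := by
    intro t ht
    rcases ht.2.eq_or_lt with rfl | h'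
    · rw [hγ1]
      exact hp.1
    · rw [hγ]
      simp only [h'.ne, if_false]
      exact .inl ⟨_, hβu t ⟨ht.1, h'⟩, rfl⟩
  have hcontγ : ContinuousOn γ (Set.Icc 0 1) := by
    intro t ht
    rcases ht.2.eq_or_lt with rfl | h'
    · rw [← Set.Ico_insert_right zero_le_one, continuousWithinAt_insert_self]
      have h3 : Tendsto (fun t => incl (β t)) (𝓝[Set.Ico 0 1] (1 : ℝ)) (𝓝 p) := by
        refine (tendsto_incl_unitPt h₁ h₂ hp.1).comp (tendsto_nhdsWithin_iff.2 ⟨?_, ?_⟩)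
        · rw [← hYb, ← hz1]
          refine Tendsto.mono_left ?_ nhdsWithin_le_nhds
          exact tendsto_pi_nhds.2 fun e =>
            (((continuous_apply e).comp hzc).pow 4).tendsto 1
        · filter_upwards [self_mem_nhdsWithin] with t ht
          exact pow_mem_cube (hzcube t ht)
      rw [ContinuousWithinAt, hγ1]
      refine h3.congr' ?_
      filter_upwards [self_mem_nhdsWithin] with t ht
      exact (if_neg ht.2.ne).symm
    · refine ContinuousAt.continuousWithinAt ?_
      have h3 : γ =ᶠ[𝓝 t] fun u => incl (β u) := by
        filter_upwards [isOpen_ne.mem_nhds h'.ne] with u hu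
        exact if_neg hu
      refine ContinuousAt.congr ?_ h3.symm
      exact continuous_incl.continuousAt.comp
        (rootPt_arc hJ (a := a) (d := b - a) (hzcube t ⟨ht.1, h'⟩)).1.continuousAt
  obtain ⟨C, hC⟩ : ∃ C, ∀ t ∈ Set.Ioo (0 : ℝ) 1,
      J.rootNorm (rootEnt J (z t)) (z t) (b - a) ≤ C := by
    have hin : ∀ᶠ u in 𝓝[Set.Iio 1] (1 : ℝ), z u ∈ cube (Edge E₁ E₂) := by
      filter_upwards [self_mem_nhdsWithin, nhdsWithin_le_nhds (lt_mem_nhds one_pos)] with u hu hu'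
      exact hzcube u ⟨le_of_lt hu', hu⟩
    have t4 := tendsto_rootNorm (H := J) one_pos (fun _ => .inr (by norm_num)) (tendsto_rootEnt
      (by rw [hz1, hYb]; exact entropyTendsto_of_model h₁ h₂ hp.1)
      ((hzc.tendsto 1).mono_left nhdsWithin_le_nhds) hin)
      ((hzc.tendsto 1).mono_left nhdsWithin_le_nhds) (tendsto_const_nhds (x := b - a))
      (by rw [hz1, rpow_four_one, hYb]; exact (Kf_pos_of_reg h₁ h₂ hp).ne')
    obtain ⟨δ, hδ, hδ'⟩ := (mem_nhdsLT_iff_exists_Ioo_subset' (zero_lt_one' ℝ)).1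
      (t4.eventually_lt_const (lt_add_one _))
    have hcont : ContinuousOn (fun t => J.rootNorm (rootEnt J (z t)) (z t) (b - a))
        (Set.Icc 0 δ) := by
      intro t ht
      have ht1 : t ∈ Set.Ico (0 : ℝ) 1 := ⟨ht.1, ht.2.trans_lt hδ⟩
      have hzt := hzcube t ht1
      refine ContinuousAt.continuousWithinAt ?_
      refine tendsto_rootNorm (hJ.entropy_spec (negLog_mem (pow_mem_cube hzt))).1
        (fun e => .inl (hzt e).1.ne') ?_ (hzc.tendsto t) tendsto_const_nhds ?_
      · refine ContinuousAt.comp (g := J.entropy) (f := fun t => negLog fun e => z t e ^ 4)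
          (hJ.continuousAt_entropy (negLog_mem (pow_mem_cube hzt))) ?_
        exact continuousAt_pi.2 fun e => (((((continuous_apply e).comp hzc).pow 4).continuousAt).log
          (pow_pos (hzt e).1 4).ne').neg
      · have := (hJ.Kf_pos (hβu t ht1)).ne'
        rwa [hβ, yexp_rootPt hzt] at this
    obtain ⟨C, hC⟩ := (isCompact_Icc.image_of_continuousOn hcont).bddAbove
    refine ⟨max C (J.rootNorm 1 (z 1) (b - a) + 1), fun t ht => ?_⟩
    rcases le_or_gt t δ with h' | h'
    · exact (hC ⟨t, ⟨ht.1.le, h'⟩, rfl⟩).trans (le_max_left _ _)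
    · exact (le_of_lt (hδ' ⟨h', ht.2⟩)).trans (le_max_right _ _)
  have hlen : modelPathLength G₁ G₂ v₁ v₂ γ ≤ ENNReal.ofReal C := by
    change ∫⁻ t in Set.Icc (0 : ℝ) 1, mspeed G₁ G₂ v₁ v₂ γ t ≤ _
    rw [setLIntegral_congr_fun_ae measurableSet_Icc
      (ae_mem_Icc Set.finite_empty fun t ht _ => (hsm t ht).2), lintegral_Icc_eq_Ioo]
    calc _ ≤ ∫⁻ t in Set.Ioo (0 : ℝ) 1, ENNReal.ofReal C :=
          setLIntegral_mono' measurableSet_Ioo fun t ht => ENNReal.ofReal_le_ofReal (hC t ht)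
      _ = ENNReal.ofReal C := by simp
  refine lt_of_le_of_lt ?_ (hlen.trans_lt ENNReal.ofReal_lt_top)
  exact iInf₂_le γ ⟨⟨hcontγ, hmod, ∅, fun t ht _ => (hsm t ht).1⟩, hγ0, hγ1⟩

end FiniteDistance

end SepEdge

end

noncomputable section

set_option linter.unusedSectionVars false

namespace OGraph

/-! ### Sliding away from a common zero of the two factors of the determinant -/

section Slide

variable {V E : Type*} [Fintype E] {H : OGraph V E}

/-- A decomposition of the determinant function, in terms of lengths, with respect to an edge `e₀`
and a set `S` of other edges. -/
structure Split (H : OGraph V E) (e₀ : E) (S : Set E) (a b c : (E → ℝ) → ℝ) : Prop where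
  notMem : e₀ ∉ S
  smooth_a : ContDiff ℝ ∞ a
  smooth_b : ContDiff ℝ ∞ b
  smooth_c : ContDiff ℝ ∞ c
  indep_a : ∀ l l' : E → ℝ, (∀ e ∉ S, e ≠ e₀ → l e = l' e) → a l = a l'
  indep_b : ∀ l l' : E → ℝ, (∀ e ∈ S, l e = l' e) → b l = b l'
  indep_c : ∀ l l' : E → ℝ, (∀ e, e ≠ e₀ → l e = l' e) → c l = c l'
  eq : ∀ l, H.FH l = a l * b l - Real.exp (-2 * l e₀) * c l
  pos_a : ∀ l ∈ H.unitSpace, 0 < a l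
  pos_b : ∀ l ∈ H.unitSpace, 0 < b l
  mem : ∀ l ∈ H.unitSpace, ∀ l' : E → ℝ, (∀ e, e ≠ e₀ → l e ≤ l' e) → 0 < l' e₀ → H.FH l' = 0 →
    l' ∈ H.unitSpace

open Classical in
/-- The lengths of the edges in `S` are multiplied by `s`. -/
def slide (S : Set E) (q : E → ℝ) (s : ℝ) : E → ℝ := fun e => if e ∈ S then s * q e else q e

open Classical in
/-- The velocity of `slide`. -/
def slideVel (S : Set E) (q : E → ℝ) : E → ℝ := fun e => if e ∈ S then q e else 0

lemma slide_add (S : Set E) (q : E → ℝ) (s t : ℝ) :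
    slide S q s + t • slideVel S q = slide S q (s + t) := by
  funext e
  simp only [Pi.add_apply, Pi.smul_apply, smul_eq_mul, slide, slideVel]
  split_ifs <;> ring

lemma slide_one (S : Set E) (q : E → ℝ) : slide S q 1 = q := by
  funext e
  simp [slide]

lemma hasDerivAt_slide (S : Set E) (q : E → ℝ) (s : ℝ) :
    HasDerivAt (slide S q) (slideVel S q) s := by
  refine hasDerivAt_pi.2 fun e => ?_
  simp only [slide, slideVel]
  split_ifs
  · simpa using (hasDerivAt_id s).mul_const (q e)
  · exact hasDerivAt_const _ _

lemma continuous_slide (S : Set E) : Continuous fun w : (E → ℝ) × ℝ => slide S w.1 w.2 := by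
  refine continuous_pi fun e => ?_
  simp only [slide]
  split_ifs <;> fun_prop

lemma continuous_slideVel (S : Set E) : Continuous (slideVel S : (E → ℝ) → E → ℝ) := by
  refine continuous_pi fun e => ?_
  simp only [slideVel]
  split_ifs <;> fun_prop

lemma hasDerivAt_comp_slide {f : (E → ℝ) → ℝ} (hf : Differentiable ℝ f) (S : Set E) (q : E → ℝ)
    (s : ℝ) : HasDerivAt (fun s => f (slide S q s)) (fderiv ℝ f (slide S q s) (slideVel S q)) s :=
  (hf _).hasFDerivAt.comp_hasDerivAt s (hasDerivAt_slide S q s)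

lemma hasDerivAt_comp_slide₂ {f : (E → ℝ) → ℝ} (hf : ContDiff ℝ ∞ f) (S : Set E) (q : E → ℝ)
    (s : ℝ) : HasDerivAt (fun s => fderiv ℝ f (slide S q s) (slideVel S q))
      (fderiv ℝ (fderiv ℝ f) (slide S q s) (slideVel S q) (slideVel S q)) s := by
  have h1 : Differentiable ℝ (fderiv ℝ f) :=
    ((contDiff_infty.1 hf 2).fderiv_right (m := 1) (by norm_num)).differentiable one_ne_zero
  have h2 := ((h1 (slide S q s)).hasFDerivAt.comp_hasDerivAt s (hasDerivAt_slide S q s)).clm_apply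
    (hasDerivAt_const s (slideVel S q))
  rwa [map_zero, add_zero] at h2

lemma hasDerivAt_comp_smul {f : (E → ℝ) → ℝ} (hf : Differentiable ℝ f) (l : E → ℝ) :
    HasDerivAt (fun s : ℝ => f (s • l)) (fderiv ℝ f l l) 1 := by
  have h1 : HasDerivAt (fun s : ℝ => s • l) l 1 := by
    simpa using (hasDerivAt_id (1 : ℝ)).smul_const l
  have h2 : HasFDerivAt f (fderiv ℝ f l) ((1 : ℝ) • l) := by
    rw [one_smul]
    exact (hf l).hasFDerivAt
  exact h2.comp_hasDerivAt (1 : ℝ) h1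

open Classical in
/-- The length of `e₀` for which the determinant vanishes. -/
def slideLen (S : Set E) (a b c : (E → ℝ) → ℝ) (q : E → ℝ) (s : ℝ) : ℝ :=
  1 / 2 * Real.log (c (slide S q s) / (a q * b (slide S q s)))

open Classical in
/-- A path of zeros of the determinant. -/
def slidePath (e₀ : E) (S : Set E) (a b c : (E → ℝ) → ℝ) (q : E → ℝ) (s : ℝ) : E → ℝ :=
  Function.update (slide S q s) e₀ (slideLen S a b c q s)

variable {e₀ : E} {S : Set E} {a b c : (E → ℝ) → ℝ}

lemma slidePath_of_ne {q : E → ℝ} {s : ℝ} {e : E} (he : e ≠ e₀) :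
    slidePath e₀ S a b c q s e = slide S q s e := by
  classical exact Function.update_of_ne he _ _

lemma exp_slideLen {q : E → ℝ} {s : ℝ} (hα : 0 < a q) (hB : 0 < b (slide S q s))
    (hC : 0 < c (slide S q s)) :
    Real.exp (-2 * slideLen S a b c q s) = a q * b (slide S q s) / c (slide S q s) := by
  unfold slideLen
  rw [show ∀ x : ℝ, -2 * (1 / 2 * x) = -x from fun x => by ring, Real.exp_neg,
    Real.exp_log (div_pos hC (mul_pos hα hB)), inv_div]

lemma hasDerivAt_slideLen (hb : Differentiable ℝ b) (hc : Differentiable ℝ c) {q : E → ℝ} {s : ℝ}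
    (hα : 0 < a q) (hB : 0 < b (slide S q s)) (hC : 0 < c (slide S q s)) :
    HasDerivAt (slideLen S a b c q)
      (1 / 2 * (fderiv ℝ c (slide S q s) (slideVel S q) / c (slide S q s) -
        fderiv ℝ b (slide S q s) (slideVel S q) / b (slide S q s))) s := by
  have h1 := hasDerivAt_comp_slide hb S q s
  have h2 := hasDerivAt_comp_slide hc S q s
  have h3 := ((h2.div (h1.const_mul (a q)) (mul_pos hα hB).ne').log
    (div_pos hC (mul_pos hα hB)).ne').const_mul (1 / 2)
  refine h3.congr_deriv ?_
  have := hα.ne'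
  have := hB.ne'
  have := hC.ne'
  simp only [Pi.div_apply]
  field_simp

open Classical in
lemma Split.FH_line (h : H.Split e₀ S a b c) (q : E → ℝ) (s u v t : ℝ) :
    H.FH (Function.update (slide S q s) e₀ u + t • Function.update (slideVel S q) e₀ v) =
      a q * b (slide S q (s + t)) - Real.exp (-2 * (u + t * v)) * c (slide S q (s + t)) := by
  have hne : ∀ e, e ≠ e₀ →
      (Function.update (slide S q s) e₀ u + t • Function.update (slideVel S q) e₀ v) e =
        slide S q (s + t) e := fun e he => by
    rw [← slide_add]
    simp only [Pi.add_apply, Pi.smul_apply, Function.update_of_ne he]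
  rw [h.eq, h.indep_a _ q fun e he he' => (hne e he').trans (if_neg he),
    h.indep_b _ (slide S q (s + t)) fun e he => hne e fun h' => h.notMem (h' ▸ he),
    h.indep_c _ (slide S q (s + t)) hne]
  simp

/-- The quantity which controls the second derivative of the determinant. -/
def slideHess (S : Set E) (b c : (E → ℝ) → ℝ) (q : E → ℝ) (s : ℝ) : ℝ :=
  (fderiv ℝ b (slide S q s) (slideVel S q)) ^ 2 -
    b (slide S q s) ^ 2 * (fderiv ℝ c (slide S q s) (slideVel S q)) ^ 2 / c (slide S q s) ^ 2 +
    b (slide S q s) ^ 2 * fderiv ℝ (fderiv ℝ c) (slide S q s) (slideVel S q) (slideVel S q) /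
      c (slide S q s) -
    b (slide S q s) * fderiv ℝ (fderiv ℝ b) (slide S q s) (slideVel S q) (slideVel S q)

open Classical in
lemma Split.hasDerivAt_slidePath (h : H.Split e₀ S a b c) {q : E → ℝ} {s : ℝ}
    (hα : 0 < a q) (hB : 0 < b (slide S q s)) (hC : 0 < c (slide S q s)) :
    HasDerivAt (slidePath e₀ S a b c q) (Function.update (slideVel S q) e₀
      (1 / 2 * (fderiv ℝ c (slide S q s) (slideVel S q) / c (slide S q s) -
        fderiv ℝ b (slide S q s) (slideVel S q) / b (slide S q s)))) s := by
  refine hasDerivAt_pi.2 fun e => ?_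
  unfold slidePath
  by_cases he : e = e₀
  · subst he
    simp only [Function.update_self]
    exact hasDerivAt_slideLen (h.smooth_b.differentiable (by simp))
      (h.smooth_c.differentiable (by simp)) hα hB hC
  · simp only [Function.update_of_ne he]
    exact hasDerivAt_pi.1 (hasDerivAt_slide S q s) e

lemma Split.FH_slidePath (h : H.Split e₀ S a b c) {q : E → ℝ} {s : ℝ}
    (hα : 0 < a q) (hB : 0 < b (slide S q s)) (hC : 0 < c (slide S q s)) :
    H.FH (slidePath e₀ S a b c q s) = 0 := by
  classical
  have h1 := h.FH_line q s (slideLen S a b c q s) 0 0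
  rw [zero_smul, add_zero, add_zero, zero_mul, add_zero, exp_slideLen hα hB hC,
    div_mul_cancel₀ _ hC.ne', sub_self] at h1
  unfold slidePath
  convert h1

-- Along the tangent line only `b`, `c` and the length of `e₀` vary. Substituting `exp (-2 u) = a b
-- / c` brings out the factor `a / b` and leaves `slideHess`, in which `b` is never in a
-- denominator, so that it stays bounded near the common zero.
open Classical in
lemma Split.Nf_slidePath (h : H.Split e₀ S a b c) {q : E → ℝ} {s : ℝ}
    (hα : 0 < a q) (hB : 0 < b (slide S q s)) (hC : 0 < c (slide S q s)) :
    H.Nf (yexp (slidePath e₀ S a b c q s)) (Function.update (slideVel S q) e₀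
      (1 / 2 * (fderiv ℝ c (slide S q s) (slideVel S q) / c (slide S q s) -
        fderiv ℝ b (slide S q s) (slideVel S q) / b (slide S q s)))) =
      -(a q / b (slide S q s) * slideHess S b c q s) := by
  set u := slideLen S a b c q s with hu
  set v := 1 / 2 * (fderiv ℝ c (slide S q s) (slideVel S q) / c (slide S q s) -
        fderiv ℝ b (slide S q s) (slideVel S q) / b (slide S q s)) with hv
  have hadd : ∀ t : ℝ, HasDerivAt (fun t : ℝ => s + t) 1 t := fun t => by
    simpa using (hasDerivAt_id t).const_add s
  have hb1 : ∀ t : ℝ, HasDerivAt (fun t => b (slide S q (s + t)))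
      (fderiv ℝ b (slide S q (s + t)) (slideVel S q)) t := fun t => by
    have := (hasDerivAt_comp_slide (h.smooth_b.differentiable (by simp)) S q (s + t)).comp t (hadd t)
    rwa [mul_one] at this
  have hc1 : ∀ t : ℝ, HasDerivAt (fun t => c (slide S q (s + t)))
      (fderiv ℝ c (slide S q (s + t)) (slideVel S q)) t := fun t => by
    have := (hasDerivAt_comp_slide (h.smooth_c.differentiable (by simp)) S q (s + t)).comp t (hadd t)
    rwa [mul_one] at this
  have hb2 : ∀ t : ℝ, HasDerivAt (fun t => fderiv ℝ b (slide S q (s + t)) (slideVel S q))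
      (fderiv ℝ (fderiv ℝ b) (slide S q (s + t)) (slideVel S q) (slideVel S q)) t := fun t => by
    have := (hasDerivAt_comp_slide₂ h.smooth_b S q (s + t)).comp t (hadd t)
    rwa [mul_one] at this
  have hc2 : ∀ t : ℝ, HasDerivAt (fun t => fderiv ℝ c (slide S q (s + t)) (slideVel S q))
      (fderiv ℝ (fderiv ℝ c) (slide S q (s + t)) (slideVel S q) (slideVel S q)) t := fun t => by
    have := (hasDerivAt_comp_slide₂ h.smooth_c S q (s + t)).comp t (hadd t)
    rwa [mul_one] at this
  have he : ∀ t : ℝ, HasDerivAt (fun t : ℝ => Real.exp (-2 * (u + t * v)))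
      (Real.exp (-2 * (u + t * v)) * (-2 * v)) t := fun t => by
    have : HasDerivAt (fun t : ℝ => -2 * (u + t * v)) (-2 * v) t := by
      simpa using (((hasDerivAt_id t).mul_const v).const_add u).const_mul (-2)
    exact this.exp
  have h1 : ∀ t : ℝ, HasDerivAt (fun t : ℝ => H.FH (slidePath e₀ S a b c q s + t •
      Function.update (slideVel S q) e₀ v))
      (a q * fderiv ℝ b (slide S q (s + t)) (slideVel S q) -
        (Real.exp (-2 * (u + t * v)) * (-2 * v) * c (slide S q (s + t)) +
          Real.exp (-2 * (u + t * v)) * fderiv ℝ c (slide S q (s + t)) (slideVel S q))) t := by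
    intro t
    have e1 : (fun t : ℝ => H.FH (slidePath e₀ S a b c q s + t •
      Function.update (slideVel S q) e₀ v)) = fun t => a q * b (slide S q (s + t)) -
        Real.exp (-2 * (u + t * v)) * c (slide S q (s + t)) := funext fun t => h.FH_line q s u v t
    rw [e1]
    exact ((hb1 t).const_mul (a q)).sub ((he t).mul (hc1 t))
  have h2 := ((hb2 0).const_mul (a q)).sub ((((he 0).mul_const (-2 * v)).mul (hc1 0)).add
    ((he 0).mul (hc2 0)))
  rw [Nf_eq_of_hasDerivAt h1 h2]
  simp only [zero_mul, add_zero]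
  rw [hu, exp_slideLen hα hB hC, hv]
  unfold slideHess
  generalize b (slide S q s) = B at *
  generalize c (slide S q s) = C at *
  generalize fderiv ℝ b (slide S q s) (slideVel S q) = B1 at *
  generalize fderiv ℝ c (slide S q s) (slideVel S q) = C1 at *
  generalize fderiv ℝ (fderiv ℝ b) (slide S q s) (slideVel S q) (slideVel S q) = B2 at *
  generalize fderiv ℝ (fderiv ℝ c) (slide S q s) (slideVel S q) (slideVel S q) = C2 at *
  have := hB.ne'
  have := hC.ne'
  field_simp
  ring

/-- Radial derivative of `a b - exp (-2 u) c`, with `exp (-2 u)` again eliminated by `F = 0`. The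
first two terms have the size of `a + b` near the common zero, and the last one is of smaller order.
-/
lemma Split.Kf_slidePath (h : H.Split e₀ S a b c) {q : E → ℝ} {s : ℝ}
    (hα : 0 < a q) (hB : 0 < b (slide S q s)) (hC : 0 < c (slide S q s)) :
    H.Kf (yexp (slidePath e₀ S a b c q s)) =
      fderiv ℝ a q q * b (slide S q s) + a q * fderiv ℝ b (slide S q s) (slide S q s) +
        2 * slideLen S a b c q s * (a q * b (slide S q s)) -
        a q * (b (slide S q s) * (fderiv ℝ c (slide S q s) (slide S q s) / c (slide S q s))) := by
  set L := slidePath e₀ S a b c q s with hL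
  set u := slideLen S a b c q s with hu
  have hLe : L e₀ = u := by
    simp [hL, slidePath, hu]
  have hLne : ∀ e, e ≠ e₀ → L e = slide S q s e := fun e he => by
    classical exact Function.update_of_ne he _ _
  have h1 := hasDerivAt_FH_smul (H := H) L one_ne_zero
  rw [one_smul, div_one] at h1
  have h2 : (fun t : ℝ => H.FH (t • L)) = fun t : ℝ => a (t • q) * b (t • slide S q s) -
      Real.exp (t * (-2 * u)) * c (t • slide S q s) := by
    funext t
    have hne : ∀ e, e ≠ e₀ → (t • L) e = (t • slide S q s) e := fun e he => by
      rw [Pi.smul_apply, Pi.smul_apply, hLne e he]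
    rw [h.eq, h.indep_a _ (t • q) fun e he he' => (hne e he').trans
        (by rw [Pi.smul_apply, Pi.smul_apply, slide, if_neg he]),
      h.indep_b _ (t • slide S q s) fun e he => hne e fun h' => h.notMem (h' ▸ he),
      h.indep_c _ (t • slide S q s) hne, Pi.smul_apply, hLe, smul_eq_mul]
    congr 3
    ring
  rw [h2] at h1
  have da := hasDerivAt_comp_smul (h.smooth_a.differentiable (by simp)) q
  have db := hasDerivAt_comp_smul (h.smooth_b.differentiable (by simp)) (slide S q s)
  have dc := hasDerivAt_comp_smul (h.smooth_c.differentiable (by simp)) (slide S q s)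
  have de : HasDerivAt (fun t : ℝ => Real.exp (t * (-2 * u)))
      (Real.exp (1 * (-2 * u)) * (-2 * u)) 1 := by
    have := ((hasDerivAt_id (1 : ℝ)).mul_const (-2 * u)).exp
    simpa using this
  rw [h1.unique ((da.mul db).sub (de.mul dc))]
  rw [one_smul, one_smul, one_mul, hu, exp_slideLen hα hB hC, ← hu]
  have := hC.ne'
  field_simp
  ring

end Slide

end OGraph

end

noncomputable section

set_option linter.unusedSectionVars false

namespace OGraph

/-! ### The cost of a slide -/

section Step

variable {V E : Type*} [Fintype E] {H : OGraph V E}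
  {e₀ : E} {S : Set E} {a b c : (E → ℝ) → ℝ}

lemma contDiff_slide (S : Set E) (q : E → ℝ) : ContDiff ℝ ∞ (slide S q) := by
  refine contDiff_pi.2 fun e => ?_
  simp only [slide]
  split_ifs <;> fun_prop

lemma Split.contDiffAt_slidePath (h : H.Split e₀ S a b c) {q : E → ℝ} {s : ℝ}
    (hα : 0 < a q) (hB : 0 < b (slide S q s)) (hC : 0 < c (slide S q s)) :
    ContDiffAt ℝ ∞ (slidePath e₀ S a b c q) s := by
  classical
  refine contDiffAt_pi.2 fun e => ?_
  have hs := contDiff_slide S q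
  by_cases he : e = e₀
  · subst he
    have h1 : (fun s => slidePath e S a b c q s e) = slideLen S a b c q := by
      funext s
      simp [slidePath]
    rw [h1]
    have hb : ContDiffAt ℝ ∞ (fun s => b (slide S q s)) s := (h.smooth_b.comp hs).contDiffAt
    have hc : ContDiffAt ℝ ∞ (fun s => c (slide S q s)) s := (h.smooth_c.comp hs).contDiffAt
    exact contDiffAt_const.mul ((hc.div (contDiffAt_const.mul hb) (mul_pos hα hB).ne').log
      (div_pos hC (mul_pos hα hB)).ne')
  · have h1 : (fun s => slidePath e₀ S a b c q s e) = fun s => slide S q s e := by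
      funext s
      exact Function.update_of_ne he _ _
    rw [h1]
    exact (contDiff_pi.1 hs e).contDiffAt

/-- The estimates which hold near a common zero of the two factors of the determinant. -/
structure SlideBounds (S : Set E) (a b c : (E → ℝ) → ℝ) (k M : ℝ) (q : E → ℝ) (s : ℝ) : Prop where
  der_a : k < fderiv ℝ a q q
  der_b : k < fderiv ℝ b (slide S q s) (slide S q s)
  vel_b : k < fderiv ℝ b (slide S q s) (slideVel S q)
  pos_c : 0 < c (slide S q s)
  hess : slideHess S b c q s < M
  small : b (slide S q s) * (fderiv ℝ c (slide S q s) (slide S q s) / c (slide S q s)) < k / 2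
  lt : a q * b (slide S q s) < c (slide S q s)

/-- All the estimates are strict inequalities between continuous functions, and they hold at `(p,
1)`. -/
lemma eventually_slideBounds (h : H.Split e₀ S a b c) {p : E → ℝ} {k M : ℝ} (hk : 0 < k)
    (pa : a p = 0) (pb : b p = 0) (ka : k < fderiv ℝ a p p) (kb : k < fderiv ℝ b p p)
    (pc : 0 < c p) (hM : slideHess S b c p 1 < M) :
    ∀ᶠ w in 𝓝 (p, (1 : ℝ)), SlideBounds S a b c k M w.1 w.2 := by
  have X : Continuous fun w : (E → ℝ) × ℝ => slide S w.1 w.2 := continuous_slide S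
  have W : Continuous fun w : (E → ℝ) × ℝ => slideVel S w.1 :=
    (continuous_slideVel S).comp continuous_fst
  have ca : Continuous fun w : (E → ℝ) × ℝ => a w.1 := h.smooth_a.continuous.comp continuous_fst
  have cb := h.smooth_b.continuous.comp X
  have cc := h.smooth_c.continuous.comp X
  have ca' : Continuous fun w : (E → ℝ) × ℝ => fderiv ℝ a w.1 w.1 :=
    ((h.smooth_a.continuous_fderiv (by simp)).comp continuous_fst).clm_apply continuous_fst
  have cb' := ((h.smooth_b.continuous_fderiv (by simp)).comp X)
  have cc' := ((h.smooth_c.continuous_fderiv (by simp)).comp X)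
  have cb'' : Continuous fun w : (E → ℝ) × ℝ => fderiv ℝ (fderiv ℝ b) (slide S w.1 w.2) :=
    (((contDiff_infty.1 h.smooth_b 2).fderiv_right (m := 1) (by norm_num)).continuous_fderiv
      one_ne_zero).comp X
  have cc'' : Continuous fun w : (E → ℝ) × ℝ => fderiv ℝ (fderiv ℝ c) (slide S w.1 w.2) :=
    (((contDiff_infty.1 h.smooth_c 2).fderiv_right (m := 1) (by norm_num)).continuous_fderiv
      one_ne_zero).comp X
  have s1 : slide S p 1 = p := slide_one S p
  -- `b` depends only on the lengths in `S`, so for it the sliding direction at `p` is the radial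
  -- one.
  have hvel : fderiv ℝ b p (slideVel S p) = fderiv ℝ b p p := by
    have h1 := hasDerivAt_comp_slide (h.smooth_b.differentiable (by simp)) S p 1
    have h2 := hasDerivAt_comp_smul (h.smooth_b.differentiable (by simp)) p
    have h3 : (fun s => b (slide S p s)) = fun s : ℝ => b (s • p) := funext fun s =>
      h.indep_b _ _ fun e he => by simp [slide, he]
    rw [h3, s1] at h1
    exact h1.unique h2
  have pc' : c (slide S p 1) ≠ 0 := by rw [s1]; exact pc.ne'
  have hess : ContinuousAt (fun w : (E → ℝ) × ℝ => slideHess S b c w.1 w.2) (p, 1) := by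
    unfold slideHess
    have cc0 : ContinuousAt (fun w : (E → ℝ) × ℝ => c (slide S w.1 w.2)) (p, 1) := cc.continuousAt
    refine ((((cb'.clm_apply W).pow 2).continuousAt.sub
      ((((cb.pow 2).mul ((cc'.clm_apply W).pow 2)).continuousAt).div (cc0.pow 2)
        (pow_ne_zero 2 pc'))).add ((((cb.pow 2).mul
        ((cc''.clm_apply W).clm_apply W)).continuousAt).div cc0 pc')).sub
      (cb.mul ((cb''.clm_apply W).clm_apply W)).continuousAt
  have small : ContinuousAt (fun w : (E → ℝ) × ℝ => b (slide S w.1 w.2) *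
      (fderiv ℝ c (slide S w.1 w.2) (slide S w.1 w.2) / c (slide S w.1 w.2))) (p, 1) :=
    cb.continuousAt.mul ((cc'.clm_apply X).continuousAt.div cc.continuousAt pc')
  have ca1 : ContinuousAt (fun w : (E → ℝ) × ℝ => fderiv ℝ a w.1 w.1) (p, 1) := ca'.continuousAt
  have cb1 : ContinuousAt (fun w : (E → ℝ) × ℝ =>
      fderiv ℝ b (slide S w.1 w.2) (slide S w.1 w.2)) (p, 1) := (cb'.clm_apply X).continuousAt
  have cb2 : ContinuousAt (fun w : (E → ℝ) × ℝ =>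
      fderiv ℝ b (slide S w.1 w.2) (slideVel S w.1)) (p, 1) := (cb'.clm_apply W).continuousAt
  have cc1 : ContinuousAt (fun w : (E → ℝ) × ℝ => c (slide S w.1 w.2)) (p, 1) := cc.continuousAt
  have cl : ContinuousAt (fun w : (E → ℝ) × ℝ => c (slide S w.1 w.2) -
      a w.1 * b (slide S w.1 w.2)) (p, 1) := (cc.sub (ca.mul cb)).continuousAt
  have v1 : k < fderiv ℝ b (slide S p 1) (slide S p 1) := by rwa [s1]
  have v2 : k < fderiv ℝ b (slide S p 1) (slideVel S p) := by rwa [s1, hvel]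
  have v3 : 0 < c (slide S p 1) := by rwa [s1]
  have v4 : b (slide S p 1) * (fderiv ℝ c (slide S p 1) (slide S p 1) / c (slide S p 1)) <
      k / 2 := by
    rw [s1, pb, zero_mul]
    exact half_pos hk
  have v5 : 0 < c (slide S p 1) - a p * b (slide S p 1) := by rwa [s1, pa, zero_mul, sub_zero]
  filter_upwards [ca1.eventually_const_lt ka, cb1.eventually_const_lt v1,
    cb2.eventually_const_lt v2, cc1.eventually_const_lt v3, hess.eventually_lt_const hM,
    small.eventually_lt_const v4, cl.eventually_const_lt v5] with w h1 h2 h3 h4 h5 h6 h7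
  exact ⟨h1, h2, h3, h4, h5, h6, sub_pos.1 h7⟩

lemma Split.slideLen_pos {k M : ℝ} {q : E → ℝ} {s : ℝ} (hw : SlideBounds S a b c k M q s)
    (hα : 0 < a q) (hB : 0 < b (slide S q s)) : 0 < slideLen S a b c q s := by
  refine mul_pos (by norm_num) (Real.log_pos ?_)
  rw [one_lt_div (mul_pos hα hB)]
  exact hw.lt

/-- The squared norm is `(a / b) * slideHess / Kf`. The bound `Kf ≥ (k / 2) √(a b)` balances the two
variables: a positive power of `a` is left, and a power of `b` whose square root is integrable along
the slide. -/
lemma Split.norm_slidePath_le (hH : H.Good) (h : H.Split e₀ S a b c) {k M : ℝ} (hk : 0 < k)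
    (hM : 0 < M) {q : E → ℝ} {s : ℝ} (hw : SlideBounds S a b c k M q s)
    (hα : 0 < a q) (hB : 0 < b (slide S q s)) (hu : slidePath e₀ S a b c q s ∈ H.unitSpace) :
    H.entropyNorm (slidePath e₀ S a b c q s) (deriv (slidePath e₀ S a b c q) s) ≤
      Real.sqrt (2 * M / k * (Real.sqrt (a q) /
        (b (slide S q s) * Real.sqrt (b (slide S q s))))) := by
  classical
  have hd := h.hasDerivAt_slidePath hα hB hw.pos_c
  have htan : fderiv ℝ H.entropy (slidePath e₀ S a b c q s)
      (deriv (slidePath e₀ S a b c q) s) = 0 := by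
    have h1 := hasDerivAt_FH (H := H) (g := slidePath e₀ S a b c q) (hasDerivAt_pi.1 hd)
    have h2 : (fun s => H.FH (slidePath e₀ S a b c q s)) =ᶠ[𝓝 s] fun _ => 0 := by
      have e1 : ContinuousAt (fun s => b (slide S q s)) s :=
        (hasDerivAt_comp_slide (h.smooth_b.differentiable (by simp)) S q s).continuousAt
      have e2 : ContinuousAt (fun s => c (slide S q s)) s :=
        (hasDerivAt_comp_slide (h.smooth_c.differentiable (by simp)) S q s).continuousAt
      filter_upwards [e1.eventually_const_lt hB, e2.eventually_const_lt hw.pos_c] with s' h3 h4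
      exact h.FH_slidePath hα h3 h4
    have h3 := h1.unique ((hasDerivAt_const s (0 : ℝ)).congr_of_eventuallyEq h2)
    rw [hd.deriv]
    have h4 := hH.fderiv_detFun_unit hu (Function.update (slideVel S q) e₀
      (1 / 2 * (fderiv ℝ c (slide S q s) (slideVel S q) / c (slide S q s) -
        fderiv ℝ b (slide S q s) (slideVel S q) / b (slide S q s))))
    have h5 : ∀ w : E → ℝ, (fun e => -(yexp (slidePath e₀ S a b c q s) e * w e)) =
      -fun e => yexp (slidePath e₀ S a b c q s) e * w e := fun w => rfl
    rw [h5, map_neg, neg_eq_zero] at h3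
    refine (mul_eq_zero.1 (h4.symm.trans ?_)).resolve_right (hH.Kf_pos hu).ne'
    convert h3
  rw [hH.entropyNorm_eq hu htan]
  refine Real.sqrt_le_sqrt ?_
  have hN := h.Nf_slidePath hα hB hw.pos_c
  have hK := h.Kf_slidePath hα hB hw.pos_c
  have hl := Split.slideLen_pos hw hα hB
  have hd' : deriv (slidePath e₀ S a b c q) s = _ := hd.deriv
  rw [hd', show H.Nf (yexp (slidePath e₀ S a b c q s)) _ = _ from hN]
  -- The error term costs at most half of `k a`, the term with the length of `e₀` is nonnegative,
  -- and `√a √b ≤ a + b`.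
  have hKlow : k / 2 * (Real.sqrt (a q) * Real.sqrt (b (slide S q s))) ≤
      H.Kf (yexp (slidePath e₀ S a b c q s)) := by
    rw [hK]
    have t1 := mul_le_mul_of_nonneg_right hw.der_a.le hB.le
    have t2 := mul_le_mul_of_nonneg_left hw.der_b.le hα.le
    have t3 := mul_nonneg (mul_nonneg zero_le_two hl.le) (mul_pos hα hB).le
    have t4 := mul_le_mul_of_nonneg_left hw.small.le hα.le
    have t5 : Real.sqrt (a q) * Real.sqrt (b (slide S q s)) ≤ a q + b (slide S q s) := by
      have e1 := Real.sq_sqrt hα.le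
      have e2 := Real.sq_sqrt hB.le
      have e3 := Real.sqrt_nonneg (a q)
      have e4 := Real.sqrt_nonneg (b (slide S q s))
      nlinarith [sq_nonneg (Real.sqrt (a q) - Real.sqrt (b (slide S q s)))]
    have t6 := mul_le_mul_of_nonneg_left t5 (half_pos hk).le
    have t7 := mul_pos hk hB
    linarith
  have hsa := Real.sqrt_pos.2 hα
  have hsb := Real.sqrt_pos.2 hB
  have hKpos := hH.Kf_pos hu
  rw [neg_div, neg_neg]
  calc a q / b (slide S q s) * slideHess S b c q s / H.Kf (yexp (slidePath e₀ S a b c q s))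
      ≤ a q / b (slide S q s) * M / H.Kf (yexp (slidePath e₀ S a b c q s)) := by
        gcongr
        exact hw.hess.le
    _ ≤ a q / b (slide S q s) * M / (k / 2 * (Real.sqrt (a q) * Real.sqrt (b (slide S q s)))) := by
        gcongr
    _ = 2 * M / k * (Real.sqrt (a q) / (b (slide S q s) * Real.sqrt (b (slide S q s)))) := by
        have e1 := Real.mul_self_sqrt hα.le
        field_simp
        rw [Real.sq_sqrt hα.le]

/-- By the mean value inequality `b ≥ k (s - 1)` along the slide, so the speed is at most a constant
times `a^(1/4) (s - 1)^(-3/4)`, which is integrable, and `a q → a p = 0`. The vector `q` carries the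
lengths of `x` away from `e₀`; its own entry at `e₀` is arbitrary, because the length of `e₀` in `x`
need not stay bounded. -/
theorem Split.exists_step (hH : H.Good) (h : H.Split e₀ S a b c) {p : E → ℝ}
    (pa : a p = 0) (pb : b p = 0) (ka : 0 < fderiv ℝ a p p) (kb : 0 < fderiv ℝ b p p)
    (pc : 0 < c p) : ∃ δ : ℝ, 0 < δ ∧ ∃ Q : ℝ, 0 < c (slide S p (1 + δ)) ∧
      ∀ᶠ q in 𝓝 p, ∀ x ∈ H.unitSpace, (∀ e, e ≠ e₀ → q e = x e) →
        0 < a q ∧ 0 < b (slide S q (1 + δ)) ∧ 0 < c (slide S q (1 + δ)) ∧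
        slidePath e₀ S a b c q (1 + δ) ∈ H.unitSpace ∧
        H.entropyDist x (slidePath e₀ S a b c q (1 + δ)) ≤
          ENNReal.ofReal (Real.sqrt (Q * Real.sqrt (a q))) := by
  set k := min (fderiv ℝ a p p) (fderiv ℝ b p p) / 2 with hk
  have hk0 : 0 < k := half_pos (lt_min ka kb)
  have hmin : k < min (fderiv ℝ a p p) (fderiv ℝ b p p) := half_lt_self (lt_min ka kb)
  set M := max (slideHess S b c p 1) 0 + 1 with hM
  have hM0 : 0 < M := by positivity
  have hev := eventually_slideBounds h hk0 pa pb (hmin.trans_le (min_le_left _ _))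
    (hmin.trans_le (min_le_right _ _)) pc (M := M) ((le_max_left _ _).trans_lt (lt_add_one _))
  rw [nhds_prod_eq] at hev
  obtain ⟨U, hU, W, hW, hUW⟩ := mem_prod_iff.1 hev
  obtain ⟨ε, hε, hball⟩ := Metric.mem_nhds_iff.1 hW
  set δ := ε / 2 with hδ
  have hδ0 : 0 < δ := half_pos hε
  have hin : ∀ q ∈ U, ∀ s ∈ Set.Icc (1 : ℝ) (1 + δ), SlideBounds S a b c k M q s := by
    intro q hq s hs
    refine hUW (Set.mk_mem_prod hq (hball ?_))
    rw [Metric.mem_ball, Real.dist_eq, abs_of_nonneg (sub_nonneg.2 hs.1)]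
    linarith [hs.2]
  set m := Real.sqrt (k * δ) with hm
  have hm0 : 0 < m := Real.sqrt_pos.2 (mul_pos hk0 hδ0)
  -- With `s = 1 + δ τ ^ 4` the derivative is `4 δ τ ^ 3` and `b ≥ (m τ ^ 2) ^ 2`, so in the squared
  -- speed `τ ^ 6` cancels against the lower bound `m ^ 3 τ ^ 6` for `b √b`.
  set Q := (4 * δ) ^ 2 * (2 * M / k) / m ^ 3 with hQ
  refine ⟨δ, hδ0, Q, (hin p (mem_of_mem_nhds hU) _ ⟨by linarith, le_rfl⟩).pos_c, ?_⟩
  filter_upwards [hU] with q hq x hx hqx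
  have hb' := h.smooth_b.differentiable (by simp)
  have haq : a q = a x := h.indep_a _ _ fun e _ he => hqx e he
  have hα : 0 < a q := haq ▸ h.pos_a x hx
  have hB1 : 0 < b (slide S q 1) := by
    rw [slide_one, h.indep_b q x fun e he => hqx e fun h' => h.notMem (h' ▸ he)]
    exact h.pos_b x hx
  have hgrow : ∀ s ∈ Set.Icc (1 : ℝ) (1 + δ), k * (s - 1) < b (slide S q s) := by
    intro s hs
    have h1 := (convex_Icc (1 : ℝ) (1 + δ)).mul_sub_le_image_sub_of_le_deriv
      (f := fun s => b (slide S q s)) (C := k)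
      (fun t _ => (hasDerivAt_comp_slide hb' S q t).continuousAt.continuousWithinAt)
      (fun t _ => (hasDerivAt_comp_slide hb' S q t).differentiableAt.differentiableWithinAt)
      (fun t ht => by
        rw [(hasDerivAt_comp_slide hb' S q t).deriv]
        exact (hin q hq t (interior_subset ht)).vel_b.le)
      1 ⟨le_rfl, by linarith⟩ s hs hs.1
    linarith
  have hB : ∀ s ∈ Set.Icc (1 : ℝ) (1 + δ), 0 < b (slide S q s) := fun s hs =>
    (mul_nonneg hk0.le (sub_nonneg.2 hs.1)).trans_lt (hgrow s hs)
  have hmem : ∀ s ∈ Set.Icc (1 : ℝ) (1 + δ), slidePath e₀ S a b c q s ∈ H.unitSpace := by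
    classical
    intro s hs
    refine h.mem x hx _ (fun e he => ?_) ?_ (h.FH_slidePath hα (hB s hs) (hin q hq s hs).pos_c)
    · rw [slidePath, Function.update_of_ne he, ← hqx e he, slide]
      split_ifs
      · have : 0 < q e := hqx e he ▸ hx.1 e
        nlinarith [hs.1]
      · exact le_rfl
    · rw [slidePath, Function.update_self]
      exact Split.slideLen_pos (hin q hq s hs) hα (hB s hs)
  have hstart : slidePath e₀ S a b c q 1 = x := by
    classical
    have hC1 := (hin q hq 1 ⟨le_rfl, by linarith⟩).pos_c
    funext e
    by_cases he : e = e₀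
    · rw [he, slidePath, Function.update_self]
      have h1 : H.FH x = 0 := hH.detFun_eq_zero hx
      rw [h.eq, ← haq, h.indep_b x (slide S q 1) fun e he => ?_,
        h.indep_c x (slide S q 1) fun e he => ?_] at h1
      · have h2 := exp_slideLen hα hB1 hC1
        rw [eq_div_iff hC1.ne'] at h2
        have h3 : Real.exp (-2 * slideLen S a b c q 1) = Real.exp (-2 * x e₀) :=
          mul_right_cancel₀ hC1.ne' (by linarith)
        have := Real.exp_injective h3
        linarith
      all_goals rw [slide_one]
      · exact (hqx e he).symm
      · exact (hqx e fun h' => h.notMem (h' ▸ he)).symm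
    · rw [slidePath, Function.update_of_ne he, slide_one, hqx e he]
  have hend : (1 : ℝ) + δ ∈ Set.Icc (1 : ℝ) (1 + δ) := ⟨by linarith, le_rfl⟩
  refine ⟨hα, hB _ hend, (hin q hq _ hend).pos_c, hmem _ hend, ?_⟩
  -- The substitution `s = 1 + δ τ ^ 4` absorbs the singularity `(s - 1)^(-3/4)` at the start.
  have hσ : ∀ τ ∈ Set.Icc (0 : ℝ) 1, 1 + δ * τ ^ 4 ∈ Set.Icc (1 : ℝ) (1 + δ) := fun τ hτ => by
    have h1 := pow_le_one₀ (n := 4) hτ.1 hτ.2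
    have h2 := pow_nonneg hτ.1 4
    constructor <;> nlinarith
  have harc := entropyDist_le_arc (H := H) (p := 0) (q := 1)
    (γ := fun τ => slidePath e₀ S a b c q (1 + δ * τ ^ 4)) ?_ ?_
  · beta_reduce at harc
    rw [show (1 : ℝ) + δ * 0 ^ 4 = 1 by ring, hstart, show (1 : ℝ) + δ * 1 ^ 4 = 1 + δ by ring]
      at harc
    refine harc.trans ?_
    rw [Set.uIcc_of_le (zero_le_one' ℝ)]
    calc _ ≤ ∫⁻ t in Set.Icc (0 : ℝ) 1, ENNReal.ofReal (Real.sqrt (Q * Real.sqrt (a q))) := by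
          refine setLIntegral_mono' measurableSet_Icc fun τ hτ => ENNReal.ofReal_le_ofReal ?_
          have hs := hσ τ hτ
          have hd : HasDerivAt (fun τ : ℝ => 1 + δ * τ ^ 4) (4 * δ * τ ^ 3) τ := by
            have := ((hasDerivAt_pow 4 τ).const_mul δ).const_add 1
            refine this.congr_deriv ?_
            norm_num
            ring
          have hd2 := (h.contDiffAt_slidePath hα (hB _ hs) (hin q hq _ hs).pos_c).differentiableAt
            (by simp) |>.hasDerivAt.scomp τ hd
          rw [show deriv (fun τ => slidePath e₀ S a b c q (1 + δ * τ ^ 4)) τ = _ from hd2.deriv,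
            entropyNorm_smul]
          have hτ3 : 0 ≤ 4 * δ * τ ^ 3 := by
            have := pow_nonneg hτ.1 3
            positivity
          rw [abs_of_nonneg hτ3]
          refine (mul_le_mul_of_nonneg_left (Split.norm_slidePath_le hH h hk0 hM0 (hin q hq _ hs) hα
            (hB _ hs) (hmem _ hs)) hτ3).trans ?_
          rw [← Real.sqrt_sq hτ3, ← Real.sqrt_mul (sq_nonneg _)]
          refine Real.sqrt_le_sqrt ?_
          rcases hτ.1.eq_or_lt with rfl | h0
          · have : 0 ≤ Q * Real.sqrt (a q) := by positivity
            simpa using this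
          · have hBs := hB _ hs
            have hlow : (m * τ ^ 2) ^ 2 ≤ b (slide S q (1 + δ * τ ^ 4)) := by
              have := (hgrow _ hs).le
              rw [mul_pow, hm, Real.sq_sqrt (mul_pos hk0 hδ0).le]
              calc _ = k * (1 + δ * τ ^ 4 - 1) := by ring
                _ ≤ _ := this
            have hlow2 : m * τ ^ 2 ≤ Real.sqrt (b (slide S q (1 + δ * τ ^ 4))) :=
              Real.le_sqrt_of_sq_le hlow
            have hprod : m ^ 3 * τ ^ 6 ≤ b (slide S q (1 + δ * τ ^ 4)) *
                Real.sqrt (b (slide S q (1 + δ * τ ^ 4))) := by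
              calc m ^ 3 * τ ^ 6 = (m * τ ^ 2) ^ 2 * (m * τ ^ 2) := by ring
                _ ≤ _ := by gcongr
            calc (4 * δ * τ ^ 3) ^ 2 * (2 * M / k * (Real.sqrt (a q) /
                  (b (slide S q (1 + δ * τ ^ 4)) * Real.sqrt (b (slide S q (1 + δ * τ ^ 4))))))
                ≤ (4 * δ * τ ^ 3) ^ 2 * (2 * M / k * (Real.sqrt (a q) / (m ^ 3 * τ ^ 6))) := by
                  gcongr
              _ = Q * Real.sqrt (a q) := by
                  rw [hQ]
                  field_simp
      _ = ENNReal.ofReal (Real.sqrt (Q * Real.sqrt (a q))) := by simp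
  · intro τ hτ
    rw [Set.uIcc_of_le (zero_le_one' ℝ)] at hτ
    have hs := hσ τ hτ
    exact ContDiffAt.comp (f := fun τ : ℝ => 1 + δ * τ ^ 4) τ
      (h.contDiffAt_slidePath hα (hB _ hs) (hin q hq _ hs).pos_c) (by fun_prop)
  · intro τ hτ
    rw [Set.uIcc_of_le (zero_le_one' ℝ)] at hτ
    exact hmem _ (hσ τ hτ)

end Step

end OGraph

end

noncomputable section

set_option linter.unusedSectionVars false

namespace SepEdge

open OGraph

variable {V₁ E₁ V₂ E₂ : Type*} [Fintype E₁] [Fintype E₂]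
  {G₁ : OGraph V₁ E₁} {G₂ : OGraph V₂ E₂} {v₁ : V₁} {v₂ : V₂}

/-! ### The splitting of the joined determinant, in both orders -/

section JoinSplit

/-- A criterion for unit entropy of the joined graph. -/
lemma mem_unitSpace_of_detFun (h₁ : G₁.Good) (h₂ : G₂.Good) {l : Edge E₁ E₂ → ℝ}
    (hl : l ∈ (join G₁ G₂ v₁ v₂).lengthSpace) (s₁ : ¬ SubInv (G₁.T (yexp (res₁ l))))
    (s₂ : ¬ SubInv (G₂.T (yexp (res₂ l)))) (h0 : (join G₁ G₂ v₁ v₂).detFun (yexp l) = 0) :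
    l ∈ (join G₁ G₂ v₁ v₂).unitSpace := by
  have hJ := good_join (v₁ := v₁) (v₂ := v₂) h₁ h₂
  have hpos : ∀ e, 0 ≤ yexp l e := fun e => (yexp_pos l e).le
  refine ⟨hl, le_antisymm ?_ ?_⟩
  · by_contra! hlt
    set s := (join G₁ G₂ v₁ v₂).entropy l with hs
    have hs0 : 0 < s := zero_lt_one.trans hlt
    have hsl := smul_mem_lengthSpace (H := join G₁ G₂ v₁ v₂) hl hs0
    have hle : ∀ e, yexp (s • l) e ≤ yexp l e := fun e => by
      refine Real.exp_le_exp.2 (neg_le_neg ?_)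
      rw [Pi.smul_apply, smul_eq_mul]
      exact le_mul_of_one_le_left (hl e).le hlt.le
    have hlt' : yexp (s • l) none < yexp l none := by
      refine Real.exp_lt_exp.2 (neg_lt_neg ?_)
      rw [Pi.smul_apply, smul_eq_mul]
      exact lt_mul_of_one_lt_left (hl none) hlt
    have hpos' : ∀ e, 0 ≤ yexp (s • l) e := fun e => (yexp_pos _ e).le
    have s₁' : ¬ SubInv (G₁.T (res₁ (yexp (s • l)))) := fun h =>
      s₁ (h.mono (T_mono fun e => hle (some (Sum.inl e))))
    have s₂' : ¬ SubInv (G₂.T (res₂ (yexp (s • l)))) := fun h =>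
      s₂ (h.mono (T_mono fun e => hle (some (Sum.inr e))))
    refine not_subInv_join (v₁ := v₁) (v₂ := v₂) hpos' s₁' s₂' ?_
      ((hJ.subInv_iff hsl).2 (by rw [hJ.entropy_smul hl hs0, ← hs, div_self hs0.ne']))
    rw [detFun_join] at h0 ⊢
    obtain ⟨a1, a2⟩ := Pf_div_mono (v := v₁) (fun e => hpos' (some (Sum.inl e)))
      (fun e => hle (some (Sum.inl e))) s₁
    obtain ⟨b1, b2⟩ := Pf_div_mono (v := v₂) (fun e => hpos' (some (Sum.inr e)))
      (fun e => hle (some (Sum.inr e))) s₂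
    have d₁ : 0 < G₁.detFun (res₁ (yexp l)) := detFun_pos (fun e => hpos _) s₁
    have d₂ : 0 < G₂.detFun (res₂ (yexp l)) := detFun_pos (fun e => hpos _) s₂
    have d₁' : 0 < G₁.detFun (res₁ (yexp (s • l))) := detFun_pos (fun e => hpos' _) s₁'
    have d₂' : 0 < G₂.detFun (res₂ (yexp (s • l))) := detFun_pos (fun e => hpos' _) s₂'
    change 0 ≤ G₁.Pf v₁ (res₁ (yexp (s • l))) / G₁.detFun (res₁ (yexp (s • l))) at a1
    change 0 ≤ G₂.Pf v₂ (res₂ (yexp (s • l))) / G₂.detFun (res₂ (yexp (s • l))) at b1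
    change G₁.Pf v₁ (res₁ (yexp (s • l))) / G₁.detFun (res₁ (yexp (s • l))) ≤
      G₁.Pf v₁ (res₁ (yexp l)) / G₁.detFun (res₁ (yexp l)) at a2
    change G₂.Pf v₂ (res₂ (yexp (s • l))) / G₂.detFun (res₂ (yexp (s • l))) ≤
      G₂.Pf v₂ (res₂ (yexp l)) / G₂.detFun (res₂ (yexp l)) at b2
    set A := G₁.detFun (res₁ (yexp l))
    set B := G₂.detFun (res₂ (yexp l))
    set A' := G₁.detFun (res₁ (yexp (s • l)))
    set B' := G₂.detFun (res₂ (yexp (s • l)))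
    set P := G₁.Pf v₁ (res₁ (yexp l))
    set R := G₂.Pf v₂ (res₂ (yexp l))
    set P' := G₁.Pf v₁ (res₁ (yexp (s • l)))
    set R' := G₂.Pf v₂ (res₂ (yexp (s • l)))
    set y := yexp l none
    set y' := yexp (s • l) none
    -- `F = 0` says that round trips through `e₀` have total weight one. At `s • l` with `s > 1` the
    -- loops are no heavier and `e₀` is strictly lighter, so `F > 0` and `s` cannot be the entropy.
    have e1 : y ^ 2 * (P / A * (R / B)) = 1 := by
      field_simp
      linarith
    have e2 : y' ^ 2 * (P' / A' * (R' / B')) < 1 := by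
      rw [← e1]
      have hq : 0 < P / A * (R / B) := by
        rcases (mul_nonneg (a1.trans a2) (b1.trans b2)).eq_or_lt with h | h
        · rw [← h, mul_zero] at e1
          exact absurd e1 zero_ne_one
        · exact h
      calc y' ^ 2 * (P' / A' * (R' / B')) ≤ y' ^ 2 * (P / A * (R / B)) := by
            have := a1.trans a2
            gcongr
        _ < _ := by
            have : 0 ≤ y' := hpos' none
            gcongr
    have e3 : A' * B' - y' ^ 2 * (P' * R') = A' * B' * (1 - y' ^ 2 * (P' / A' * (R' / B'))) := by
      field_simp
    rw [e3]
    exact mul_pos (mul_pos d₁' d₂') (sub_pos.2 e2)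
  · refine (hJ.subInv_iff hl).1 (not_not.1 fun h => ?_)
    exact (detFun_pos hpos h).ne' h0

lemma FH_join (l : Edge E₁ E₂ → ℝ) : (join G₁ G₂ v₁ v₂).FH l =
    G₁.FH (res₁ l) * G₂.FH (res₂ l) -
      Real.exp (-2 * l none) * (G₁.Pf v₁ (yexp (res₁ l)) * G₂.Pf v₂ (yexp (res₂ l))) := by
  unfold FH
  rw [detFun_join, show yexp l none = Real.exp (-l none) from rfl, ← Real.exp_nat_mul]
  push_cast
  rw [show (2 : ℝ) * -l none = -2 * l none by ring]
  rfl

lemma contDiff_res₁ : ContDiff ℝ ∞ (res₁ : (Edge E₁ E₂ → ℝ) → E₁ → ℝ) :=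
  contDiff_pi.2 fun _ => contDiff_apply _ _ _

lemma contDiff_res₂ : ContDiff ℝ ∞ (res₂ : (Edge E₁ E₂ → ℝ) → E₂ → ℝ) :=
  contDiff_pi.2 fun _ => contDiff_apply _ _ _

lemma contDiff_Pf_mul : ContDiff ℝ ∞ fun l : Edge E₁ E₂ → ℝ =>
    G₁.Pf v₁ (yexp (res₁ l)) * G₂.Pf v₂ (yexp (res₂ l)) :=
  ((contDiff_Pf.comp contDiff_yexp).comp contDiff_res₁).mul
    ((contDiff_Pf.comp contDiff_yexp).comp contDiff_res₂)

lemma FH_pos_of_unit (h₁ : G₁.Good) (h₂ : G₂.Good) {l : Edge E₁ E₂ → ℝ}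
    (hl : l ∈ (join G₁ G₂ v₁ v₂).unitSpace) : 0 < G₁.FH (res₁ l) ∧ 0 < G₂.FH (res₂ l) := by
  have h := not_subInv_of_unit (good_join h₁ h₂) hl
  exact ⟨detFun_pos (fun e => (yexp_pos _ e).le) h.1, detFun_pos (fun e => (yexp_pos _ e).le) h.2⟩

lemma mem_unitSpace_of_le (h₁ : G₁.Good) (h₂ : G₂.Good) {l : Edge E₁ E₂ → ℝ}
    (hl : l ∈ (join G₁ G₂ v₁ v₂).unitSpace) (l' : Edge E₁ E₂ → ℝ)
    (hle : ∀ e, e ≠ none → l e ≤ l' e) (h0 : 0 < l' none)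
    (hF : (join G₁ G₂ v₁ v₂).FH l' = 0) : l' ∈ (join G₁ G₂ v₁ v₂).unitSpace := by
  have h := not_subInv_of_unit (good_join h₁ h₂) hl
  refine mem_unitSpace_of_detFun h₁ h₂ (fun e => ?_) (fun h' => h.1 (h'.mono (T_mono fun e => ?_)))
    (fun h' => h.2 (h'.mono (T_mono fun e => ?_))) hF
  · rcases e with _ | e
    · exact h0
    · exact (hl.1 _).trans_le (hle _ (Option.some_ne_none e))
  · exact Real.exp_le_exp.2 (neg_le_neg (hle _ (Option.some_ne_none _)))
  · exact Real.exp_le_exp.2 (neg_le_neg (hle _ (Option.some_ne_none _)))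

/-- The edges of the first graph. -/
def left (E₁ E₂ : Type*) : Set (Edge E₁ E₂) := Set.range fun e : E₁ => some (Sum.inl e)

/-- The edges of the second graph. -/
def right (E₁ E₂ : Type*) : Set (Edge E₁ E₂) := Set.range fun e : E₂ => some (Sum.inr e)

lemma inl_mem_left (e : E₁) : (some (Sum.inl e) : Edge E₁ E₂) ∈ left E₁ E₂ := ⟨e, rfl⟩

lemma inr_mem_right (e : E₂) : (some (Sum.inr e) : Edge E₁ E₂) ∈ right E₁ E₂ := ⟨e, rfl⟩

lemma inr_notMem_left (e : E₂) : (some (Sum.inr e) : Edge E₁ E₂) ∉ left E₁ E₂ := by simp [left]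

lemma inl_notMem_right (e : E₁) : (some (Sum.inl e) : Edge E₁ E₂) ∉ right E₁ E₂ := by simp [right]

lemma none_notMem_left : (none : Edge E₁ E₂) ∉ left E₁ E₂ := by simp [left]

lemma none_notMem_right : (none : Edge E₁ E₂) ∉ right E₁ E₂ := by simp [right]

theorem split_right (h₁ : G₁.Good) (h₂ : G₂.Good) : (join G₁ G₂ v₁ v₂).Split none (right E₁ E₂)
    (fun l => G₁.FH (res₁ l)) (fun l => G₂.FH (res₂ l))
    (fun l => G₁.Pf v₁ (yexp (res₁ l)) * G₂.Pf v₂ (yexp (res₂ l))) where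
  notMem := none_notMem_right
  smooth_a := contDiff_FH.comp contDiff_res₁
  smooth_b := contDiff_FH.comp contDiff_res₂
  smooth_c := contDiff_Pf_mul
  indep_a l l' h := congrArg G₁.FH (funext fun e => h _ (inl_notMem_right e) (Option.some_ne_none _))
  indep_b l l' h := congrArg G₂.FH (funext fun e => h _ (inr_mem_right e))
  indep_c l l' h := by
    have e1 : res₁ l = res₁ l' := funext fun e => h _ (Option.some_ne_none _)
    have e2 : res₂ l = res₂ l' := funext fun e => h _ (Option.some_ne_none _)
    rw [e1, e2]
  eq := FH_join
  pos_a l hl := (FH_pos_of_unit h₁ h₂ hl).1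
  pos_b l hl := (FH_pos_of_unit h₁ h₂ hl).2
  mem l hl l' := mem_unitSpace_of_le h₁ h₂ hl l'

theorem split_left (h₁ : G₁.Good) (h₂ : G₂.Good) : (join G₁ G₂ v₁ v₂).Split none (left E₁ E₂)
    (fun l => G₂.FH (res₂ l)) (fun l => G₁.FH (res₁ l))
    (fun l => G₁.Pf v₁ (yexp (res₁ l)) * G₂.Pf v₂ (yexp (res₂ l))) where
  notMem := none_notMem_left
  smooth_a := contDiff_FH.comp contDiff_res₂
  smooth_b := contDiff_FH.comp contDiff_res₁
  smooth_c := contDiff_Pf_mul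
  indep_a l l' h := congrArg G₂.FH (funext fun e => h _ (inr_notMem_left e) (Option.some_ne_none _))
  indep_b l l' h := congrArg G₁.FH (funext fun e => h _ (inl_mem_left e))
  indep_c := (split_right h₁ h₂).indep_c
  eq l := by rw [FH_join, mul_comm (G₁.FH _)]
  pos_a l hl := (FH_pos_of_unit h₁ h₂ hl).2
  pos_b l hl := (FH_pos_of_unit h₁ h₂ hl).1
  mem l hl l' := mem_unitSpace_of_le h₁ h₂ hl l'

lemma fderiv_FH_res₁_pos (h₁ : G₁.Good) {p : Edge E₁ E₂ → ℝ} (hp : res₁ p ∈ G₁.unitSpace) :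
    0 < fderiv ℝ (fun l : Edge E₁ E₂ → ℝ => G₁.FH (res₁ l)) p p := by
  have d := hasDerivAt_comp_smul (f := fun l : Edge E₁ E₂ → ℝ => G₁.FH (res₁ l))
    ((contDiff_FH.comp contDiff_res₁).differentiable (by simp)) p
  have d' := hasDerivAt_FH_smul (H := G₁) (res₁ p) one_ne_zero
  rw [d.unique d', one_smul, div_one]
  exact h₁.Kf_pos hp

lemma fderiv_FH_res₂_pos (h₂ : G₂.Good) {p : Edge E₁ E₂ → ℝ} (hp : res₂ p ∈ G₂.unitSpace) :
    0 < fderiv ℝ (fun l : Edge E₁ E₂ → ℝ => G₂.FH (res₂ l)) p p := by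
  have d := hasDerivAt_comp_smul (f := fun l : Edge E₁ E₂ → ℝ => G₂.FH (res₂ l))
    ((contDiff_FH.comp contDiff_res₂).differentiable (by simp)) p
  have d' := hasDerivAt_FH_smul (H := G₂) (res₂ p) one_ne_zero
  rw [d.unique d', one_smul, div_one]
  exact h₂.Kf_pos hp

end JoinSplit

/-! ### Leaving singular points inside the unit entropy space -/

section Transport

/-- Near a point at which both factors of the determinant vanish, the points of the unit entropy
space are asymptotically at distance zero from stretched ones. -/
theorem Split.near_stretch (h₁ : G₁.Good) (h₂ : G₂.Good) {S : Set (Edge E₁ E₂)}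
    {a b c : (Edge E₁ E₂ → ℝ) → ℝ} (h : (join G₁ G₂ v₁ v₂).Split none S a b c)
    {p : ExtLength E₁ E₂} (p0 : p none = ⊤) (pf : ∀ e, e ≠ none → p e ≠ ⊤)
    (pa : a (fun e => (p e).toReal) = 0) (pb : b (fun e => (p e).toReal) = 0)
    (ka : 0 < fderiv ℝ a (fun e => (p e).toReal) fun e => (p e).toReal)
    (kb : 0 < fderiv ℝ b (fun e => (p e).toReal) fun e => (p e).toReal)
    (pc : 0 < c fun e => (p e).toReal)
    (hreg : ∀ t ∈ Set.Ioo (0 : ℝ) 1, stretch S p t ∈ reg G₁ G₂ v₁ v₂) :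
    ∃ t ∈ Set.Ioo (0 : ℝ) 1, Near G₁ G₂ v₁ v₂ p (stretch S p t) 0 := by
  classical
  have hJ := good_join (v₁ := v₁) (v₂ := v₂) h₁ h₂
  set P : Edge E₁ E₂ → ℝ := fun e => (p e).toReal with hP
  obtain ⟨δ, hδ, Q, hcδ, hev⟩ := h.exists_step hJ pa pb ka kb pc
  have hδ1 : 0 < 1 + δ := by linarith
  -- Chosen so that `1 / (1 - t) = 1 + δ`: stretching up to time `t` is sliding up to parameter `1 +
  -- δ`.
  set t := δ / (1 + δ) with ht
  have h1t : 1 - t = (1 + δ)⁻¹ := by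
    rw [ht]
    field_simp
    ring
  have htm : t ∈ Set.Ioo (0 : ℝ) 1 := ⟨by positivity, by rw [← sub_pos, h1t]; positivity⟩
  refine ⟨t, htm, ?_⟩
  have hst : ∀ e, e ≠ none → stretch S p t e = ENNReal.ofReal (slide S P (1 + δ) e) := by
    intro e he
    unfold stretch slide
    split_ifs
    · rw [h1t, ENNReal.ofReal_inv_of_pos hδ1, div_eq_mul_inv, inv_inv,
        ENNReal.ofReal_mul hδ1.le, hP, ENNReal.ofReal_toReal (pf e he), mul_comm]
    · rw [hP, ENNReal.ofReal_toReal (pf e he)]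
  have hst0 : stretch S p t none = ⊤ := by
    rw [stretch, if_neg h.notMem, p0]
  -- The length of `e₀` diverges near `p`. Replacing it by `0 = toReal ⊤` makes `q x` converge to
  -- `P`.
  set q : (Edge E₁ E₂ → ℝ) → Edge E₁ E₂ → ℝ := fun x => Function.update x none 0 with hq
  have hqt : Tendsto q (nearby G₁ G₂ v₁ v₂ p) (𝓝 P) := by
    refine tendsto_pi_nhds.2 fun e => ?_
    by_cases he : e = none
    · subst he
      simp only [hq, hP, p0, Function.update_self, ENNReal.toReal_top]
      exact tendsto_const_nhds
    · have e1 : Tendsto (fun x => (incl x e).toReal) (nearby G₁ G₂ v₁ v₂ p) (𝓝 (P e)) :=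
        (ENNReal.tendsto_toReal (pf e he)).comp
          (((continuous_apply e).tendsto p).comp (tendsto_incl_nearby p))
      refine e1.congr' ?_
      filter_upwards [eventually_nearby_mem p] with x hx
      simp only [hq, Function.update_of_ne he, incl, ENNReal.toReal_ofReal (hx.1 e).le]
  set f : (Edge E₁ E₂ → ℝ) → Edge E₁ E₂ → ℝ := fun x => slidePath none S a b c (q x) (1 + δ)
    with hf
  have hstep : ∀ᶠ x in nearby G₁ G₂ v₁ v₂ p, 0 < a (q x) ∧ 0 < b (slide S (q x) (1 + δ)) ∧
      0 < c (slide S (q x) (1 + δ)) ∧ f x ∈ (join G₁ G₂ v₁ v₂).unitSpace ∧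
      (join G₁ G₂ v₁ v₂).entropyDist x (f x) ≤
        ENNReal.ofReal (Real.sqrt (Q * Real.sqrt (a (q x)))) := by
    filter_upwards [hqt.eventually hev, eventually_nearby_mem p] with x hx hxu
    exact hx x hxu fun e he => Function.update_of_ne he _ _
  have hat : Tendsto (fun x => a (q x)) (nearby G₁ G₂ v₁ v₂ p) (𝓝 0) := by
    rw [← pa]
    exact (h.smooth_a.continuous.tendsto P).comp hqt
  have hsl : Tendsto (fun x => slide S (q x) (1 + δ)) (nearby G₁ G₂ v₁ v₂ p)
      (𝓝 (slide S P (1 + δ))) := by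
    have e1 : Continuous fun q : Edge E₁ E₂ → ℝ => slide S q (1 + δ) :=
      (continuous_slide S).comp (Continuous.prodMk_left (1 + δ))
    exact (e1.tendsto P).comp hqt
  have hft : Tendsto f (nearby G₁ G₂ v₁ v₂ p) (nearby G₁ G₂ v₁ v₂ (stretch S p t)) := by
    refine tendsto_nearby_iff.2 ⟨?_, hstep.mono fun x hx => hx.2.2.2.1⟩
    refine isClosedEmbedding_Yc.tendsto_nhds_iff.2 (tendsto_pi_nhds.2 fun e => ?_)
    have hY : (fun x => yexp (f x) e) =ᶠ[nearby G₁ G₂ v₁ v₂ p] fun x => (Yc ∘ fun x => incl (f x)) x e := by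
      filter_upwards [hstep] with x hx
      exact (congrFun (Yc_incl fun e => (hx.2.2.2.1.1 e).le) e).symm
    refine Tendsto.congr' hY ?_
    by_cases he : e = none
    · subst he
      -- At the end of the slide the weight of `e₀` is `√(a b / c)`, which tends to zero with `a`:
      -- the slid points approach `stretch S p t`, where `e₀` is infinite.
      have e2 : Tendsto (fun x => Real.sqrt (a (q x) * b (slide S (q x) (1 + δ)) /
          c (slide S (q x) (1 + δ)))) (nearby G₁ G₂ v₁ v₂ p)
          (𝓝 (Real.sqrt (0 * b (slide S P (1 + δ)) / c (slide S P (1 + δ))))) :=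
        ((hat.mul ((h.smooth_b.continuous.tendsto _).comp hsl)).div
          ((h.smooth_c.continuous.tendsto _).comp hsl) hcδ.ne').sqrt
      rw [zero_mul, zero_div, Real.sqrt_zero] at e2
      rw [show Yc (stretch S p t) none = 0 from expNeg_eq_zero.2 hst0]
      refine e2.congr' ?_
      filter_upwards [hstep] with x hx
      rw [← exp_slideLen hx.1 hx.2.1 hx.2.2.1]
      have e3 : f x none = slideLen S a b c (q x) (1 + δ) := by
        simp only [hf, slidePath, Function.update_self]
      rw [yexp, e3, show ∀ u : ℝ, -2 * u = -u + -u from fun u => by ring, Real.exp_add,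
        Real.sqrt_mul_self (Real.exp_pos _).le]
    · have e1 : ∀ x, f x e = slide S (q x) (1 + δ) e := fun x => slidePath_of_ne he
      have e2 : 0 ≤ slide S P (1 + δ) e := by
        unfold slide
        have : 0 ≤ P e := ENNReal.toReal_nonneg
        split_ifs
        · positivity
        · exact this
      have e3 : Yc (stretch S p t) e = Real.exp (-slide S P (1 + δ) e) := by
        rw [Yc, hst e he, expNeg_ofReal e2]
      rw [e3]
      simp only [yexp, e1]
      exact ((Real.continuous_exp.comp continuous_neg).tendsto _).comp
        (((continuous_apply e).tendsto _).comp hsl)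
  intro ε hε
  have hd : ∀ᶠ x in nearby G₁ G₂ v₁ v₂ p,
      (join G₁ G₂ v₁ v₂).entropyDist x (f x) ≤ ENNReal.ofReal (ε / 2) := by
    have e1 : Tendsto (fun x => Real.sqrt (Q * Real.sqrt (a (q x)))) (nearby G₁ G₂ v₁ v₂ p)
        (𝓝 0) := by
      have := ((hat.sqrt).const_mul Q).sqrt
      simpa using this
    filter_upwards [hstep, e1.eventually_lt_const (half_pos hε)] with x hx hx'
    exact hx.2.2.2.2.trans (ENNReal.ofReal_le_ofReal hx'.le)
  -- The point `stretch S p t` is regular, so points close to it are close to each other.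
  have hn := near_self h₁ h₂ (hreg t htm) (ε / 2) (half_pos hε)
  filter_upwards [(hft.prodMap tendsto_id).eventually hn, hd.prod_inl _] with w hw hw'
  refine (entropyDist_triangle _ (f w.1) _).trans ((add_le_add hw' hw).trans_eq ?_)
  rw [zero_add, zero_add, ← ENNReal.ofReal_add (half_pos hε).le (half_pos hε).le, add_halves]

end Transport

end SepEdge

end

noncomputable section

set_option linter.unusedSectionVars false

namespace SepEdge

open OGraph

variable {V₁ E₁ V₂ E₂ : Type*} [Fintype E₁] [Fintype E₂]
  {G₁ : OGraph V₁ E₁} {G₂ : OGraph V₂ E₂} {v₁ : V₁} {v₂ : V₂}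

/-! ### Any two added points are related at no cost -/

section Collapse

/-- The lengths of the edges of the first graph. -/
def len₁ (p : ExtLength E₁ E₂) : E₁ → ℝ := fun e => (p (some (Sum.inl e))).toReal

/-- The lengths of the edges of the second graph. -/
def len₂ (p : ExtLength E₁ E₂) : E₂ → ℝ := fun e => (p (some (Sum.inr e))).toReal

lemma stretch_zero (T : Set (Edge E₁ E₂)) (p : ExtLength E₁ E₂) : stretch T p 0 = p := by
  funext e
  simp [stretch]

lemma stretch_one (T : Set (Edge E₁ E₂)) {p : ExtLength E₁ E₂} (hp : ∀ e, 0 < p e) :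
    stretch T p 1 = kill T p := by
  funext e
  unfold stretch kill
  split_ifs
  · rw [sub_self, ENNReal.ofReal_zero, ENNReal.div_zero (hp e).ne']
  · rfl

lemma kill_stretch (T : Set (Edge E₁ E₂)) (p : ExtLength E₁ E₂) (t : ℝ) :
    kill T (stretch T p t) = kill T p := by
  funext e
  by_cases he : e ∈ T <;> simp [stretch, kill, he]

lemma kill_none_left {p : ExtLength E₁ E₂} (hp : p ∈ unit₁ G₁ E₂) :
    kill {none} p = top₁ E₂ (len₁ p) := by
  funext e
  rcases e with _ | e | e
  · simp [kill, top₁]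
  · simp [kill, top₁, len₁, ENNReal.ofReal_toReal (hp.2.1.1 e)]
  · simp [kill, top₁, hp.2.2 e]

lemma kill_none_right {p : ExtLength E₁ E₂} (hp : p ∈ unit₂ E₁ G₂) :
    kill {none} p = top₂ E₁ (len₂ p) := by
  funext e
  rcases e with _ | e | e
  · simp [kill, top₂]
  · simp [kill, top₂, hp.2.1 e]
  · simp [kill, top₂, len₂, ENNReal.ofReal_toReal (hp.2.2.1 e)]

lemma kill_right {p : ExtLength E₁ E₂} (hp : p ∈ unit₁₂ G₁ G₂) :
    kill (right E₁ E₂) p = top₁ E₂ (len₁ p) := by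
  funext e
  rcases e with _ | e | e
  · simp [kill, top₁, hp.1]
  · simp [kill, top₁, len₁, ENNReal.ofReal_toReal (hp.2.1.1 e), inl_notMem_right]
  · simp [kill, top₁, inr_mem_right]

lemma kill_left {p : ExtLength E₁ E₂} (hp : p ∈ unit₁₂ G₁ G₂) :
    kill (left E₁ E₂) p = top₂ E₁ (len₂ p) := by
  funext e
  rcases e with _ | e | e
  · simp [kill, top₂, hp.1]
  · simp [kill, top₂, inl_mem_left]
  · simp [kill, top₂, len₂, ENNReal.ofReal_toReal (hp.2.2.1.1 e), inr_notMem_left]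

lemma stretch_none_mem₁ {p : ExtLength E₁ E₂} (hp : p ∈ unit₁ G₁ E₂) (t : ℝ) :
    stretch {none} p t ∈ unit₁ G₁ E₂ := by
  refine ⟨?_, ⟨fun e => ?_, ?_⟩, fun e => ?_⟩
  · simpa [stretch] using hp.1.ne'
  · simpa [stretch] using hp.2.1.1 e
  · simpa [stretch] using hp.2.1.2
  · simpa [stretch] using hp.2.2 e

lemma stretch_none_mem₂ {p : ExtLength E₁ E₂} (hp : p ∈ unit₂ E₁ G₂) (t : ℝ) :
    stretch {none} p t ∈ unit₂ E₁ G₂ := by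
  refine ⟨?_, fun e => ?_, fun e => ?_, ?_⟩
  · simpa [stretch] using hp.1.ne'
  · simpa [stretch] using hp.2.1 e
  · simpa [stretch] using hp.2.2.1 e
  · simpa [stretch] using hp.2.2.2

lemma stretch_right_mem (h₂ : G₂.Good) {p : ExtLength E₁ E₂} (hp : p ∈ unit₁₂ G₁ G₂)
    (h : FiniteOn₁ G₁.unitSpace p) {t : ℝ} (ht : t ∈ Set.Ioo (0 : ℝ) 1) :
    stretch (right E₁ E₂) p t ∈ unit₁₂ G₁ G₂ ∧ len₁ (stretch (right E₁ E₂) p t) = len₁ p ∧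
      G₂.entropy (len₂ (stretch (right E₁ E₂) p t)) < 1 := by
  have t0 : 0 < 1 - t := sub_pos.2 ht.2
  have e1 : ∀ e : E₁, stretch (right E₁ E₂) p t (some (Sum.inl e)) = p (some (Sum.inl e)) :=
    fun e => if_neg (inl_notMem_right e)
  have e2 : ∀ e : E₂, stretch (right E₁ E₂) p t (some (Sum.inr e)) =
      p (some (Sum.inr e)) / ENNReal.ofReal (1 - t) := fun e => if_pos (inr_mem_right e)
  have l1 : len₁ (stretch (right E₁ E₂) p t) = len₁ p := funext fun e => by
    rw [len₁, e1, len₁]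
  have l2 : len₂ (stretch (right E₁ E₂) p t) = (1 - t)⁻¹ • len₂ p := funext fun e => by
    rw [len₂, e2, ENNReal.toReal_div, ENNReal.toReal_ofReal t0.le, div_eq_inv_mul]
    rfl
  have hlt : G₂.entropy (len₂ (stretch (right E₁ E₂) p t)) < 1 := by
    have hle : G₂.entropy (len₂ p) ≤ 1 := (le_max_right _ _).trans hp.2.2.2.le
    rw [l2, h₂.entropy_smul (l := len₂ p) hp.2.2.1.2 (inv_pos.2 t0), div_inv_eq_mul]
    nlinarith [ht.1]
  refine ⟨⟨(if_neg none_notMem_right).trans hp.1, ⟨fun e => by rw [e1]; exact h.1 e, ?_⟩,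
    ⟨fun e => ?_, ?_⟩, ?_⟩, l1, hlt⟩
  · change len₁ _ ∈ _
    rw [l1]
    exact h.2.1
  · rw [e2]
    exact ENNReal.div_ne_top (hp.2.2.1.1 e) (ENNReal.ofReal_pos.2 t0).ne'
  · change len₂ _ ∈ _
    rw [l2]
    exact smul_mem_lengthSpace hp.2.2.1.2 (inv_pos.2 t0)
  · change max (G₁.entropy (len₁ _)) (G₂.entropy (len₂ _)) = 1
    rw [l1, show G₁.entropy (len₁ p) = 1 from h.2.2, max_eq_left hlt.le]

lemma stretch_left_mem (h₁ : G₁.Good) {p : ExtLength E₁ E₂} (hp : p ∈ unit₁₂ G₁ G₂)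
    (h : FiniteOn₂ G₂.unitSpace p) {t : ℝ} (ht : t ∈ Set.Ioo (0 : ℝ) 1) :
    stretch (left E₁ E₂) p t ∈ unit₁₂ G₁ G₂ ∧ len₂ (stretch (left E₁ E₂) p t) = len₂ p ∧
      G₁.entropy (len₁ (stretch (left E₁ E₂) p t)) < 1 := by
  have t0 : 0 < 1 - t := sub_pos.2 ht.2
  have e2 : ∀ e : E₂, stretch (left E₁ E₂) p t (some (Sum.inr e)) = p (some (Sum.inr e)) :=
    fun e => if_neg (inr_notMem_left e)
  have e1 : ∀ e : E₁, stretch (left E₁ E₂) p t (some (Sum.inl e)) =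
      p (some (Sum.inl e)) / ENNReal.ofReal (1 - t) := fun e => if_pos (inl_mem_left e)
  have l2 : len₂ (stretch (left E₁ E₂) p t) = len₂ p := funext fun e => by
    rw [len₂, e2, len₂]
  have l1 : len₁ (stretch (left E₁ E₂) p t) = (1 - t)⁻¹ • len₁ p := funext fun e => by
    rw [len₁, e1, ENNReal.toReal_div, ENNReal.toReal_ofReal t0.le, div_eq_inv_mul]
    rfl
  have hlt : G₁.entropy (len₁ (stretch (left E₁ E₂) p t)) < 1 := by
    have hle : G₁.entropy (len₁ p) ≤ 1 := (le_max_left _ _).trans hp.2.2.2.le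
    rw [l1, h₁.entropy_smul (l := len₁ p) hp.2.1.2 (inv_pos.2 t0), div_inv_eq_mul]
    nlinarith [ht.1]
  refine ⟨⟨(if_neg none_notMem_left).trans hp.1, ⟨fun e => ?_, ?_⟩,
    ⟨fun e => by rw [e2]; exact h.1 e, ?_⟩, ?_⟩, l2, hlt⟩
  · rw [e1]
    exact ENNReal.div_ne_top (hp.2.1.1 e) (ENNReal.ofReal_pos.2 t0).ne'
  · change len₁ _ ∈ _
    rw [l1]
    exact smul_mem_lengthSpace hp.2.1.2 (inv_pos.2 t0)
  · change len₂ _ ∈ _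
    rw [l2]
    exact h.2.1
  · change max (G₁.entropy (len₁ _)) (G₂.entropy (len₂ _)) = 1
    rw [l2, show G₂.entropy (len₂ p) = 1 from h.2.2, max_eq_right hlt.le]

lemma mem_reg_of_lt {p : ExtLength E₁ E₂} (hp : p ∈ unit₁₂ G₁ G₂)
    (h : G₁.entropy (len₁ p) < 1 ∨ G₂.entropy (len₂ p) < 1) : p ∈ reg G₁ G₂ v₁ v₂ := by
  refine ⟨.inr (.inr hp), fun hs => ?_⟩
  rcases h with h | h
  · exact h.ne hs.2.1.2.2
  · exact h.ne hs.2.2.2.2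

lemma detFun_join_eq_zero_left (h₁ : G₁.Good) {p : ExtLength E₁ E₂} {T : Set (Edge E₁ E₂)}
    (h : FiniteOn₁ G₁.unitSpace p) (hT : ∀ e, some (Sum.inl e) ∉ T) {y : Edge E₁ E₂ → ℝ}
    (hy : ∀ e ∉ T, y e = Yc p e) (hz : y none = 0 ∨ res₂ y = 0) :
    (join G₁ G₂ v₁ v₂).detFun y = 0 := by
  rw [detFun_join_of_zero (by tauto), show res₁ y = res₁ (Yc p) from funext fun e => hy _ (hT e),
    res₁_Yc_of_ne_top h.1, h₁.detFun_eq_zero h.2, zero_mul]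

lemma detFun_join_eq_zero_right (h₂ : G₂.Good) {p : ExtLength E₁ E₂} {T : Set (Edge E₁ E₂)}
    (h : FiniteOn₂ G₂.unitSpace p) (hT : ∀ e, some (Sum.inr e) ∉ T) {y : Edge E₁ E₂ → ℝ}
    (hy : ∀ e ∉ T, y e = Yc p e) (hz : y none = 0 ∨ res₁ y = 0) :
    (join G₁ G₂ v₁ v₂).detFun y = 0 := by
  rw [detFun_join_of_zero (by tauto), show res₂ y = res₂ (Yc p) from funext fun e => hy _ (hT e),
    res₂_Yc_of_ne_top h.1, h₂.detFun_eq_zero h.2, mul_zero]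

lemma scaleOn_Yc_bounds {T : Set (Edge E₁ E₂)} {c : ℝ} (hc : c ∈ Set.Icc (0 : ℝ) 1)
    (p : ExtLength E₁ E₂) (e : Edge E₁ E₂) :
    0 ≤ scaleOn T c (Yc p) e ∧ scaleOn T c (Yc p) e ≤ Yc p e := by
  have := Yc_nonneg p e
  unfold scaleOn
  split_ifs
  · exact ⟨mul_nonneg hc.1 this, mul_le_of_le_one_left this hc.2⟩
  · exact ⟨this, le_rfl⟩

/-- Along the segment `G₁` keeps unit entropy and the weights of `G₂` only decrease, so the segment
consists of regular added points and `near_kill` applies. -/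
lemma near_kill_left (h₁ : G₁.Good) (h₂ : G₂.Good) {T : Set (Edge E₁ E₂)} {p : ExtLength E₁ E₂}
    (hp : ∀ e, 0 < p e) (h : FiniteOn₁ G₁.unitSpace p) (hS : ¬ SubInv (G₂.T (res₂ (Yc p))))
    (hT : ∀ e, some (Sum.inl e) ∉ T)
    (hz : ∀ y : Edge E₁ E₂ → ℝ, (∀ e ∉ T, y e = Yc p e) → y none = 0 ∨ res₂ y = 0) :
    Near G₁ G₂ v₁ v₂ p (kill T p) 0 := by
  refine near_kill h₁ h₂ T p (fun c hc => ?_) fun y hy =>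
    detFun_join_eq_zero_left h₁ h hT hy (hz y hy)
  have hb := scaleOn_Yc_bounds (T := T) hc p
  obtain ⟨k1, k2⟩ := addedY_of_left (G₂ := G₂) h₁ (y := scaleOn T c (Yc p)) h.2
    (by rw [← res₁_Yc_of_ne_top h.1]; exact funext fun e => if_neg (hT e)) (fun e => (hb e).1)
    (fun e => (hb e).2.trans_lt (expNeg_lt_one (hp e)))
    (fun h' => hS (h'.mono (T_mono fun e => (hb _).2))) (hz _ fun e he => if_neg he)
  exact ⟨k1.entropyTendsto h₁ h₂, (k2.Kf_pos h₁ h₂ fun e => (hb e).1).ne'⟩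

lemma near_kill_right (h₁ : G₁.Good) (h₂ : G₂.Good) {T : Set (Edge E₁ E₂)} {p : ExtLength E₁ E₂}
    (hp : ∀ e, 0 < p e) (h : FiniteOn₂ G₂.unitSpace p) (hS : ¬ SubInv (G₁.T (res₁ (Yc p))))
    (hT : ∀ e, some (Sum.inr e) ∉ T)
    (hz : ∀ y : Edge E₁ E₂ → ℝ, (∀ e ∉ T, y e = Yc p e) → y none = 0 ∨ res₁ y = 0) :
    Near G₁ G₂ v₁ v₂ p (kill T p) 0 := by
  refine near_kill h₁ h₂ T p (fun c hc => ?_) fun y hy =>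
    detFun_join_eq_zero_right h₂ h hT hy (hz y hy)
  have hb := scaleOn_Yc_bounds (T := T) hc p
  obtain ⟨k1, k2⟩ := addedY_of_right (G₁ := G₁) h₂ (y := scaleOn T c (Yc p)) h.2
    (by rw [← res₂_Yc_of_ne_top h.1]; exact funext fun e => if_neg (hT e)) (fun e => (hb e).1)
    (fun e => (hb e).2.trans_lt (expNeg_lt_one (hp e)))
    (fun h' => hS (h'.mono (T_mono fun e => (hb _).2))) (hz _ fun e he => if_neg he)
  exact ⟨k1.entropyTendsto h₁ h₂, (k2.Kf_pos h₁ h₂ fun e => (hb e).1).ne'⟩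

lemma not_none_inl (e : E₁) : (some (Sum.inl e) : Edge E₁ E₂) ∉ ({none} : Set (Edge E₁ E₂)) :=
  Option.some_ne_none _

lemma not_none_inr (e : E₂) : (some (Sum.inr e) : Edge E₁ E₂) ∉ ({none} : Set (Edge E₁ E₂)) :=
  Option.some_ne_none _

lemma not_subInv_of_lt {V E : Type*} [Fintype E] {H : OGraph V E} (hH : H.Good) {l : E → ℝ}
    (hl : l ∈ H.lengthSpace) (h : H.entropy l < 1) : ¬ SubInv (H.T (yexp l)) := by
  rw [hH.subInv_iff hl]
  exact h.not_ge

lemma yc_none {p : ExtLength E₁ E₂} (hp : p ∈ unit₁₂ G₁ G₂) : Yc p none = 0 := expNeg_eq_zero.2 hp.1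

/-- A point of unit entropy on the first graph can be moved, at no cost, to one where all other
lengths are infinite. -/
theorem near_top₁ (h₁ : G₁.Good) (h₂ : G₂.Good) {p : ExtLength E₁ E₂} (hp : p ∈ added G₁ G₂)
    (h : FiniteOn₁ G₁.unitSpace p) : Near G₁ G₂ v₁ v₂ p (top₁ E₂ (len₁ p)) 0 := by
  have hpos := pos_of_mem_added hp
  rcases hp with (hp | hp) | hp
  · have hr : res₂ (Yc p) = 0 := res₂_Yc_of_top hp.2.2
    rw [← kill_none_left hp]
    refine near_kill_left h₁ h₂ hpos h ?_ not_none_inl fun y hy => .inr ?_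
    · rw [hr]
      exact not_subInv_zero
    · rw [← hr]
      exact funext fun e => hy _ (not_none_inr e)
  · obtain ⟨e⟩ := h₁.nonempty_edge
    exact absurd (hp.2.1 e) (h.1 e)
  -- At regular points of this kind `F₁ = 0` and `y₀ = 0`, so the lengths in `G₂` are free.
  · have hreg : ∀ q ∈ unit₁₂ G₁ G₂, FiniteOn₁ G₁.unitSpace q → G₂.entropy (len₂ q) < 1 →
        Near G₁ G₂ v₁ v₂ q (kill (right E₁ E₂) q) 0 := fun q hq hq₁ hlt => by
      refine near_kill_left h₁ h₂ (pos_of_mem_added (.inr hq)) hq₁ ?_ inl_notMem_right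
        fun y hy => .inl ((hy _ none_notMem_right).trans (yc_none hq))
      rw [res₂_Yc_of_ne_top hq.2.2.1.1]
      exact not_subInv_of_lt h₂ hq.2.2.1.2 hlt
    rw [← kill_right hp]
    rcases (show G₂.entropy (len₂ p) ≤ 1 from (le_max_right _ _).trans hp.2.2.2.le).lt_or_eq with
      hlt | heq
    · exact hreg p hp h hlt
    -- A singular point is first left by a slide that stretches `G₂`; the entropy of `G₂` drops
    -- below one and the regular case takes over.
    · have u₂ : len₂ p ∈ G₂.unitSpace := ⟨hp.2.2.1.2, heq⟩
      have u₁ : len₁ p ∈ G₁.unitSpace := h.2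
      have hst := fun t ht => stretch_right_mem h₂ hp h (t := t) ht
      obtain ⟨t, ht, hn⟩ := Split.near_stretch h₁ h₂ (split_right (v₁ := v₁) (v₂ := v₂) h₁ h₂) hp.1
        (fun e he => by
          rcases e with _ | e | e
          · exact absurd rfl he
          · exact h.1 e
          · exact hp.2.2.1.1 e)
        (h₁.detFun_eq_zero u₁) (h₂.detFun_eq_zero u₂) (fderiv_FH_res₁_pos h₁ u₁)
        (fderiv_FH_res₂_pos h₂ u₂) (mul_pos (h₁.Pf_pos u₁) (h₂.Pf_pos u₂))
        fun t ht => mem_reg_of_lt (hst t ht).1 (.inr (hst t ht).2.2)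
      obtain ⟨m1, m2, m3⟩ := hst t ht
      have hn' := hreg _ m1 ⟨m1.2.1.1, by change len₁ _ ∈ _; rwa [m2]⟩ m3
      rw [kill_stretch] at hn'
      have := hn.trans h₁ h₂ (.inr (.inr m1)) hn'
      rwa [add_zero] at this

/-- A point of unit entropy on the second graph can be moved, at no cost, to one where all other
lengths are infinite. -/
theorem near_top₂ (h₁ : G₁.Good) (h₂ : G₂.Good) {p : ExtLength E₁ E₂} (hp : p ∈ added G₁ G₂)
    (h : FiniteOn₂ G₂.unitSpace p) : Near G₁ G₂ v₁ v₂ p (top₂ E₁ (len₂ p)) 0 := by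
  have hpos := pos_of_mem_added hp
  rcases hp with (hp | hp) | hp
  · obtain ⟨e⟩ := h₂.nonempty_edge
    exact absurd (hp.2.2 e) (h.1 e)
  · have hr : res₁ (Yc p) = 0 := res₁_Yc_of_top hp.2.1
    rw [← kill_none_right hp]
    refine near_kill_right h₁ h₂ hpos h ?_ not_none_inr fun y hy => .inr ?_
    · rw [hr]
      exact not_subInv_zero
    · rw [← hr]
      exact funext fun e => hy _ (not_none_inl e)
  · have hreg : ∀ q ∈ unit₁₂ G₁ G₂, FiniteOn₂ G₂.unitSpace q → G₁.entropy (len₁ q) < 1 →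
        Near G₁ G₂ v₁ v₂ q (kill (left E₁ E₂) q) 0 := fun q hq hq₁ hlt => by
      refine near_kill_right h₁ h₂ (pos_of_mem_added (.inr hq)) hq₁ ?_ inr_notMem_left
        fun y hy => .inl ((hy _ none_notMem_left).trans (yc_none hq))
      rw [res₁_Yc_of_ne_top hq.2.1.1]
      exact not_subInv_of_lt h₁ hq.2.1.2 hlt
    rw [← kill_left hp]
    rcases (show G₁.entropy (len₁ p) ≤ 1 from (le_max_left _ _).trans hp.2.2.2.le).lt_or_eq with
      hlt | heq
    · exact hreg p hp h hlt
    · have u₁ : len₁ p ∈ G₁.unitSpace := ⟨hp.2.1.2, heq⟩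
      have u₂ : len₂ p ∈ G₂.unitSpace := h.2
      have hst := fun t ht => stretch_left_mem h₁ hp h (t := t) ht
      obtain ⟨t, ht, hn⟩ := Split.near_stretch h₁ h₂ (split_left (v₁ := v₁) (v₂ := v₂) h₁ h₂) hp.1
        (fun e he => by
          rcases e with _ | e | e
          · exact absurd rfl he
          · exact hp.2.1.1 e
          · exact h.1 e)
        (h₂.detFun_eq_zero u₂) (h₁.detFun_eq_zero u₁) (fderiv_FH_res₂_pos h₂ u₂)
        (fderiv_FH_res₁_pos h₁ u₁) (mul_pos (h₁.Pf_pos u₁) (h₂.Pf_pos u₂))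
        fun t ht => mem_reg_of_lt (hst t ht).1 (.inl (hst t ht).2.2)
      obtain ⟨m1, m2, m3⟩ := hst t ht
      have hn' := hreg _ m1 ⟨m1.2.2.1.1, by change len₂ _ ∈ _; rwa [m2]⟩ m3
      rw [kill_stretch] at hn'
      have := hn.trans h₁ h₂ (.inr (.inr m1)) hn'
      rwa [add_zero] at this

lemma forall_stretch_mem_model {T : Set (Edge E₁ E₂)} {p : ExtLength E₁ E₂}
    (hp : p ∈ model G₁ G₂ v₁ v₂) (hk : kill T p ∈ model G₁ G₂ v₁ v₂) (hpos : ∀ e, 0 < p e)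
    (h : ∀ t ∈ Set.Ioo (0 : ℝ) 1, stretch T p t ∈ reg G₁ G₂ v₁ v₂) :
    ∀ t ∈ Set.Icc (0 : ℝ) 1, stretch T p t ∈ model G₁ G₂ v₁ v₂ := by
  intro t ht
  rcases ht.1.eq_or_lt with rfl | t0
  · rwa [stretch_zero]
  rcases ht.2.eq_or_lt with rfl | t1
  · rwa [stretch_one T hpos]
  · exact (h t ⟨t0, t1⟩).1

/-- Inside the model space no slide is needed at a singular point: it is the initial point of the
stretching path, where regularity is not required. -/
theorem modelDist_top₁ (h₁ : G₁.Good) (h₂ : G₂.Good) {p : ExtLength E₁ E₂} (hp : p ∈ added G₁ G₂)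
    (h : FiniteOn₁ G₁.unitSpace p) : modelDist G₁ G₂ v₁ v₂ p (top₁ E₂ (len₁ p)) = 0 := by
  have hpos := pos_of_mem_added hp
  have htop : top₁ E₂ (len₁ p) ∈ model G₁ G₂ v₁ v₂ := .inr (.inl (.inl (top₁_mem h.2)))
  rcases hp with (hp | hp) | hp
  · rw [← kill_none_left hp]
    refine modelDist_kill h₁ h₂ (fun t _ => .inr (.inl (.inl (stretch_none_mem₁ hp t))))
      (fun t _ => unit₁_subset_reg h₂ (stretch_none_mem₁ hp t))
      fun y hy => detFun_join_eq_zero_left h₁ h not_none_inl hy (.inr ?_)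
    rw [← res₂_Yc_of_top hp.2.2]
    exact funext fun e => hy _ (not_none_inr e)
  · obtain ⟨e⟩ := h₁.nonempty_edge
    exact absurd (hp.2.1 e) (h.1 e)
  · rw [← kill_right hp] at htop ⊢
    have hst : ∀ t ∈ Set.Ioo (0 : ℝ) 1, stretch (right E₁ E₂) p t ∈ reg G₁ G₂ v₁ v₂ := fun t ht =>
      mem_reg_of_lt (stretch_right_mem h₂ hp h ht).1 (.inr (stretch_right_mem h₂ hp h ht).2.2)
    exact modelDist_kill h₁ h₂ (forall_stretch_mem_model (.inr (.inr hp)) htop hpos hst) hst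
      fun y hy => detFun_join_eq_zero_left h₁ h inl_notMem_right hy
        (.inl ((hy _ none_notMem_right).trans (yc_none hp)))

theorem modelDist_top₂ (h₁ : G₁.Good) (h₂ : G₂.Good) {p : ExtLength E₁ E₂} (hp : p ∈ added G₁ G₂)
    (h : FiniteOn₂ G₂.unitSpace p) : modelDist G₁ G₂ v₁ v₂ p (top₂ E₁ (len₂ p)) = 0 := by
  have hpos := pos_of_mem_added hp
  have htop : top₂ E₁ (len₂ p) ∈ model G₁ G₂ v₁ v₂ := .inr (.inl (.inr (top₂_mem h.2)))
  rcases hp with (hp | hp) | hp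
  · obtain ⟨e⟩ := h₂.nonempty_edge
    exact absurd (hp.2.2 e) (h.1 e)
  · rw [← kill_none_right hp]
    refine modelDist_kill h₁ h₂ (fun t _ => .inr (.inl (.inr (stretch_none_mem₂ hp t))))
      (fun t _ => unit₂_subset_reg h₁ (stretch_none_mem₂ hp t))
      fun y hy => detFun_join_eq_zero_right h₂ h not_none_inr hy (.inr ?_)
    rw [← res₁_Yc_of_top hp.2.1]
    exact funext fun e => hy _ (not_none_inl e)
  · rw [← kill_left hp] at htop ⊢
    have hst : ∀ t ∈ Set.Ioo (0 : ℝ) 1, stretch (left E₁ E₂) p t ∈ reg G₁ G₂ v₁ v₂ := fun t ht =>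
      mem_reg_of_lt (stretch_left_mem h₁ hp h ht).1 (.inl (stretch_left_mem h₁ hp h ht).2.2)
    exact modelDist_kill h₁ h₂ (forall_stretch_mem_model (.inr (.inr hp)) htop hpos hst) hst
      fun y hy => detFun_join_eq_zero_right h₂ h inr_notMem_left hy
        (.inl ((hy _ none_notMem_left).trans (yc_none hp)))

/-- The singular point with given lengths. -/
def singPt (l₁ : E₁ → ℝ) (l₂ : E₂ → ℝ) : ExtLength E₁ E₂
  | none => ⊤
  | some (Sum.inl e) => ENNReal.ofReal (l₁ e)
  | some (Sum.inr e) => ENNReal.ofReal (l₂ e)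

/-- A relation which allows to move points of unit entropy to those with infinite lengths on the
rest of the graph relates all added points. -/
theorem added_induction (h₁ : G₁.Good) (h₂ : G₂.Good)
    {R : ExtLength E₁ E₂ → ExtLength E₁ E₂ → Prop} (symm : ∀ p q, R p q → R q p)
    (trans : ∀ p q, q ∈ added G₁ G₂ → ∀ r, R p q → R q r → R p r)
    (r₁ : ∀ p ∈ added G₁ G₂, FiniteOn₁ G₁.unitSpace p → R p (top₁ E₂ (len₁ p)))
    (r₂ : ∀ p ∈ added G₁ G₂, FiniteOn₂ G₂.unitSpace p → R p (top₂ E₁ (len₂ p)))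
    {p q : ExtLength E₁ E₂} (hp : p ∈ added G₁ G₂) (hq : q ∈ added G₁ G₂) : R p q := by
  have m₁ : ∀ l ∈ G₁.unitSpace, top₁ E₂ l ∈ added G₁ G₂ := fun l hl => .inl (.inl (top₁_mem hl))
  have m₂ : ∀ l ∈ G₂.unitSpace, top₂ E₁ l ∈ added G₁ G₂ := fun l hl => .inl (.inr (top₂_mem hl))
  -- The singular point `singPt l l'` has unit entropy on both sides, so it can be moved to either
  -- family and links them.
  have cross : ∀ l ∈ G₁.unitSpace, ∀ l' ∈ G₂.unitSpace, R (top₁ E₂ l) (top₂ E₁ l') := by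
    intro l hl l' hl'
    have e1 : len₁ (singPt l l') = l := funext fun e => ENNReal.toReal_ofReal (hl.1 e).le
    have e2 : len₂ (singPt l l') = l' := funext fun e => ENNReal.toReal_ofReal (hl'.1 e).le
    have f1 : FiniteOn₁ G₁.unitSpace (singPt l l') :=
      ⟨fun _ => ENNReal.ofReal_ne_top, by change len₁ _ ∈ _; rwa [e1]⟩
    have f2 : FiniteOn₂ G₂.unitSpace (singPt l l') :=
      ⟨fun _ => ENNReal.ofReal_ne_top, by change len₂ _ ∈ _; rwa [e2]⟩
    have hs : singPt l l' ∈ added G₁ G₂ := by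
      refine .inr ⟨rfl, ⟨f1.1, f1.2.1⟩, ⟨f2.1, f2.2.1⟩, ?_⟩
      rw [f1.2.2, f2.2.2, max_self]
    have := trans _ _ hs _ (symm _ _ (r₁ _ hs f1)) (r₂ _ hs f2)
    rwa [e1, e2] at this
  obtain ⟨k₁, hk₁⟩ := exists_mem_unitSpace h₁
  obtain ⟨k₂, hk₂⟩ := exists_mem_unitSpace h₂
  have base : ∀ p ∈ added G₁ G₂, R p (top₂ E₁ k₂) := by
    intro p hp
    have hcase : FiniteOn₁ G₁.unitSpace p ∨ FiniteOn₂ G₂.unitSpace p := by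
      rcases hp with (hp | hp) | hp
      · exact .inl hp.2.1
      · exact .inr hp.2.2
      · rcases max_choice (G₁.entropy (len₁ p)) (G₂.entropy (len₂ p)) with h | h
        · exact .inl ⟨hp.2.1.1, hp.2.1.2, h.symm.trans hp.2.2.2⟩
        · exact .inr ⟨hp.2.2.1.1, hp.2.2.1.2, h.symm.trans hp.2.2.2⟩
    rcases hcase with h | h
    · exact trans _ _ (m₁ _ h.2) _ (r₁ p hp h) (cross _ h.2 _ hk₂)
    · exact trans _ _ (m₁ _ hk₁) _ (trans _ _ (m₂ _ h.2) _ (r₂ p hp h)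
        (symm _ _ (cross _ hk₁ _ h.2))) (cross _ hk₁ _ hk₂)
  exact trans _ _ (m₂ _ hk₂) _ (base p hp) (symm _ _ (base q hq))

theorem near_added (h₁ : G₁.Good) (h₂ : G₂.Good) {p q : ExtLength E₁ E₂} (hp : p ∈ added G₁ G₂)
    (hq : q ∈ added G₁ G₂) : Near G₁ G₂ v₁ v₂ p q 0 := by
  refine added_induction h₁ h₂ (R := fun p q => Near G₁ G₂ v₁ v₂ p q 0) (fun _ _ h => h.symm)
    (fun p q hq r h h' => ?_) (fun p => near_top₁ h₁ h₂) (fun p => near_top₂ h₁ h₂) hp hq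
  have := h.trans h₁ h₂ (.inr hq) h'
  rwa [add_zero] at this

theorem modelDist_added (h₁ : G₁.Good) (h₂ : G₂.Good) {p q : ExtLength E₁ E₂}
    (hp : p ∈ added G₁ G₂) (hq : q ∈ added G₁ G₂) : modelDist G₁ G₂ v₁ v₂ p q = 0 := by
  refine added_induction h₁ h₂ (R := fun p q => modelDist G₁ G₂ v₁ v₂ p q = 0)
    (fun p q h => le_antisymm ((modelDist_comm_le h₁ h₂ p q).trans h.le) zero_le)
    (fun p q _ r h h' => le_antisymm ((modelDist_triangle h₁ h₂ p q r).trans ?_) zero_le)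
    (fun p => modelDist_top₁ h₁ h₂) (fun p => modelDist_top₂ h₁ h₂) hp hq
  rw [h, h', add_zero]

end Collapse

end SepEdge

end

noncomputable section

set_option linter.unusedSectionVars false

namespace SepEdge

open OGraph

variable {V₁ E₁ V₂ E₂ : Type*} [Fintype E₁] [Fintype E₂]
  {G₁ : OGraph V₁ E₁} {G₂ : OGraph V₂ E₂} {v₁ : V₁} {v₂ : V₂}

/-! ### The isometric embedding -/

section Isometry

/-- At a singular point `near_self` is not available, since `Kf` vanishes there; the relation comes
from the detour through other added points. -/
lemma near_refl (h₁ : G₁.Good) (h₂ : G₂.Good) {p : ExtLength E₁ E₂}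
    (hp : p ∈ model G₁ G₂ v₁ v₂) : Near G₁ G₂ v₁ v₂ p p 0 := by
  rcases hp with ⟨x, hx, rfl⟩ | hp
  · exact near_self h₁ h₂ (incl_mem_reg h₁ h₂ hx)
  · exact near_added h₁ h₂ hp hp

lemma exists_eq_top_iff (h₁ : G₁.Good) (h₂ : G₂.Good) {p : ExtLength E₁ E₂}
    (hp : p ∈ model G₁ G₂ v₁ v₂) : (∃ e, p e = ⊤) ↔ p ∈ added G₁ G₂ := by
  constructor
  · rintro ⟨e, he⟩
    rcases hp with ⟨x, hx, rfl⟩ | hp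
    · exact absurd he ENNReal.ofReal_ne_top
    · exact hp
  · rintro ((h | h) | h)
    · obtain ⟨e⟩ := h₂.nonempty_edge
      exact ⟨_, h.2.2 e⟩
    · obtain ⟨e⟩ := h₁.nonempty_edge
      exact ⟨_, h.2.1 e⟩
    · exact ⟨none, h.1⟩

/-- The finite lengths along a path. -/
def toFinite (γ : ℝ → ExtLength E₁ E₂) (t : ℝ) : Edge E₁ E₂ → ℝ := fun e => (γ t e).toReal

lemma incl_toFinite {γ : ℝ → ExtLength E₁ E₂} {t : ℝ} (h : ∀ e, γ t e ≠ ⊤) :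
    incl (toFinite γ t) = γ t := funext fun e => ENNReal.ofReal_toReal (h e)

lemma toFinite_mem (h₁ : G₁.Good) (h₂ : G₂.Good) {γ : ℝ → ExtLength E₁ E₂} {t : ℝ}
    (hm : γ t ∈ model G₁ G₂ v₁ v₂) (h : ∀ e, γ t e ≠ ⊤) :
    toFinite γ t ∈ (join G₁ G₂ v₁ v₂).unitSpace := by
  rcases hm with ⟨x, hx, he⟩ | hm
  · have : toFinite γ t = x := funext fun e => by
      rw [toFinite, ← he]
      exact ENNReal.toReal_ofReal (hx.1 e).le
    rwa [this]
  · obtain ⟨e, he⟩ := (exists_eq_top_iff (v₁ := v₁) (v₂ := v₂) h₁ h₂ (.inr hm)).2 hm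
    exact absurd he (h e)

lemma SmoothTime.toFinite (h₁ : G₁.Good) (h₂ : G₂.Good) {γ : ℝ → ExtLength E₁ E₂} {t : ℝ}
    (hs : SmoothTime G₁ G₂ v₁ v₂ γ t) (hc : ContinuousAt γ t)
    (hm : ∀ᶠ u in 𝓝 t, γ u ∈ model G₁ G₂ v₁ v₂) (hf : ∀ e, γ t e ≠ ⊤) :
    ContDiffAt ℝ ∞ (toFinite γ) t ∧
      mspeed G₁ G₂ v₁ v₂ γ t = (join G₁ G₂ v₁ v₂).speed (toFinite γ) t := by
  have hβ : ContDiffAt ℝ ∞ (SepEdge.toFinite γ) t := by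
    refine contDiffAt_pi.2 fun e => ?_
    rcases hs.2 e with h | h
    · exact absurd h.self_of_nhds (hf e)
    · exact h.2
  have hfin : ∀ᶠ u in 𝓝 t, ∀ e, γ u e ≠ ⊤ := eventually_all.2 fun e =>
    (((continuous_apply e).continuousAt.comp hc).eventually_ne (hf e) :)
  refine ⟨hβ, (smoothTime_incl h₁ h₂ ?_ hβ ?_).2⟩
  · filter_upwards [hfin] with u hu
    exact (incl_toFinite hu).symm
  · filter_upwards [hfin, hm] with u hu hu'
    exact toFinite_mem h₁ h₂ hu' hu

variable {γ : ℝ → ExtLength E₁ E₂}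

/-- The end points may have infinite lengths or be singular, so the path is used only between two
interior times close to them. That arc lies in `M¹(G)`, and `near_refl` accounts for the two ends.
-/
lemma near_of_smooth (h₁ : G₁.Good) (h₂ : G₂.Good) (hc : ContinuousOn γ (Set.Icc 0 1))
    (hm : ∀ t ∈ Set.Icc (0 : ℝ) 1, γ t ∈ model G₁ G₂ v₁ v₂) {a b : ℝ} (ha : 0 ≤ a) (hab : a < b)
    (hb : b ≤ 1) (hs : ∀ t ∈ Set.Ioo a b, SmoothTime G₁ G₂ v₁ v₂ γ t)
    (hf : ∀ t ∈ Set.Ioo a b, ∀ e, γ t e ≠ ⊤) :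
    Near G₁ G₂ v₁ v₂ (γ a) (γ b) (∫⁻ t in Set.Icc a b, mspeed G₁ G₂ v₁ v₂ γ t) := by
  have hsub : ∀ t ∈ Set.Ioo a b, Set.Icc (0 : ℝ) 1 ∈ 𝓝 t := fun t ht =>
    Icc_mem_nhds (ha.trans_lt ht.1) (ht.2.trans_le hb)
  have key := fun t ht => (hs t ht).toFinite h₁ h₂ (hc.continuousAt (hsub t ht))
    (Filter.mem_of_superset (hsub t ht) hm) (hf t ht)
  have ht : ∀ c ∈ Set.Icc a b,
      Tendsto (toFinite γ) (𝓝[Set.Ioo a b] c) (nearby G₁ G₂ v₁ v₂ (γ c)) := by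
    intro c hcab
    refine tendsto_nearby_iff.2 ⟨?_, ?_⟩
    · have h3 : Tendsto γ (𝓝[Set.Ioo a b] c) (𝓝 (γ c)) :=
        (hc c ⟨ha.trans hcab.1, hcab.2.trans hb⟩).mono fun t ht =>
          ⟨ha.trans ht.1.le, ht.2.le.trans hb⟩
      refine h3.congr' ?_
      filter_upwards [self_mem_nhdsWithin] with t ht
      exact (incl_toFinite (hf t ht)).symm
    · filter_upwards [self_mem_nhdsWithin] with t ht
      exact toFinite_mem h₁ h₂ (hm t ⟨ha.trans ht.1.le, ht.2.le.trans hb⟩) (hf t ht)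
  have hbot : ∀ c ∈ Set.Icc a b, (𝓝[Set.Ioo a b] c).NeBot := fun c hcab => by
    rw [← mem_closure_iff_nhdsWithin_neBot, closure_Ioo hab.ne]
    exact hcab
  have hA : a ∈ Set.Icc a b := ⟨le_rfl, hab.le⟩
  have hB : b ∈ Set.Icc a b := ⟨hab.le, le_rfl⟩
  have := hbot a hA
  have := hbot b hB
  intro ε hε
  have n1 := (tendsto_id.prodMap (ht a hA)).eventually
    (near_refl h₁ h₂ (hm a ⟨ha, hab.le.trans hb⟩) (ε / 2) (half_pos hε))
  have n2 := ((ht b hB).prodMap tendsto_id).eventually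
    (near_refl h₁ h₂ (hm b ⟨ha.trans hab.le, hb⟩) (ε / 2) (half_pos hε))
  obtain ⟨A, hA', T, hT, k1⟩ := mem_prod_iff.1 n1
  obtain ⟨T', hT', B, hB', k2⟩ := mem_prod_iff.1 n2
  obtain ⟨t, htT, htI⟩ := nonempty_of_mem (inter_mem hT self_mem_nhdsWithin)
  obtain ⟨t', htT', htI'⟩ := nonempty_of_mem (inter_mem hT' self_mem_nhdsWithin)
  have hIoo : Set.uIcc t t' ⊆ Set.Ioo a b := Set.OrdConnected.uIcc_subset inferInstance htI htI'
  have harc : (join G₁ G₂ v₁ v₂).entropyDist (toFinite γ t) (toFinite γ t') ≤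
      ∫⁻ t in Set.Icc a b, mspeed G₁ G₂ v₁ v₂ γ t := by
    refine (entropyDist_le_arc (fun u hu => (key u (hIoo hu)).1) fun u hu => ?_).trans ?_
    · have hu' := hIoo hu
      exact toFinite_mem h₁ h₂ (hm u ⟨ha.trans hu'.1.le, hu'.2.le.trans hb⟩) (hf u hu')
    · rw [← setLIntegral_congr_fun measurableSet_uIcc fun u hu => (key u (hIoo hu)).2]
      exact lintegral_mono_set (hIoo.trans Set.Ioo_subset_Icc_self)
  filter_upwards [prod_mem_prod hA' hB'] with w hw
  have e1 : (join G₁ G₂ v₁ v₂).entropyDist w.1 (toFinite γ t) ≤ 0 + ENNReal.ofReal (ε / 2) :=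
    k1 (Set.mk_mem_prod hw.1 htT)
  have e2 : (join G₁ G₂ v₁ v₂).entropyDist (toFinite γ t') w.2 ≤ 0 + ENNReal.ofReal (ε / 2) :=
    k2 (Set.mk_mem_prod htT' hw.2)
  rw [zero_add] at e1 e2
  refine (entropyDist_triangle _ (toFinite γ t) _).trans ((add_le_add e1
    ((entropyDist_triangle _ (toFinite γ t') _).trans (add_le_add harc e2))).trans_eq ?_)
  rw [add_left_comm, ← ENNReal.ofReal_add (half_pos hε).le (half_pos hε).le, add_halves]

/-- Induction on the number of break points inside the interval, cutting at one of them. -/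
lemma near_of_finite (h₁ : G₁.Good) (h₂ : G₂.Good) (hc : ContinuousOn γ (Set.Icc 0 1))
    (hm : ∀ t ∈ Set.Icc (0 : ℝ) 1, γ t ∈ model G₁ G₂ v₁ v₂) {s : Finset ℝ}
    (hs : ∀ t ∈ Set.Ioo (0 : ℝ) 1, t ∉ s → SmoothTime G₁ G₂ v₁ v₂ γ t) (n : ℕ) :
    ∀ {a b : ℝ}, 0 ≤ a → a ≤ b → b ≤ 1 → (∀ t ∈ Set.Ioo a b, ∀ e, γ t e ≠ ⊤) →
      (s.filter fun t => t ∈ Set.Ioo a b).card ≤ n →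
      Near G₁ G₂ v₁ v₂ (γ a) (γ b) (∫⁻ t in Set.Icc a b, mspeed G₁ G₂ v₁ v₂ γ t) := by
  induction n with
  | zero =>
    intro a b ha hab hb hf hn
    rcases hab.eq_or_lt with rfl | hab
    · exact (near_refl h₁ h₂ (hm a ⟨ha, hb⟩)).mono zero_le
    · refine near_of_smooth h₁ h₂ hc hm ha hab hb (fun t ht => hs t
        ⟨ha.trans_lt ht.1, ht.2.trans_le hb⟩ fun h => ?_) hf
      have := Finset.card_eq_zero.1 (Nat.le_zero.1 hn)
      exact Finset.notMem_empty t (this ▸ Finset.mem_filter.2 ⟨h, ht⟩)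
  | succ n ih =>
    intro a b ha hab hb hf hn
    by_cases hne : (s.filter fun t => t ∈ Set.Ioo a b).Nonempty
    · obtain ⟨c, hcs⟩ := hne
      have hcI := (Finset.mem_filter.1 hcs).2
      have k : ∀ a' b', a ≤ a' → b' ≤ b → c ∉ Set.Ioo a' b' →
          (s.filter fun t => t ∈ Set.Ioo a' b').card ≤ n := by
        intro a' b' h3 h4 h5
        refine Nat.le_of_lt_succ ((Finset.card_lt_card ?_).trans_le hn)
        refine Finset.ssubset_iff_subset_ne.2 ⟨fun t ht => ?_, fun h => ?_⟩
        · obtain ⟨h6, h7⟩ := Finset.mem_filter.1 ht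
          exact Finset.mem_filter.2 ⟨h6, h3.trans_lt h7.1, h7.2.trans_le h4⟩
        · rw [← h] at hcs
          exact h5 (Finset.mem_filter.1 hcs).2
      have n1 := ih ha hcI.1.le (hcI.2.le.trans hb) (fun t ht => hf t ⟨ht.1, ht.2.trans hcI.2⟩)
        (k a c le_rfl hcI.2.le fun h => h.2.false)
      have n2 := ih (ha.trans hcI.1.le) hcI.2.le hb (fun t ht => hf t ⟨hcI.1.trans ht.1, ht.2⟩)
        (k c b hcI.1.le le_rfl fun h => h.1.false)
      have := n1.trans h₁ h₂ (hm c ⟨ha.trans hcI.1.le, hcI.2.le.trans hb⟩) n2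
      rwa [lintegral_Icc_add hcI.1.le hcI.2.le] at this
    · rw [Finset.not_nonempty_iff_eq_empty] at hne
      exact ih ha hab hb hf (by rw [hne]; exact Nat.zero_le n)

/-- The path is cut at the first and the last time at which some length is infinite. Outside this
interval it runs in `M¹(G)`; inside, whatever it does, its two end points are added points and are
related at no cost by `near_added`. -/
theorem near_of_isModelPath (h₁ : G₁.Good) (h₂ : G₂.Good) (h : IsModelPath G₁ G₂ v₁ v₂ γ) :
    Near G₁ G₂ v₁ v₂ (γ 0) (γ 1) (modelPathLength G₁ G₂ v₁ v₂ γ) := by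
  obtain ⟨hc, hm, s, hs⟩ := h
  change Near _ _ _ _ _ _ (∫⁻ t in Set.Icc (0 : ℝ) 1, mspeed G₁ G₂ v₁ v₂ γ t)
  set C : Set ℝ := Set.Icc 0 1 ∩ γ ⁻¹' {p | ∃ e, p e = ⊤} with hC
  have hCc : IsClosed C := by
    refine hc.preimage_isClosed_of_isClosed isClosed_Icc ?_
    have : {p : ExtLength E₁ E₂ | ∃ e, p e = ⊤} = ⋃ e, {p | p e = ⊤} := by
      ext p
      simp
    rw [this]
    exact isClosed_iUnion_of_finite fun e => isClosed_eq (continuous_apply e) continuous_const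
  have hCk : IsCompact C := isCompact_Icc.of_isClosed_subset hCc Set.inter_subset_left
  rcases C.eq_empty_or_nonempty with hE | hne
  · refine near_of_finite h₁ h₂ hc hm hs _ le_rfl zero_le_one le_rfl (fun t ht e he => ?_) le_rfl
    have : t ∈ C := ⟨⟨ht.1.le, ht.2.le⟩, e, he⟩
    rw [hE] at this
    exact this
  · obtain ⟨a, haC, hamin⟩ := hCk.exists_isLeast hne
    obtain ⟨b, hbC, hbmax⟩ := hCk.exists_isGreatest hne
    have hab : a ≤ b := hamin hbC
    have n1 := near_of_finite h₁ h₂ hc hm hs _ le_rfl haC.1.1 haC.1.2 (fun t ht e he =>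
      (hamin ⟨⟨ht.1.le, ht.2.le.trans haC.1.2⟩, e, he⟩).not_gt ht.2) le_rfl
    have n2 := near_of_finite h₁ h₂ hc hm hs _ hbC.1.1 hbC.1.2 le_rfl (fun t ht e he =>
      (hbmax ⟨⟨hbC.1.1.trans ht.1.le, ht.2.le⟩, e, he⟩).not_gt ht.1) le_rfl
    have n3 := near_added (v₁ := v₁) (v₂ := v₂) h₁ h₂
      ((exists_eq_top_iff h₁ h₂ (hm a haC.1)).1 haC.2) ((exists_eq_top_iff h₁ h₂ (hm b hbC.1)).1 hbC.2)
    refine ((n1.trans h₁ h₂ (hm a haC.1) n3).trans h₁ h₂ (hm b hbC.1) n2).mono ?_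
    rw [add_zero, ← lintegral_Icc_add haC.1.1 (hab.trans hbC.1.2), ← lintegral_Icc_add hab hbC.1.2]
    exact add_le_add le_rfl le_add_self

theorem modelDist_incl (h₁ : G₁.Good) (h₂ : G₂.Good) {x y : Edge E₁ E₂ → ℝ}
    (hx : x ∈ (join G₁ G₂ v₁ v₂).unitSpace) (hy : y ∈ (join G₁ G₂ v₁ v₂).unitSpace) :
    modelDist G₁ G₂ v₁ v₂ (incl x) (incl y) = (join G₁ G₂ v₁ v₂).entropyDist x y := by
  refine le_antisymm (modelDist_le_entropyDist h₁ h₂ x y) (le_iInf₂ fun γ h => ?_)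
  have hn := near_of_isModelPath h₁ h₂ h.1
  rw [h.2.1, h.2.2] at hn
  exact hn.entropyDist_le hx hy

lemma entropyDist_self {V E : Type*} [Fintype E] {H : OGraph V E} {x : E → ℝ}
    (hx : x ∈ H.unitSpace) : H.entropyDist x x = 0 := by
  have h := entropyDist_le_arc (H := H) (γ := fun _ => x) (p := 0) (q := 0)
    (fun _ _ => contDiffAt_const) fun _ _ => hx
  simpa using h

lemma modelDist_self (h₁ : G₁.Good) (h₂ : G₂.Good) {p : ExtLength E₁ E₂}
    (hp : p ∈ model G₁ G₂ v₁ v₂) : modelDist G₁ G₂ v₁ v₂ p p = 0 := by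
  rcases hp with ⟨x, hx, rfl⟩ | hp
  · rw [modelDist_incl h₁ h₂ hx hx, entropyDist_self hx]
  · exact modelDist_added h₁ h₂ hp hp

lemma modelDist_comm (h₁ : G₁.Good) (h₂ : G₂.Good) (p q : ExtLength E₁ E₂) :
    modelDist G₁ G₂ v₁ v₂ p q = modelDist G₁ G₂ v₁ v₂ q p :=
  le_antisymm (modelDist_comm_le h₁ h₂ _ _) (modelDist_comm_le h₁ h₂ _ _)

lemma modelDist_lt_top (h₁ : G₁.Good) (h₂ : G₂.Good) {p q : ExtLength E₁ E₂}
    (hp : p ∈ model G₁ G₂ v₁ v₂) (hq : q ∈ model G₁ G₂ v₁ v₂) :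
    modelDist G₁ G₂ v₁ v₂ p q < ⊤ := by
  obtain ⟨l, hl⟩ := exists_mem_unitSpace h₁
  have hb : top₁ E₂ l ∈ unit₁ G₁ E₂ := top₁_mem hl
  have key : ∀ p ∈ model G₁ G₂ v₁ v₂, modelDist G₁ G₂ v₁ v₂ p (top₁ E₂ l) < ⊤ := by
    rintro _ (⟨x, hx, rfl⟩ | hp)
    · exact modelDist_incl_lt_top h₁ h₂ hx (unit₁_subset_reg h₂ hb)
    · rw [modelDist_added h₁ h₂ hp (.inl (.inl hb))]
      exact ENNReal.zero_lt_top
  refine (modelDist_triangle h₁ h₂ p (top₁ E₂ l) q).trans_lt (ENNReal.add_lt_top.2 ⟨key p hp, ?_⟩)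
  rw [modelDist_comm h₁ h₂]
  exact key q hq

/-- The entropy pseudometric on the model space. -/
abbrev modelPseudoMetric (h₁ : G₁.Good) (h₂ : G₂.Good) : PseudoMetricSpace (model G₁ G₂ v₁ v₂) :=
  letI m : PseudoEMetricSpace (model G₁ G₂ v₁ v₂) :=
    { edist := fun x y => modelDist G₁ G₂ v₁ v₂ x y
      edist_self := fun x => modelDist_self h₁ h₂ x.2
      edist_comm := fun x y => modelDist_comm h₁ h₂ x y
      edist_triangle := fun x y z => modelDist_triangle h₁ h₂ x y z }
  m.toPseudoMetricSpace fun x y => (modelDist_lt_top h₁ h₂ x.2 y.2).ne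

end Isometry

end SepEdge

end

theorem proposition10p6 {V₁ E₁ V₂ E₂ : Type*} [Fintype V₁] [Fintype E₁] [Fintype V₂] [Fintype E₂]
    (G₁ : OGraph V₁ E₁) (G₂ : OGraph V₂ E₂) (v₁ : V₁) (v₂ : V₂)
    (hconn₁ : G₁.Connected) (hconn₂ : G₂.Connected)
    (hrank₁ : 2 ≤ G₁.rank) (hrank₂ : 2 ≤ G₂.rank)
    (hval : ∀ v, (OGraph.join G₁ G₂ v₁ v₂).valence v ≠ 1 ∧
      (OGraph.join G₁ G₂ v₁ v₂).valence v ≠ 2) :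
    -- the entropy norm extends continuously (and uniquely) over the regular points
    (SepEdge.finTangent G₁ G₂ v₁ v₂ ⊆ SepEdge.regTangent G₁ G₂ v₁ v₂ ∧
      SepEdge.regTangent G₁ G₂ v₁ v₂ ⊆ closure (SepEdge.finTangent G₁ G₂ v₁ v₂) ∧
      Set.EqOn (SepEdge.extNorm G₁ G₂ v₁ v₂) (SepEdge.finNorm G₁ G₂ v₁ v₂)
        (SepEdge.finTangent G₁ G₂ v₁ v₂) ∧
      ContinuousOn (SepEdge.extNorm G₁ G₂ v₁ v₂) (SepEdge.regTangent G₁ G₂ v₁ v₂)) ∧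
    -- it defines a pseudometric on the model space
    (∃ m : PseudoMetricSpace (SepEdge.model G₁ G₂ v₁ v₂),
      ∀ x y : SepEdge.model G₁ G₂ v₁ v₂,
        m.edist x y = SepEdge.modelDist G₁ G₂ v₁ v₂ x y) ∧
    -- the set of added points has diameter zero
    (∀ x ∈ SepEdge.added G₁ G₂, ∀ y ∈ SepEdge.added G₁ G₂,
      SepEdge.modelDist G₁ G₂ v₁ v₂ x y = 0) ∧
    -- the inclusion of the unit entropy moduli space is an isometric embedding
    (∀ x ∈ (OGraph.join G₁ G₂ v₁ v₂).unitSpace, ∀ y ∈ (OGraph.join G₁ G₂ v₁ v₂).unitSpace,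
      SepEdge.modelDist G₁ G₂ v₁ v₂ (SepEdge.incl x) (SepEdge.incl y) =
        (OGraph.join G₁ G₂ v₁ v₂).entropyDist x y) := by
  have h₁ : G₁.Good := OGraph.good_left hconn₁ hrank₁ hval
  have h₂ : G₂.Good := OGraph.good_right hconn₂ hrank₂ hval
  refine ⟨⟨SepEdge.finTangent_subset h₁ h₂, SepEdge.regTangent_subset_closure h₁ h₂, ?_, ?_⟩,
    ⟨SepEdge.modelPseudoMetric h₁ h₂, fun _ _ => rfl⟩,
    fun x hx y hy => SepEdge.modelDist_added h₁ h₂ hx hy,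
    fun x hx y hy => SepEdge.modelDist_incl h₁ h₂ hx hy⟩
  · exact ((SepEdge.extNorm_eq h₁ h₂).mono (SepEdge.finTangent_subset h₁ h₂)).trans
      (SepEdge.finNorm_eq h₁ h₂).symm
  · exact (SepEdge.continuousOn_nrm h₁ h₂).congr (SepEdge.extNorm_eq h₁ h₂)
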